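/- Let $\varepsilon\in(0,1]$ and consider the relativistic isothermal Euler equations $$\partial_t G+\partial_x H=0,\qquad \partial_t H+\partial_x F=0,$$ $$G=\frac{1+\varepsilon^4v^2}{1-\varepsilon^2v^2}\,\rho,\qquad H=\frac{1+\varepsilon^2}{1-\varepsilon^2v^2}\,\rho v,\qquad F=\frac{1+v^2}{1-\varepsilon^2v^2}\,\rho .$$ Set $\varepsilon'=\frac{2\varepsilon}{1+\varepsilon^2}$, $\alpha=\frac{(1-\varepsilon)^2}{2(1+\varepsilon^2)}$, $$\lambda_1=\frac{v-1}{1-\varepsilon^2v},\quad \lambda_2=\frac{v+1}{1+\varepsilon^2v},\quad r_1=\Big(\frac{-1}{1-\varepsilon^2v^2},\frac{1}{(1+\varepsilon^2)\rho}\Big),\quad r_2=\Big(\frac{1}{1-\varepsilon^2v^2},\frac{1}{(1+\varepsilon^2)\rho}\Big),$$ and, for $M>0$, define the tame region $$\mathcal T_\varepsilon(M)=\{(\rho,v):\ 0\le\rho\le M,\ 1-\varepsilon|v|\ge(\rho/M)^{\varepsilon'}\}.$$ The modified Riemann invariants are $$W=\rho^{\frac1{1+\varepsilon^2}}\Big(\frac{1+\varepsilon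 v}{1-\varepsilon v}\Big)^{\frac1{2\varepsilon}},\qquad Z=\rho^{\frac1{1+\varepsilon^2}}\Big(\frac{1+\varepsilon v}{1-\varepsilon v}\Big)^{-\frac1{2\varepsilon}},$$ both being $0$ on the vacuum $\rho=0$. A convex smooth weak entropy pair is a pair $(\mathcal U,\mathcal F)$ of real functions of $(\rho,v)$, continuous on $\{\rho\ge0,\ |v|<1/\varepsilon\}$ and $C^\infty$ on $\{\rho>0,\ |v|<1/\varepsilon\}$, such that on the latter set $\nabla\mathcal F\cdot r_j=\lambda_j\,\nabla\mathcal U\cdot r_j$ for $j=1,2$ and $\mathcal U$ is a convex function of $(G,H)$, such that $\mathcal U=\mathcal F=0$ on $\rho=0$, and such that for every $M>0$ there is a $C$ with $|\mathcal U|+|\mathcal F|\le C\rho^{\alpha}$ on $\mathcal T_\varepsilon(M)$. A tame entropy solution with initial data $(\rho_0,v_0)$ is a measurable pair $(\rho,v)$ on $(0,\infty)\times\mathbb R$ whose range lies in some tame region and which satisfies $$\iint_{(0,\infty)\times\mathbb R}\big(\mathcal U(\rho,v)\,\partial_t\theta+\mathcal F(\rho,v)\,\partial_x\theta\big)\,dx\,dt+\int_{\mathbb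 R}\mathcal U(\rho_0,v_0)\,\theta(0,x)\,dx\ \ge 0$$ for every convex smooth weak entropy pair and every smooth, compactly supported $\theta$ that is nonnegative on $[0,\infty)\times\mathbb R$. **Lemma (Riemann problem).** Let $(\rho_l,v_l)$, $(\rho_r,v_r)$ be two constant states with $\rho_l,\rho_r\ge0$ and let $\varepsilon_1\in(0,1]$ satisfy $\varepsilon_1|v_l|<1$ and $\varepsilon_1|v_r|<1$. There is a constant $M>0$, depending only on the two states and on $\varepsilon_1$ (hence only on the two states if $|v_l|,|v_r|<1$, where one may take $\varepsilon_1=1$), such that the following holds for every $\varepsilon\in(0,\varepsilon_1]$, where in the case $\varepsilon=1$ it is also assumed that $\rho_l,\rho_r$ are both positive or both zero. The Riemann problem, with initial data $(\rho_l,v_l)$ for $x<0$ and $(\rho_r,v_r)$ for $x>0$, has a self-similar tame entropy solution $(\rho,v)=(\rho,v)(x/t)$. It is unique: any other self-similar tame entropy solution has the same $\rho(\xi)$ for almost every $\xi=x/t$, and the same $v(\xi)$ for almost every $\xi$ with $\rho(\xi)>0$. For all $\xi=x/t$ it satisfies $$0\le W(\xi)\le\max(W_l,W_r),\qquad 0\le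 Z(\xi)\le\max(Z_l,Z_r),$$ and consequently $$0\le\rho(\xi)\le M,\qquad 1-\varepsilon|v(\xi)|\ge\big(\rho(\xi)/M\big)^{\varepsilon'} .$$ -/

import Mathlib

open Set MeasureTheory
open scoped ContDiff

noncomputable section

namespace RelEuler

/-! The isothermal relativistic Euler equations (sound speed `1`, light speed `1 / ε`)
`∂ₜ G + ∂ₓ H = 0`, `∂ₜ H + ∂ₓ F = 0` in the unknowns `(ρ, v)`.
A state is a pair `p = (ρ, v)`, i.e. `p.1` is the density and `p.2` is the velocity;
a point of spacetime is a pair `(t, x)`. -/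

/-- First conservative variable. -/
def G (ε : ℝ) (p : ℝ × ℝ) : ℝ := (1 + ε ^ 4 * p.2 ^ 2) / (1 - ε ^ 2 * p.2 ^ 2) * p.1

/-- Second conservative variable, which is also the flux of the first one. -/
def H (ε : ℝ) (p : ℝ × ℝ) : ℝ := (1 + ε ^ 2) / (1 - ε ^ 2 * p.2 ^ 2) * p.1 * p.2

/-- Flux of the second conservative variable. -/
def F (ε : ℝ) (p : ℝ × ℝ) : ℝ := (1 + p.2 ^ 2) / (1 - ε ^ 2 * p.2 ^ 2) * p.1

/-- States away from the vacuum: `ρ > 0` and `|v| < 1 / ε`. -/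
def nonVacuum (ε : ℝ) : Set (ℝ × ℝ) := {p | 0 < p.1 ∧ ε * |p.2| < 1}

/-- States with `ρ ≥ 0` and `|v| < 1 / ε`. -/
def phaseSpace (ε : ℝ) : Set (ℝ × ℝ) := {p | 0 ≤ p.1 ∧ ε * |p.2| < 1}

/-- The range of the conservative variables `(G, H)` over the states away from the vacuum. -/
def conservedCone (ε : ℝ) : Set (ℝ × ℝ) := {q | ε * |q.2| < q.1}

/-- The wave speeds. -/
def lam₁ (ε : ℝ) (p : ℝ × ℝ) : ℝ := (p.2 - 1) / (1 - ε ^ 2 * p.2)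

def lam₂ (ε : ℝ) (p : ℝ × ℝ) : ℝ := (p.2 + 1) / (1 + ε ^ 2 * p.2)

/-- The characteristic directions in the `(ρ, v)` coordinates. -/
def r₁ (ε : ℝ) (p : ℝ × ℝ) : ℝ × ℝ :=
  (-1 / (1 - ε ^ 2 * p.2 ^ 2), 1 / (1 + ε ^ 2) * (1 / p.1))

def r₂ (ε : ℝ) (p : ℝ × ℝ) : ℝ × ℝ :=
  (1 / (1 - ε ^ 2 * p.2 ^ 2), 1 / (1 + ε ^ 2) * (1 / p.1))

/-- Modified Riemann invariants. -/
def W (ε : ℝ) (p : ℝ × ℝ) : ℝ :=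
  p.1 ^ (1 / (1 + ε ^ 2)) * ((1 + ε * p.2) / (1 - ε * p.2)) ^ (1 / (2 * ε))

def Z (ε : ℝ) (p : ℝ × ℝ) : ℝ :=
  p.1 ^ (1 / (1 + ε ^ 2)) * ((1 + ε * p.2) / (1 - ε * p.2)) ^ (-(1 / (2 * ε)))

/-- The exponent `ε' = 2 ε / (1 + ε²)`. -/
def epsPrime (ε : ℝ) : ℝ := 2 * ε / (1 + ε ^ 2)

/-- The tame region with constant `M`. -/
def tameRegion (ε M : ℝ) : Set (ℝ × ℝ) :=
  {p | 0 ≤ p.1 ∧ p.1 ≤ M ∧ (p.1 / M) ^ epsPrime ε ≤ 1 - ε * |p.2|}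

/-- The rate at which weak entropies vanish on the vacuum within tame regions. -/
def alpha (ε : ℝ) : ℝ := (1 - ε) ^ 2 / (2 * (1 + ε ^ 2))

/-- Smooth weak entropy pairs `(𝓤, 𝓕)`: continuous up to the vacuum, smooth away from it,
compatible with the system (`∇𝓕 · rⱼ = λⱼ ∇𝓤 · rⱼ`), and vanishing on the vacuum,
within every tame region at the rate `ρ ^ alpha`. -/
structure IsWeakEntropyPair (ε : ℝ) (𝓤 𝓕 : ℝ × ℝ → ℝ) : Prop where
  continuousOn_entropy : ContinuousOn 𝓤 (phaseSpace ε)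
  continuousOn_flux : ContinuousOn 𝓕 (phaseSpace ε)
  smooth_entropy : ContDiffOn ℝ ∞ 𝓤 (nonVacuum ε)
  smooth_flux : ContDiffOn ℝ ∞ 𝓕 (nonVacuum ε)
  compat₁ : ∀ p ∈ nonVacuum ε,
    fderiv ℝ 𝓕 p (r₁ ε p) = lam₁ ε p * fderiv ℝ 𝓤 p (r₁ ε p)
  compat₂ : ∀ p ∈ nonVacuum ε,
    fderiv ℝ 𝓕 p (r₂ ε p) = lam₂ ε p * fderiv ℝ 𝓤 p (r₂ ε p)
  vacuum : ∀ v : ℝ, 𝓤 (0, v) = 0 ∧ 𝓕 (0, v) = 0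
  decay : ∀ M : ℝ, 0 < M → ∃ C : ℝ, ∀ p ∈ tameRegion ε M,
    |𝓤 p| + |𝓕 p| ≤ C * p.1 ^ alpha ε

/-- Convexity of an entropy with respect to the conservative variables `(G, H)`. -/
def IsConvexEntropy (ε : ℝ) (𝓤 : ℝ × ℝ → ℝ) : Prop :=
  ∃ η : ℝ × ℝ → ℝ, ConvexOn ℝ (conservedCone ε) η ∧
    ∀ p ∈ nonVacuum ε, 𝓤 p = η (G ε p, H ε p)

/-- Tame entropy solutions `s = (ρ, v)` on `t > 0`, with `s (t, x)`, for initial data `s₀`.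
Test functions on `[0, ∞) × ℝ` are restrictions of test functions on the plane, nonnegative for
`t ≥ 0`; the values of `s` for `t ≤ 0` play no role. -/
structure IsTameEntropySolution (ε : ℝ) (s₀ : ℝ → ℝ × ℝ) (s : ℝ × ℝ → ℝ × ℝ) : Prop where
  measurable : Measurable (fun q : {q : ℝ × ℝ // 0 < q.1} => s q)
  tame : ∃ M : ℝ, 0 < M ∧ ∀ t x : ℝ, 0 < t → s (t, x) ∈ tameRegion ε M
  entropy : ∀ 𝓤 𝓕 : ℝ × ℝ → ℝ, IsWeakEntropyPair ε 𝓤 𝓕 → IsConvexEntropy ε 𝓤 →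
    ∀ θ : ℝ × ℝ → ℝ, ContDiff ℝ ∞ θ → HasCompactSupport θ → (∀ q, 0 ≤ q.1 → 0 ≤ θ q) →
      0 ≤ (∫ q in Ioi (0 : ℝ) ×ˢ (univ : Set ℝ),
            (𝓤 (s q) * fderiv ℝ θ q (1, 0) + 𝓕 (s q) * fderiv ℝ θ q (0, 1)))
          + ∫ x : ℝ, 𝓤 (s₀ x) * θ (0, x)

/-- Initial data with a single jump at `x = 0`. -/
def riemannData (pl pr : ℝ × ℝ) (x : ℝ) : ℝ × ℝ := if x < 0 then pl else pr

/-- `x / t ↦ (ρ, v)` is the profile of a self-similar entropy solution of the Riemann problem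
with left state `pl` and right state `pr`. -/
def IsRiemannSolution (ε : ℝ) (pl pr : ℝ × ℝ) (φ : ℝ → ℝ × ℝ) : Prop :=
  IsTameEntropySolution ε (riemannData pl pr) (fun q => φ (q.2 / q.1))

end RelEuler

end

/-! Coordinates. Put a = √(ρ/(1-ε²v²)) and b = a v. Then G = a²+ε⁴b², H = (1+ε²)ab, F = a²+b² are
quadratic forms, ρ = a²-ε²b², and the states away from the vacuum fill the cone ε|b| < a. For a
self-similar solution the conservation laws say that H-xG and F-xH have the bounded derivatives -G
and -H in x = ξ, hence continuous representatives. Combinations of these and of their products with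
x are the perfect squares sp² and sm², where sp = (a+b)-x(a+ε²b) and sm = (a-b)+x(a-ε²b) are linear
in (a,b), with sp positive below the second wave speed and sm negative below the first. For |x| <
1/ε the two squares carry all the jump relations, so a jump can only reverse the sign of sp (a
2-shock) or of sm (a 1-shock). The structure `Prof` records these facts.

Uniqueness, ε < 1. One further convex entropy suffices, minus the particle number. It forbids sm to
jump from positive to negative (`Prof.sm_local`), so sm changes sign once, at some α, and by
reflection sp changes sign once, at some β. Left of α the square sm² decreases: while it is
positive, ODEs for √(sp²) and √(sm²) force a constant state (`Prof.const_of_signs`); once it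
vanishes, the profile is a centered rarefaction (`Prof.fan_const`). Between α and β both forms are
positive and the state is constant again. Thus the profile is a 1-wave from the left state, an
intermediate state and a 2-wave to the right state (`Prof.structure_nonvac`), with rarefactions
reaching the light cone in the vacuum cases. Beyond the light cone the signs of sp and sm are fixed,
the profile is constant and it equals the data (`IsRiemannSolution.far_field`). Along the 1-wave
curve the density decreases strictly and the ratio (a+εb)/(a-εb) increases strictly with the slope,
while the 2-wave curve is its mirror image (`behind1_mono`). Hence the intermediate state exists and
is unique (`exists_slopes`, `slopes_unique`).

Existence. By `weakIneq_of_dissipation` it is enough that every convex entropy is dissipated in the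
similarity variable. In rarefactions V-xU has derivative -U. Across a shock, differentiating the
jump relations along the shock curve and using the gradient inequality of the convex entropy gives
the right sign (`shock_dissipation`). At the edge of the vacuum the prescribed decay ρ^α makes the
flux continuous. When ε = 1 both fields are linearly degenerate: sp = (1-x)(a+b), the conservation
laws alone determine a+b and a-b, and the waves are contacts.

Bounds. W is constant in 1-rarefactions and does not increase across 1-shocks; Z is its mirror
image. So the intermediate state inherits the bound on W from the left and the bound on Z from the
right. A common bound K ≥ 1 on W and Z confines states to the tame region with M = K², and K can be
chosen independently of ε ≤ ε₁. -/

noncomputable section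

namespace RelEuler

open Filter Topology

/-! ### Square-root coordinates -/

/-- The open cone of square-root coordinates of states away from the vacuum. -/
def cone (ε : ℝ) : Set (ℝ × ℝ) := {q | ε * |q.2| < q.1}

/-- Square-root coordinates of a state. -/
def toA (ε : ℝ) (p : ℝ × ℝ) : ℝ × ℝ :=
  (√(p.1 / (1 - ε ^ 2 * p.2 ^ 2)), √(p.1 / (1 - ε ^ 2 * p.2 ^ 2)) * p.2)

/-- The state with given square-root coordinates. -/
def ofA (ε : ℝ) (q : ℝ × ℝ) : ℝ × ℝ := (q.1 ^ 2 - ε ^ 2 * q.2 ^ 2, q.2 / q.1)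

/-- States which are either vacuum or subluminal. -/
def Adm (ε : ℝ) (p : ℝ × ℝ) : Prop := 0 ≤ p.1 ∧ (0 < p.1 → ε * |p.2| < 1)

/-- Signed square root of the `2`-characteristic form at slope `x`. -/
def sp (ε x : ℝ) (q : ℝ × ℝ) : ℝ := (q.1 + q.2) - x * (q.1 + ε ^ 2 * q.2)

/-- Signed square root of the `1`-characteristic form at slope `x`. -/
def sm (ε x : ℝ) (q : ℝ × ℝ) : ℝ := (q.1 - q.2) + x * (q.1 - ε ^ 2 * q.2)

/-- Conserved quantities and fluxes become quadratic forms of the square-root coordinates; this is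
what turns the jump relations into equalities of squares of linear forms. -/
def GA (ε : ℝ) (q : ℝ × ℝ) : ℝ := q.1 ^ 2 + ε ^ 4 * q.2 ^ 2

def HA (ε : ℝ) (q : ℝ × ℝ) : ℝ := (1 + ε ^ 2) * q.1 * q.2

def FA (_ε : ℝ) (q : ℝ × ℝ) : ℝ := q.1 ^ 2 + q.2 ^ 2

lemma lum_pos {ε v : ℝ} (hε : 0 < ε) (h : ε * |v| < 1) : 0 < 1 - ε ^ 2 * v ^ 2 := by
  have h0 : 0 ≤ ε * |v| := by positivity
  have : (ε * |v|) ^ 2 < 1 := by nlinarith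
  rw [mul_pow, sq_abs] at this
  linarith

lemma lum_lt {ε v : ℝ} (hε : 0 < ε) (h : ε * |v| < 1) : -1 < ε * v ∧ ε * v < 1 := by
  rw [← abs_lt, abs_mul, abs_of_pos hε]; exact h

lemma cone_iff {ε : ℝ} (hε : 0 < ε) {q : ℝ × ℝ} :
    q ∈ cone ε ↔ -q.1 < ε * q.2 ∧ ε * q.2 < q.1 := by
  rw [← abs_lt, abs_mul, abs_of_pos hε]; rfl

lemma cone_fst_pos {ε : ℝ} (hε : 0 < ε) {q : ℝ × ℝ} (h : q ∈ cone ε) : 0 < q.1 :=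
  lt_of_le_of_lt (by positivity) (show ε * |q.2| < q.1 from h)

lemma cone_rho_pos {ε : ℝ} (hε : 0 < ε) {q : ℝ × ℝ} (h : q ∈ cone ε) :
    0 < q.1 ^ 2 - ε ^ 2 * q.2 ^ 2 := by
  obtain ⟨h1, h2⟩ := (cone_iff hε).1 h
  nlinarith

/-- In the cone, combinations `q.1 + s * q.2` with `|s| ≤ ε` are positive. -/
lemma cone_comb_pos {ε s : ℝ} {q : ℝ × ℝ} (h : q ∈ cone ε) (hs : |s| ≤ ε) :
    0 < q.1 + s * q.2 := by
  have h1 : |s * q.2| ≤ ε * |q.2| := by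
    rw [abs_mul]; gcongr
  have h2 : ε * |q.2| < q.1 := h
  have := neg_abs_le (s * q.2)
  linarith

lemma ofA_zero (ε : ℝ) : ofA ε (0, 0) = (0, 0) := by simp [ofA]

lemma ofA_mem {ε : ℝ} (hε : 0 < ε) {q : ℝ × ℝ} (h : q ∈ cone ε) : ofA ε q ∈ nonVacuum ε := by
  refine ⟨cone_rho_pos hε h, ?_⟩
  have h1 := cone_fst_pos hε h
  have h2 : ε * |q.2| < q.1 := h
  simp only [ofA, abs_div, abs_of_pos h1]
  rw [← mul_div_assoc, div_lt_one h1]; exact h2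

lemma lum_ofA {ε : ℝ} (hε : 0 < ε) {q : ℝ × ℝ} (h : q ∈ cone ε) :
    1 - ε ^ 2 * (ofA ε q).2 ^ 2 = (ofA ε q).1 / q.1 ^ 2 := by
  have h1 := (cone_fst_pos hε h).ne'
  simp only [ofA]; field_simp

lemma toA_mem {ε : ℝ} (hε : 0 < ε) {p : ℝ × ℝ} (h : p ∈ nonVacuum ε) : toA ε p ∈ cone ε := by
  have h1 := lum_pos hε h.2
  have h2 : 0 < √(p.1 / (1 - ε ^ 2 * p.2 ^ 2)) := Real.sqrt_pos.2 (div_pos h.1 h1)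
  show ε * |_ * p.2| < _
  rw [abs_mul, abs_of_pos h2]
  have := h.2
  simp only [toA]
  nlinarith

lemma ofA_toA {ε : ℝ} (hε : 0 < ε) {p : ℝ × ℝ} (h : p ∈ nonVacuum ε) : ofA ε (toA ε p) = p := by
  have h1 := lum_pos hε h.2
  have h2 : 0 < √(p.1 / (1 - ε ^ 2 * p.2 ^ 2)) := Real.sqrt_pos.2 (div_pos h.1 h1)
  have h3 := Real.sq_sqrt (div_pos h.1 h1).le
  ext
  · simp only [ofA, toA, mul_pow, h3]; field_simp
  · simp only [ofA, toA]; field_simp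

lemma toA_ofA {ε : ℝ} (hε : 0 < ε) {q : ℝ × ℝ} (h : q ∈ cone ε) : toA ε (ofA ε q) = q := by
  have h1 := cone_fst_pos hε h
  have h2 := cone_rho_pos hε h
  have h3 : (ofA ε q).1 / (1 - ε ^ 2 * (ofA ε q).2 ^ 2) = q.1 ^ 2 := by
    rw [lum_ofA hε h]
    have : (ofA ε q).1 ≠ 0 := h2.ne'
    field_simp
  ext
  · simp only [toA, h3]; exact Real.sqrt_sq h1.le
  · simp only [toA, h3]
    rw [Real.sqrt_sq h1.le]; simp only [ofA]; field_simp

lemma Adm.cases {ε : ℝ} {p : ℝ × ℝ} (h : Adm ε p) : p.1 = 0 ∨ p ∈ nonVacuum ε := by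
  rcases h.1.eq_or_lt with h0 | h0
  · exact Or.inl h0.symm
  · exact Or.inr ⟨h0, h.2 h0⟩

lemma toA_vac {ε : ℝ} {p : ℝ × ℝ} (h : p.1 = 0) : toA ε p = (0, 0) := by
  simp [toA, h]

lemma toA_cases {ε : ℝ} (hε : 0 < ε) {p : ℝ × ℝ} (h : Adm ε p) :
    toA ε p = (0, 0) ∨ toA ε p ∈ cone ε :=
  h.cases.imp toA_vac (toA_mem hε)

lemma G_eq {ε : ℝ} (hε : 0 < ε) {p : ℝ × ℝ} (h : Adm ε p) : G ε p = GA ε (toA ε p) := by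
  rcases h.cases with h0 | h0
  · simp [G, GA, toA_vac h0, h0]
  · have h1 := lum_pos hε h0.2
    have h3 := Real.sq_sqrt (div_pos h0.1 h1).le
    simp only [G, GA, toA, mul_pow, h3]; field_simp

lemma H_eq {ε : ℝ} (hε : 0 < ε) {p : ℝ × ℝ} (h : Adm ε p) : H ε p = HA ε (toA ε p) := by
  rcases h.cases with h0 | h0
  · simp [H, HA, toA_vac h0, h0]
  · have h1 := lum_pos hε h0.2
    have h3 := Real.sq_sqrt (div_pos h0.1 h1).le
    simp only [H, HA, toA]
    rw [show ∀ a b c : ℝ, c * a * (a * b) = c * b * a ^ 2 by intros; ring, h3]; field_simp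

lemma F_eq {ε : ℝ} (hε : 0 < ε) {p : ℝ × ℝ} (h : Adm ε p) : F ε p = FA ε (toA ε p) := by
  rcases h.cases with h0 | h0
  · simp [F, FA, toA_vac h0, h0]
  · have h1 := lum_pos hε h0.2
    have h3 := Real.sq_sqrt (div_pos h0.1 h1).le
    simp only [F, FA, toA, mul_pow, h3]; field_simp

lemma rho_eq {ε : ℝ} (hε : 0 < ε) {p : ℝ × ℝ} (h : Adm ε p) :
    p.1 = (toA ε p).1 ^ 2 - ε ^ 2 * (toA ε p).2 ^ 2 := by
  rcases h.cases with h0 | h0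
  · simp [toA_vac h0, h0]
  · exact (congrArg Prod.fst (ofA_toA hε h0)).symm

lemma adm_of_nonVacuum {ε : ℝ} {p : ℝ × ℝ} (h : p ∈ nonVacuum ε) : Adm ε p :=
  ⟨h.1.le, fun _ => h.2⟩

lemma adm_of_tame {ε M : ℝ} (hM : 0 < M) {p : ℝ × ℝ} (h : p ∈ tameRegion ε M) : Adm ε p := by
  refine ⟨h.1, fun h0 => ?_⟩
  have := Real.rpow_pos_of_pos (div_pos h0 hM) (epsPrime ε)
  linarith [h.2.2]

lemma adm_ofA {ε : ℝ} (hε : 0 < ε) {q : ℝ × ℝ} (h : q = (0, 0) ∨ q ∈ cone ε) :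
    Adm ε (ofA ε q) := by
  rcases h with rfl | h
  · rw [ofA_zero]; exact ⟨le_rfl, fun h => absurd h (lt_irrefl _)⟩
  · exact adm_of_nonVacuum (ofA_mem hε h)

lemma toA_ofA' {ε : ℝ} (hε : 0 < ε) {q : ℝ × ℝ} (h : q = (0, 0) ∨ q ∈ cone ε) :
    toA ε (ofA ε q) = q := by
  rcases h with rfl | h
  · rw [ofA_zero, toA_vac rfl]
  · exact toA_ofA hε h

lemma isOpen_nonVacuum (ε : ℝ) : IsOpen (nonVacuum ε) := by
  have h1 : IsOpen {p : ℝ × ℝ | 0 < p.1} := isOpen_lt continuous_const continuous_fst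
  have h2 : IsOpen {p : ℝ × ℝ | ε * |p.2| < 1} := isOpen_lt (by fun_prop) continuous_const
  exact h1.inter h2

/-! ### The particle number entropy -/

/-- Particle number density. -/
def Nn (ε : ℝ) (p : ℝ × ℝ) : ℝ := (√(1 - ε ^ 2 * p.2 ^ 2))⁻¹ * p.1 ^ (1 / (1 + ε ^ 2))

/-- Particle number flux. -/
def Qn (ε : ℝ) (p : ℝ × ℝ) : ℝ := (p.2 * (√(1 - ε ^ 2 * p.2 ^ 2))⁻¹) * p.1 ^ (1 / (1 + ε ^ 2))

/-- The exponent expressing the particle number in square-root coordinates. -/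
def mu (ε : ℝ) : ℝ := (1 - ε ^ 2) / (2 * (1 + ε ^ 2))

lemma Nn_eq {ε : ℝ} (hε : 0 < ε) {p : ℝ × ℝ} (h : Adm ε p) :
    Nn ε p = (toA ε p).1 * ((toA ε p).1 ^ 2 - ε ^ 2 * (toA ε p).2 ^ 2) ^ mu ε := by
  rw [← rho_eq hε h]
  rcases h.cases with h0 | h0
  · have : (1 / (1 + ε ^ 2)) ≠ 0 := by positivity
    simp only [Nn, toA_vac h0, h0, Real.zero_rpow this]; simp
  · have h1 := lum_pos hε h0.2
    have h2 : 0 < p.1 := h0.1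
    -- `mu ε` equals 1/(1+ε²) - 1/2; the factor √ρ split off here combines with the Lorentz factor
    -- into the first square-root coordinate.
    have e : p.1 ^ (1 / (1 + ε ^ 2)) = √p.1 * p.1 ^ mu ε := by
      rw [Real.sqrt_eq_rpow, ← Real.rpow_add h2]
      congr 1; rw [mu]; field_simp; ring
    simp only [Nn, toA]
    rw [e, Real.sqrt_div h2.le]; field_simp

lemma Qn_eq {ε : ℝ} (hε : 0 < ε) {p : ℝ × ℝ} (h : Adm ε p) :
    Qn ε p = (toA ε p).2 * ((toA ε p).1 ^ 2 - ε ^ 2 * (toA ε p).2 ^ 2) ^ mu ε := by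
  have := Nn_eq hε h
  have e : Qn ε p = Nn ε p * p.2 := by simp only [Qn, Nn]; ring
  rw [e, this]; simp only [toA]; ring

/-! ### Weak entropy pairs: conservative variables and particle number -/

/-- All entropies and fluxes differentiated explicitly below are products of a function of v and a
function of ρ, so one formula serves for G, H, F, N and Q. -/
lemma fderiv_sep {g h : ℝ → ℝ} {g' h' : ℝ} {p : ℝ × ℝ} (hg : HasDerivAt g g' p.2)
    (hh : HasDerivAt h h' p.1) (x : ℝ × ℝ) :
    fderiv ℝ (fun p : ℝ × ℝ => g p.2 * h p.1) p x = g' * x.2 * h p.1 + g p.2 * (h' * x.1) := by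
  have h1 : HasFDerivAt (fun p : ℝ × ℝ => g p.2) _ p := hg.hasFDerivAt.comp p hasFDerivAt_snd
  have h2 : HasFDerivAt (fun p : ℝ × ℝ => h p.1) _ p := hh.hasFDerivAt.comp p hasFDerivAt_fst
  have h3 : fderiv ℝ (fun p : ℝ × ℝ => g p.2 * h p.1) p = _ := (h1.mul h2).fderiv
  rw [h3]
  simp
  ring

lemma IsWeakEntropyPair.neg {ε : ℝ} {U V : ℝ × ℝ → ℝ} (h : IsWeakEntropyPair ε U V) :
    IsWeakEntropyPair ε (fun p => -U p) (fun p => -V p) where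
  continuousOn_entropy := h.continuousOn_entropy.neg
  continuousOn_flux := h.continuousOn_flux.neg
  smooth_entropy := h.smooth_entropy.neg
  smooth_flux := h.smooth_flux.neg
  compat₁ p hp := by
    have := h.compat₁ p hp
    simp [fderiv_fun_neg, this]
  compat₂ p hp := by
    have := h.compat₂ p hp
    simp [fderiv_fun_neg, this]
  vacuum v := by simp [h.vacuum v]
  decay M hM := by simpa using h.decay M hM

/-- Lower bound for the distance to the light speed in a tame region. -/
lemma tame_lum {ε M : ℝ} (hε : 0 < ε) {p : ℝ × ℝ} (h : p ∈ tameRegion ε M)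
    (hM : 0 < M) : (p.1 / M) ^ epsPrime ε ≤ 1 - ε ^ 2 * p.2 ^ 2 := by
  have h1 := h.2.2
  have h0 : 0 ≤ (p.1 / M) ^ epsPrime ε := Real.rpow_nonneg (div_nonneg h.1 hM.le) _
  have h2 : ε ^ 2 * p.2 ^ 2 = (ε * |p.2|) ^ 2 := by rw [mul_pow, sq_abs]
  have h3 : 0 ≤ ε * |p.2| := by positivity
  rw [h2]; nlinarith

lemma alpha_nonneg (ε : ℝ) : 0 ≤ alpha ε := by
  unfold alpha; positivity

/-- Decay of functions controlled by a power of the density and the distance to light speed. -/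
lemma decay_of_bound {ε : ℝ} (hε : 0 < ε) {U : ℝ × ℝ → ℝ} {s e C : ℝ} (hC : 0 ≤ C)
    (he : 0 ≤ e) (hs : alpha ε ≤ s - e * epsPrime ε)
    (h0 : ∀ v, U (0, v) = 0)
    (h : ∀ p ∈ nonVacuum ε, |U p| ≤ C * p.1 ^ s * (1 - ε ^ 2 * p.2 ^ 2) ^ (-e)) (M : ℝ)
    (hM : 0 < M) : ∃ C' : ℝ, ∀ p ∈ tameRegion ε M, |U p| ≤ C' * p.1 ^ alpha ε := by
  -- The first power of M comes from 1-ε²v² ≥ (ρ/M)^ε' raised to the power -e; the second bounds the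
  -- surplus power of ρ beyond `alpha ε` by means of ρ ≤ M.
  refine ⟨C * M ^ (e * epsPrime ε) * M ^ (s - e * epsPrime ε - alpha ε), fun p hp => ?_⟩
  rcases (adm_of_tame hM hp).cases with h1 | h1
  · have : U p = 0 := by rw [← h0 p.2, ← h1]
    rw [this, abs_zero]
    have := Real.rpow_nonneg hp.1 (alpha ε)
    positivity
  · have hr : 0 < p.1 := h1.1
    have hd := tame_lum hε hp hM
    have hq : 0 < (p.1 / M) ^ epsPrime ε := Real.rpow_pos_of_pos (div_pos hr hM) _
    calc |U p| ≤ C * p.1 ^ s * (1 - ε ^ 2 * p.2 ^ 2) ^ (-e) := h p h1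
      _ ≤ C * p.1 ^ s * ((p.1 / M) ^ epsPrime ε) ^ (-e) := by
          have := Real.rpow_le_rpow_of_nonpos hq hd (neg_nonpos.2 he)
          gcongr
      _ = C * M ^ (e * epsPrime ε) * (p.1 ^ alpha ε * p.1 ^ (s - e * epsPrime ε - alpha ε)) := by
          rw [← Real.rpow_mul (div_pos hr hM).le, Real.div_rpow hr.le hM.le, ← Real.rpow_add hr,
            show epsPrime ε * -e = -(e * epsPrime ε) by ring, Real.rpow_neg hM.le, div_inv_eq_mul]
          rw [show alpha ε + (s - e * epsPrime ε - alpha ε) = s + -(e * epsPrime ε) by ring,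
            Real.rpow_add hr]
          ring
      _ ≤ C * M ^ (e * epsPrime ε) * (p.1 ^ alpha ε * M ^ (s - e * epsPrime ε - alpha ε)) := by
          have := Real.rpow_le_rpow hr.le hp.2.1
            (show 0 ≤ s - e * epsPrime ε - alpha ε by linarith)
          gcongr
      _ = _ := by ring

lemma sep_decay {ε : ℝ} {U V : ℝ × ℝ → ℝ}
    (hU : ∀ M : ℝ, 0 < M → ∃ C : ℝ, ∀ p ∈ tameRegion ε M, |U p| ≤ C * p.1 ^ alpha ε)
    (hV : ∀ M : ℝ, 0 < M → ∃ C : ℝ, ∀ p ∈ tameRegion ε M, |V p| ≤ C * p.1 ^ alpha ε) :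
    ∀ M : ℝ, 0 < M → ∃ C : ℝ, ∀ p ∈ tameRegion ε M, |U p| + |V p| ≤ C * p.1 ^ alpha ε := by
  intro M hM
  obtain ⟨C, hC⟩ := hU M hM
  obtain ⟨D, hD⟩ := hV M hM
  exact ⟨C + D, fun p hp => by linarith [hC p hp, hD p hp, add_mul C D (p.1 ^ alpha ε)]⟩

/-- This is the decay exponent of G, H and F, which are of order ρ/(1-ε²v²); it leaves twice the
required rate. -/
lemma one_sub_epsPrime (ε : ℝ) : 1 - 1 * epsPrime ε = 2 * alpha ε := by
  have : 1 + ε ^ 2 ≠ 0 := by positivity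
  unfold epsPrime alpha; field_simp; ring

lemma decay_frac {ε : ℝ} (hε : 0 < ε) {g : ℝ → ℝ} {C : ℝ} (hC : 0 ≤ C)
    (h : ∀ v, ε * |v| < 1 → |g v| ≤ C) (M : ℝ) (hM : 0 < M) :
    ∃ C' : ℝ, ∀ p ∈ tameRegion ε M, |g p.2 / (1 - ε ^ 2 * p.2 ^ 2) * p.1| ≤ C' * p.1 ^ alpha ε := by
  refine decay_of_bound (U := fun p => g p.2 / (1 - ε ^ 2 * p.2 ^ 2) * p.1) (s := 1) (e := 1) hε hC
    zero_le_one ?_ (by simp) ?_ M hM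
  · rw [one_sub_epsPrime]; linarith [alpha_nonneg ε]
  · intro p hp
    have h1 := lum_pos hε hp.2
    rw [Real.rpow_one, Real.rpow_neg_one, abs_mul, abs_div, abs_of_pos h1, abs_of_pos hp.1,
      div_eq_mul_inv]
    have := h _ hp.2
    have h2 : 0 < p.1 := hp.1
    calc |g p.2| * (1 - ε ^ 2 * p.2 ^ 2)⁻¹ * p.1 ≤ C * (1 - ε ^ 2 * p.2 ^ 2)⁻¹ * p.1 := by gcongr
      _ = _ := by ring

lemma sq_le_of_lum {ε v : ℝ} (hε : 0 < ε) (h : ε * |v| < 1) : v ^ 2 ≤ 1 / ε ^ 2 := by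
  rw [le_div_iff₀ (by positivity)]; linarith [lum_pos hε h]

lemma abs_le_of_lum {ε v : ℝ} (hε : 0 < ε) (h : ε * |v| < 1) : |v| ≤ 1 / ε := by
  rw [le_div_iff₀ hε]; linarith

lemma hasDerivAt_lum (ε v : ℝ) :
    HasDerivAt (fun v : ℝ => 1 - ε ^ 2 * v ^ 2) (-(2 * ε ^ 2 * v)) v := by
  exact (((hasDerivAt_pow 2 v).const_mul (ε ^ 2)).const_sub 1).congr_deriv (by push_cast; ring)

lemma hasDerivAt_Gcoef {ε v : ℝ} (h : 1 - ε ^ 2 * v ^ 2 ≠ 0) :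
    HasDerivAt (fun v : ℝ => (1 + ε ^ 4 * v ^ 2) / (1 - ε ^ 2 * v ^ 2))
      (2 * ε ^ 2 * v * (1 + ε ^ 2) / (1 - ε ^ 2 * v ^ 2) ^ 2) v := by
  have h1 := ((hasDerivAt_pow 2 v).const_mul (ε ^ 4)).const_add 1
  refine (h1.div (hasDerivAt_lum ε v) h).congr_deriv ?_
  rw [div_left_inj' (pow_ne_zero 2 h)]; push_cast; ring

lemma hasDerivAt_Hcoef {ε v : ℝ} (h : 1 - ε ^ 2 * v ^ 2 ≠ 0) :
    HasDerivAt (fun v : ℝ => (1 + ε ^ 2) * v / (1 - ε ^ 2 * v ^ 2))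
      ((1 + ε ^ 2) * (1 + ε ^ 2 * v ^ 2) / (1 - ε ^ 2 * v ^ 2) ^ 2) v := by
  have h1 := (hasDerivAt_id' v).const_mul (1 + ε ^ 2)
  refine (h1.div (hasDerivAt_lum ε v) h).congr_deriv ?_
  rw [div_left_inj' (pow_ne_zero 2 h)]; ring

lemma hasDerivAt_Fcoef {ε v : ℝ} (h : 1 - ε ^ 2 * v ^ 2 ≠ 0) :
    HasDerivAt (fun v : ℝ => (1 + v ^ 2) / (1 - ε ^ 2 * v ^ 2))
      (2 * v * (1 + ε ^ 2) / (1 - ε ^ 2 * v ^ 2) ^ 2) v := by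
  have h1 := (hasDerivAt_pow 2 v).const_add 1
  refine (h1.div (hasDerivAt_lum ε v) h).congr_deriv ?_
  rw [div_left_inj' (pow_ne_zero 2 h)]; push_cast; ring

lemma H_fun (ε : ℝ) : H ε = fun p : ℝ × ℝ => (1 + ε ^ 2) * p.2 / (1 - ε ^ 2 * p.2 ^ 2) * p.1 := by
  funext p; simp only [H]; ring

lemma fderiv_G {ε : ℝ} {p : ℝ × ℝ} (h : 1 - ε ^ 2 * p.2 ^ 2 ≠ 0) (x : ℝ × ℝ) :
    fderiv ℝ (G ε) p x = 2 * ε ^ 2 * p.2 * (1 + ε ^ 2) / (1 - ε ^ 2 * p.2 ^ 2) ^ 2 * x.2 * p.1 +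
      (1 + ε ^ 4 * p.2 ^ 2) / (1 - ε ^ 2 * p.2 ^ 2) * x.1 := by
  have := fderiv_sep (hasDerivAt_Gcoef h) (hasDerivAt_id' p.1) x
  rw [one_mul] at this; exact this

lemma fderiv_H {ε : ℝ} {p : ℝ × ℝ} (h : 1 - ε ^ 2 * p.2 ^ 2 ≠ 0) (x : ℝ × ℝ) :
    fderiv ℝ (H ε) p x =
      (1 + ε ^ 2) * (1 + ε ^ 2 * p.2 ^ 2) / (1 - ε ^ 2 * p.2 ^ 2) ^ 2 * x.2 * p.1 +
      (1 + ε ^ 2) * p.2 / (1 - ε ^ 2 * p.2 ^ 2) * x.1 := by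
  have := fderiv_sep (hasDerivAt_Hcoef h) (hasDerivAt_id' p.1) x
  rw [one_mul] at this; rw [H_fun]; exact this

lemma fderiv_F {ε : ℝ} {p : ℝ × ℝ} (h : 1 - ε ^ 2 * p.2 ^ 2 ≠ 0) (x : ℝ × ℝ) :
    fderiv ℝ (F ε) p x = 2 * p.2 * (1 + ε ^ 2) / (1 - ε ^ 2 * p.2 ^ 2) ^ 2 * x.2 * p.1 +
      (1 + p.2 ^ 2) / (1 - ε ^ 2 * p.2 ^ 2) * x.1 := by
  have := fderiv_sep (hasDerivAt_Fcoef h) (hasDerivAt_id' p.1) x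
  rw [one_mul] at this; exact this

lemma lam_den_pos {ε v : ℝ} (hε : 0 < ε) (hε1 : ε ≤ 1) (h : ε * |v| < 1) :
    0 < 1 - ε ^ 2 * v ∧ 0 < 1 + ε ^ 2 * v := by
  obtain ⟨h1, h2⟩ := lum_lt hε h
  constructor <;> nlinarith

lemma contDiffOn_lum {ε : ℝ} :
    ContDiffOn ℝ ∞ (fun p : ℝ × ℝ => 1 - ε ^ 2 * p.2 ^ 2) (nonVacuum ε) := by
  fun_prop

lemma continuousOn_frac {ε : ℝ} (hε : 0 < ε) {g : ℝ → ℝ} (hg : Continuous g) :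
    ContinuousOn (fun p : ℝ × ℝ => g p.2 / (1 - ε ^ 2 * p.2 ^ 2) * p.1) (phaseSpace ε) := by
  refine ContinuousOn.mul (ContinuousOn.div (by fun_prop) (by fun_prop) ?_) (by fun_prop)
  intro p hp; exact (lum_pos hε hp.2).ne'

lemma contDiffOn_frac {ε : ℝ} (hε : 0 < ε) {g : ℝ → ℝ} (hg : ContDiff ℝ ∞ g) :
    ContDiffOn ℝ ∞ (fun p : ℝ × ℝ => g p.2 / (1 - ε ^ 2 * p.2 ^ 2) * p.1) (nonVacuum ε) := by
  refine ContDiffOn.mul (ContDiffOn.div (by fun_prop) contDiffOn_lum ?_) (by fun_prop)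
  intro p hp; exact (lum_pos hε hp.2).ne'

theorem isWeakEntropyPair_GH {ε : ℝ} (hε : 0 < ε) (hε1 : ε ≤ 1) :
    IsWeakEntropyPair ε (G ε) (H ε) where
  continuousOn_entropy := continuousOn_frac hε (g := fun v => 1 + ε ^ 4 * v ^ 2) (by fun_prop)
  continuousOn_flux := by
    rw [H_fun]; exact continuousOn_frac hε (g := fun v => (1 + ε ^ 2) * v) (by fun_prop)
  smooth_entropy := contDiffOn_frac hε (g := fun v => 1 + ε ^ 4 * v ^ 2) (by fun_prop)
  smooth_flux := by
    rw [H_fun]; exact contDiffOn_frac hε (g := fun v => (1 + ε ^ 2) * v) (by fun_prop)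
  compat₁ p hp := by
    have h1 := (lum_pos hε hp.2).ne'
    have h2 := (lam_den_pos hε hε1 hp.2).1.ne'
    have h3 : p.1 ≠ 0 := hp.1.ne'
    have h4 : 1 + ε ^ 2 ≠ 0 := by positivity
    rw [fderiv_G h1, fderiv_H h1]
    simp only [r₁, lam₁]; field_simp; ring
  compat₂ p hp := by
    have h1 := (lum_pos hε hp.2).ne'
    have h2 := (lam_den_pos hε hε1 hp.2).2.ne'
    have h3 : p.1 ≠ 0 := hp.1.ne'
    have h4 : 1 + ε ^ 2 ≠ 0 := by positivity
    rw [fderiv_G h1, fderiv_H h1]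
    simp only [r₂, lam₂]; field_simp; ring
  vacuum v := by simp [G, H]
  decay := by
    rw [H_fun]
    refine sep_decay (decay_frac hε (g := fun v => 1 + ε ^ 4 * v ^ 2) (C := 2)
      (by norm_num) ?_) (decay_frac hε (g := fun v => (1 + ε ^ 2) * v) (C := 2 / ε)
      (by positivity) ?_)
    · intro v hv
      have := sq_le_of_lum hε hv
      have h2 : ε ^ 4 * v ^ 2 ≤ 1 := by
        calc ε ^ 4 * v ^ 2 ≤ ε ^ 4 * (1 / ε ^ 2) := by gcongr
          _ = ε ^ 2 := by field_simp
          _ ≤ 1 := by nlinarith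
      have h3 : 0 ≤ ε ^ 4 * v ^ 2 := by positivity
      rw [abs_of_nonneg (by linarith)]; linarith
    · intro v hv
      have h3 : 0 < 1 + ε ^ 2 := by positivity
      rw [abs_mul, abs_of_pos h3]
      calc (1 + ε ^ 2) * |v| ≤ 2 * (1 / ε) := by
            apply mul_le_mul _ (abs_le_of_lum hε hv) (abs_nonneg _) (by norm_num); nlinarith
        _ = _ := by ring

theorem isWeakEntropyPair_HF {ε : ℝ} (hε : 0 < ε) (hε1 : ε ≤ 1) :
    IsWeakEntropyPair ε (H ε) (F ε) where
  continuousOn_entropy := (isWeakEntropyPair_GH hε hε1).continuousOn_flux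
  continuousOn_flux := continuousOn_frac hε (g := fun v => 1 + v ^ 2) (by fun_prop)
  smooth_entropy := (isWeakEntropyPair_GH hε hε1).smooth_flux
  smooth_flux := contDiffOn_frac hε (g := fun v => 1 + v ^ 2) (by fun_prop)
  compat₁ p hp := by
    have h1 := (lum_pos hε hp.2).ne'
    have h2 := (lam_den_pos hε hε1 hp.2).1.ne'
    have h3 : p.1 ≠ 0 := hp.1.ne'
    have h4 : 1 + ε ^ 2 ≠ 0 := by positivity
    rw [fderiv_F h1, fderiv_H h1]
    simp only [r₁, lam₁]
    generalize hd : 1 - ε ^ 2 * p.2 ^ 2 = d at *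
    generalize he : 1 - ε ^ 2 * p.2 = e at *
    field_simp; rw [← he]; ring
  compat₂ p hp := by
    have h1 := (lum_pos hε hp.2).ne'
    have h2 := (lam_den_pos hε hε1 hp.2).2.ne'
    have h3 : p.1 ≠ 0 := hp.1.ne'
    have h4 : 1 + ε ^ 2 ≠ 0 := by positivity
    rw [fderiv_F h1, fderiv_H h1]
    simp only [r₂, lam₂]
    generalize hd : 1 - ε ^ 2 * p.2 ^ 2 = d at *
    generalize he : 1 + ε ^ 2 * p.2 = e at *
    field_simp; rw [← he]; ring
  vacuum v := by simp [F, H]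
  decay := by
    refine sep_decay ?_ (decay_frac hε (g := fun v => 1 + v ^ 2) (C := 1 + 1 / ε ^ 2)
      (by positivity) ?_)
    · intro M hM
      obtain ⟨C, hC⟩ := (isWeakEntropyPair_GH hε hε1).decay M hM
      exact ⟨C, fun p hp => by linarith [hC p hp, abs_nonneg (G ε p)]⟩
    · intro v hv
      rw [abs_of_nonneg (by positivity)]; linarith [sq_le_of_lum hε hv]

lemma convex_cone (ε : ℝ) (hε : 0 < ε) : Convex ℝ (conservedCone ε) := by
  intro x hx y hy a b ha hb hab
  have hx' : ε * |x.2| < x.1 := hx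
  have hy' : ε * |y.2| < y.1 := hy
  show ε * |a * x.2 + b * y.2| < a * x.1 + b * y.1
  have h1 : |a * x.2 + b * y.2| ≤ a * |x.2| + b * |y.2| := by
    refine (abs_add_le _ _).trans ?_
    rw [abs_mul, abs_mul, abs_of_nonneg ha, abs_of_nonneg hb]
  have h2 : ε * |a * x.2 + b * y.2| ≤ ε * (a * |x.2| + b * |y.2|) := by gcongr
  rcases ha.eq_or_lt with h | h
  · subst h; have : b = 1 := by linarith
    subst this; nlinarith
  · nlinarith

/-- Coefficients of either sign are admitted, so the entropy inequalities contain the two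
conservation laws as equalities. -/
lemma isConvexEntropy_linear {ε : ℝ} (hε : 0 < ε) (c d : ℝ) :
    IsConvexEntropy ε (fun p => c * G ε p + d * H ε p) := by
  refine ⟨fun q => c * q.1 + d * q.2, ⟨convex_cone ε hε, ?_⟩, fun p _ => rfl⟩
  intro x _ y _ a b _ _ _
  simp only [Prod.fst_add, Prod.snd_add, Prod.smul_fst, Prod.smul_snd, smul_eq_mul]
  apply le_of_eq; ring

/-! ### The particle number entropy pair -/

lemma hasDerivAt_inv_sqrt_lum {ε v : ℝ} (h : 0 < 1 - ε ^ 2 * v ^ 2) :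
    HasDerivAt (fun v : ℝ => (√(1 - ε ^ 2 * v ^ 2))⁻¹)
      (ε ^ 2 * v / (√(1 - ε ^ 2 * v ^ 2) * (1 - ε ^ 2 * v ^ 2))) v := by
  have h1 := ((hasDerivAt_lum ε v).sqrt h.ne').inv (Real.sqrt_pos.2 h).ne'
  refine h1.congr_deriv ?_
  rw [Real.sq_sqrt h.le]
  have h2 := (Real.sqrt_pos.2 h).ne'
  field_simp

lemma hasDerivAt_mul_inv_sqrt_lum {ε v : ℝ} (h : 0 < 1 - ε ^ 2 * v ^ 2) :
    HasDerivAt (fun v : ℝ => v * (√(1 - ε ^ 2 * v ^ 2))⁻¹)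
      (1 / (√(1 - ε ^ 2 * v ^ 2) * (1 - ε ^ 2 * v ^ 2))) v := by
  refine ((hasDerivAt_id' v).mul (hasDerivAt_inv_sqrt_lum h)).congr_deriv ?_
  have h2 := (Real.sqrt_pos.2 h).ne'
  have h3 := h.ne'
  generalize √(1 - ε ^ 2 * v ^ 2) = s at *
  generalize hd : 1 - ε ^ 2 * v ^ 2 = d at *
  field_simp
  rw [← hd]; ring

lemma hasDerivAt_rpow_density {ε r : ℝ} (h : 0 < r) :
    HasDerivAt (fun r : ℝ => r ^ (1 / (1 + ε ^ 2))) (1 / (1 + ε ^ 2) * r ^ (1 / (1 + ε ^ 2)) / r) r := by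
  refine (Real.hasDerivAt_rpow_const (Or.inl h.ne')).congr_deriv ?_
  rw [Real.rpow_sub_one h.ne']; ring

lemma fderiv_Nn {ε : ℝ} {p : ℝ × ℝ} (h : 0 < 1 - ε ^ 2 * p.2 ^ 2) (hp : 0 < p.1) (x : ℝ × ℝ) :
    fderiv ℝ (Nn ε) p x =
      ε ^ 2 * p.2 / (√(1 - ε ^ 2 * p.2 ^ 2) * (1 - ε ^ 2 * p.2 ^ 2)) * x.2 *
        p.1 ^ (1 / (1 + ε ^ 2)) +
      (√(1 - ε ^ 2 * p.2 ^ 2))⁻¹ * (1 / (1 + ε ^ 2) * p.1 ^ (1 / (1 + ε ^ 2)) / p.1 * x.1) :=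
  fderiv_sep (hasDerivAt_inv_sqrt_lum h) (hasDerivAt_rpow_density hp) x

lemma fderiv_Qn {ε : ℝ} {p : ℝ × ℝ} (h : 0 < 1 - ε ^ 2 * p.2 ^ 2) (hp : 0 < p.1) (x : ℝ × ℝ) :
    fderiv ℝ (Qn ε) p x =
      1 / (√(1 - ε ^ 2 * p.2 ^ 2) * (1 - ε ^ 2 * p.2 ^ 2)) * x.2 *
        p.1 ^ (1 / (1 + ε ^ 2)) +
      p.2 * (√(1 - ε ^ 2 * p.2 ^ 2))⁻¹ *
        (1 / (1 + ε ^ 2) * p.1 ^ (1 / (1 + ε ^ 2)) / p.1 * x.1) :=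
  fderiv_sep (hasDerivAt_mul_inv_sqrt_lum h) (hasDerivAt_rpow_density hp) x

lemma rpow_density_pos {ε r : ℝ} (h : 0 < r) : 0 < r ^ (1 / (1 + ε ^ 2)) :=
  Real.rpow_pos_of_pos h _

/-- The particle number loses only half a power of 1-ε²v², which leaves the exponent (1-ε)/(1+ε²).
-/
lemma decay_exponent_Nn {ε : ℝ} (hε : 0 < ε) (hε1 : ε ≤ 1) :
    alpha ε ≤ 1 / (1 + ε ^ 2) - 1 / 2 * epsPrime ε := by
  unfold alpha epsPrime
  have h : 0 < 1 + ε ^ 2 := by positivity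
  rw [show 1 / (1 + ε ^ 2) - 1 / 2 * (2 * ε / (1 + ε ^ 2)) = (2 * (1 - ε)) / (2 * (1 + ε ^ 2)) by
    field_simp]
  gcongr
  nlinarith

theorem isWeakEntropyPair_particle {ε : ℝ} (hε : 0 < ε) (hε1 : ε ≤ 1) :
    IsWeakEntropyPair ε (Nn ε) (Qn ε) where
  continuousOn_entropy := by
    refine ContinuousOn.mul (ContinuousOn.inv₀ (by fun_prop) ?_) ?_
    · intro p hp; exact (Real.sqrt_pos.2 (lum_pos hε hp.2)).ne'
    · exact ContinuousOn.rpow_const (by fun_prop) (fun p _ => Or.inr (by positivity))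
  continuousOn_flux := by
    refine ContinuousOn.mul (ContinuousOn.mul (by fun_prop) (ContinuousOn.inv₀ (by fun_prop) ?_)) ?_
    · intro p hp; exact (Real.sqrt_pos.2 (lum_pos hε hp.2)).ne'
    · exact ContinuousOn.rpow_const (by fun_prop) (fun p _ => Or.inr (by positivity))
  smooth_entropy := by
    refine ContDiffOn.mul (ContDiffOn.inv (contDiffOn_lum.sqrt ?_) ?_) ?_
    · intro p hp; exact (lum_pos hε hp.2).ne'
    · intro p hp; exact (Real.sqrt_pos.2 (lum_pos hε hp.2)).ne'
    · exact ContDiffOn.rpow_const_of_ne (by fun_prop) (fun p hp => hp.1.ne')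
  smooth_flux := by
    refine ContDiffOn.mul (ContDiffOn.mul (by fun_prop)
      (ContDiffOn.inv (contDiffOn_lum.sqrt ?_) ?_)) ?_
    · intro p hp; exact (lum_pos hε hp.2).ne'
    · intro p hp; exact (Real.sqrt_pos.2 (lum_pos hε hp.2)).ne'
    · exact ContDiffOn.rpow_const_of_ne (by fun_prop) (fun p hp => hp.1.ne')
  compat₁ p hp := by
    have h0 := lum_pos hε hp.2
    have h1 := h0.ne'
    have h2 := (lam_den_pos hε hε1 hp.2).1.ne'
    have h3 : p.1 ≠ 0 := hp.1.ne'
    have h4 : 1 + ε ^ 2 ≠ 0 := by positivity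
    have h5 := (Real.sqrt_pos.2 h0).ne'
    rw [fderiv_Nn h0 hp.1, fderiv_Qn h0 hp.1]
    simp only [r₁, lam₁]
    generalize p.1 ^ (1 / (1 + ε ^ 2)) = n
    generalize √(1 - ε ^ 2 * p.2 ^ 2) = s at *
    generalize hd : 1 - ε ^ 2 * p.2 ^ 2 = d at *
    generalize he : 1 - ε ^ 2 * p.2 = e at *
    field_simp; rw [← he]; ring
  compat₂ p hp := by
    have h0 := lum_pos hε hp.2
    have h1 := h0.ne'
    have h2 := (lam_den_pos hε hε1 hp.2).2.ne'
    have h3 : p.1 ≠ 0 := hp.1.ne'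
    have h4 : 1 + ε ^ 2 ≠ 0 := by positivity
    have h5 := (Real.sqrt_pos.2 h0).ne'
    rw [fderiv_Nn h0 hp.1, fderiv_Qn h0 hp.1]
    simp only [r₂, lam₂]
    generalize p.1 ^ (1 / (1 + ε ^ 2)) = n
    generalize √(1 - ε ^ 2 * p.2 ^ 2) = s at *
    generalize hd : 1 - ε ^ 2 * p.2 ^ 2 = d at *
    generalize he : 1 + ε ^ 2 * p.2 = e at *
    field_simp; rw [← he]; ring
  vacuum v := by
    have : (1 / (1 + ε ^ 2)) ≠ 0 := by positivity
    simp [Nn, Qn, Real.zero_rpow (show (1 + ε ^ 2)⁻¹ ≠ 0 by positivity)]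
  decay := by
    have e : ∀ p ∈ nonVacuum ε,
        (√(1 - ε ^ 2 * p.2 ^ 2))⁻¹ = (1 - ε ^ 2 * p.2 ^ 2) ^ (-(1 / 2 : ℝ)) := by
      intro p hp
      rw [Real.sqrt_eq_rpow, Real.rpow_neg (lum_pos hε hp.2).le]
    refine sep_decay ?_ ?_
    · refine decay_of_bound (s := 1 / (1 + ε ^ 2)) (e := 1 / 2) (C := 1) hε zero_le_one
        (by norm_num) (decay_exponent_Nn hε hε1) ?_ ?_
      · intro v; simp [Nn, Real.zero_rpow (show (1 + ε ^ 2)⁻¹ ≠ 0 by positivity)]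
      · intro p hp
        have h1 : 0 ≤ p.1 ^ (1 / (1 + ε ^ 2)) := (rpow_density_pos hp.1).le
        have h2 : 0 ≤ (1 - ε ^ 2 * p.2 ^ 2) ^ (-(1 / 2 : ℝ)) :=
          Real.rpow_nonneg (lum_pos hε hp.2).le _
        rw [Nn, e p hp, abs_of_nonneg (by positivity)]
        apply le_of_eq; ring
    · refine decay_of_bound (s := 1 / (1 + ε ^ 2)) (e := 1 / 2) (C := 1 / ε) hε (by positivity)
        (by norm_num) (decay_exponent_Nn hε hε1) ?_ ?_
      · intro v; simp [Qn, Real.zero_rpow (show (1 + ε ^ 2)⁻¹ ≠ 0 by positivity)]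
      · intro p hp
        have h1 : 0 ≤ p.1 ^ (1 / (1 + ε ^ 2)) := (rpow_density_pos hp.1).le
        have h2 : 0 ≤ (1 - ε ^ 2 * p.2 ^ 2) ^ (-(1 / 2 : ℝ)) :=
          Real.rpow_nonneg (lum_pos hε hp.2).le _
        rw [Qn, e p hp, abs_mul, abs_mul, abs_of_nonneg h1, abs_of_nonneg h2]
        calc |p.2| * (1 - ε ^ 2 * p.2 ^ 2) ^ (-(1 / 2 : ℝ)) * p.1 ^ (1 / (1 + ε ^ 2))
            ≤ 1 / ε * (1 - ε ^ 2 * p.2 ^ 2) ^ (-(1 / 2 : ℝ)) * p.1 ^ (1 / (1 + ε ^ 2)) := by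
              gcongr; exact abs_le_of_lum hε hp.2
          _ = _ := by ring

/-! ### Inverting the conservative variables -/

/-- Square-root coordinates in terms of the conservative variables. -/
def phiInvA (ε : ℝ) (q : ℝ × ℝ) : ℝ × ℝ :=
  ((√(q.1 + 2 * ε ^ 2 / (1 + ε ^ 2) * q.2) + √(q.1 - 2 * ε ^ 2 / (1 + ε ^ 2) * q.2)) / 2,
   (√(q.1 + 2 * ε ^ 2 / (1 + ε ^ 2) * q.2) - √(q.1 - 2 * ε ^ 2 / (1 + ε ^ 2) * q.2)) / (2 * ε ^ 2))

lemma conserved_pos {ε : ℝ} (hε : 0 < ε) {q : ℝ × ℝ} (h : q ∈ conservedCone ε) :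
    0 < q.1 + 2 * ε ^ 2 / (1 + ε ^ 2) * q.2 ∧ 0 < q.1 - 2 * ε ^ 2 / (1 + ε ^ 2) * q.2 := by
  have h1 : 2 * ε ^ 2 / (1 + ε ^ 2) ≤ ε := by
    rw [div_le_iff₀ (by positivity)]; nlinarith [sq_nonneg (1 - ε)]
  have h2 : 0 ≤ 2 * ε ^ 2 / (1 + ε ^ 2) := by positivity
  constructor
  · exact cone_comb_pos (q := q) h (by rw [abs_of_nonneg h2]; exact h1)
  · have := cone_comb_pos (q := q) (s := -(2 * ε ^ 2 / (1 + ε ^ 2))) h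
      (by rw [abs_neg, abs_of_nonneg h2]; exact h1)
    linarith

lemma phiInvA_mem {ε : ℝ} (hε : 0 < ε) {q : ℝ × ℝ} (h : q ∈ conservedCone ε) :
    phiInvA ε q ∈ cone ε := by
  obtain ⟨h1, h2⟩ := conserved_pos hε h
  obtain ⟨h3, h4⟩ := (cone_iff (q := q) hε).1 h
  have hp : 0 < 1 + ε ^ 2 := by positivity
  have s1 := Real.sqrt_pos.2 h1
  have s2 := Real.sqrt_pos.2 h2
  have t1 := Real.sq_sqrt h1.le
  have t2 := Real.sq_sqrt h2.le
  rw [cone_iff hε]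
  simp only [phiInvA]
  set c := √(q.1 + 2 * ε ^ 2 / (1 + ε ^ 2) * q.2)
  set d := √(q.1 - 2 * ε ^ 2 / (1 + ε ^ 2) * q.2)
  -- Here c and d play the roles of a+ε²b and a-ε²b. The condition εb < a reads (1-ε)c < (1+ε)d, and
  -- the squares of the two sides differ by a positive multiple of q.1 - ε q.2.
  have key1 : (1 - ε) * c < (1 + ε) * d := by
    apply lt_of_pow_lt_pow_left₀ 2 (by positivity)
    rw [mul_pow, mul_pow, t1, t2]
    have : (1 + ε) ^ 2 * (q.1 - 2 * ε ^ 2 / (1 + ε ^ 2) * q.2) -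
      (1 - ε) ^ 2 * (q.1 + 2 * ε ^ 2 / (1 + ε ^ 2) * q.2) = 4 * ε * (q.1 - ε * q.2) := by
      field_simp; ring
    have : 0 < 4 * ε * (q.1 - ε * q.2) := by apply mul_pos <;> linarith
    linarith
  have key2 : (1 - ε) * d < (1 + ε) * c := by
    apply lt_of_pow_lt_pow_left₀ 2 (by positivity)
    rw [mul_pow, mul_pow, t1, t2]
    have : (1 + ε) ^ 2 * (q.1 + 2 * ε ^ 2 / (1 + ε ^ 2) * q.2) -
      (1 - ε) ^ 2 * (q.1 - 2 * ε ^ 2 / (1 + ε ^ 2) * q.2) = 4 * ε * (q.1 + ε * q.2) := by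
      field_simp; ring
    have : 0 < 4 * ε * (q.1 + ε * q.2) := by apply mul_pos <;> linarith
    linarith
  have e : ε * ((c - d) / (2 * ε ^ 2)) = (c - d) / (2 * ε) := by field_simp
  rw [e, lt_div_iff₀ (by positivity), div_lt_iff₀ (by positivity)]
  constructor <;> nlinarith

lemma GA_phiInvA {ε : ℝ} (hε : 0 < ε) {q : ℝ × ℝ} (h : q ∈ conservedCone ε) :
    GA ε (phiInvA ε q) = q.1 := by
  obtain ⟨h1, h2⟩ := conserved_pos hε h
  have t1 := Real.sq_sqrt h1.le
  have t2 := Real.sq_sqrt h2.le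
  simp only [GA, phiInvA]
  generalize √(q.1 + 2 * ε ^ 2 / (1 + ε ^ 2) * q.2) = c at *
  generalize √(q.1 - 2 * ε ^ 2 / (1 + ε ^ 2) * q.2) = d at *
  field_simp; linarith

lemma HA_phiInvA {ε : ℝ} (hε : 0 < ε) {q : ℝ × ℝ} (h : q ∈ conservedCone ε) :
    HA ε (phiInvA ε q) = q.2 := by
  obtain ⟨h1, h2⟩ := conserved_pos hε h
  have t1 := Real.sq_sqrt h1.le
  have t2 := Real.sq_sqrt h2.le
  have e : HA ε (phiInvA ε q) = (1 + ε ^ 2) / (4 * ε ^ 2) *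
    (√(q.1 + 2 * ε ^ 2 / (1 + ε ^ 2) * q.2) ^ 2 - √(q.1 - 2 * ε ^ 2 / (1 + ε ^ 2) * q.2) ^ 2) := by
    simp only [HA, phiInvA]; field_simp; ring
  rw [e, t1, t2]; field_simp; ring

lemma sq_le_self_of_le_one {ε : ℝ} (hε : 0 < ε) (hε1 : ε ≤ 1) : |ε ^ 2| ≤ ε := by
  rw [abs_of_nonneg (by positivity)]; nlinarith

/-- The combinations G ± 2ε²/(1+ε²) H are the squares of a ± ε²b, and both roots are nonnegative on
the cone because ε² ≤ ε. -/
lemma phiInvA_apply {ε : ℝ} (hε : 0 < ε) (hε1 : ε ≤ 1) {q : ℝ × ℝ}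
    (h : q = (0, 0) ∨ q ∈ cone ε) : phiInvA ε (GA ε q, HA ε q) = q := by
  have h1 : 0 ≤ q.1 + ε ^ 2 * q.2 ∧ 0 ≤ q.1 - ε ^ 2 * q.2 := by
    rcases h with rfl | h
    · simp
    · have h1 := cone_comb_pos h (sq_le_self_of_le_one hε hε1)
      have h2 := cone_comb_pos h (s := -ε ^ 2)
        (by rw [abs_neg]; exact sq_le_self_of_le_one hε hε1)
      constructor <;> linarith
  have e1 : GA ε q + 2 * ε ^ 2 / (1 + ε ^ 2) * HA ε q = (q.1 + ε ^ 2 * q.2) ^ 2 := by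
    simp only [GA, HA]; field_simp; ring
  have e2 : GA ε q - 2 * ε ^ 2 / (1 + ε ^ 2) * HA ε q = (q.1 - ε ^ 2 * q.2) ^ 2 := by
    simp only [GA, HA]; field_simp; ring
  simp only [phiInvA, e1, e2, Real.sqrt_sq h1.1, Real.sqrt_sq h1.2]
  ext
  · simp only []; ring
  · simp only []; field_simp; ring

/-- The forms G ± εH factor as (a ± εb)(a ± ε³b), with both factors positive on the cone. -/
lemma GH_mem {ε : ℝ} (hε : 0 < ε) (hε1 : ε ≤ 1) {p : ℝ × ℝ} (h : p ∈ nonVacuum ε) :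
    (G ε p, H ε p) ∈ conservedCone ε := by
  have hc := toA_mem hε h
  obtain ⟨h1, h2⟩ := (cone_iff hε).1 hc
  have h3 := cone_fst_pos hε hc
  refine (cone_iff (q := (G ε p, H ε p)) hε).2 ?_
  rw [G_eq hε (adm_of_nonVacuum h), H_eq hε (adm_of_nonVacuum h)]
  simp only [GA, HA]
  generalize toA ε p = q at *
  have e1 : q.1 ^ 2 + ε ^ 4 * q.2 ^ 2 + ε * ((1 + ε ^ 2) * q.1 * q.2) =
    (q.1 + ε * q.2) * (q.1 + ε ^ 3 * q.2) := by ring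
  have e2 : q.1 ^ 2 + ε ^ 4 * q.2 ^ 2 - ε * ((1 + ε ^ 2) * q.1 * q.2) =
    (q.1 - ε * q.2) * (q.1 - ε ^ 3 * q.2) := by ring
  have hs : |ε ^ 3| ≤ ε := by
    rw [abs_of_nonneg (by positivity)]; nlinarith [sq_nonneg ε, mul_pos hε hε]
  have h5 := cone_comb_pos hc hs
  have h6 := cone_comb_pos (s := -ε ^ 3) hc (by rw [abs_neg]; exact hs)
  have f1 := mul_pos (show 0 < q.1 + ε * q.2 by linarith) h5
  have f2 := mul_pos (show 0 < q.1 - ε * q.2 by linarith)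
    (show 0 < q.1 - ε ^ 3 * q.2 by linarith)
  constructor <;> linarith

/-- The state with given conservative variables. -/
def phiInv (ε : ℝ) (q : ℝ × ℝ) : ℝ × ℝ := ofA ε (phiInvA ε q)

lemma phiInv_mem {ε : ℝ} (hε : 0 < ε) {q : ℝ × ℝ} (h : q ∈ conservedCone ε) :
    phiInv ε q ∈ nonVacuum ε := ofA_mem hε (phiInvA_mem hε h)

lemma G_phiInv {ε : ℝ} (hε : 0 < ε) {q : ℝ × ℝ} (h : q ∈ conservedCone ε) :
    G ε (phiInv ε q) = q.1 := by
  rw [G_eq hε (adm_of_nonVacuum (phiInv_mem hε h)), phiInv, toA_ofA hε (phiInvA_mem hε h),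
    GA_phiInvA hε h]

lemma H_phiInv {ε : ℝ} (hε : 0 < ε) {q : ℝ × ℝ} (h : q ∈ conservedCone ε) :
    H ε (phiInv ε q) = q.2 := by
  rw [H_eq hε (adm_of_nonVacuum (phiInv_mem hε h)), phiInv, toA_ofA hε (phiInvA_mem hε h),
    HA_phiInvA hε h]

lemma phiInv_apply {ε : ℝ} (hε : 0 < ε) (hε1 : ε ≤ 1) {p : ℝ × ℝ} (h : p ∈ nonVacuum ε) :
    phiInv ε (G ε p, H ε p) = p := by
  rw [phiInv, G_eq hε (adm_of_nonVacuum h), H_eq hε (adm_of_nonVacuum h),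
    phiInvA_apply hε hε1 (Or.inr (toA_mem hε h)), ofA_toA hε h]

/-! ### Concavity of the particle number -/

/-- The velocity part of the concavity of the particle number: the right side is the component of G
- ε²wH per unit density, compared here with a power of the ratio of Lorentz factors. -/
lemma lorentz_factor_le {ε v w : ℝ} (hε : 0 < ε) (hε1 : ε ≤ 1) (hv : ε * |v| < 1)
    (hw : ε * |w| < 1) :
    (√(1 - ε ^ 2 * w ^ 2) / √(1 - ε ^ 2 * v ^ 2)) ^ (1 + ε ^ 2) ≤
      ((1 + ε ^ 4 * v ^ 2) - ε ^ 2 * (1 + ε ^ 2) * w * v) / (1 - ε ^ 2 * v ^ 2) := by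
  have h1 := lum_pos hε hv
  have h2 := lum_pos hε hw
  rw [← Real.sqrt_div h2.le]
  have hq : 0 < (1 - ε ^ 2 * w ^ 2) / (1 - ε ^ 2 * v ^ 2) := div_pos h2 h1
  -- The weight (1+ε²)/2 turns the exponent 1+ε² of the square root into a weighted geometric mean
  -- with 1.
  have am := Real.geom_mean_le_arith_mean2_weighted (w₁ := (1 + ε ^ 2) / 2) (w₂ := (1 - ε ^ 2) / 2)
    (p₁ := (1 - ε ^ 2 * w ^ 2) / (1 - ε ^ 2 * v ^ 2)) (p₂ := 1) (by positivity)
    (by nlinarith) hq.le zero_le_one (by ring)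
  rw [Real.one_rpow, mul_one, mul_one] at am
  rw [Real.sqrt_eq_rpow, ← Real.rpow_mul hq.le,
    show 1 / 2 * (1 + ε ^ 2) = (1 + ε ^ 2) / 2 by ring]
  refine am.trans ?_
  rw [le_div_iff₀ h1]
  have e : ((1 + ε ^ 2) / 2 * ((1 - ε ^ 2 * w ^ 2) / (1 - ε ^ 2 * v ^ 2)) + (1 - ε ^ 2) / 2) *
    (1 - ε ^ 2 * v ^ 2) = (1 + ε ^ 2) / 2 * (1 - ε ^ 2 * w ^ 2) +
      (1 - ε ^ 2) / 2 * (1 - ε ^ 2 * v ^ 2) := by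
    have := h1.ne'
    field_simp
  rw [e]
  -- The remaining gap is exactly ε²(1+ε²)/2 · (v-w)².
  nlinarith [mul_nonneg (show 0 ≤ ε ^ 2 * (1 + ε ^ 2) by positivity) (sq_nonneg (v - w))]

/-- Supporting affine functions of the particle number in the conservative variables. -/
lemma Nn_le_support {ε : ℝ} (hε : 0 < ε) (hε1 : ε ≤ 1) {p p₀ : ℝ × ℝ} (hp : p ∈ nonVacuum ε)
    (hp₀ : p₀ ∈ nonVacuum ε) :
    Nn ε p ≤ Nn ε p₀ * ((1 - 1 / (1 + ε ^ 2)) +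
      1 / (1 + ε ^ 2) / p₀.1 * (G ε p - ε ^ 2 * p₀.2 * H ε p)) := by
  have h1 := lum_pos hε hp.2
  have h2 := lum_pos hε hp₀.2
  have r1 : 0 < p.1 := hp.1
  have r2 : 0 < p₀.1 := hp₀.1
  have s1 := Real.sqrt_pos.2 h1
  have s2 := Real.sqrt_pos.2 h2
  have hs : 0 < 1 / (1 + ε ^ 2) := by positivity
  have hs1 : 1 / (1 + ε ^ 2) ≤ 1 := by rw [div_le_one (by positivity)]; nlinarith
  set s := 1 / (1 + ε ^ 2) with hsdef
  set κ := ((1 + ε ^ 4 * p.2 ^ 2) - ε ^ 2 * (1 + ε ^ 2) * p₀.2 * p.2) / (1 - ε ^ 2 * p.2 ^ 2)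
    with hκ
  set q := √(1 - ε ^ 2 * p₀.2 ^ 2) / √(1 - ε ^ 2 * p.2 ^ 2) with hq
  have hq0 : 0 < q := div_pos s2 s1
  have hle : q ^ (1 + ε ^ 2) ≤ κ := lorentz_factor_le hε hε1 hp.2 hp₀.2
  have hκ0 : 0 < κ := lt_of_lt_of_le (Real.rpow_pos_of_pos hq0 _) hle
  have hqs : q ≤ κ ^ s := by
    have := Real.rpow_le_rpow (Real.rpow_pos_of_pos hq0 _).le hle hs.le
    rwa [← Real.rpow_mul hq0.le, hsdef, mul_one_div_cancel (by positivity), Real.rpow_one] at this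
  -- Bernoulli's inequality y^s ≤ s y + (1-s) for y = (ρ/ρ₀)κ handles the density part; ρκ is the
  -- affine expression G - ε²v₀H.
  have am := Real.geom_mean_le_arith_mean2_weighted (w₁ := s) (w₂ := 1 - s)
    (p₁ := p.1 / p₀.1 * κ) (p₂ := 1) hs.le (by linarith) (by positivity) zero_le_one (by ring)
  rw [Real.one_rpow, mul_one, mul_one, Real.mul_rpow (by positivity) hκ0.le] at am
  have hy : 0 < (p.1 / p₀.1) ^ s := Real.rpow_pos_of_pos (by positivity) _
  have main : (p.1 / p₀.1) ^ s * q ≤ s * (p.1 / p₀.1 * κ) + (1 - s) := by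
    refine le_trans ?_ am; gcongr
  have e1 : Nn ε p = Nn ε p₀ * ((p.1 / p₀.1) ^ s * q) := by
    rw [Real.div_rpow r1.le r2.le, Nn, Nn, hq]
    have := (Real.rpow_pos_of_pos r2 s).ne'
    rw [← hsdef]
    field_simp
  have e2 : (1 - s) + s / p₀.1 * (G ε p - ε ^ 2 * p₀.2 * H ε p) =
      s * (p.1 / p₀.1 * κ) + (1 - s) := by
    have e3 : G ε p - ε ^ 2 * p₀.2 * H ε p = p.1 * κ := by
      rw [hκ, G, H]; have := h1.ne'; field_simp
    rw [e3]; ring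
  rw [e1, e2]
  have : 0 < Nn ε p₀ := mul_pos (inv_pos.2 s2) (Real.rpow_pos_of_pos r2 _)
  exact mul_le_mul_of_nonneg_left main this.le

lemma Nn_support_eq {ε : ℝ} (hε : 0 < ε) {p : ℝ × ℝ} (hp : p ∈ nonVacuum ε) :
    Nn ε p = Nn ε p * ((1 - 1 / (1 + ε ^ 2)) +
      1 / (1 + ε ^ 2) / p.1 * (G ε p - ε ^ 2 * p.2 * H ε p)) := by
  have h1 := (lum_pos hε hp.2).ne'
  have r1 : p.1 ≠ 0 := hp.1.ne'
  have e : G ε p - ε ^ 2 * p.2 * H ε p = p.1 := by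
    rw [G, H]
    generalize hd : 1 - ε ^ 2 * p.2 ^ 2 = d at *
    field_simp; rw [← hd]; ring
  rw [e]; field_simp; ring

/-- At every state N lies below an affine function of (G, H) that touches it there (`Nn_le_support`,
`Nn_support_eq`). Evaluating that function at the two endpoints of a convex combination gives
concavity of N. -/
theorem isConvexEntropy_neg_particle {ε : ℝ} (hε : 0 < ε) (hε1 : ε ≤ 1) :
    IsConvexEntropy ε (fun p => -Nn ε p) := by
  refine ⟨fun q => -Nn ε (phiInv ε q), ⟨convex_cone ε hε, ?_⟩, fun p hp => ?_⟩
  · intro x hx y hy a b ha hb hab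
    have hz := convex_cone ε hε hx hy ha hb hab
    set z := a • x + b • y with hzdef
    have mz := phiInv_mem hε hz
    have ex := Nn_le_support hε hε1 (phiInv_mem hε hx) mz
    have ey := Nn_le_support hε hε1 (phiInv_mem hε hy) mz
    have ez := Nn_support_eq hε mz
    rw [G_phiInv hε hx, H_phiInv hε hx] at ex
    rw [G_phiInv hε hy, H_phiInv hε hy] at ey
    rw [G_phiInv hε hz, H_phiInv hε hz] at ez
    have z1 : z.1 = a * x.1 + b * y.1 := rfl
    have z2 : z.2 = a * x.2 + b * y.2 := rfl
    rw [z1, z2] at ez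
    simp only [smul_eq_mul]
    have ex' := mul_le_mul_of_nonneg_left ex ha
    have ey' := mul_le_mul_of_nonneg_left ey hb
    have hb' : b = 1 - a := by linarith
    subst hb'
    nlinarith
  · simp only [phiInv_apply hε hε1 hp]

/-! ### The weak formulation for self-similar functions -/

/-- The entropy inequality for self-similar entropy and flux densities `u (x / t)`, `f (x / t)`
with initial density `u₀`. -/
def WeakIneq (u f u₀ : ℝ → ℝ) : Prop :=
  ∀ θ : ℝ × ℝ → ℝ, ContDiff ℝ ∞ θ → HasCompactSupport θ → (∀ q, 0 ≤ q.1 → 0 ≤ θ q) →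
    0 ≤ (∫ q in Ioi (0 : ℝ) ×ˢ (univ : Set ℝ),
          (u (q.2 / q.1) * fderiv ℝ θ q (1, 0) + f (q.2 / q.1) * fderiv ℝ θ q (0, 1)))
        + ∫ x : ℝ, u₀ x * θ (0, x)

/-- Measurable and bounded functions. -/
def BddMeas (u : ℝ → ℝ) : Prop := Measurable u ∧ ∃ C, ∀ x, |u x| ≤ C

lemma BddMeas.integrable_mul {u : ℝ → ℝ} (hu : BddMeas u) {g : ℝ → ℝ} (hg : Integrable g) :
    Integrable (fun x => u x * g x) := by
  obtain ⟨hm, C, hC⟩ := hu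
  exact hg.bdd_mul (c := C) hm.aestronglyMeasurable (ae_of_all _ hC)

lemma BddMeas.integrable_mul_cont {u : ℝ → ℝ} (hu : BddMeas u) {g : ℝ → ℝ} (hg : Continuous g)
    (hc : HasCompactSupport g) : Integrable (fun x => u x * g x) :=
  hu.integrable_mul (hg.integrable_of_hasCompactSupport hc)

lemma BddMeas.neg {u : ℝ → ℝ} (hu : BddMeas u) : BddMeas (fun x => -u x) :=
  ⟨hu.1.neg, hu.2.imp fun C hC x => by rw [abs_neg]; exact hC x⟩

lemma BddMeas.intervalIntegrable {u : ℝ → ℝ} (hu : BddMeas u) (a b : ℝ) :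
    IntervalIntegrable u volume a b := by
  obtain ⟨hm, C, hC⟩ := hu
  exact (intervalIntegrable_const (c := C)).mono_fun hm.aestronglyMeasurable
    (ae_of_all _ fun x => by simpa using (hC x).trans (le_abs_self C))

lemma continuous_fderiv_dir {θ : ℝ × ℝ → ℝ} (hθ : ContDiff ℝ ∞ θ) (v : ℝ × ℝ) : Continuous fun q => fderiv ℝ θ q v :=
  (hθ.continuous_fderiv (by simp)).clm_apply continuous_const

lemma exists_support_bound {θ : ℝ × ℝ → ℝ} (hc : HasCompactSupport θ)
    : ∃ X : ℝ, 0 < X ∧ ∀ q : ℝ × ℝ, (X < |q.1| ∨ X < |q.2|) →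
    θ q = 0 ∧ fderiv ℝ θ q = 0 := by
  obtain ⟨X, hX⟩ := hc.isBounded.subset_closedBall 0
  refine ⟨max X 1, by positivity, fun q hq => ?_⟩
  have : q ∉ tsupport θ := by
    intro h
    have h1 := hX h
    rw [mem_closedBall_zero_iff, Prod.norm_def] at h1
    simp only [Real.norm_eq_abs] at h1
    have h2 := le_max_left |q.1| |q.2|
    have h3 := le_max_right |q.1| |q.2|
    have h4 := le_max_left X 1
    rcases hq with hq | hq <;> linarith
  refine ⟨image_eq_zero_of_notMem_tsupport this, ?_⟩
  by_contra hne
  exact this (support_fderiv_subset ℝ hne)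

lemma integrable_weak {θ : ℝ × ℝ → ℝ} (hθ : ContDiff ℝ ∞ θ) (hc : HasCompactSupport θ)
    {u f : ℝ → ℝ} (hu : BddMeas u) (hf : BddMeas f) :
    Integrable (fun q : ℝ × ℝ =>
      u (q.2 / q.1) * fderiv ℝ θ q (1, 0) + f (q.2 / q.1) * fderiv ℝ θ q (0, 1)) := by
  have h : ∀ (u : ℝ → ℝ) (v : ℝ × ℝ), BddMeas u →
      Integrable (fun q : ℝ × ℝ => u (q.2 / q.1) * fderiv ℝ θ q v) := by
    intro u v hu
    obtain ⟨hm, C, hC⟩ := hu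
    have h1 : Integrable (fun q : ℝ × ℝ => fderiv ℝ θ q v) :=
      (continuous_fderiv_dir hθ v).integrable_of_hasCompactSupport (hc.fderiv_apply ℝ v)
    refine h1.bdd_mul (c := C) ?_ (ae_of_all _ fun q => hC _)
    exact (hm.comp (measurable_snd.div measurable_fst)).aestronglyMeasurable
  exact (h u _ hu).add (h f _ hf)

/-- Fubini and the substitution x = tξ; the factor t is the Jacobian. -/
lemma weak_eq_iterated {θ : ℝ × ℝ → ℝ} (hθ : ContDiff ℝ ∞ θ) (hc : HasCompactSupport θ)
    {u f : ℝ → ℝ} (hu : BddMeas u) (hf : BddMeas f) :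
    (∫ q in Ioi (0 : ℝ) ×ˢ (univ : Set ℝ),
      (u (q.2 / q.1) * fderiv ℝ θ q (1, 0) + f (q.2 / q.1) * fderiv ℝ θ q (0, 1))) =
    ∫ t in Ioi (0 : ℝ), t * ∫ ξ, (u ξ * fderiv ℝ θ (t, t * ξ) (1, 0) +
      f ξ * fderiv ℝ θ (t, t * ξ) (0, 1)) := by
  rw [Measure.volume_eq_prod, setIntegral_prod _ (by
    rw [← Measure.volume_eq_prod]; exact (integrable_weak hθ hc hu hf).integrableOn)]
  refine setIntegral_congr_fun measurableSet_Ioi fun t ht => ?_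
  have ht' : (0 : ℝ) < t := ht
  simp only [Measure.restrict_univ]
  have := Measure.integral_comp_mul_left (fun x => u (x / t) * fderiv ℝ θ (t, x) (1, 0) +
    f (x / t) * fderiv ℝ θ (t, x) (0, 1)) t
  rw [abs_of_pos (inv_pos.2 ht'), smul_eq_mul] at this
  have e : ∀ ξ, t * ξ / t = ξ := fun ξ => by field_simp
  simp only [e] at this
  rw [this]; field_simp

lemma integrableOn_slice {θ : ℝ × ℝ → ℝ} (hθ : ContDiff ℝ ∞ θ) (hc : HasCompactSupport θ)
    {u f : ℝ → ℝ} (hu : BddMeas u) (hf : BddMeas f) :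
    IntegrableOn (fun t => t * ∫ ξ, (u ξ * fderiv ℝ θ (t, t * ξ) (1, 0) +
      f ξ * fderiv ℝ θ (t, t * ξ) (0, 1))) (Ioi 0) := by
  have h1 := (integrable_weak hθ hc hu hf)
  rw [Measure.volume_eq_prod] at h1
  refine h1.integral_prod_left.integrableOn.congr_fun (fun t ht => ?_) measurableSet_Ioi
  have ht' : (0 : ℝ) < t := ht
  have := Measure.integral_comp_mul_left (fun x => u (x / t) * fderiv ℝ θ (t, x) (1, 0) +
    f (x / t) * fderiv ℝ θ (t, x) (0, 1)) t
  rw [abs_of_pos (inv_pos.2 ht'), smul_eq_mul] at this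
  have e : ∀ ξ, t * ξ / t = ξ := fun ξ => by field_simp
  simp only [e] at this
  simp only []
  rw [this]; field_simp

lemma hasCompactSupport_slice {g : ℝ × ℝ → ℝ} {X t : ℝ} (ht : 0 < t)
    (h : ∀ q : ℝ × ℝ, X < |q.2| → g q = 0) : HasCompactSupport fun ξ => g (t, t * ξ) := by
  refine HasCompactSupport.intro (isCompact_Icc (a := -(X / t)) (b := X / t)) fun ξ hξ => ?_
  apply h
  by_contra hle
  apply hξ
  rw [not_lt, abs_mul, abs_of_pos ht] at hle
  rw [mem_Icc, ← abs_le, le_div_iff₀ ht]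
  linarith

lemma hasDerivAt_ray {θ : ℝ × ℝ → ℝ} (hθ : ContDiff ℝ ∞ θ) (t ξ : ℝ) : HasDerivAt (fun t => t * θ (t, t * ξ))
    (θ (t, t * ξ) + t * fderiv ℝ θ (t, t * ξ) (1, ξ)) t := by
  have h1 : HasDerivAt (fun t : ℝ => (t, t * ξ)) ((1 : ℝ), ξ) t := by
    have := (hasDerivAt_id' t).prodMk ((hasDerivAt_id' t).mul_const ξ)
    simpa using this
  have h2 : HasDerivAt (fun t => θ (t, t * ξ)) _ t :=
    ((hθ.differentiable (by simp)) (t, t * ξ)).hasFDerivAt.comp_hasDerivAt t h1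
  exact ((hasDerivAt_id' t).mul h2).congr_deriv (by simp)

lemma hasDerivAt_slice {θ : ℝ × ℝ → ℝ} (hθ : ContDiff ℝ ∞ θ) (t ξ : ℝ) : HasDerivAt (fun ξ => θ (t, t * ξ))
    (t * fderiv ℝ θ (t, t * ξ) (0, 1)) ξ := by
  have h1 : HasDerivAt (fun ξ : ℝ => (t, t * ξ)) ((0 : ℝ), t) ξ := by
    have := (hasDerivAt_const ξ t).prodMk ((hasDerivAt_id' ξ).const_mul t)
    simpa using this
  have h2 := ((hθ.differentiable (by simp)) (t, t * ξ)).hasFDerivAt.comp_hasDerivAt ξ h1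
  refine h2.congr_deriv ?_
  rw [show ((0 : ℝ), t) = t • ((0 : ℝ), (1 : ℝ)) by simp, map_smul, smul_eq_mul]

/-- After the substitution x = tξ the profile no longer depends on t, so the mass can be
differentiated under the integral although u is merely measurable. -/
lemma hasDerivAt_mass {θ : ℝ × ℝ → ℝ} (hθ : ContDiff ℝ ∞ θ) (hc : HasCompactSupport θ)
    {u : ℝ → ℝ} (hu : BddMeas u) {t : ℝ} (ht : 0 < t) :
    HasDerivAt (fun t => ∫ ξ, u ξ * (t * θ (t, t * ξ)))
      (∫ ξ, u ξ * (θ (t, t * ξ) + t * fderiv ℝ θ (t, t * ξ) (1, ξ))) t := by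
  obtain ⟨X, hX, hs⟩ := exists_support_bound hc
  obtain ⟨B, hB⟩ := hc.exists_bound_of_continuous hθ.continuous
  obtain ⟨B', hB'⟩ := HasCompactSupport.exists_bound_of_continuous (f := fderiv ℝ θ)
    (hc.fderiv ℝ) (hθ.continuous_fderiv (by simp))
  obtain ⟨hm, C, hC⟩ := hu
  have hcont : Continuous θ := hθ.continuous
  have hcont' : Continuous (fderiv ℝ θ) := hθ.continuous_fderiv (by simp)
  -- For times above t/2 the test function vanishes when |ξ| > R, which gives a dominating function
  -- uniform near t.
  set R := X / (t / 2)
  have hball : Ioo (t / 2) (2 * t) ∈ 𝓝 t := Ioo_mem_nhds (by linarith) (by linarith)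
  have hB0 : 0 ≤ B := (norm_nonneg _).trans (hB 0)
  have hB'0 : 0 ≤ B' := (norm_nonneg _).trans (hB' 0)
  have hC0 : 0 ≤ C := (abs_nonneg _).trans (hC 0)
  refine (hasDerivAt_integral_of_dominated_loc_of_deriv_le (𝕜 := ℝ) (E := ℝ) (μ := volume)
    (F := fun t ξ => u ξ * (t * θ (t, t * ξ)))
    (F' := fun t ξ => u ξ * (θ (t, t * ξ) + t * fderiv ℝ θ (t, t * ξ) (1, ξ)))
    (s := Ioo (t / 2) (2 * t))
    (bound := (Icc (-R) R).indicator fun _ => C * (B + 2 * t * (B' * (1 + R)))) hball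
    ?_ ?_ ?_ ?_ ?_ ?_).2
  · refine Eventually.of_forall fun s => ?_
    exact (hm.mul (by fun_prop : Continuous fun ξ => s * θ (s, s * ξ)).measurable).aestronglyMeasurable
  · refine BddMeas.integrable_mul_cont ⟨hm, C, hC⟩ (by fun_prop) ?_
    have := hasCompactSupport_slice (g := fun q => q.1 * θ q) (X := X) ht
      (fun q hq => by simp [(hs q (Or.inr hq)).1])
    exact this
  · refine (hm.mul (Continuous.measurable ?_)).aestronglyMeasurable
    have : Continuous fun ξ : ℝ => fderiv ℝ θ (t, t * ξ) (1, ξ) :=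
      (hcont'.comp (by fun_prop)).clm_apply (by fun_prop)
    fun_prop
  · refine ae_of_all _ fun ξ s hs' => ?_
    have hs0 : 0 < s := by linarith [hs'.1]
    by_cases hξ : ξ ∈ Icc (-R) R
    · rw [indicator_of_mem hξ]
      have h1 : |ξ| ≤ R := abs_le.2 hξ
      have h2 : ‖((1 : ℝ), ξ)‖ ≤ 1 + R := by
        rw [Prod.norm_def]; simp only [Real.norm_eq_abs, abs_one]
        exact max_le (by linarith [abs_nonneg ξ]) (by linarith)
      have h3 : ‖fderiv ℝ θ (s, s * ξ) (1, ξ)‖ ≤ B' * (1 + R) :=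
        (ContinuousLinearMap.le_opNorm _ _).trans
          (mul_le_mul (hB' _) h2 (norm_nonneg _) hB'0)
      rw [norm_mul]
      refine mul_le_mul (hC ξ) ((norm_add_le _ _).trans (add_le_add (hB _) ?_)) (norm_nonneg _) hC0
      rw [norm_mul, Real.norm_eq_abs, abs_of_pos hs0]
      exact mul_le_mul hs'.2.le h3 (norm_nonneg _) (by linarith)
    · rw [indicator_of_notMem hξ]
      have h1 : R < |ξ| := by
        by_contra h; exact hξ (abs_le.1 (not_lt.1 h))
      have h2 : X < |s * ξ| := by
        rw [abs_mul, abs_of_pos hs0]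
        have h3 : X < t / 2 * |ξ| := by rwa [← div_lt_iff₀' (by linarith)]
        have h4 : t / 2 * |ξ| ≤ s * |ξ| := by gcongr; exact hs'.1.le
        linarith
      obtain ⟨h3, h4⟩ := hs (s, s * ξ) (Or.inr h2)
      rw [h3, h4]; simp
  · exact (integrable_indicator_iff measurableSet_Icc).2 continuous_const.integrableOn_Icc
  · refine ae_of_all _ fun ξ s _ => ?_
    exact (hasDerivAt_ray hθ s ξ).const_mul (u ξ)

/-- For fixed x ≠ 0 the slope x/t leaves [-R, R] as t ↓ 0, so the profile already takes its
far-field value; this is how the initial data enter. -/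
lemma tendsto_mass {θ : ℝ × ℝ → ℝ} (hθ : ContDiff ℝ ∞ θ) (hc : HasCompactSupport θ)
    {u u₀ : ℝ → ℝ} (hu : BddMeas u) {R : ℝ}
    (hl : ∀ ξ y, ξ < -R → y < 0 → u ξ = u₀ y) (hr : ∀ ξ y, R < ξ → 0 < y → u ξ = u₀ y) :
    Tendsto (fun t => ∫ x, u (x / t) * θ (t, x)) (𝓝[>] 0) (𝓝 (∫ x, u₀ x * θ (0, x))) := by
  obtain ⟨X, hX, hs⟩ := exists_support_bound hc
  obtain ⟨B, hB⟩ := hc.exists_bound_of_continuous hθ.continuous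
  obtain ⟨hm, C, hC⟩ := hu
  have hC0 : 0 ≤ C := (abs_nonneg _).trans (hC 0)
  have hcont : Continuous θ := hθ.continuous
  refine tendsto_integral_filter_of_dominated_convergence
    ((Icc (-X) X).indicator fun _ => C * B) ?_ ?_ ?_ ?_
  · refine Eventually.of_forall fun t => Measurable.aestronglyMeasurable ?_
    exact (hm.comp (by fun_prop)).mul (by fun_prop : Continuous fun x => θ (t, x)).measurable
  · refine Eventually.of_forall fun t => ae_of_all _ fun x => ?_
    by_cases hx : x ∈ Icc (-X) X
    · rw [indicator_of_mem hx, norm_mul]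
      exact mul_le_mul (hC _) (hB _) (norm_nonneg _) hC0
    · rw [indicator_of_notMem hx]
      have h1 : X < |x| := by
        by_contra h; exact hx (abs_le.1 (not_lt.1 h))
      simp [(hs (t, x) (Or.inr h1)).1]
  · exact (integrable_indicator_iff measurableSet_Icc).2 continuous_const.integrableOn_Icc
  · have h0 : ∀ᵐ x : ℝ, x ≠ 0 := Measure.ae_ne volume 0
    filter_upwards [h0] with x hx
    have h1 : Tendsto (fun t => θ (t, x)) (𝓝[>] 0) (𝓝 (θ (0, x))) :=
      ((by fun_prop : Continuous fun t => θ (t, x)).tendsto 0).mono_left nhdsWithin_le_nhds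
    have h2 : ∀ᶠ t in 𝓝[>] (0 : ℝ), u (x / t) = u₀ x := by
      have h3 : ∀ᶠ t in 𝓝[>] (0 : ℝ), t < |x| / (|R| + 1) :=
        (eventually_lt_nhds (by positivity)).filter_mono nhdsWithin_le_nhds
      filter_upwards [h3, self_mem_nhdsWithin] with t ht ht0
      have ht0' : (0 : ℝ) < t := ht0
      rw [lt_div_iff₀ (by positivity)] at ht
      have h4 := le_abs_self R
      rcases lt_or_gt_of_ne hx with hx' | hx'
      · apply hl _ _ _ hx'
        rw [div_lt_iff₀ ht0']
        rw [abs_of_neg hx'] at ht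
        nlinarith
      · apply hr _ _ _ hx'
        rw [lt_div_iff₀ ht0']
        rw [abs_of_pos hx'] at ht
        nlinarith
    refine (h1.const_mul (u₀ x)).congr' ?_
    filter_upwards [h2] with t ht
    rw [ht]

/-- Profiles dissipating entropy in self-similar coordinates give entropy solutions. -/
theorem weakIneq_of_dissipation {u f u₀ : ℝ → ℝ} (hu : BddMeas u) (hf : BddMeas f) {R : ℝ}
    (hl : ∀ ξ y, ξ < -R → y < 0 → u ξ = u₀ y) (hr : ∀ ξ y, R < ξ → 0 < y → u ξ = u₀ y)
    (hd : ∀ a : ℝ → ℝ, ContDiff ℝ 1 a → HasCompactSupport a → (∀ x, 0 ≤ a x) →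
      0 ≤ ∫ x, (-u x * a x + (f x - x * u x) * deriv a x)) : WeakIneq u f u₀ := by
  intro θ hθ hc hpos
  obtain ⟨X, hX, hs⟩ := exists_support_bound hc
  have hcont : Continuous θ := hθ.continuous
  have hcont' : Continuous (fderiv ℝ θ) := hθ.continuous_fderiv (by simp)
  -- `L` is the time slice of the space-time integral, `I` is the mass ∫ u(x/t) θ(t,x) dx extended
  -- to t = 0 by the initial term, and `J` is the derivative of `I`.
  set L : ℝ → ℝ := fun t => t * ∫ ξ, (u ξ * fderiv ℝ θ (t, t * ξ) (1, 0) +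
    f ξ * fderiv ℝ θ (t, t * ξ) (0, 1)) with hL
  set J : ℝ → ℝ := fun t => ∫ ξ, u ξ * (θ (t, t * ξ) + t * fderiv ℝ θ (t, t * ξ) (1, ξ)) with hJ
  set I : ℝ → ℝ := fun t => if t = 0 then ∫ x, u₀ x * θ (0, x) else ∫ x, u (x / t) * θ (t, x)
    with hI
  rw [weak_eq_iterated hθ hc hu hf]
  have hIpos : ∀ t, 0 < t → I t = ∫ ξ, u ξ * (t * θ (t, t * ξ)) := by
    intro t ht
    have := Measure.integral_comp_mul_left (fun x => u (x / t) * θ (t, x)) t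
    rw [abs_of_pos (inv_pos.2 ht), smul_eq_mul] at this
    have e : ∀ ξ, t * ξ / t = ξ := fun ξ => by field_simp
    simp only [e] at this
    simp only [hI, if_neg ht.ne']
    have e2 : (∫ ξ, u ξ * (t * θ (t, t * ξ))) = t * ∫ ξ, u ξ * θ (t, t * ξ) := by
      rw [← integral_const_mul]; congr 1; funext ξ; ring
    rw [e2, this]; field_simp
  have hIder : ∀ t, 0 < t → HasDerivAt I (J t) t := by
    intro t ht
    refine (hasDerivAt_mass hθ hc hu ht).congr_of_eventuallyEq ?_
    filter_upwards [eventually_gt_nhds ht] with s hs' using hIpos s hs'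
  -- L - J is the dissipation integral for a(ξ) = θ(t, tξ), since a' = t ∂ₓθ.
  have hLJ : ∀ t, 0 < t → J t ≤ L t := by
    intro t ht
    have k0 : HasCompactSupport fun ξ => θ (t, t * ξ) :=
      hasCompactSupport_slice ht (fun q hq => (hs q (Or.inr hq)).1)
    have k1 : HasCompactSupport fun ξ => fderiv ℝ θ (t, t * ξ) (1, 0) :=
      hasCompactSupport_slice (g := fun q => fderiv ℝ θ q (1, 0)) (X := X) ht
        (fun q hq => by simp [(hs q (Or.inr hq)).2])
    have k2 : HasCompactSupport fun ξ => fderiv ℝ θ (t, t * ξ) (0, 1) :=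
      hasCompactSupport_slice (g := fun q => fderiv ℝ θ q (0, 1)) (X := X) ht
        (fun q hq => by simp [(hs q (Or.inr hq)).2])
    have c1 : Continuous fun ξ : ℝ => fderiv ℝ θ (t, t * ξ) (1, 0) :=
      (continuous_fderiv_dir hθ _).comp (by fun_prop)
    have c2 : Continuous fun ξ : ℝ => fderiv ℝ θ (t, t * ξ) (0, 1) :=
      (continuous_fderiv_dir hθ _).comp (by fun_prop)
    have i0 := hu.integrable_mul_cont (by fun_prop : Continuous fun ξ => θ (t, t * ξ)) k0
    have i1 := hu.integrable_mul_cont c1 k1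
    have i2 := hf.integrable_mul_cont c2 k2
    have i3 := hu.integrable_mul_cont (continuous_id.mul c2) k2.mul_left
    have hder : deriv (fun ξ => θ (t, t * ξ)) = fun ξ => t * fderiv ℝ θ (t, t * ξ) (0, 1) :=
      funext fun ξ => (hasDerivAt_slice hθ t ξ).deriv
    have key := hd (fun ξ => θ (t, t * ξ)) ((hθ.of_le (by exact_mod_cast le_top)).comp (by fun_prop))
      k0 (fun ξ => hpos _ ht.le)
    rw [hder] at key
    have eJ : J t = ∫ ξ, (u ξ * θ (t, t * ξ) + t * (u ξ * fderiv ℝ θ (t, t * ξ) (1, 0)) +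
        t * (u ξ * (id ξ * fderiv ℝ θ (t, t * ξ) (0, 1)))) := by
      simp only [hJ]; congr 1; funext ξ
      rw [show ((1 : ℝ), ξ) = ((1 : ℝ), (0 : ℝ)) + ξ • ((0 : ℝ), (1 : ℝ)) by simp, map_add, map_smul,
        smul_eq_mul, id]
      ring
    have eL : L t = ∫ ξ, (t * (u ξ * fderiv ℝ θ (t, t * ξ) (1, 0)) +
        t * (f ξ * fderiv ℝ θ (t, t * ξ) (0, 1))) := by
      simp only [hL]; rw [← integral_const_mul]; congr 1; funext ξ; ring
    have hA : Integrable fun ξ => t * (u ξ * fderiv ℝ θ (t, t * ξ) (1, 0)) +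
        t * (f ξ * fderiv ℝ θ (t, t * ξ) (0, 1)) := (i1.const_mul t).add (i2.const_mul t)
    have hB : Integrable fun ξ => u ξ * θ (t, t * ξ) +
        t * (u ξ * fderiv ℝ θ (t, t * ξ) (1, 0)) +
        t * (u ξ * (id ξ * fderiv ℝ θ (t, t * ξ) (0, 1))) :=
      (i0.add (i1.const_mul t)).add (i3.const_mul t)
    rw [← sub_nonneg, eL, eJ, ← integral_sub hA hB]
    convert key using 2
    funext ξ; simp only [id]; ring
  have hcontI : ContinuousOn I (Icc 0 (X + 1)) := by
    intro t ht
    rcases ht.1.eq_or_lt with h | h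
    · subst h
      have h1 : ContinuousWithinAt I (Ioi 0) 0 := by
        have := tendsto_mass hθ hc hu hl hr
        simp only [ContinuousWithinAt, hI, if_true]
        refine this.congr' ?_
        filter_upwards [self_mem_nhdsWithin] with s hs'
        rw [if_neg (ne_of_gt hs')]
      exact (continuousWithinAt_Ioi_iff_Ici.1 h1).mono Icc_subset_Ici_self
    · exact (hIder t h).continuousAt.continuousWithinAt
  have hLint : IntegrableOn L (Ioi 0) := integrableOn_slice hθ hc hu hf
  -- Integrating I' = J ≤ L over [0, X+1], where I vanishes at the right end, gives -I(0) ≤ ∫ L,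
  -- which is the claim.
  have hmono := intervalIntegral.sub_le_integral_of_hasDeriv_right_of_le (g' := J) (φ := L)
    (by linarith : (0 : ℝ) ≤ X + 1) hcontI
    (fun t ht => (hIder t ht.1).hasDerivWithinAt)
    (by
      rw [integrableOn_Icc_iff_integrableOn_Ioc]
      exact hLint.mono_set Ioc_subset_Ioi_self)
    (fun t ht => hLJ t ht.1)
  have hIX : I (X + 1) = 0 := by
    have : ∀ x, θ (X + 1, x) = 0 := fun x =>
      (hs (X + 1, x) (Or.inl (by rw [abs_of_pos (by linarith)]; linarith))).1
    simp only [hI, this]; simp [show X + 1 ≠ 0 by linarith]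
  have hI0 : I 0 = ∫ x, u₀ x * θ (0, x) := by simp [hI]
  have hset : ∫ t in Ioi (0 : ℝ), L t = ∫ t in (0 : ℝ)..(X + 1), L t := by
    rw [intervalIntegral.integral_of_le (by linarith)]
    refine (setIntegral_eq_of_subset_of_forall_sdiff_eq_zero measurableSet_Ioi
      Ioc_subset_Ioi_self fun t ht => ?_)
    have ht1 : X < |t| := by
      have h1 : (0 : ℝ) < t := ht.1
      rw [abs_of_pos h1]
      by_contra hcon
      exact ht.2 ⟨h1, by linarith⟩
    have : ∀ ξ, fderiv ℝ θ (t, t * ξ) = 0 := fun ξ => (hs _ (Or.inl ht1)).2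
    simp [hL, this]
  rw [hset, ← hI0]
  linarith

/-! ### Distributional inequalities on the line -/

/-- `u + E' ≤ 0` in the sense of distributions. -/
def DistIneq (u E : ℝ → ℝ) : Prop :=
  ∀ χ : ℝ → ℝ, ContDiff ℝ ∞ χ → HasCompactSupport χ → (∀ x, 0 ≤ χ x) →
    0 ≤ ∫ x, (-u x * χ x + E x * deriv χ x)

/-- A sequence of bump functions concentrating at the origin. -/
def bumpSeq (n : ℕ) : ContDiffBump (0 : ℝ) where
  rIn := 1 / (n + 2)
  rOut := 2 / (n + 2)
  rIn_pos := by positivity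
  rIn_lt_rOut := by gcongr; norm_num

/-- The associated normalized kernel. -/
def ker (n : ℕ) : ℝ → ℝ := (bumpSeq n).normed volume

lemma ker_contDiff (n : ℕ) : ContDiff ℝ ∞ (ker n) := (bumpSeq n).contDiff_normed

lemma ker_continuous (n : ℕ) : Continuous (ker n) := (ker_contDiff n).continuous

lemma ker_nonneg (n : ℕ) (x : ℝ) : 0 ≤ ker n x := (bumpSeq n).nonneg_normed x

lemma ker_compact (n : ℕ) : HasCompactSupport (ker n) := (bumpSeq n).hasCompactSupport_normed

lemma ker_integral (n : ℕ) : ∫ x, ker n x = 1 := (bumpSeq n).integral_normed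

lemma ker_neg (n : ℕ) (x : ℝ) : ker n (-x) = ker n x := (bumpSeq n).normed_neg x

lemma ker_integrable (n : ℕ) : Integrable (ker n) :=
  (ker_continuous n).integrable_of_hasCompactSupport (ker_compact n)

lemma ker_zero {n : ℕ} {x : ℝ} (h : 2 / (n + 2 : ℝ) ≤ |x|) : ker n x = 0 := by
  have h1 : x ∉ Function.support (ker n) := by
    rw [ker, (bumpSeq n).support_normed_eq, Metric.mem_ball, dist_zero_right, Real.norm_eq_abs,
      not_lt]
    exact h
  simpa using h1

/-- Smooth approximation of the indicator of `[x, y]`. -/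
def plateau (n : ℕ) (x y s : ℝ) : ℝ := ∫ t in (s - y)..(s - x), ker n t

lemma plateau_nonneg (n : ℕ) {x y : ℝ} (h : x ≤ y) (s : ℝ) : 0 ≤ plateau n x y s :=
  intervalIntegral.integral_nonneg (by linarith) fun t _ => ker_nonneg n t

lemma plateau_le_one (n : ℕ) {x y : ℝ} (h : x ≤ y) (s : ℝ) : plateau n x y s ≤ 1 := by
  rw [plateau, intervalIntegral.integral_of_le (by linarith), ← ker_integral n]
  exact setIntegral_le_integral (ker_integrable n) (ae_of_all _ (ker_nonneg n))

lemma plateau_hasDerivAt (n : ℕ) (x y s : ℝ) :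
    HasDerivAt (plateau n x y) (ker n (s - x) - ker n (s - y)) s := by
  have hk := ker_continuous n
  have e : plateau n x y = fun s => (∫ t in (0 : ℝ)..(s - x), ker n t) -
      ∫ t in (0 : ℝ)..(s - y), ker n t := by
    funext s
    rw [plateau, intervalIntegral.integral_interval_sub_left (hk.intervalIntegrable _ _)
      (hk.intervalIntegrable _ _)]
  rw [e]
  have h : ∀ c, HasDerivAt (fun s => ∫ t in (0 : ℝ)..(s - c), ker n t) (ker n (s - c)) s := by
    intro c
    have h1 : HasDerivAt (fun r => ∫ t in (0 : ℝ)..r, ker n t) (ker n (s - c)) (s - c) :=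
      hk.integral_hasStrictDerivAt 0 (s - c) |>.hasDerivAt
    exact (h1.comp s ((hasDerivAt_id' s).sub_const c)).congr_deriv (mul_one _)
  exact (h x).sub (h y)

lemma plateau_contDiff (n : ℕ) (x y : ℝ) : ContDiff ℝ ∞ (plateau n x y) := by
  rw [contDiff_infty_iff_deriv]
  refine ⟨fun s => (plateau_hasDerivAt n x y s).differentiableAt, ?_⟩
  have : deriv (plateau n x y) = fun s => ker n (s - x) - ker n (s - y) :=
    funext fun s => (plateau_hasDerivAt n x y s).deriv
  rw [this]
  have hk := ker_contDiff n
  exact (hk.comp (by fun_prop)).sub (hk.comp (by fun_prop))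

lemma two_div_le_one (n : ℕ) : 2 / (n + 2 : ℝ) ≤ 1 := by
  rw [div_le_one (by positivity)]; have : (0 : ℝ) ≤ n := by positivity
  linarith

lemma plateau_zero {n : ℕ} {x y s : ℝ} (h : x ≤ y)
    (hs : s ≤ x - 2 / (n + 2) ∨ y + 2 / (n + 2) ≤ s) : plateau n x y s = 0 := by
  rw [plateau, ← intervalIntegral.integral_zero (a := s - y) (b := s - x)]
  refine intervalIntegral.integral_congr fun t ht => ?_
  rw [uIcc_of_le (by linarith)] at ht
  apply ker_zero
  rcases hs with hs | hs
  · rw [le_abs]; right; linarith [ht.2]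
  · rw [le_abs]; left; linarith [ht.1]

lemma plateau_one {n : ℕ} {x y s : ℝ} (h1 : x + 2 / (n + 2) ≤ s) (h2 : s ≤ y - 2 / (n + 2)) :
    plateau n x y s = 1 := by
  have h0 : (0 : ℝ) < 2 / (n + 2) := by positivity
  rw [plateau, intervalIntegral.integral_of_le (by linarith), ← ker_integral n]
  refine setIntegral_eq_integral_of_forall_compl_eq_zero fun t ht => ker_zero ?_
  by_contra hcon
  rw [not_le, abs_lt] at hcon
  exact ht ⟨by linarith [hcon.1], by linarith [hcon.2]⟩

lemma plateau_compact (n : ℕ) {x y : ℝ} (h : x ≤ y) : HasCompactSupport (plateau n x y) := by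
  refine HasCompactSupport.intro (isCompact_Icc (a := x - 2 / (n + 2)) (b := y + 2 / (n + 2)))
    fun s hs => plateau_zero h ?_
  by_contra hcon
  push Not at hcon
  exact hs ⟨hcon.1.le, hcon.2.le⟩

lemma tendsto_two_div : Tendsto (fun n : ℕ => (2 : ℝ) / (n + 2)) atTop (𝓝 0) := by
  have h1 : Tendsto (fun n : ℕ => (n : ℝ) + 2) atTop atTop :=
    tendsto_atTop_add_const_right _ _ tendsto_natCast_atTop_atTop
  exact h1.const_div_atTop 2

lemma plateau_tendsto {x y s : ℝ} (h : x ≤ y) (hx : s ≠ x) (hy : s ≠ y) :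
    Tendsto (fun n => plateau n x y s) atTop (𝓝 ((Ioc x y).indicator (fun _ => 1) s)) := by
  have key : ∀ c : ℝ, 0 < c → ∀ᶠ n : ℕ in atTop, (2 : ℝ) / (n + 2) < c := fun c hc =>
    tendsto_two_div.eventually_lt_const hc
  rcases lt_or_gt_of_ne hx with h1 | h1
  · rw [indicator_of_notMem (fun hm => by linarith [hm.1])]
    refine tendsto_const_nhds.congr' ?_
    filter_upwards [key (x - s) (by linarith)] with n hn
    rw [plateau_zero h (Or.inl (by linarith))]
  · rcases lt_or_gt_of_ne hy with h2 | h2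
    · rw [indicator_of_mem (show s ∈ Ioc x y from ⟨h1, h2.le⟩)]
      refine tendsto_const_nhds.congr' ?_
      filter_upwards [key (s - x) (by linarith), key (y - s) (by linarith)] with n hn hn'
      rw [plateau_one (by linarith) (by linarith)]
    · rw [indicator_of_notMem (fun hm => by linarith [hm.2])]
      refine tendsto_const_nhds.congr' ?_
      filter_upwards [key (s - y) (by linarith)] with n hn
      rw [plateau_zero h (Or.inr (by linarith))]

/-- Lebesgue differentiation along shrinking bumps; it supplies the points at which a merely
integrable E may be evaluated. -/
lemma ae_tendsto_ker {g : ℝ → ℝ} (hg : LocallyIntegrable g) :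
    ∀ᵐ x, Tendsto (fun n => ∫ s, g s * ker n (s - x)) atTop (𝓝 (g x)) := by
  have h := ContDiffBump.ae_convolution_tendsto_right_of_locallyIntegrable (φ := bumpSeq)
    (l := atTop) (K := 2) (μ := (volume : Measure ℝ)) (g := g) tendsto_two_div
    (Eventually.of_forall fun n => by simp only [bumpSeq]; apply le_of_eq; ring) hg
  filter_upwards [h] with x hx
  refine hx.congr fun n => ?_
  rw [convolution_eq_swap]
  congr 1; funext s
  simp only [ContinuousLinearMap.lsmul_apply, smul_eq_mul]
  rw [← ker_neg n (s - x), neg_sub, mul_comm]; rfl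

lemma integrable_mul_of_compact {g k : ℝ → ℝ} (hg : LocallyIntegrable g) (hk : Continuous k)
    (hc : HasCompactSupport k) : Integrable fun x => g x * k x := by
  have := hg.integrable_smul_left_of_hasCompactSupport hk hc
  simpa [mul_comm] using this

/-- The distributional inequality `u + E' ≤ 0` in integrated form, almost everywhere. -/
theorem DistIneq.mono {u E : ℝ → ℝ} (hu : LocallyIntegrable u) (hE : LocallyIntegrable E)
    (h : DistIneq u E) : ∃ S : Set ℝ, (∀ᵐ x, x ∈ S) ∧
      ∀ x ∈ S, ∀ y ∈ S, x < y → ∫ s in x..y, u s ≤ E x - E y := by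
  -- S consists of the points where mollification recovers E. Testing with smoothed indicators of
  -- [x, y], whose derivative is a bump at x minus a bump at y, yields the inequality in the limit.
  refine ⟨_, ae_tendsto_ker hE, fun x hx y hy hxy => ?_⟩
  have hint : ∀ (g : ℝ → ℝ) (n : ℕ) (c : ℝ), LocallyIntegrable g →
      Integrable fun s => g s * ker n (s - c) := by
    intro g n c hg
    exact integrable_mul_of_compact hg ((ker_continuous n).comp (by fun_prop))
      ((ker_compact n).comp_homeomorph (Homeomorph.subRight c))
  have h1 : Tendsto (fun n => (∫ s, E s * ker n (s - x)) - ∫ s, E s * ker n (s - y)) atTop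
      (𝓝 (E x - E y)) := Tendsto.sub hx hy
  have h2 : Tendsto (fun n => ∫ s, u s * plateau n x y s) atTop (𝓝 (∫ s in x..y, u s)) := by
    rw [intervalIntegral.integral_of_le hxy.le, ← integral_indicator measurableSet_Ioc]
    refine tendsto_integral_of_dominated_convergence
      ((Icc (x - 1) (y + 1)).indicator fun s => |u s|) ?_ ?_ ?_ ?_
    · exact fun n => hu.aestronglyMeasurable.mul
        (plateau_contDiff n x y).continuous.aestronglyMeasurable
    · exact (integrable_indicator_iff measurableSet_Icc).2
        (hu.integrableOn_isCompact isCompact_Icc).norm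
    · refine fun n => ae_of_all _ fun s => ?_
      by_cases hs : s ∈ Icc (x - 1) (y + 1)
      · rw [indicator_of_mem hs, norm_mul, Real.norm_eq_abs, Real.norm_eq_abs,
          abs_of_nonneg (plateau_nonneg n hxy.le s)]
        exact mul_le_of_le_one_right (abs_nonneg _) (plateau_le_one n hxy.le s)
      · rw [indicator_of_notMem hs, plateau_zero hxy.le, mul_zero, norm_zero]
        have := two_div_le_one n
        by_contra hcon
        push Not at hcon
        exact hs ⟨by linarith [hcon.1], by linarith [hcon.2]⟩
    · filter_upwards [Measure.ae_ne volume x, Measure.ae_ne volume y] with s hsx hsy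
      have := (plateau_tendsto hxy.le hsx hsy).const_mul (u s)
      convert this using 2
      by_cases hs : s ∈ Ioc x y <;> simp [hs]
  refine sub_nonneg.1 (ge_of_tendsto (h1.sub h2) (Eventually.of_forall fun n => ?_))
  have h3 := h (plateau n x y) (plateau_contDiff n x y) (plateau_compact n hxy.le)
    (plateau_nonneg n hxy.le)
  have e : deriv (plateau n x y) = fun s => ker n (s - x) - ker n (s - y) :=
    funext fun s => (plateau_hasDerivAt n x y s).deriv
  have i1 : Integrable fun s => u s * plateau n x y s :=
    integrable_mul_of_compact hu (plateau_contDiff n x y).continuous (plateau_compact n hxy.le)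
  have i2 : Integrable fun s => E s * ker n (s - x) - E s * ker n (s - y) :=
    (hint E n x hE).sub (hint E n y hE)
  rw [← integral_sub (hint E n x hE) (hint E n y hE), ← integral_sub i2 i1]
  refine h3.trans_eq (integral_congr_ae (ae_of_all _ fun s => ?_))
  simp only [e]; ring

/-- Multiplying a distributional conservation law by the coordinate. -/
theorem DistIneq.weight {u E : ℝ → ℝ} (hu : LocallyIntegrable u) (hE : LocallyIntegrable E)
    (h : DistIneq u E) (h' : DistIneq (fun x => -u x) (fun x => -E x)) :
    DistIneq (fun x => x * u x - E x) (fun x => x * E x) := by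
  intro χ hχ hc hpos
  obtain ⟨X, hX⟩ := hc.isBounded.subset_closedBall 0
  have hz : ∀ x, X < |x| → χ x = 0 := fun x hx => by
    apply image_eq_zero_of_notMem_tsupport
    intro hm
    have := hX hm
    rw [mem_closedBall_zero_iff, Real.norm_eq_abs] at this
    linarith
  have hd := hχ.differentiable (by simp)
  have hder : deriv (fun x => (x + X) * χ x) = fun x => χ x + (x + X) * deriv χ x := by
    funext x
    have := (((hasDerivAt_id' x).add_const X).mul (hd x).hasDerivAt).deriv
    rw [one_mul] at this; exact this
  -- The weight x changes sign and is not admissible. Instead x + X, nonnegative where χ ≠ 0, is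
  -- used, and X times the opposite inequality removes the shift.
  have k1 := h (fun x => (x + X) * χ x) (by fun_prop) hc.mul_left fun x => by
    by_cases hx : X < |x|
    · simp [hz x hx]
    · have := neg_abs_le x
      exact mul_nonneg (by linarith) (hpos x)
  have k2 := h' χ hχ hc hpos
  rcases le_or_gt X 0 with hX0 | hX0
  · have h0 : ∀ᵐ x, χ x = 0 := by
      filter_upwards [Measure.ae_ne volume 0] with x hx
      exact hz x (by linarith [abs_pos.2 hx])
    have h00 : χ = 0 := Measure.eq_of_ae_eq (μ := volume) h0 hχ.continuous continuous_zero
    subst h00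
    simp
  have cd : Continuous (deriv χ) := hχ.continuous_deriv (by simp)
  have i1 : Integrable fun x => -u x * ((x + X) * χ x) :=
    integrable_mul_of_compact hu.neg (by have := hχ.continuous; fun_prop) hc.mul_left
  have i2 : Integrable fun x => E x * (χ x + (x + X) * deriv χ x) :=
    integrable_mul_of_compact hE (by have := hχ.continuous; fun_prop) (hc.add hc.deriv.mul_left)
  have i3 : Integrable fun x => - -u x * χ x := by
    simpa using integrable_mul_of_compact hu hχ.continuous hc
  have i4 : Integrable fun x => -E x * deriv χ x := integrable_mul_of_compact hE.neg cd hc.deriv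
  rw [hder] at k1
  have k3 := add_nonneg k1 (mul_nonneg hX0.le k2)
  have j1 : Integrable fun x => -u x * ((x + X) * χ x) + E x * (χ x + (x + X) * deriv χ x) :=
    i1.add i2
  have j2 : Integrable fun x => X * (- -u x * χ x + -E x * deriv χ x) := (i3.add i4).const_mul X
  rw [← integral_const_mul, ← integral_add j1 j2] at k3
  refine k3.trans_eq (integral_congr_ae (ae_of_all _ fun x => ?_))
  simp only []; ring

/-! ### Consequences of the weak formulation for self-similar functions -/

lemma fderiv_apply_time {θ : ℝ × ℝ → ℝ} {q : ℝ × ℝ} {d : ℝ} (h : DifferentiableAt ℝ θ q)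
    (hd : HasDerivAt (fun t => θ (t, q.2)) d q.1) : fderiv ℝ θ q (1, 0) = d := by
  have h1 : HasDerivAt (fun t : ℝ => (t, q.2)) ((1 : ℝ), (0 : ℝ)) q.1 :=
    (hasDerivAt_id' q.1).prodMk (hasDerivAt_const q.1 q.2)
  have h2 : HasDerivAt (fun t => θ (t, q.2)) (fderiv ℝ θ q (1, 0)) q.1 :=
    HasFDerivAt.comp_hasDerivAt q.1 (f := fun t : ℝ => (t, q.2)) (l := θ) h.hasFDerivAt h1
  exact h2.unique hd

lemma fderiv_apply_space {θ : ℝ × ℝ → ℝ} {q : ℝ × ℝ} {d : ℝ} (h : DifferentiableAt ℝ θ q)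
    (hd : HasDerivAt (fun x => θ (q.1, x)) d q.2) : fderiv ℝ θ q (0, 1) = d := by
  have h1 : HasDerivAt (fun x : ℝ => (q.1, x)) ((0 : ℝ), (1 : ℝ)) q.2 :=
    (hasDerivAt_const q.2 q.1).prodMk (hasDerivAt_id' q.2)
  have h2 : HasDerivAt (fun x => θ (q.1, x)) (fderiv ℝ θ q (0, 1)) q.2 :=
    HasFDerivAt.comp_hasDerivAt q.2 (f := fun x : ℝ => (q.1, x)) (l := θ) h.hasFDerivAt h1
  exact h2.unique hd

/-- A bump function in time supported in `(1, 3)`. -/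
def timeBump : ContDiffBump (2 : ℝ) where
  rIn := 1 / 2
  rOut := 1
  rIn_pos := by norm_num
  rIn_lt_rOut := by norm_num

lemma timeBump_zero {t : ℝ} (h : t ≤ 1 ∨ 3 ≤ t) : timeBump t = 0 := by
  apply timeBump.zero_of_le_dist
  rw [Real.dist_eq]
  show 1 ≤ _
  rw [le_abs]
  rcases h with h | h
  · right; linarith
  · left; linarith

/-- The singularity of x/t at t = 0 is harmless because the time bump vanishes for t ≤ 1. -/
lemma contDiff_conical {χ : ℝ → ℝ} (hχ : ContDiff ℝ ∞ χ) :
    ContDiff ℝ ∞ (fun q : ℝ × ℝ => timeBump q.1 * χ (q.2 / q.1)) := by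
  rw [contDiff_iff_contDiffAt]
  intro q
  by_cases hq : q.1 < 1
  · refine (contDiffAt_const (c := (0 : ℝ))).congr_of_eventuallyEq ?_
    have : ∀ᶠ q' : ℝ × ℝ in 𝓝 q, q'.1 < 1 := continuous_fst.continuousAt.eventually_lt_const hq
    filter_upwards [this] with q' hq'
    rw [timeBump_zero (Or.inl hq'.le), zero_mul]
  · have h0 : q.1 ≠ 0 := by linarith
    refine ContDiffAt.mul (timeBump.contDiff.contDiffAt.comp q contDiffAt_fst) ?_
    exact hχ.contDiffAt.comp q (contDiffAt_snd.div contDiffAt_fst h0)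

lemma compact_conical {χ : ℝ → ℝ} (hc : HasCompactSupport χ) :
    HasCompactSupport (fun q : ℝ × ℝ => timeBump q.1 * χ (q.2 / q.1)) := by
  obtain ⟨X, hX⟩ := hc.isBounded.subset_closedBall 0
  refine HasCompactSupport.intro
    (isCompact_Icc.prod isCompact_Icc : IsCompact (Icc (1 : ℝ) 3 ×ˢ Icc (-(3 * |X|)) (3 * |X|)))
    fun q hq => ?_
  by_cases h1 : q.1 ∈ Icc (1 : ℝ) 3
  · have h2 : χ (q.2 / q.1) = 0 := by
      apply image_eq_zero_of_notMem_tsupport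
      intro hm
      have h3 := hX hm
      rw [mem_closedBall_zero_iff, Real.norm_eq_abs, abs_div,
        abs_of_pos (show (0 : ℝ) < q.1 by linarith [h1.1]),
        div_le_iff₀ (show (0 : ℝ) < q.1 by linarith [h1.1])] at h3
      apply hq
      refine ⟨h1, abs_le.1 ?_⟩
      have h4 := le_abs_self X
      have h5 := abs_nonneg X
      nlinarith [h1.1, h1.2]
    rw [h2, mul_zero]
  · rw [timeBump_zero, zero_mul]
    by_contra hcon
    push Not at hcon
    exact h1 ⟨hcon.1.le, hcon.2.le⟩

/-- Self-similar weak solutions satisfy an inequality in the similarity variable. -/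
theorem WeakIneq.distIneq {u f u₀ : ℝ → ℝ} (hu : BddMeas u) (hf : BddMeas f)
    (h : WeakIneq u f u₀) : DistIneq u (fun x => f x - x * u x) := by
  intro χ hχ hc hpos
  -- A test function g(t) χ(x/t) separates time from slope. It vanishes at t = 0, so the initial
  -- data drop out.
  have h1 := h _ (contDiff_conical hχ) (compact_conical hc)
    (fun q _ => mul_nonneg timeBump.nonneg (hpos _))
  rw [weak_eq_iterated (contDiff_conical hχ) (compact_conical hc) hu hf] at h1
  have e0 : ∀ x, u₀ x * (timeBump (0 : ℝ) * χ (x / 0)) = 0 := fun x => by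
    rw [timeBump_zero (Or.inl zero_le_one)]; ring
  simp only [e0, integral_zero, add_zero] at h1
  have hgd : ∀ t, HasDerivAt timeBump (deriv timeBump t) t := fun t =>
    (timeBump.contDiff (n := 1)).differentiable one_ne_zero t |>.hasDerivAt
  have hχd : ∀ t, HasDerivAt χ (deriv χ t) t := fun t => (hχ.differentiable (by simp) t).hasDerivAt
  have dθ : ∀ q, DifferentiableAt ℝ (fun q : ℝ × ℝ => timeBump q.1 * χ (q.2 / q.1)) q :=
    (contDiff_conical hχ).differentiable (by simp)
  have d1 : ∀ t ξ : ℝ, 0 < t → fderiv ℝ (fun q : ℝ × ℝ => timeBump q.1 * χ (q.2 / q.1)) (t, t * ξ)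
      (1, 0) = deriv timeBump t * χ ξ - timeBump t * (deriv χ ξ * ξ / t) := by
    intro t ξ ht
    refine fderiv_apply_time (dθ _) ?_
    have e : t * ξ / t = ξ := by field_simp
    have h2 : HasDerivAt (fun s => t * ξ / s) (-(ξ / t)) t := by
      refine ((hasDerivAt_const t (t * ξ)).div (hasDerivAt_id' t) ht.ne').congr_deriv ?_
      field_simp; ring
    have h3 : HasDerivAt (fun s => χ (t * ξ / s)) (deriv χ ξ * (-(ξ / t))) t :=
      HasDerivAt.comp (h₂ := χ) (h := fun s => t * ξ / s) t (by rw [e]; exact hχd ξ) h2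
    refine ((hgd t).mul h3).congr_deriv ?_
    rw [e]; ring
  have d2 : ∀ t ξ : ℝ, 0 < t → fderiv ℝ (fun q : ℝ × ℝ => timeBump q.1 * χ (q.2 / q.1)) (t, t * ξ)
      (0, 1) = timeBump t * (deriv χ ξ / t) := by
    intro t ξ ht
    refine fderiv_apply_space (dθ _) ?_
    have e : t * ξ / t = ξ := by field_simp
    have h2 : HasDerivAt (fun s => s / t) (1 / t) (t * ξ) := (hasDerivAt_id' _).div_const t
    have h3 : HasDerivAt (fun s => χ (s / t)) (deriv χ ξ * (1 / t)) (t * ξ) :=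
      HasDerivAt.comp (h₂ := χ) (h := fun s => s / t) (t * ξ) (by rw [e]; exact hχd ξ) h2
    refine (h3.const_mul (timeBump t)).congr_deriv ?_
    ring
  have i1 : Integrable fun x => u x * χ x := hu.integrable_mul_cont hχ.continuous hc
  have cd : Continuous (deriv χ) := hχ.continuous_deriv (by simp)
  have i2 : Integrable fun x => f x * deriv χ x := hf.integrable_mul_cont cd hc.deriv
  have i3 : Integrable fun x => u x * (x * deriv χ x) :=
    hu.integrable_mul_cont (by fun_prop) hc.deriv.mul_left
  set A := ∫ x, u x * χ x with hA
  set B := ∫ x, (f x * deriv χ x - u x * (x * deriv χ x)) with hB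
  have hslice : ∀ t ∈ Ioi (0 : ℝ),
      t * (∫ ξ, (u ξ * fderiv ℝ (fun q : ℝ × ℝ => timeBump q.1 * χ (q.2 / q.1)) (t, t * ξ) (1, 0) +
        f ξ * fderiv ℝ (fun q : ℝ × ℝ => timeBump q.1 * χ (q.2 / q.1)) (t, t * ξ) (0, 1))) =
      t * deriv timeBump t * A + timeBump t * B := by
    intro t ht
    have ht' : (0 : ℝ) < t := ht
    have i4 : Integrable fun x => f x * deriv χ x - u x * (x * deriv χ x) := i2.sub i3
    rw [hA, hB, ← integral_const_mul, ← integral_const_mul, ← integral_const_mul,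
      ← integral_add (i1.const_mul _) (i4.const_mul _)]
    refine integral_congr_ae (ae_of_all _ fun ξ => ?_)
    simp only [d1 t ξ ht', d2 t ξ ht']
    field_simp; ring
  rw [setIntegral_congr_fun measurableSet_Ioi hslice] at h1
  have cg : Continuous timeBump := timeBump.continuous
  have cg' : Continuous (deriv timeBump) :=
    (timeBump.contDiff (n := 1)).continuous_deriv le_rfl
  have kg : HasCompactSupport timeBump := timeBump.hasCompactSupport
  have j1 : Integrable fun t => t * deriv timeBump t :=
    (by fun_prop : Continuous fun t => t * deriv timeBump t).integrable_of_hasCompactSupport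
      kg.deriv.mul_left
  have j2 : Integrable timeBump := cg.integrable_of_hasCompactSupport kg
  have hset : ∫ t in Ioi (0 : ℝ), (t * deriv timeBump t * A + timeBump t * B) =
      ∫ t, (t * deriv timeBump t * A + timeBump t * B) := by
    refine setIntegral_eq_integral_of_forall_compl_eq_zero fun t ht => ?_
    have ht' : t ≤ 0 := not_lt.1 ht
    have hz : timeBump =ᶠ[𝓝 t] fun _ => 0 := by
      filter_upwards [eventually_lt_nhds (show t < 1 by linarith)] with s hs
      exact timeBump_zero (Or.inl hs.le)
    rw [hz.deriv_eq, hz.eq_of_nhds]; simp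
  -- With this integration by parts the time integral becomes (B - A) ∫ g, so positivity of ∫ g
  -- leaves an inequality in ξ alone.
  have hparts : ∫ t, t * deriv timeBump t = -∫ t, timeBump t := by
    have := integral_mul_deriv_eq_deriv_mul_of_integrable (u := fun t : ℝ => t) (v := timeBump)
      (u' := fun _ => 1) (v' := deriv timeBump) (fun t _ => hasDerivAt_id' t) (fun t _ => hgd t)
      j1 (by simpa [Pi.mul_def] using j2)
      ((by fun_prop : Continuous fun t => t * timeBump t).integrable_of_hasCompactSupport kg.mul_left)
    simpa using this
  rw [hset, integral_add (j1.mul_const A) (j2.mul_const B), integral_mul_const, integral_mul_const,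
    hparts] at h1
  have hpos' : 0 < ∫ t, timeBump t := timeBump.integral_pos
  have h5 : 0 ≤ B - A := by
    by_contra hneg
    push Not at hneg
    nlinarith
  have i4 : Integrable fun x => f x * deriv χ x - u x * (x * deriv χ x) := i2.sub i3
  rw [hB, hA, ← integral_sub i4 i1] at h5
  refine h5.trans_eq (integral_congr_ae (ae_of_all _ fun x => ?_))
  simp only []; ring

/-- A spatial bump function at negative position `-(R + 2)`. -/
def spaceBump (c : ℝ) : ContDiffBump c where
  rIn := 1 / 2
  rOut := 1
  rIn_pos := by norm_num
  rIn_lt_rOut := by norm_num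

lemma spaceBump_zero {c x : ℝ} (h : x ≤ c - 1 ∨ c + 1 ≤ x) : spaceBump c x = 0 := by
  apply (spaceBump c).zero_of_le_dist
  rw [Real.dist_eq]
  show 1 ≤ _
  rw [le_abs]
  rcases h with h | h
  · right; linarith
  · left; linarith

/-- If the profile is constant near `-∞` or `+∞`, then the constant does not exceed the initial
value on the corresponding side. -/
theorem WeakIneq.le_initial {u f u₀ : ℝ → ℝ} (hu : BddMeas u) (hf : BddMeas f)
    (h : WeakIneq u f u₀) {c U V U₀ : ℝ}
    (hfar : ∀ᵐ ξ, ∀ t : ℝ, 0 < t → t < 1 → c - 1 < t * ξ → t * ξ < c + 1 → u ξ = U ∧ f ξ = V)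
    (h0 : ∀ x, c - 1 < x → x < c + 1 → u₀ x = U₀) : U ≤ U₀ := by
  set g := spaceBump 0 with hg
  set k := spaceBump c with hk
  -- Where θ is nonzero for t > 0 the densities equal the constants U and V almost everywhere. The
  -- flux term vanishes as ∫ k' = 0, and the time term gives -U g(0) ∫ k with g(0) = 1; comparison
  -- with U₀ ∫ k finishes the argument.
  set θ : ℝ × ℝ → ℝ := fun q => g q.1 * k q.2 with hθdef
  have hθ : ContDiff ℝ ∞ θ := (g.contDiff.comp contDiff_fst).mul (k.contDiff.comp contDiff_snd)
  have hc : HasCompactSupport θ := by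
    refine HasCompactSupport.intro
      (isCompact_Icc.prod isCompact_Icc : IsCompact (Icc (0 - 1 : ℝ) (0 + 1) ×ˢ Icc (c - 1) (c + 1)))
      fun q hq => ?_
    by_cases h1 : q.1 ∈ Icc (0 - 1 : ℝ) (0 + 1)
    · have h2 : k q.2 = 0 := by
        apply spaceBump_zero
        by_contra hcon
        push Not at hcon
        exact hq ⟨h1, hcon.1.le, hcon.2.le⟩
      simp [hθdef, h2]
    · have h2 : g q.1 = 0 := by
        apply spaceBump_zero
        by_contra hcon
        push Not at hcon
        exact h1 ⟨hcon.1.le, hcon.2.le⟩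
      simp [hθdef, h2]
  have hineq := h θ hθ hc (fun q _ => mul_nonneg g.nonneg k.nonneg)
  rw [weak_eq_iterated hθ hc hu hf] at hineq
  have hgd : ∀ t, HasDerivAt g (deriv g t) t := fun t =>
    (g.contDiff (n := 1)).differentiable one_ne_zero t |>.hasDerivAt
  have hkd : ∀ t, HasDerivAt k (deriv k t) t := fun t =>
    (k.contDiff (n := 1)).differentiable one_ne_zero t |>.hasDerivAt
  have cg' : Continuous (deriv g) := (g.contDiff (n := 1)).continuous_deriv le_rfl
  have ck' : Continuous (deriv k) := (k.contDiff (n := 1)).continuous_deriv le_rfl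
  have dθ : ∀ q, DifferentiableAt ℝ θ q := hθ.differentiable (by simp)
  have d1 : ∀ q, fderiv ℝ θ q (1, 0) = deriv g q.1 * k q.2 := fun q =>
    fderiv_apply_time (dθ q) ((hgd q.1).mul_const (k q.2))
  have d2 : ∀ q, fderiv ℝ θ q (0, 1) = g q.1 * deriv k q.2 := fun q =>
    fderiv_apply_space (dθ q) ((hkd q.2).const_mul (g q.1))
  have hz : ∀ x, x ≤ c - 1 ∨ c + 1 ≤ x → deriv k x = 0 := by
    intro x hx
    have hm : IsLocalMin k x := Eventually.of_forall fun y => by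
      rw [hk, spaceBump_zero hx]; exact k.nonneg
    exact hm.deriv_eq_zero
  have hzg : ∀ x, 1 ≤ x → deriv g x = 0 := by
    intro x hx
    have hm : IsLocalMin g x := Eventually.of_forall fun y => by
      rw [hg, spaceBump_zero (Or.inr (by linarith))]; exact g.nonneg
    exact hm.deriv_eq_zero
  have kk : HasCompactSupport k := k.hasCompactSupport
  have ik : Integrable k := k.continuous.integrable_of_hasCompactSupport kk
  have ik' : Integrable (deriv k) := ck'.integrable_of_hasCompactSupport kk.deriv
  have hk0 : ∫ x, deriv k x = 0 := integral_eq_zero_of_hasDerivAt_of_integrable hkd ik' ik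
  have hslice : ∀ t ∈ Ioi (0 : ℝ), t * (∫ ξ, (u ξ * fderiv ℝ θ (t, t * ξ) (1, 0) +
      f ξ * fderiv ℝ θ (t, t * ξ) (0, 1))) = deriv g t * (U * ∫ x, k x) := by
    intro t ht
    have ht' : (0 : ℝ) < t := ht
    have e : (∫ ξ, (u ξ * fderiv ℝ θ (t, t * ξ) (1, 0) + f ξ * fderiv ℝ θ (t, t * ξ) (0, 1))) =
        ∫ ξ, (fun x => U * deriv g t * k x + V * g t * deriv k x) (t * ξ) := by
      refine integral_congr_ae ?_
      filter_upwards [hfar] with ξ hξ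
      simp only [d1, d2]
      by_cases ht1 : t < 1
      · by_cases h1 : c - 1 < t * ξ ∧ t * ξ < c + 1
        · obtain ⟨hU, hV⟩ := hξ t ht' ht1 h1.1 h1.2
          rw [hU, hV]; ring
        · have h2 : t * ξ ≤ c - 1 ∨ c + 1 ≤ t * ξ := by
            by_contra hcon; push Not at hcon; exact h1 hcon
          rw [hz _ h2, hk, spaceBump_zero h2]; ring
      · have hgz : g t = 0 := by
          rw [hg, spaceBump_zero (Or.inr (by linarith))]
        rw [hzg t (not_lt.1 ht1), hgz]; ring
    rw [e, Measure.integral_comp_mul_left (fun x => U * deriv g t * k x + V * g t * deriv k x) t,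
      abs_of_pos (inv_pos.2 ht'), smul_eq_mul,
      integral_add (ik.const_mul _) (ik'.const_mul _), integral_const_mul, integral_const_mul, hk0]
    field_simp; ring
  rw [setIntegral_congr_fun measurableSet_Ioi hslice, integral_mul_const] at hineq
  have hg0 : ∫ t in Ioi (0 : ℝ), deriv g t = 0 - g 0 := by
    refine integral_Ioi_of_hasDerivAt_of_tendsto' (fun t _ => hgd t)
      (cg'.integrable_of_hasCompactSupport g.hasCompactSupport.deriv).integrableOn ?_
    refine tendsto_const_nhds.congr' ?_
    filter_upwards [eventually_ge_atTop 1] with t ht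
    rw [hg, spaceBump_zero (Or.inr (by linarith))]
  have hg1 : g 0 = 1 := g.one_of_mem_closedBall (by simp [g.rIn_pos.le])
  have hinit : ∫ x, u₀ x * θ (0, x) = U₀ * ∫ x, k x := by
    rw [← integral_const_mul]
    refine integral_congr_ae (ae_of_all _ fun x => ?_)
    simp only [hθdef, hg1, one_mul]
    by_cases h1 : c - 1 < x ∧ x < c + 1
    · rw [h0 x h1.1 h1.2]
    · have h2 : x ≤ c - 1 ∨ c + 1 ≤ x := by
        by_contra hcon; push Not at hcon; exact h1 hcon
      rw [hk, spaceBump_zero h2]; ring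
  rw [hg0, hg1, hinit] at hineq
  have hpos : 0 < ∫ x, k x := k.integral_pos
  nlinarith

/-! ### Bounded profiles -/

/-- No continuity at the vacuum is needed: g is continuous on an open set and vanishes at the
remaining admissible states. -/
lemma measurable_comp_profile {ε : ℝ} {g : ℝ × ℝ → ℝ} (hg : ContinuousOn g (nonVacuum ε))
    (hv : ∀ v, g (0, v) = 0) {ψ : ℝ → ℝ × ℝ} (hm : Measurable ψ) (ha : ∀ x, Adm ε (ψ x)) :
    Measurable (fun x => g (ψ x)) := by
  classical
  have h1 : Measurable ((nonVacuum ε).piecewise g (fun _ => 0)) :=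
    hg.measurable_piecewise continuousOn_const (isOpen_nonVacuum ε).measurableSet
  have h2 : (fun x => g (ψ x)) = fun x => (nonVacuum ε).piecewise g (fun _ => 0) (ψ x) := by
    funext x
    rcases (ha x).cases with h | h
    · rw [piecewise_eq_of_notMem _ _ _ (fun hn => (hn.1.ne' h).elim)]
      rw [show ψ x = (0, (ψ x).2) from Prod.ext h rfl, hv]
    · rw [piecewise_eq_of_mem _ _ _ h]
  rw [h2]; exact h1.comp hm

lemma nonVacuum_subset (ε : ℝ) : nonVacuum ε ⊆ phaseSpace ε := fun _ hp => ⟨hp.1.le, hp.2⟩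

lemma IsWeakEntropyPair.bounded {ε M : ℝ} {U V : ℝ × ℝ → ℝ} (h : IsWeakEntropyPair ε U V)
    (hM : 0 < M) : ∃ C, ∀ p ∈ tameRegion ε M, |U p| ≤ C ∧ |V p| ≤ C := by
  obtain ⟨C, hC⟩ := h.decay M hM
  refine ⟨|C| * M ^ alpha ε, fun p hp => ?_⟩
  have h1 : |U p| + |V p| ≤ |C| * M ^ alpha ε := by
    refine (hC p hp).trans (mul_le_mul (le_abs_self C) ?_ (Real.rpow_nonneg hp.1 _) (abs_nonneg C))
    exact Real.rpow_le_rpow hp.1 hp.2.1 (alpha_nonneg ε)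
  have := abs_nonneg (U p)
  have := abs_nonneg (V p)
  constructor <;> linarith

lemma IsWeakEntropyPair.bddMeas {ε M : ℝ} {U V : ℝ × ℝ → ℝ}
    (h : IsWeakEntropyPair ε U V) (hM : 0 < M) {ψ : ℝ → ℝ × ℝ} (hm : Measurable ψ)
    (ht : ∀ x, ψ x ∈ tameRegion ε M) :
    BddMeas (fun x => U (ψ x)) ∧ BddMeas (fun x => V (ψ x)) := by
  obtain ⟨C, hC⟩ := h.bounded hM
  have ha : ∀ x, Adm ε (ψ x) := fun x => adm_of_tame hM (ht x)
  exact ⟨⟨measurable_comp_profile (h.continuousOn_entropy.mono (nonVacuum_subset ε))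
      (fun v => (h.vacuum v).1) hm ha, C, fun x => (hC _ (ht x)).1⟩,
    ⟨measurable_comp_profile (h.continuousOn_flux.mono (nonVacuum_subset ε))
      (fun v => (h.vacuum v).2) hm ha, C, fun x => (hC _ (ht x)).2⟩⟩

lemma measurable_toA (ε : ℝ) : Measurable (toA ε) := by
  unfold toA
  fun_prop

lemma IsRiemannSolution.measurable {ε : ℝ} {pl pr : ℝ × ℝ} {ψ : ℝ → ℝ × ℝ}
    (h : IsRiemannSolution ε pl pr ψ) : Measurable ψ := by
  have h1 : Measurable (fun x : ℝ => (⟨(1, x), one_pos⟩ : {q : ℝ × ℝ // 0 < q.1})) :=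
    Measurable.subtype_mk (by fun_prop)
  have h2 := IsTameEntropySolution.measurable h |>.comp h1
  simpa [Function.comp_def] using h2

lemma IsRiemannSolution.weakIneq {ε : ℝ} {pl pr : ℝ × ℝ} {ψ : ℝ → ℝ × ℝ}
    (h : IsRiemannSolution ε pl pr ψ) {U V : ℝ × ℝ → ℝ} (hp : IsWeakEntropyPair ε U V)
    (hc : IsConvexEntropy ε U) :
    WeakIneq (fun x => U (ψ x)) (fun x => V (ψ x)) (fun x => U (riemannData pl pr x)) :=
  fun θ h1 h2 h3 => IsTameEntropySolution.entropy h U V hp hc θ h1 h2 h3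

lemma BddMeas.locallyIntegrable {u : ℝ → ℝ} (hu : BddMeas u) : LocallyIntegrable u := by
  obtain ⟨hm, C, hC⟩ := hu
  exact (locallyIntegrable_const C).mono hm.aestronglyMeasurable
    (ae_of_all _ fun x => by simpa using (hC x).trans (le_abs_self C))

lemma locallyIntegrable_id_mul {u : ℝ → ℝ} (hu : LocallyIntegrable u) :
    LocallyIntegrable (fun x => x * u x) := hu.continuous_mul continuous_id

lemma intervalIntegrable_of_locallyIntegrable {u : ℝ → ℝ} (hu : LocallyIntegrable u) (x y : ℝ) :
    IntervalIntegrable u volume x y :=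
  (hu.integrableOn_isCompact isCompact_uIcc).intervalIntegrable

lemma DistIneq.weight_neg {u E : ℝ → ℝ} (hu : LocallyIntegrable u) (hE : LocallyIntegrable E)
    (h : DistIneq u E) (h' : DistIneq (fun x => -u x) (fun x => -E x)) :
    DistIneq (fun x => -(x * u x - E x)) (fun x => -(x * E x)) := by
  have h1 : DistIneq (fun x => x * -u x - -E x) (fun x => x * -E x) :=
    h'.weight hu.neg hE.neg (by simpa only [neg_neg] using h)
  have e1 : (fun x => -(x * u x - E x)) = fun x => x * -u x - -E x := by funext x; ring
  have e2 : (fun x => -(x * E x)) = fun x => x * -E x := by funext x; ring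
  rw [e1, e2]; exact h1

lemma intervalIntegral_comb {f g h k : ℝ → ℝ} {x y : ℝ} (hf : IntervalIntegrable f volume x y)
    (hg : IntervalIntegrable g volume x y) (hh : IntervalIntegrable h volume x y)
    (hk : IntervalIntegrable k volume x y) (a b c d : ℝ) :
    ∫ t in x..y, (a * f t + b * g t + c * h t + d * k t) =
      a * (∫ t in x..y, f t) + b * (∫ t in x..y, g t) + c * (∫ t in x..y, h t) +
        d * ∫ t in x..y, k t := by
  have i1 : IntervalIntegrable (fun t => a * f t) volume x y := hf.const_mul a
  have i2 : IntervalIntegrable (fun t => b * g t) volume x y := hg.const_mul b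
  have i3 : IntervalIntegrable (fun t => c * h t) volume x y := hh.const_mul c
  have i4 : IntervalIntegrable (fun t => d * k t) volume x y := hk.const_mul d
  have i12 : IntervalIntegrable (fun t => a * f t + b * g t) volume x y := i1.add i2
  have i123 : IntervalIntegrable (fun t => a * f t + b * g t + c * h t) volume x y := i12.add i3
  rw [intervalIntegral.integral_add i123 i4, intervalIntegral.integral_add i12 i3,
    intervalIntegral.integral_add i1 i2, intervalIntegral.integral_const_mul,
    intervalIntegral.integral_const_mul, intervalIntegral.integral_const_mul,
    intervalIntegral.integral_const_mul]

/-- A distributional identity `u + E' = 0` provides a continuous representative of `E`. -/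
lemma DistIneq.rep {u E : ℝ → ℝ} (hu : LocallyIntegrable u) (hE : LocallyIntegrable E)
    (h : DistIneq u E) (h' : DistIneq (fun x => -u x) (fun x => -E x)) :
    ∃ E' : ℝ → ℝ, (∀ x y, E' y - E' x = -∫ t in x..y, u t) ∧ ∀ᵐ x, E x = E' x := by
  obtain ⟨S, hS, h1⟩ := h.mono hu hE
  obtain ⟨S', hS', h2⟩ := h'.mono (u := fun x => -u x) (E := fun x => -E x) hu.neg hE.neg
  have hi : ∀ x y, IntervalIntegrable u volume x y := fun x y =>
    intervalIntegrable_of_locallyIntegrable hu x y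
  obtain ⟨x₀, hx₀, hx₀'⟩ := (hS.and hS').exists
  refine ⟨fun x => E x₀ - ∫ t in x₀..x, u t, fun x y => ?_, ?_⟩
  · have e := intervalIntegral.integral_add_adjacent_intervals (hi x₀ x) (hi x y)
    simp only
    linarith
  · filter_upwards [hS, hS'] with x hx hx'
    rcases lt_trichotomy x x₀ with hlt | rfl | hlt
    · have e1 := h1 x hx x₀ hx₀ hlt
      have e2 := h2 x hx' x₀ hx₀' hlt
      rw [intervalIntegral.integral_neg] at e2
      rw [intervalIntegral.integral_symm]; linarith
    · simp
    · have e1 := h1 x₀ hx₀ x hx hlt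
      have e2 := h2 x₀ hx₀' x hx' hlt
      rw [intervalIntegral.integral_neg] at e2
      linarith

/-! ### Continuous representatives of the characteristic squares -/

/-- Self-similar density of the particle number entropy. -/
def en (ε x : ℝ) (q : ℝ × ℝ) : ℝ := (q.2 - x * q.1) * (q.1 ^ 2 - ε ^ 2 * q.2 ^ 2) ^ mu ε

/-- Profiles of self-similar solutions in square-root coordinates. The functions `Ap`, `Am`
and `m` are the continuous representatives of `sp ^ 2`, `sm ^ 2` and `H - x * G`. -/
structure Prof (ε : ℝ) (q : ℝ → ℝ × ℝ) (S : Set ℝ) (Ap Am m : ℝ → ℝ) : Prop where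
  cases : ∀ x, q x = (0, 0) ∨ q x ∈ cone ε
  meas : Measurable q
  bdd : ∃ C, ∀ x, |(q x).1| ≤ C ∧ |(q x).2| ≤ C
  ae : ∀ᵐ x, x ∈ S
  ap : ∀ x ∈ S, Ap x = sp ε x (q x) ^ 2
  am : ∀ x ∈ S, Am x = sm ε x (q x) ^ 2
  mm : ∀ x ∈ S, m x = HA ε (q x) - x * GA ε (q x)
  ap_int : ∀ x y, Ap y - Ap x =
    ∫ t in x..y, -2 * sp ε t (q t) * ((q t).1 + ε ^ 2 * (q t).2)
  am_int : ∀ x y, Am y - Am x =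
    ∫ t in x..y, 2 * sm ε t (q t) * ((q t).1 - ε ^ 2 * (q t).2)
  m_int : ∀ x y, m y - m x = -∫ t in x..y, GA ε (q t)
  ent : ∃ C, ∀ x ∈ S, ∀ y ∈ S, x < y → -C * (y - x) ≤ en ε y (q y) - en ε x (q x)

lemma intervalIntegral_neg_comp (f : ℝ → ℝ) (x y : ℝ) :
    ∫ t in x..y, f (-t) = -∫ t in (-x)..(-y), f t := by
  rw [intervalIntegral.integral_comp_neg, intervalIntegral.integral_symm]

/-- Profiles are invariant under reflection of space. -/
lemma Prof.reflect {ε : ℝ} {q : ℝ → ℝ × ℝ} {S : Set ℝ} {Ap Am m : ℝ → ℝ}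
    (h : Prof ε q S Ap Am m) :
    Prof ε (fun x => ((q (-x)).1, -(q (-x)).2)) {x | -x ∈ S}
      (fun x => Am (-x)) (fun x => Ap (-x)) (fun x => -m (-x)) where
  cases x := by
    rcases h.cases (-x) with h0 | h0
    · left; rw [h0]; simp
    · right
      have : ε * |(q (-x)).2| < (q (-x)).1 := h0
      show ε * |-(q (-x)).2| < (q (-x)).1
      rwa [abs_neg]
  meas := by
    have := h.meas.comp measurable_neg
    exact (this.fst).prodMk (this.snd.neg)
  bdd := h.bdd.imp fun _ hC x => ⟨(hC (-x)).1, by simpa using (hC (-x)).2⟩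
  ae := (Measure.measurePreserving_neg (volume : Measure ℝ)).quasiMeasurePreserving.ae h.ae
  ap x hx := by rw [h.am _ hx]; simp only [sp, sm]; ring
  am x hx := by rw [h.ap _ hx]; simp only [sp, sm]; ring
  mm x hx := by rw [h.mm _ hx]; simp only [HA, GA]; ring
  ap_int x y := by
    rw [h.am_int, ← neg_neg (intervalIntegral _ _ _ _), ← intervalIntegral_neg_comp,
      ← intervalIntegral.integral_neg]
    congr 1; funext t; simp only [sp, sm]; ring
  am_int x y := by
    rw [h.ap_int, ← neg_neg (intervalIntegral _ _ _ _), ← intervalIntegral_neg_comp,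
      ← intervalIntegral.integral_neg]
    congr 1; funext t; simp only [sp, sm]; ring
  m_int x y := by
    have e := h.m_int (-x) (-y)
    have e2 : ∫ t in x..y, GA ε ((q (-t)).1, -(q (-t)).2) = -∫ t in (-x)..(-y), GA ε (q t) := by
      rw [← intervalIntegral_neg_comp]
      congr 1; funext t; simp only [GA]; ring
    rw [e2]; linarith
  ent := by
    obtain ⟨C, hC⟩ := h.ent
    refine ⟨C, fun x hx y hy hxy => ?_⟩
    have e := hC (-y) hy (-x) hx (by linarith)
    have e2 : ∀ t, en ε t ((q (-t)).1, -(q (-t)).2) = -en ε (-t) (q (-t)) := fun t => by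
      simp only [en, neg_sq]; ring
    rw [e2, e2]; linarith

/-- Construction of the continuous representatives for a self-similar solution. -/
theorem IsRiemannSolution.prof {ε : ℝ} (hε : 0 < ε) (hε1 : ε ≤ 1) {pl pr : ℝ × ℝ}
    {ψ : ℝ → ℝ × ℝ} (h : IsRiemannSolution ε pl pr ψ) :
    ∃ (S : Set ℝ) (Ap Am m : ℝ → ℝ), Prof ε (fun x => toA ε (ψ x)) S Ap Am m := by
  obtain ⟨M, hM, ht'⟩ := h.tame
  have ht : ∀ x, ψ x ∈ tameRegion ε M := fun x => by simpa using ht' 1 x one_pos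
  have hm := h.measurable
  have ha : ∀ x, Adm ε (ψ x) := fun x => adm_of_tame hM (ht x)
  have pGH := isWeakEntropyPair_GH hε hε1
  have pHF := isWeakEntropyPair_HF hε hε1
  have pNQ := isWeakEntropyPair_particle hε hε1
  obtain ⟨bG, bH⟩ := pGH.bddMeas hM hm ht
  obtain ⟨-, bF⟩ := pHF.bddMeas hM hm ht
  obtain ⟨bN, bQ⟩ := pNQ.bddMeas hM hm ht
  have cG : IsConvexEntropy ε (G ε) := by simpa using isConvexEntropy_linear hε 1 0
  have cG' : IsConvexEntropy ε (fun p => -G ε p) := by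
    simpa using isConvexEntropy_linear hε (-1) 0
  have cH : IsConvexEntropy ε (H ε) := by simpa using isConvexEntropy_linear hε 0 1
  have cH' : IsConvexEntropy ε (fun p => -H ε p) := by
    simpa using isConvexEntropy_linear hε 0 (-1)
  have d1 := (h.weakIneq pGH cG).distIneq bG bH
  have d1' := (h.weakIneq pGH.neg cG').distIneq bG.neg bH.neg
  have d2 := (h.weakIneq pHF cH).distIneq bH bF
  have d2' := (h.weakIneq pHF.neg cH').distIneq bH.neg bF.neg
  have dN := (h.weakIneq pNQ.neg (isConvexEntropy_neg_particle hε hε1)).distIneq bN.neg bQ.neg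
  have eneg : ∀ u f : ℝ → ℝ, (fun x => -f x - x * -u x) = fun x => -(f x - x * u x) := by
    intro u f; funext x; ring
  rw [eneg (fun x => G ε (ψ x)) (fun x => H ε (ψ x))] at d1'
  rw [eneg (fun x => H ε (ψ x)) (fun x => F ε (ψ x))] at d2'
  have lG := bG.locallyIntegrable
  have lH := bH.locallyIntegrable
  have lF := bF.locallyIntegrable
  have lN := bN.locallyIntegrable
  have lQ := bQ.locallyIntegrable
  have l1 : LocallyIntegrable (fun x => H ε (ψ x) - x * G ε (ψ x)) := lH.sub (locallyIntegrable_id_mul lG)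
  have l2 : LocallyIntegrable (fun x => F ε (ψ x) - x * H ε (ψ x)) := lF.sub (locallyIntegrable_id_mul lH)
  -- The squares sp² and sm² also contain x(H-xG) and x(F-xH), whose distributional equations follow
  -- from multiplication by x.
  have w1 := d1.weight lG l1 d1'
  have w2 := d2.weight lH l2 d2'
  have w1' := d1.weight_neg lG l1 d1'
  have w2' := d2.weight_neg lH l2 d2'
  have k1 : LocallyIntegrable (fun x => x * G ε (ψ x) - (H ε (ψ x) - x * G ε (ψ x))) :=
    (locallyIntegrable_id_mul lG).sub l1
  have k2 : LocallyIntegrable (fun x => x * H ε (ψ x) - (F ε (ψ x) - x * H ε (ψ x))) :=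
    (locallyIntegrable_id_mul lH).sub l2
  obtain ⟨m1, m1i, m1e⟩ := d1.rep lG l1 d1'
  obtain ⟨m2, m2i, m2e⟩ := d2.rep lH l2 d2'
  obtain ⟨n1, n1i, n1e⟩ := w1.rep k1 (locallyIntegrable_id_mul l1) w1'
  obtain ⟨n2, n2i, n2e⟩ := w2.rep k2 (locallyIntegrable_id_mul l2) w2'
  obtain ⟨S, hS, hSm⟩ := dN.mono (u := fun x => -Nn ε (ψ x))
    (E := fun x => -Qn ε (ψ x) - x * -Nn ε (ψ x)) lN.neg ((lQ.neg).sub (locallyIntegrable_id_mul (u := fun x => -Nn ε (ψ x)) lN.neg))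
  have hcomb : ∀ s x y : ℝ, ∫ t in x..y, (-(H ε (ψ t)) +
      (t * G ε (ψ t) - (H ε (ψ t) - t * G ε (ψ t))) +
      s * (-G ε (ψ t) + ε ^ 2 * (t * H ε (ψ t) - (F ε (ψ t) - t * H ε (ψ t))))) =
      -(∫ t in x..y, H ε (ψ t)) +
      (∫ t in x..y, (t * G ε (ψ t) - (H ε (ψ t) - t * G ε (ψ t)))) +
      s * (-(∫ t in x..y, G ε (ψ t)) +
        ε ^ 2 * ∫ t in x..y, (t * H ε (ψ t) - (F ε (ψ t) - t * H ε (ψ t)))) := by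
    intro s x y
    have i1 := intervalIntegrable_of_locallyIntegrable lG x y
    have i2 := intervalIntegrable_of_locallyIntegrable lH x y
    have i3 := intervalIntegrable_of_locallyIntegrable k1 x y
    have i4 := intervalIntegrable_of_locallyIntegrable k2 x y
    have e := intervalIntegral_comb i2 i3 i1 i4 (-1) 1 (-s) (s * ε ^ 2)
    refine (Eq.trans ?_ e).trans (by ring)
    congr 1; funext t; ring
  have hne : (1 + ε ^ 2) ≠ 0 := by positivity
  obtain ⟨CG, hCG⟩ := bG.2
  obtain ⟨CF, hCF⟩ := bF.2
  obtain ⟨CN, hCN⟩ := bN.2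
  -- With m₁ = H-xG and m₂ = F-xH one has sp² = m₂ - x m₁ + 2/(1+ε²) · (m₁ - ε² x m₂), and sm² is
  -- the same with the opposite sign in front of 2/(1+ε²).
  refine ⟨S ∩ {x | H ε (ψ x) - x * G ε (ψ x) = m1 x ∧ F ε (ψ x) - x * H ε (ψ x) = m2 x ∧
    x * (H ε (ψ x) - x * G ε (ψ x)) = n1 x ∧ x * (F ε (ψ x) - x * H ε (ψ x)) = n2 x},
    fun x => m2 x - n1 x + 2 / (1 + ε ^ 2) * (m1 x - ε ^ 2 * n2 x),
    fun x => m2 x - n1 x + -(2 / (1 + ε ^ 2)) * (m1 x - ε ^ 2 * n2 x), m1, ?_⟩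
  constructor
  · exact fun x => toA_cases hε (ha x)
  · exact (measurable_toA ε).comp hm
  · refine ⟨CG + CF + 1, fun x => ?_⟩
    have e1 : G ε (ψ x) ≤ CG := (abs_le.1 (hCG x)).2
    have e2 : F ε (ψ x) ≤ CF := (abs_le.1 (hCF x)).2
    rw [G_eq hε (ha x), GA] at e1
    rw [F_eq hε (ha x), FA] at e2
    have e3 : 0 ≤ ε ^ 4 * (toA ε (ψ x)).2 ^ 2 := by positivity
    constructor
    · rw [abs_le]; constructor <;> nlinarith [sq_nonneg ((toA ε (ψ x)).1 - 1), sq_nonneg ((toA ε (ψ x)).1 + 1), sq_nonneg (toA ε (ψ x)).2]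
    · rw [abs_le]; constructor <;> nlinarith [sq_nonneg ((toA ε (ψ x)).2 - 1), sq_nonneg ((toA ε (ψ x)).2 + 1), sq_nonneg (toA ε (ψ x)).1]
  · filter_upwards [hS, m1e, m2e, n1e, n2e] with x h1 h2 h3 h4 h5
    exact ⟨h1, h2, h3, h4, h5⟩
  · rintro x ⟨-, h1, h2, h3, h4⟩
    rw [← h3, ← h4, ← h1, ← h2, G_eq hε (ha x), H_eq hε (ha x), F_eq hε (ha x)]
    simp only [sp, GA, HA, FA]; field_simp; ring
  · rintro x ⟨-, h1, h2, h3, h4⟩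
    rw [← h3, ← h4, ← h1, ← h2, G_eq hε (ha x), H_eq hε (ha x), F_eq hε (ha x)]
    simp only [sm, GA, HA, FA]; field_simp; ring
  · rintro x ⟨-, h1, h2, h3, h4⟩
    rw [← h1, G_eq hε (ha x), H_eq hε (ha x)]
  · intro x y
    have e : ∀ t, -2 * sp ε t (toA ε (ψ t)) * ((toA ε (ψ t)).1 + ε ^ 2 * (toA ε (ψ t)).2) =
        -(H ε (ψ t)) + (t * G ε (ψ t) - (H ε (ψ t) - t * G ε (ψ t))) + 2 / (1 + ε ^ 2) *
          (-G ε (ψ t) + ε ^ 2 * (t * H ε (ψ t) - (F ε (ψ t) - t * H ε (ψ t)))) := by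
      intro t
      rw [G_eq hε (ha t), H_eq hε (ha t), F_eq hε (ha t)]
      simp only [sp, GA, HA, FA]; field_simp; ring
    simp only [e]
    rw [hcomb]
    have e1 := m1i x y
    have e2 := m2i x y
    have e3 := n1i x y
    have e4 := n2i x y
    linear_combination e2 - e3 + 2 / (1 + ε ^ 2) * (e1 - ε ^ 2 * e4)
  · intro x y
    have e : ∀ t, 2 * sm ε t (toA ε (ψ t)) * ((toA ε (ψ t)).1 - ε ^ 2 * (toA ε (ψ t)).2) =
        -(H ε (ψ t)) + (t * G ε (ψ t) - (H ε (ψ t) - t * G ε (ψ t))) + -(2 / (1 + ε ^ 2)) *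
          (-G ε (ψ t) + ε ^ 2 * (t * H ε (ψ t) - (F ε (ψ t) - t * H ε (ψ t)))) := by
      intro t
      rw [G_eq hε (ha t), H_eq hε (ha t), F_eq hε (ha t)]
      simp only [sm, GA, HA, FA]; field_simp; ring
    simp only [e]
    rw [hcomb]
    have e1 := m1i x y
    have e2 := m2i x y
    have e3 := n1i x y
    have e4 := n2i x y
    linear_combination e2 - e3 + -(2 / (1 + ε ^ 2)) * (e1 - ε ^ 2 * e4)
  · intro x y
    rw [m1i]
    simp only [G_eq hε (ha _)]
  · refine ⟨CN, fun x hx y hy hxy => ?_⟩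
    have e := hSm x hx.1 y hy.1 hxy
    rw [intervalIntegral.integral_neg] at e
    have e1 : ∫ t in x..y, Nn ε (ψ t) ≤ CN * (y - x) := by
      have := intervalIntegral.norm_integral_le_of_norm_le_const (a := x) (b := y) (C := CN)
        (f := fun t => Nn ε (ψ t)) (fun t _ => hCN t)
      rw [abs_of_pos (sub_pos.2 hxy)] at this
      exact (le_abs_self _).trans this
    have e2 : ∀ t, en ε t (toA ε (ψ t)) = Qn ε (ψ t) - t * Nn ε (ψ t) := fun t => by
      rw [Qn_eq hε (ha t), Nn_eq hε (ha t), en]; ring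
    rw [e2, e2]; linarith

/-! ### Characteristic coordinates -/

lemma one_sub_pos {ε x : ℝ} (hε : 0 < ε) (h1 : -(1 / ε) < x) (h2 : x < 1 / ε) :
    0 < 1 - ε ^ 2 * x ^ 2 ∧ 0 < 1 + ε * x ∧ 0 < 1 - ε * x := by
  have e1 : ε * x < 1 := by rw [lt_div_iff₀ hε] at h2; linarith
  have e2 : -1 < ε * x := by
    have := (lt_div_iff₀ hε).1 (show -x < 1 / ε by linarith)
    linarith
  refine ⟨?_, by linarith, by linarith⟩
  nlinarith

/-- Off the light cone sp and sm are linear coordinates on the plane; this and `snd_eq` invert them.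
-/
lemma fst_eq {ε x : ℝ} (h : 1 - ε ^ 2 * x ^ 2 ≠ 0) (q : ℝ × ℝ) :
    q.1 = ((1 + ε ^ 2 * x) * sp ε x q + (1 - ε ^ 2 * x) * sm ε x q) / (2 * (1 - ε ^ 2 * x ^ 2)) := by
  rw [eq_div_iff (by positivity)]; simp only [sp, sm]; ring

lemma snd_eq {ε x : ℝ} (h : 1 - ε ^ 2 * x ^ 2 ≠ 0) (q : ℝ × ℝ) :
    q.2 = ((1 + x) * sp ε x q - (1 - x) * sm ε x q) / (2 * (1 - ε ^ 2 * x ^ 2)) := by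
  rw [eq_div_iff (by positivity)]; simp only [sp, sm]; ring

/-- Up to constants, sp + sm and sp - sm are the components of the Lorentz boost of (a,b) with
velocity x, which preserves a²-ε²b² up to the factor 1-ε²x². -/
lemma rho_char {ε x : ℝ} (q : ℝ × ℝ) :
    4 * (1 - ε ^ 2 * x ^ 2) * (q.1 ^ 2 - ε ^ 2 * q.2 ^ 2) =
      (sp ε x q + sm ε x q) ^ 2 - ε ^ 2 * (sp ε x q - sm ε x q) ^ 2 := by
  simp only [sp, sm]; ring

/-- The same boost argument: for |x| < 1/ε it maps the cone onto itself. -/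
lemma cone_char {ε x : ℝ} (hε : 0 < ε) (h1 : -(1 / ε) < x) (h2 : x < 1 / ε) {q : ℝ × ℝ} :
    q ∈ cone ε ↔ ε * |sp ε x q - sm ε x q| < sp ε x q + sm ε x q := by
  obtain ⟨d0, d1, d2⟩ := one_sub_pos hε h1 h2
  have e1 : sp ε x q - sm ε x q = 2 * (q.2 - x * q.1) := by simp only [sp, sm]; ring
  have e2 : sp ε x q + sm ε x q = 2 * (q.1 - ε ^ 2 * x * q.2) := by simp only [sp, sm]; ring
  rw [cone_iff hε, ← abs_of_pos hε, ← abs_mul, abs_of_pos hε, abs_lt, e1, e2]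
  constructor
  · rintro ⟨a1, a2⟩
    constructor <;> nlinarith
  · rintro ⟨a1, a2⟩
    have b1 : 0 < (1 + ε * x) * (q.1 - ε * q.2) := by nlinarith
    have b2 : 0 < (1 - ε * x) * (q.1 + ε * q.2) := by nlinarith
    have b3 := (mul_pos_iff_of_pos_left d1).1 b1
    have b4 := (mul_pos_iff_of_pos_left d2).1 b2
    constructor <;> linarith

/-- The sum is 2(a - ε²xb) with |ε²x| ≤ ε. Consequently the two forms are never both nonpositive
inside the light cone, which orders the sign changes α ≤ β. -/
lemma cone_sum_pos {ε x : ℝ} (hε : 0 < ε) (h1 : -(1 / ε) ≤ x) (h2 : x ≤ 1 / ε) {q : ℝ × ℝ}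
    (h : q ∈ cone ε) : 0 < sp ε x q + sm ε x q := by
  have e2 : sp ε x q + sm ε x q = 2 * (q.1 + (-(ε ^ 2 * x)) * q.2) := by simp only [sp, sm]; ring
  rw [e2]
  refine mul_pos two_pos (cone_comb_pos h ?_)
  rw [abs_neg, abs_mul, abs_of_pos (pow_pos hε 2)]
  have : |x| ≤ 1 / ε := abs_le.2 ⟨h1, h2⟩
  calc ε ^ 2 * |x| ≤ ε ^ 2 * (1 / ε) := by gcongr
    _ = ε := by field_simp

lemma cone_c_pos {ε : ℝ} (hε : 0 < ε) (hε1 : ε ≤ 1) {q : ℝ × ℝ} (h : q ∈ cone ε) :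
    0 < q.1 + ε ^ 2 * q.2 ∧ 0 < q.1 - ε ^ 2 * q.2 := by
  have h1 := cone_comb_pos h (sq_le_self_of_le_one hε hε1)
  have h2 := cone_comb_pos (s := -ε ^ 2) h
    (by rw [abs_neg]; exact sq_le_self_of_le_one hε hε1)
  constructor <;> linarith

lemma sm_vac (ε x : ℝ) : sm ε x (0, 0) = 0 := by simp [sm]

lemma sp_vac (ε x : ℝ) : sp ε x (0, 0) = 0 := by simp [sp]

/-- One of the two halves of the cone condition in characteristic coordinates. It limits how
negative sm can be relative to sp, hence which sign reversals stay in the cone. -/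
lemma sp_dom {ε x : ℝ} (hε : 0 < ε) (h1 : -(1 / ε) < x) (h2 : x < 1 / ε) {q : ℝ × ℝ}
    (h : q ∈ cone ε) : (1 + ε) * -sm ε x q < (1 - ε) * sp ε x q := by
  have := (cone_char hε h1 h2).1 h
  have h3 := le_abs_self (sp ε x q - sm ε x q)
  nlinarith

lemma sm_dom {ε x : ℝ} (hε : 0 < ε) (h1 : -(1 / ε) < x) (h2 : x < 1 / ε) {q : ℝ × ℝ}
    (h : q ∈ cone ε) : (1 + ε) * -sp ε x q < (1 - ε) * sm ε x q := by
  have := (cone_char hε h1 h2).1 h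
  have h3 := neg_abs_le (sp ε x q - sm ε x q)
  nlinarith

/-! ### Continuity and monotonicity of the representatives -/

/-- An a.e. identity on S suffices: replacing the integrand by the continuous g does not change the
primitive, to which the fundamental theorem applies. -/
lemma hasDerivAt_of_integral {X f g : ℝ → ℝ} {S : Set ℝ} (hS : ∀ᵐ x, x ∈ S)
    (hX : ∀ x y, X y - X x = ∫ t in x..y, f t) {c d : ℝ} (hg : ContinuousOn g (Ioo c d))
    (hfg : ∀ x ∈ S, c < x → x < d → f x = g x) {x : ℝ} (hx : x ∈ Ioo c d) :
    HasDerivAt X (g x) x := by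
  have h1 : HasDerivAt (fun y => X x + ∫ t in x..y, g t) (g x) x := by
    refine (intervalIntegral.integral_hasDerivAt_right ?_ ?_ ?_).const_add _
    · exact IntervalIntegrable.refl
    · exact hg.stronglyMeasurableAtFilter isOpen_Ioo x hx
    · exact hg.continuousAt (isOpen_Ioo.mem_nhds hx)
  refine h1.congr_of_eventuallyEq ?_
  filter_upwards [isOpen_Ioo.mem_nhds hx] with y hy
  have e : ∫ t in x..y, f t = ∫ t in x..y, g t := by
    refine intervalIntegral.integral_congr_ae ?_
    filter_upwards [hS] with t ht htI
    have : t ∈ Ioo c d := by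
      rw [uIoc] at htI
      exact ⟨(lt_min hx.1 hy.1).trans htI.1, htI.2.trans_lt (max_lt hx.2 hy.2)⟩
    exact hfg t ht this.1 this.2
  rw [← e, ← hX]; ring

lemma le_of_integral_nonneg {X f : ℝ → ℝ} {S : Set ℝ} (hS : ∀ᵐ x, x ∈ S)
    (hX : ∀ x y, X y - X x = ∫ t in x..y, f t) {x y : ℝ} (hxy : x ≤ y)
    (hf : ∀ t ∈ S, x < t → t < y → 0 ≤ f t) : X x ≤ X y := by
  have : 0 ≤ ∫ t in x..y, f t := by
    rw [intervalIntegral.integral_of_le hxy, integral_Ioc_eq_integral_Ioo]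
    refine setIntegral_nonneg_of_ae_restrict ?_
    rw [EventuallyLE, ae_restrict_iff' measurableSet_Ioo]
    filter_upwards [hS] with t ht htI
    exact hf t ht htI.1 htI.2
  linarith [hX x y]

namespace Prof

variable {ε : ℝ} {q : ℝ → ℝ × ℝ} {S : Set ℝ} {Ap Am m : ℝ → ℝ}

lemma bddMeas_quadratic (h : Prof ε q S Ap Am m) (a b c : ℝ) :
    BddMeas (fun x => a * (q x).1 ^ 2 + b * ((q x).1 * (q x).2) + c * (q x).2 ^ 2) := by
  have h1 := h.meas.fst
  have h2 := h.meas.snd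
  refine ⟨by fun_prop, ?_⟩
  obtain ⟨C, hC⟩ := h.bdd
  refine ⟨|a| * C ^ 2 + |b| * (C * C) + |c| * C ^ 2, fun x => ?_⟩
  obtain ⟨e1, e2⟩ := hC x
  have hC0 : 0 ≤ C := (abs_nonneg _).trans e1
  refine (abs_add_three _ _ _).trans ?_
  simp only [abs_mul, abs_pow]
  gcongr

lemma am_cont (h : Prof ε q S Ap Am m) : Continuous Am := by
  have e : ∀ t, 2 * sm ε t (q t) * ((q t).1 - ε ^ 2 * (q t).2) =
      (2 * (q t).1 ^ 2 + (-2 - 2 * ε ^ 2) * ((q t).1 * (q t).2) + (2 * ε ^ 2) * (q t).2 ^ 2) +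
      t * (2 * (q t).1 ^ 2 + (-4 * ε ^ 2) * ((q t).1 * (q t).2) + (2 * ε ^ 4) * (q t).2 ^ 2) := by
    intro t; simp only [sm]; ring
  have hl : LocallyIntegrable (fun t => 2 * sm ε t (q t) * ((q t).1 - ε ^ 2 * (q t).2)) := by
    simp only [e]
    exact (h.bddMeas_quadratic _ _ _).locallyIntegrable.add
      (locallyIntegrable_id_mul (h.bddMeas_quadratic _ _ _).locallyIntegrable)
  have hc := intervalIntegral.continuous_primitive
    (fun a b => intervalIntegrable_of_locallyIntegrable hl a b) 0
  have : Am = fun x => Am 0 + ∫ t in 0..x, 2 * sm ε t (q t) * ((q t).1 - ε ^ 2 * (q t).2) := by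
    funext x; rw [← h.am_int]; ring
  rw [this]; exact hc.const_add _

lemma ap_cont (h : Prof ε q S Ap Am m) : Continuous Ap := by
  have h1 := h.reflect.am_cont.comp continuous_neg
  simpa [Function.comp_def] using h1

lemma m_cont (h : Prof ε q S Ap Am m) : Continuous m := by
  have e : ∀ t, GA ε (q t) = 1 * (q t).1 ^ 2 + 0 * ((q t).1 * (q t).2) + ε ^ 4 * (q t).2 ^ 2 := by
    intro t; simp only [GA]; ring
  have hl : LocallyIntegrable (fun t => GA ε (q t)) := by
    simp only [e]
    exact (h.bddMeas_quadratic _ _ _).locallyIntegrable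
  have hc := intervalIntegral.continuous_primitive
    (fun a b => intervalIntegrable_of_locallyIntegrable hl a b) 0
  have : m = fun x => m 0 - ∫ t in 0..x, GA ε (q t) := by
    funext x; linarith [h.m_int 0 x]
  rw [this]; exact continuous_const.sub hc

lemma exists_mem (h : Prof ε q S Ap Am m) {x y : ℝ} (hxy : x < y) : ∃ z ∈ S, x < z ∧ z < y := by
  have h1 : (volume : Measure ℝ) (Ioo x y) ≠ 0 := by simp [hxy]
  have h2 : ∃ᵐ z, z ∈ Ioo x y := frequently_ae_iff.2 h1
  obtain ⟨z, hz, hz'⟩ := (h2.and_eventually h.ae).exists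
  exact ⟨z, hz', hz.1, hz.2⟩

/-- Two continuous functions agreeing on `S` to the right of `x` agree at `x`. -/
lemma eq_of_right (h : Prof ε q S Ap Am m) {f g : ℝ → ℝ} {x d : ℝ} (hf : ContinuousAt f x)
    (hg : ContinuousAt g x) (hxd : x < d) (hfg : ∀ t ∈ S, x < t → t < d → f t = g t) :
    f x = g x := by
  by_contra hne
  have h1 : ∀ᶠ t in 𝓝 x, f t ≠ g t := (hf.prodMk hg).eventually
    ((isOpen_ne_fun continuous_fst continuous_snd).mem_nhds hne)
  obtain ⟨δ, hδ, h2⟩ := Metric.eventually_nhds_iff.1 h1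
  obtain ⟨z, hz, hz1, hz2⟩ := h.exists_mem (show x < min d (x + δ) from lt_min hxd (by linarith))
  refine h2 ?_ (hfg z hz hz1 (hz2.trans_le (min_le_left _ _)))
  rw [Real.dist_eq, abs_lt]
  have := hz2.trans_le (min_le_right _ _)
  constructor <;> linarith

lemma eq_of_left (h : Prof ε q S Ap Am m) {f g : ℝ → ℝ} {x c : ℝ} (hf : ContinuousAt f x)
    (hg : ContinuousAt g x) (hxd : c < x) (hfg : ∀ t ∈ S, c < t → t < x → f t = g t) :
    f x = g x := by
  by_contra hne
  have h1 : ∀ᶠ t in 𝓝 x, f t ≠ g t := (hf.prodMk hg).eventually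
    ((isOpen_ne_fun continuous_fst continuous_snd).mem_nhds hne)
  obtain ⟨δ, hδ, h2⟩ := Metric.eventually_nhds_iff.1 h1
  obtain ⟨z, hz, hz1, hz2⟩ := h.exists_mem (show max c (x - δ) < x from max_lt hxd (by linarith))
  refine h2 ?_ (hfg z hz ((le_max_left _ _).trans_lt hz1) hz2)
  rw [Real.dist_eq, abs_lt]
  have := (le_max_right _ _).trans_lt hz1
  constructor <;> linarith

lemma am_nonneg (h : Prof ε q S Ap Am m) (x : ℝ) : 0 ≤ Am x := by
  by_contra hlt
  have h1 : ∀ᶠ t in 𝓝 x, Am t < 0 := h.am_cont.continuousAt.eventually_lt_const (not_le.1 hlt)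
  obtain ⟨δ, hδ, h2⟩ := Metric.eventually_nhds_iff.1 h1
  obtain ⟨z, hz, hz1, hz2⟩ := h.exists_mem (show x < x + δ by linarith)
  have h3 := h2 (y := z) (by rw [Real.dist_eq, abs_lt]; constructor <;> linarith)
  rw [h.am z hz] at h3
  nlinarith

lemma ap_nonneg (h : Prof ε q S Ap Am m) (x : ℝ) : 0 ≤ Ap x := by
  simpa using h.reflect.am_nonneg (-x)

/-- Where both characteristic forms have a constant sign and do not vanish, the profile is
constant. -/
lemma const_of_signs (h : Prof ε q S Ap Am m) {c d σ τ : ℝ} (hσ : σ ^ 2 = 1) (hτ : τ ^ 2 = 1)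
    (hne : ∀ x ∈ Ioo c d, 1 - ε ^ 2 * x ^ 2 ≠ 0)
    (hp : ∀ x ∈ Ioo c d, 0 < Ap x) (hm : ∀ x ∈ Ioo c d, 0 < Am x)
    (hsp : ∀ x ∈ S, c < x → x < d → 0 ≤ σ * sp ε x (q x))
    (hsm : ∀ x ∈ S, c < x → x < d → 0 ≤ τ * sm ε x (q x)) :
    ∀ x ∈ S, ∀ y ∈ S, c < x → x < d → c < y → y < d → q x = q y := by
  have esp : ∀ x ∈ S, c < x → x < d → sp ε x (q x) = σ * √(Ap x) := by
    intro x hx h1 h2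
    have e : √(Ap x) = σ * sp ε x (q x) := by
      rw [h.ap x hx, show sp ε x (q x) ^ 2 = (σ * sp ε x (q x)) ^ 2 by rw [mul_pow, hσ, one_mul],
        Real.sqrt_sq (hsp x hx h1 h2)]
    rw [e]; linear_combination (-sp ε x (q x)) * hσ
  have esm : ∀ x ∈ S, c < x → x < d → sm ε x (q x) = τ * √(Am x) := by
    intro x hx h1 h2
    have e : √(Am x) = τ * sm ε x (q x) := by
      rw [h.am x hx, show sm ε x (q x) ^ 2 = (τ * sm ε x (q x)) ^ 2 by rw [mul_pow, hτ, one_mul],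
        Real.sqrt_sq (hsm x hx h1 h2)]
    rw [e]; linear_combination (-sm ε x (q x)) * hτ
  set P : ℝ → ℝ := fun x => σ * √(Ap x) with hP
  set N : ℝ → ℝ := fun x => τ * √(Am x) with hN
  set A : ℝ → ℝ := fun x =>
    ((1 + ε ^ 2 * x) * P x + (1 - ε ^ 2 * x) * N x) / (2 * (1 - ε ^ 2 * x ^ 2)) with hA
  set B : ℝ → ℝ := fun x =>
    ((1 + x) * P x - (1 - x) * N x) / (2 * (1 - ε ^ 2 * x ^ 2)) with hB
  have eq1 : ∀ x ∈ S, c < x → x < d → (q x).1 = A x := fun x hx h1 h2 => by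
    rw [fst_eq (hne x ⟨h1, h2⟩) (q x), esp x hx h1 h2, esm x hx h1 h2]
  have eq2 : ∀ x ∈ S, c < x → x < d → (q x).2 = B x := fun x hx h1 h2 => by
    rw [snd_eq (hne x ⟨h1, h2⟩) (q x), esp x hx h1 h2, esm x hx h1 h2]
  have hPc : Continuous P := (h.ap_cont.sqrt).const_mul σ
  have hNc : Continuous N := (h.am_cont.sqrt).const_mul τ
  have hAc : ContinuousOn A (Ioo c d) := by
    refine ContinuousOn.div (by fun_prop) (by fun_prop) fun x hx => ?_
    exact mul_ne_zero two_ne_zero (hne x hx)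
  have hBc : ContinuousOn B (Ioo c d) := by
    refine ContinuousOn.div (by fun_prop) (by fun_prop) fun x hx => ?_
    exact mul_ne_zero two_ne_zero (hne x hx)
  have dAp : ∀ x ∈ Ioo c d, HasDerivAt Ap (-2 * P x * (A x + ε ^ 2 * B x)) x := by
    intro x hx
    refine hasDerivAt_of_integral (g := fun x => -2 * P x * (A x + ε ^ 2 * B x)) h.ae h.ap_int
      (by fun_prop) (fun t ht h1 h2 => ?_) hx
    rw [esp t ht h1 h2, eq1 t ht h1 h2, eq2 t ht h1 h2]
  have dAm : ∀ x ∈ Ioo c d, HasDerivAt Am (2 * N x * (A x - ε ^ 2 * B x)) x := by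
    intro x hx
    refine hasDerivAt_of_integral (g := fun x => 2 * N x * (A x - ε ^ 2 * B x)) h.ae h.am_int
      (by fun_prop) (fun t ht h1 h2 => ?_) hx
    rw [esm t ht h1 h2, eq1 t ht h1 h2, eq2 t ht h1 h2]
  -- The square roots carry the fixed signs σ and τ. Their equations P' = -(A+ε²B), N' = A-ε²B are
  -- those satisfied by the two forms of a constant state, so A and B recovered from P and N have
  -- derivative zero.
  have dP : ∀ x ∈ Ioo c d, HasDerivAt P (-(A x + ε ^ 2 * B x)) x := by
    intro x hx
    refine (((dAp x hx).sqrt (hp x hx).ne').const_mul σ).congr_deriv ?_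
    have := (Real.sqrt_pos.2 (hp x hx)).ne'
    simp only [hP]; field_simp
    linear_combination (-(A x + ε ^ 2 * B x)) * hσ
  have dN : ∀ x ∈ Ioo c d, HasDerivAt N (A x - ε ^ 2 * B x) x := by
    intro x hx
    refine (((dAm x hx).sqrt (hm x hx).ne').const_mul τ).congr_deriv ?_
    have := (Real.sqrt_pos.2 (hm x hx)).ne'
    simp only [hN]; field_simp
    linear_combination (A x - ε ^ 2 * B x) * hτ
  have dden : ∀ x, HasDerivAt (fun x : ℝ => 2 * (1 - ε ^ 2 * x ^ 2)) (-(4 * ε ^ 2 * x)) x :=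
    fun x => ((hasDerivAt_lum ε x).const_mul 2).congr_deriv (by ring)
  have dA : ∀ x ∈ Ioo c d, HasDerivAt A 0 x := by
    intro x hx
    have h1 := ((((hasDerivAt_id' x).const_mul (ε ^ 2)).const_add 1).mul (dP x hx)).add
      ((((hasDerivAt_id' x).const_mul (ε ^ 2)).const_sub 1).mul (dN x hx))
    refine (h1.div (dden x) (mul_ne_zero two_ne_zero (hne x hx))).congr_deriv ?_
    have h0 := hne x hx
    simp only [hA, hB, Pi.add_apply, Pi.mul_apply]
    generalize hd : 1 - ε ^ 2 * x ^ 2 = D at *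
    field_simp; rw [← hd]; ring
  have dB : ∀ x ∈ Ioo c d, HasDerivAt B 0 x := by
    intro x hx
    have h1 := (((hasDerivAt_id' x).const_add 1).mul (dP x hx)).sub
      (((hasDerivAt_id' x).const_sub 1).mul (dN x hx))
    refine (h1.div (dden x) (mul_ne_zero two_ne_zero (hne x hx))).congr_deriv ?_
    have h0 := hne x hx
    simp only [hA, hB, Pi.sub_apply, Pi.mul_apply]
    generalize hd : 1 - ε ^ 2 * x ^ 2 = D at *
    field_simp; rw [← hd]; ring
  have key : ∀ f : ℝ → ℝ, (∀ x ∈ Ioo c d, HasDerivAt f 0 x) → ∀ x ∈ Ioo c d, ∀ y ∈ Ioo c d,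
      f x = f y := by
    intro f hf x hx y hy
    exact isOpen_Ioo.is_const_of_deriv_eq_zero isPreconnected_Ioo
      (fun z hz => (hf z hz).differentiableAt.differentiableWithinAt)
      (fun z hz => (hf z hz).deriv) hx hy
  intro x hx y hy h1 h2 h3 h4
  ext
  · rw [eq1 x hx h1 h2, eq1 y hy h3 h4]; exact key A dA x ⟨h1, h2⟩ y ⟨h3, h4⟩
  · rw [eq2 x hx h1 h2, eq2 y hy h3 h4]; exact key B dB x ⟨h1, h2⟩ y ⟨h3, h4⟩

end Prof

/-! ### The entropy condition -/

lemma mu_pos {ε : ℝ} (hε : 0 < ε) (hε1 : ε < 1) : 0 < mu ε := by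
  unfold mu
  have : ε ^ 2 < 1 := by nlinarith
  exact div_pos (by linarith) (by positivity)

/-- Here t < 1 is the relative velocity behind an admissible 1-shock and 1/t the one ahead of it;
the inequality compares the particle flux relative to the shock for the two states. The value t = ε
is the limit in which the supersonic state reaches the boundary of the cone. -/
lemma entropy_strict {ε t : ℝ} (hε : 0 < ε) (hε1 : ε < 1) (h1 : ε ≤ t) (h2 : t < 1) :
    (t ^ 2 - ε ^ 2) ^ mu ε < (1 - ε ^ 2 * t ^ 2) ^ mu ε * t := by
  have hmu := mu_pos hε hε1
  have ht0 : 0 < t := hε.trans_le h1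
  have hε2 : ε ^ 2 < 1 := by nlinarith
  have ht2 : t ^ 2 < 1 := by nlinarith
  have hd : 0 < 1 - ε ^ 2 * t ^ 2 := by nlinarith [sq_nonneg ε]
  rcases h1.eq_or_lt with rfl | h1
  · rw [sub_self, Real.zero_rpow hmu.ne']
    exact mul_pos (Real.rpow_pos_of_pos hd _) ht0
  have hn : 0 < t ^ 2 - ε ^ 2 := by nlinarith
  -- f is the logarithm of the quotient of the two sides. It vanishes at s = 1 and has derivative
  -- -ε²(1-s²)²/(s(1-ε²s²)(s²-ε²)), so it is positive before 1.
  set f : ℝ → ℝ := fun s =>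
    mu ε * Real.log (1 - ε ^ 2 * s ^ 2) + Real.log s - mu ε * Real.log (s ^ 2 - ε ^ 2) with hf
  have hpos : ∀ s ∈ Icc t 1, 0 < 1 - ε ^ 2 * s ^ 2 ∧ 0 < s ^ 2 - ε ^ 2 ∧ 0 < s := by
    intro s hs
    have hs0 : 0 < s := ht0.trans_le hs.1
    have a1 : s ^ 2 ≤ 1 := by nlinarith [hs.2]
    have a2 : t ^ 2 ≤ s ^ 2 := by nlinarith [hs.1]
    refine ⟨by nlinarith [sq_nonneg ε], by linarith, hs0⟩
  have hder : ∀ s ∈ Icc t 1, HasDerivAt f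
      (mu ε * (-(2 * ε ^ 2 * s) / (1 - ε ^ 2 * s ^ 2)) + 1 / s -
        mu ε * (2 * s / (s ^ 2 - ε ^ 2))) s := by
    intro s hs
    obtain ⟨a1, a2, a3⟩ := hpos s hs
    have e1 := ((hasDerivAt_lum ε s).log a1.ne').const_mul (mu ε)
    have e2 := (((hasDerivAt_pow 2 s).sub_const (ε ^ 2)).log a2.ne').const_mul (mu ε)
    refine ((e1.add ((hasDerivAt_id' s).log a3.ne')).sub e2).congr_deriv ?_
    norm_num
  have hanti : StrictAntiOn f (Icc t 1) := by
    refine strictAntiOn_of_deriv_neg (convex_Icc t 1)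
      (fun s hs => (hder s hs).continuousAt.continuousWithinAt) fun s hs => ?_
    rw [interior_Icc] at hs
    have hs' : s ∈ Icc t 1 := ⟨hs.1.le, hs.2.le⟩
    obtain ⟨a1, a2, a3⟩ := hpos s hs'
    rw [(hder s hs').deriv]
    have e : mu ε * (-(2 * ε ^ 2 * s) / (1 - ε ^ 2 * s ^ 2)) + 1 / s -
        mu ε * (2 * s / (s ^ 2 - ε ^ 2)) =
        -(ε ^ 2 * (1 - s ^ 2) ^ 2) / (s * (1 - ε ^ 2 * s ^ 2) * (s ^ 2 - ε ^ 2)) := by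
      have : 1 + ε ^ 2 ≠ 0 := by positivity
      have b1 := a1.ne'
      have b2 := a2.ne'
      unfold mu
      generalize hD : 1 - ε ^ 2 * s ^ 2 = D at *
      generalize hE : s ^ 2 - ε ^ 2 = E at *
      field_simp; rw [← hD, ← hE]; ring
    rw [e]
    have hs1 : 0 < 1 - s ^ 2 := by nlinarith [hs.2]
    apply div_neg_of_neg_of_pos
    · have : 0 < ε ^ 2 * (1 - s ^ 2) ^ 2 := by positivity
      linarith
    · positivity
  have h3 := hanti (left_mem_Icc.2 h2.le) (right_mem_Icc.2 h2.le) h2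
  have h4 : f 1 = 0 := by simp [hf]
  rw [h4] at h3
  have h5 : Real.log ((t ^ 2 - ε ^ 2) ^ mu ε) < Real.log ((1 - ε ^ 2 * t ^ 2) ^ mu ε * t) := by
    rw [Real.log_mul (Real.rpow_pos_of_pos hd _).ne' ht0.ne', Real.log_rpow hn, Real.log_rpow hd]
    simp only [hf] at h3
    linarith
  exact (Real.log_lt_log_iff (Real.rpow_pos_of_pos hn _)
    (mul_pos (Real.rpow_pos_of_pos hd _) ht0)).1 h5

lemma nonneg_of_dom {ε P s : ℝ} (hε : 0 < ε) (hε1 : ε < 1) (hs : 0 < s) (h : s ^ 2 < P ^ 2)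
    (hd : (1 + ε) * -P < (1 - ε) * s) : 0 ≤ P := by
  by_contra hcon
  have g1 : s < -P := by nlinarith
  nlinarith

lemma nonneg_of_dom' {ε P s : ℝ} (hε : 0 < ε) (hε1 : ε < 1) (hs : s ≤ 0)
    (hd : (1 + ε) * -s < (1 - ε) * P) : 0 ≤ P := by
  by_contra hcon
  nlinarith

/-- Self-similar density of the particle number in characteristic coordinates. -/
def enChar (ε x P s : ℝ) : ℝ :=
  (P - s) / 2 * (((P + s) ^ 2 - ε ^ 2 * (P - s) ^ 2) / (4 * (1 - ε ^ 2 * x ^ 2))) ^ mu ε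

lemma en_eq {ε x : ℝ} (h : 1 - ε ^ 2 * x ^ 2 ≠ 0) (q : ℝ × ℝ) :
    en ε x q = enChar ε x (sp ε x q) (sm ε x q) := by
  rw [en, enChar, ← rho_char, mul_div_cancel_left₀ _ (by positivity)]
  congr 1; simp only [sp, sm]; ring

/-- Reversing the sign of sm replaces the relative velocity t by 1/t, so this is `entropy_strict`
after scaling. The hypothesis on P says that the reversed state stays in the closed cone. -/
lemma enChar_lt {ε x P s : ℝ} (hε : 0 < ε) (hε1 : ε < 1) (h : 0 < 1 - ε ^ 2 * x ^ 2) (hs : 0 < s)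
    (hP : (1 + ε) * s ≤ (1 - ε) * P) : enChar ε x P (-s) < enChar ε x P s := by
  have hPs : 0 < P - s := by nlinarith
  have hsum : 0 < P + s := by linarith
  set t := (P - s) / (P + s) with ht
  have hPt : P - s = t * (P + s) := by rw [ht]; field_simp
  have h1 : ε ≤ t := by rw [ht, le_div_iff₀ hsum]; linarith
  have h2 : t < 1 := by rw [ht, div_lt_one hsum]; linarith
  have ht0 : 0 < t := hε.trans_le h1
  have hε2 : ε ^ 2 < 1 := by nlinarith
  have b1 : 0 ≤ t ^ 2 - ε ^ 2 := by nlinarith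
  have b2 : 0 ≤ 1 - ε ^ 2 * t ^ 2 := by nlinarith [sq_nonneg ε, sq_nonneg t]
  set c := (P + s) ^ 2 / (4 * (1 - ε ^ 2 * x ^ 2)) with hc
  have c0 : 0 < c := by positivity
  have e1 : ((P + -s) ^ 2 - ε ^ 2 * (P - -s) ^ 2) / (4 * (1 - ε ^ 2 * x ^ 2)) =
      c * (t ^ 2 - ε ^ 2) := by
    rw [sub_neg_eq_add, ← sub_eq_add_neg, hPt, hc]; ring
  have e2 : ((P + s) ^ 2 - ε ^ 2 * (P - s) ^ 2) / (4 * (1 - ε ^ 2 * x ^ 2)) =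
      c * (1 - ε ^ 2 * t ^ 2) := by
    rw [hPt, hc]; ring
  rw [enChar, enChar, e1, e2, Real.mul_rpow c0.le b1, Real.mul_rpow c0.le b2, sub_neg_eq_add, hPt]
  have h3 := entropy_strict hε hε1 h1 h2
  have h4 : 0 < (P + s) / 2 * c ^ mu ε := mul_pos (by linarith) (Real.rpow_pos_of_pos c0 _)
  have h5 := mul_lt_mul_of_pos_left h3 h4
  nlinarith [h5]

namespace Prof

variable {ε : ℝ} {q : ℝ → ℝ × ℝ} {S : Set ℝ} {Ap Am m : ℝ → ℝ}

lemma cone_of_sm_ne (h : Prof ε q S Ap Am m) {x : ℝ} (hx : sm ε x (q x) ≠ 0) : q x ∈ cone ε := by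
  rcases h.cases x with h0 | h0
  · rw [h0, sm_vac] at hx; exact absurd rfl hx
  · exact h0

lemma cone_of_sp_ne (h : Prof ε q S Ap Am m) {x : ℝ} (hx : sp ε x (q x) ≠ 0) : q x ∈ cone ε := by
  rcases h.cases x with h0 | h0
  · rw [h0, sp_vac] at hx; exact absurd rfl hx
  · exact h0

lemma c_nonneg (h : Prof ε q S Ap Am m) (hε : 0 < ε) (hε1 : ε ≤ 1) (x : ℝ) :
    0 ≤ (q x).1 + ε ^ 2 * (q x).2 ∧ 0 ≤ (q x).1 - ε ^ 2 * (q x).2 := by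
  rcases h.cases x with h0 | h0
  · simp [h0]
  · exact ⟨(cone_c_pos hε hε1 h0).1.le, (cone_c_pos hε hε1 h0).2.le⟩

lemma am_mono (h : Prof ε q S Ap Am m) (hε : 0 < ε) (hε1 : ε ≤ 1) {x y : ℝ} (hxy : x ≤ y)
    (hs : ∀ t ∈ S, x < t → t < y → 0 ≤ sm ε t (q t)) : Am x ≤ Am y :=
  le_of_integral_nonneg h.ae h.am_int hxy fun t ht h1 h2 =>
    mul_nonneg (mul_nonneg two_pos.le (hs t ht h1 h2)) (h.c_nonneg hε hε1 t).2

lemma am_anti (h : Prof ε q S Ap Am m) (hε : 0 < ε) (hε1 : ε ≤ 1) {x y : ℝ} (hxy : x ≤ y)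
    (hs : ∀ t ∈ S, x < t → t < y → sm ε t (q t) ≤ 0) : Am y ≤ Am x := by
  have := le_of_integral_nonneg (X := fun t => -Am t)
    (f := fun t => -(2 * sm ε t (q t) * ((q t).1 - ε ^ 2 * (q t).2))) h.ae
    (fun x y => by rw [intervalIntegral.integral_neg, ← h.am_int]; ring) hxy
    fun t ht h1 h2 => by
      have e1 := hs t ht h1 h2
      have e2 := (h.c_nonneg hε hε1 t).2
      nlinarith
  simpa using this

set_option maxHeartbeats 400000 in
/-- Entropy solutions cannot jump from positive to negative values of the `1`-form. -/
lemma sm_local (h : Prof ε q S Ap Am m) (hε : 0 < ε) (hε1 : ε < 1) {x₀ : ℝ}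
    (h1 : -(1 / ε) < x₀) (h2 : x₀ < 1 / ε) (hA : 0 < Am x₀) :
    ∃ δ > 0, ∀ x ∈ S, ∀ y ∈ S, |x - x₀| < δ → |y - x₀| < δ → x < y →
      0 < sm ε x (q x) → 0 < sm ε y (q y) := by
  obtain ⟨d0, -, -⟩ := one_sub_pos hε h1 h2
  have hnear : ∀ᶠ y in 𝓝 x₀, -(1 / ε) < y ∧ y < 1 / ε ∧ 0 < Am y :=
    (eventually_gt_nhds h1).and ((eventually_lt_nhds h2).and
      (h.am_cont.continuousAt.eventually_const_lt hA))
  -- In the first case a state with negative sm and these squares would lie outside the cone. In the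
  -- second case such a state may exist, and the entropy inequality has to exclude the jump.
  rcases lt_or_ge ((1 - ε) ^ 2 * Ap x₀) ((1 + ε) ^ 2 * Am x₀) with hc | hc
  · have h3 : ∀ᶠ y in 𝓝 x₀, (1 - ε) ^ 2 * Ap y < (1 + ε) ^ 2 * Am y :=
      (h.ap_cont.const_mul _).continuousAt.eventually_lt (h.am_cont.const_mul _).continuousAt hc
    obtain ⟨δ, hδ, h4⟩ := Metric.eventually_nhds_iff.1 (hnear.and h3)
    refine ⟨δ, hδ, fun x _ y hy _ hyd _ _ => ?_⟩
    obtain ⟨⟨g1, g2, g3⟩, g4⟩ := h4 (y := y) hyd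
    by_contra hneg
    have hne : sm ε y (q y) ≠ 0 := by
      intro h0; rw [h.am y hy, h0] at g3; norm_num at g3
    have g5 := sp_dom hε g1 g2 (h.cone_of_sm_ne hne)
    rw [h.am y hy, h.ap y hy] at g4
    have g6 : 0 ≤ (1 + ε) * -sm ε y (q y) := mul_nonneg (by linarith) (by linarith)
    nlinarith
  · set s := √(Am x₀) with hs
    set P := √(Ap x₀) with hP
    have hs0 : 0 < s := Real.sqrt_pos.2 hA
    have hs2 : s ^ 2 = Am x₀ := Real.sq_sqrt hA.le
    have hP2 : P ^ 2 = Ap x₀ := Real.sq_sqrt (h.ap_nonneg x₀)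
    have hP0 : 0 ≤ P := Real.sqrt_nonneg _
    have hPs : (1 + ε) * s ≤ (1 - ε) * P := by
      apply le_of_sq_le_sq _ (mul_nonneg (by linarith) hP0)
      rw [mul_pow, mul_pow, hs2, hP2]; exact hc
    have hlt := enChar_lt hε hε1 d0 hs0 hPs
    have hAA : Am x₀ < Ap x₀ := by
      rw [← hs2, ← hP2]; nlinarith
    have h3 : ∀ᶠ y in 𝓝 x₀, Am y < Ap y :=
      h.am_cont.continuousAt.eventually_lt h.ap_cont.continuousAt hAA
    have hcont : ∀ σ : ℝ, ContinuousAt (fun x => enChar ε x (√(Ap x)) (σ * √(Am x))) x₀ := by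
      intro σ
      have c1 := h.ap_cont
      have c2 := h.am_cont
      unfold enChar
      refine ContinuousAt.mul (by fun_prop) (ContinuousAt.rpow_const ?_ (Or.inr (mu_pos hε hε1).le))
      exact ContinuousAt.div (by fun_prop) (by fun_prop) (by positivity)
    set η := (enChar ε x₀ P s - enChar ε x₀ P (-s)) / 4 with hη
    have hη0 : 0 < η := by rw [hη]; linarith
    have h4 : ∀ᶠ y in 𝓝 x₀, enChar ε y (√(Ap y)) (-1 * √(Am y)) < enChar ε x₀ P (-s) + η :=
      (hcont (-1)).eventually_lt_const (by simp only [neg_one_mul]; rw [← hs, ← hP]; linarith)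
    have h5 : ∀ᶠ y in 𝓝 x₀, enChar ε x₀ P s - η < enChar ε y (√(Ap y)) (1 * √(Am y)) :=
      (hcont 1).eventually_const_lt (by simp only [one_mul]; rw [← hs, ← hP]; linarith)
    obtain ⟨C, hC⟩ := h.ent
    obtain ⟨δ, hδ, h6⟩ := Metric.eventually_nhds_iff.1 ((hnear.and h3).and (h4.and h5))
    -- The entropy flux would drop by more than 4η - 2η over a distance less than η/(|C|+1), whereas
    -- the entropy condition allows a drop below η.
    refine ⟨min δ (η / (2 * (|C| + 1))), by positivity, fun x hx y hy hxd hyd hxy hpos => ?_⟩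
    obtain ⟨⟨⟨x1, x2, x3⟩, x4⟩, -, x6⟩ := h6 (y := x) (hxd.trans_le (min_le_left _ _))
    obtain ⟨⟨⟨y1, y2, y3⟩, y4⟩, y5, -⟩ := h6 (y := y) (hyd.trans_le (min_le_left _ _))
    by_contra hneg
    rw [not_lt] at hneg
    have hne : sm ε y (q y) ≠ 0 := by
      intro h0; rw [h.am y hy, h0] at y3; norm_num at y3
    have spy : 0 ≤ sp ε y (q y) := by
      exact nonneg_of_dom' hε hε1 hneg (sp_dom hε y1 y2 (h.cone_of_sm_ne hne))
    have spx : 0 ≤ sp ε x (q x) := by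
      rw [h.am x hx, h.ap x hx] at x4
      exact nonneg_of_dom hε hε1 hpos x4 (sm_dom hε x1 x2 (h.cone_of_sm_ne hpos.ne'))
    have ex : enChar ε x (√(Ap x)) (1 * √(Am x)) = en ε x (q x) := by
      rw [en_eq (one_sub_pos hε x1 x2).1.ne', h.ap x hx, h.am x hx, Real.sqrt_sq spx,
        Real.sqrt_sq hpos.le, one_mul]
    have ey : enChar ε y (√(Ap y)) (-1 * √(Am y)) = en ε y (q y) := by
      rw [en_eq (one_sub_pos hε y1 y2).1.ne', h.ap y hy, h.am y hy, Real.sqrt_sq spy,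
        Real.sqrt_sq_eq_abs, abs_of_nonpos hneg, neg_one_mul, neg_neg]
    rw [ex] at x6
    rw [ey] at y5
    have hent := hC x hx y hy hxy
    have hxd' := hxd.trans_le (min_le_right _ _)
    have hyd' := hyd.trans_le (min_le_right _ _)
    rw [abs_lt] at hxd' hyd'
    have hyx : y - x < η / (|C| + 1) := by
      have : η / (|C| + 1) = 2 * (η / (2 * (|C| + 1))) := by field_simp
      linarith
    rw [lt_div_iff₀ (by positivity)] at hyx
    have hCC : C * (y - x) ≤ |C| * (y - x) :=
      mul_le_mul_of_nonneg_right (le_abs_self C) (by linarith)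
    linarith

/-- While sm stays positive, sm² cannot decrease (`am_mono`), so `sm_local` applies at every later
point. -/
lemma sm_persist (h : Prof ε q S Ap Am m) (hε : 0 < ε) (hε1 : ε < 1) {x y : ℝ}
    (hx : x ∈ S) (h1 : -(1 / ε) < x) (h2 : y < 1 / ε) (hpos : 0 < sm ε x (q x)) (hy : y ∈ S)
    (hxy : x ≤ y) : 0 < sm ε y (q y) := by
  have step : ∀ z, x ≤ z → z ≤ y → (∀ w ∈ S, x ≤ w → w < z → 0 < sm ε w (q w)) →
      ∃ δ > 0, ∀ w ∈ S, x ≤ w → w < z + δ → 0 < sm ε w (q w) := by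
    intro z hxz hzy hz
    have hAx : 0 < Am x := by rw [h.am x hx]; positivity
    have hAz : 0 < Am z := hAx.trans_le (h.am_mono hε hε1.le hxz
      fun t ht a1 a2 => (hz t ht a1.le a2).le)
    obtain ⟨δ, hδ, hloc⟩ := h.sm_local hε hε1 (h1.trans_le hxz) (hzy.trans_lt h2) hAz
    refine ⟨δ, hδ, fun w hw hxw hwz => ?_⟩
    rcases lt_or_ge w z with hlt | hge
    · exact hz w hw hxw hlt
    · rcases hxz.eq_or_lt with rfl | hxz
      · rcases hxw.eq_or_lt with rfl | hxw
        · exact hpos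
        · exact hloc x hx w hw (by simpa using hδ) (by rw [abs_lt]; constructor <;> linarith)
            hxw hpos
      · obtain ⟨u, hu, hu1, hu2⟩ := h.exists_mem (show max x (z - δ) < z from
          max_lt hxz (by linarith))
        have hxu := (le_max_left _ _).trans_lt hu1
        have hzu := (le_max_right _ _).trans_lt hu1
        exact hloc u hu w hw (by rw [abs_lt]; constructor <;> linarith)
          (by rw [abs_lt]; constructor <;> linarith) (by linarith) (hz u hu hxu.le hu2)
  -- Continuous induction: the set of z up to which sm is positive is closed and, by `step`, is
  -- extended to the right at each of its points.
  have hall : Icc x y ⊆ {z | ∀ w ∈ S, x ≤ w → w < z → 0 < sm ε w (q w)} := by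
    refine IsClosed.Icc_subset_of_forall_exists_gt ?_ (fun w hw a1 a2 => absurd a1 (not_le.2 a2)) ?_
    · refine IsClosed.inter ?_ isClosed_Icc
      rw [← isOpen_compl_iff, isOpen_iff_mem_nhds]
      intro z hz
      simp only [mem_compl_iff, mem_ofPred_eq, not_forall] at hz
      obtain ⟨w, hw, a1, a2, a3⟩ := hz
      filter_upwards [eventually_gt_nhds a2] with z' hz' hcon
      exact a3 (hcon w hw a1 hz')
    · rintro z ⟨hz, hz1, hz2⟩ t ht
      obtain ⟨δ, hδ, h3⟩ := step z hz1 hz2.le hz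
      refine ⟨min t (z + δ), fun w hw a1 a2 => h3 w hw a1 (a2.trans_le (min_le_right _ _)), ?_,
        min_le_left _ _⟩
      exact lt_min ht (by linarith)
  obtain ⟨δ, hδ, h3⟩ := step y hxy le_rfl (hall ⟨hxy, le_rfl⟩)
  exact h3 y hy hxy (by linarith)

/-- The `1`-form changes its sign once. -/
lemma exists_split (h : Prof ε q S Ap Am m) (hε : 0 < ε) (hε1 : ε < 1) :
    ∃ α, -(1 / ε) ≤ α ∧ α ≤ 1 / ε ∧
      (∀ x ∈ S, -(1 / ε) < x → x < α → sm ε x (q x) ≤ 0) ∧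
      (∀ x ∈ S, α < x → x < 1 / ε → 0 < sm ε x (q x)) := by
  have h0 : 0 < 1 / ε := by positivity
  set T : Set ℝ := {x | x ∈ S ∧ -(1 / ε) < x ∧ x < 1 / ε ∧ 0 < sm ε x (q x)} with hT
  rcases T.eq_empty_or_nonempty with hE | hE
  · refine ⟨1 / ε, by linarith, le_rfl, fun x hx a1 a2 => ?_, fun x hx a1 a2 => by linarith⟩
    by_contra hcon
    have : x ∈ T := ⟨hx, a1, a2, not_le.1 hcon⟩
    rw [hE] at this; exact this
  · have hb : BddBelow T := ⟨-(1 / ε), fun x hx => hx.2.1.le⟩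
    refine ⟨sInf T, le_csInf hE fun x hx => hx.2.1.le, ?_, fun x hx a1 a2 => ?_,
      fun x hx a1 a2 => ?_⟩
    · obtain ⟨x, hx⟩ := hE
      exact (csInf_le hb hx).trans hx.2.2.1.le
    · by_contra hcon
      obtain ⟨y, hy⟩ := hE
      have : x ∈ T := ⟨hx, a1, a2.trans_le ((csInf_le hb hy).trans hy.2.2.1.le), not_le.1 hcon⟩
      linarith [csInf_le hb this]
    · obtain ⟨y, hy, hyx⟩ := exists_lt_of_csInf_lt hE a1
      exact h.sm_persist hε hε1 hy.1 hy.2.1 a2 hy.2.2.2 hx hyx.le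

end Prof

/-! ### Rarefaction curves -/

/-- The first wave speed in square-root coordinates. -/
def lam1A (ε : ℝ) (q : ℝ × ℝ) : ℝ := (q.2 - q.1) / (q.1 - ε ^ 2 * q.2)

/-- As a-ε²b > 0, the sign of sm tells whether the slope is below or above the first wave speed of
the state. -/
lemma sm_eq {ε x : ℝ} (hε : 0 < ε) (hε1 : ε ≤ 1) {q : ℝ × ℝ} (h : q ∈ cone ε) :
    sm ε x q = (q.1 - ε ^ 2 * q.2) * (x - lam1A ε q) := by
  have := (cone_c_pos hε hε1 h).2.ne'
  rw [lam1A, mul_sub, mul_div_cancel₀ _ this, sm]; ring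

lemma lam1A_bounds {ε : ℝ} (hε : 0 < ε) (hε1 : ε < 1) {q : ℝ × ℝ} (h : q ∈ cone ε) :
    -(1 / ε) < lam1A ε q ∧ lam1A ε q < 1 / ε := by
  have h0 := (cone_c_pos hε hε1.le h).2
  obtain ⟨h1, h2⟩ := (cone_iff hε).1 h
  constructor
  · rw [lam1A, lt_div_iff₀ h0, ← sub_pos]
    have : q.2 - q.1 - -(1 / ε) * (q.1 - ε ^ 2 * q.2) = (1 - ε) * (q.1 + ε * q.2) / ε := by
      field_simp; ring
    rw [this]
    exact div_pos (mul_pos (by linarith) (by linarith)) hε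
  · rw [lam1A, div_lt_iff₀ h0, ← sub_pos]
    have : 1 / ε * (q.1 - ε ^ 2 * q.2) - (q.2 - q.1) = (1 + ε) * (q.1 - ε * q.2) / ε := by
      field_simp; ring
    rw [this]
    exact div_pos (mul_pos (by linarith) (by linarith)) hε

/-- The `2`-form along a centered `1`-rarefaction, up to a constant factor. -/
def fanP (ε x : ℝ) : ℝ :=
  (1 - ε * x) ^ ((1 + ε) ^ 2 / (4 * ε)) * (1 + ε * x) ^ (-((1 - ε) ^ 2 / (4 * ε)))

/-- The centered `1`-rarefaction for which the `2`-form equals `s * fanP ε x`. -/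
def fanQ (ε s x : ℝ) : ℝ × ℝ :=
  (s * fanP ε x / (2 * (1 - ε ^ 2 * x ^ 2)) * (1 + ε ^ 2 * x),
    s * fanP ε x / (2 * (1 - ε ^ 2 * x ^ 2)) * (1 + x))

/-- The left state followed by its centered `1`-rarefaction. -/
def curve1 (ε : ℝ) (l : ℝ × ℝ) (x : ℝ) : ℝ × ℝ :=
  if x < lam1A ε l then l else fanQ ε (sp ε (lam1A ε l) l / fanP ε (lam1A ε l)) x

lemma fanP_pos {ε x : ℝ} (hε : 0 < ε) (h1 : -(1 / ε) < x) (h2 : x < 1 / ε) : 0 < fanP ε x := by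
  obtain ⟨-, d1, d2⟩ := one_sub_pos hε h1 h2
  exact mul_pos (Real.rpow_pos_of_pos d2 _) (Real.rpow_pos_of_pos d1 _)

lemma hasDerivAt_fanP {ε x : ℝ} (hε : 0 < ε) (h1 : -(1 / ε) < x) (h2 : x < 1 / ε) :
    HasDerivAt (fanP ε)
      (-(fanP ε x * (1 + ε ^ 2 + 2 * ε ^ 2 * x) / (2 * (1 - ε ^ 2 * x ^ 2)))) x := by
  obtain ⟨d0, d1, d2⟩ := one_sub_pos hε h1 h2
  have e1 := (((hasDerivAt_id' x).const_mul ε).const_sub 1).rpow_const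
    (p := (1 + ε) ^ 2 / (4 * ε)) (Or.inl d2.ne')
  have e2 := (((hasDerivAt_id' x).const_mul ε).const_add 1).rpow_const
    (p := -((1 - ε) ^ 2 / (4 * ε))) (Or.inl d1.ne')
  refine (e1.mul e2).congr_deriv ?_
  rw [Real.rpow_sub_one d2.ne', Real.rpow_sub_one d1.ne', fanP]
  have : 1 - ε ^ 2 * x ^ 2 = (1 - ε * x) * (1 + ε * x) := by ring
  rw [this]
  have n1 := d1.ne'
  have n2 := d2.ne'
  generalize (1 - ε * x) ^ ((1 + ε) ^ 2 / (4 * ε)) = A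
  generalize (1 + ε * x) ^ (-((1 - ε) ^ 2 / (4 * ε))) = B
  field_simp; ring

lemma sp_fanQ {ε s x : ℝ} (h : 1 - ε ^ 2 * x ^ 2 ≠ 0) : sp ε x (fanQ ε s x) = s * fanP ε x := by
  simp only [sp, fanQ]
  generalize hd : 1 - ε ^ 2 * x ^ 2 = d at *
  field_simp; rw [← hd]; ring

lemma sm_fanQ {ε s x : ℝ} : sm ε x (fanQ ε s x) = 0 := by
  simp only [sm, fanQ]; ring

lemma eq_fanQ {ε s x : ℝ} (h : 1 - ε ^ 2 * x ^ 2 ≠ 0) {q : ℝ × ℝ} (h1 : sp ε x q = s * fanP ε x)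
    (h2 : sm ε x q = 0) : q = fanQ ε s x := by
  ext
  · rw [fst_eq h q, h1, h2, fanQ]; ring
  · rw [snd_eq h q, h1, h2, fanQ]; ring

lemma sp_pos_of_sm_nonpos {ε x : ℝ} (hε : 0 < ε) (h1 : -(1 / ε) ≤ x) (h2 : x ≤ 1 / ε) {q : ℝ × ℝ}
    (h : q ∈ cone ε) (hs : sm ε x q ≤ 0) : 0 < sp ε x q := by
  have := cone_sum_pos hε h1 h2 h
  linarith

lemma fanQ_mem {ε s x : ℝ} (hε : 0 < ε) (hε1 : ε < 1) (h1 : -(1 / ε) < x) (h2 : x < 1 / ε)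
    (hs : 0 < s) : fanQ ε s x ∈ cone ε := by
  obtain ⟨d0, -, -⟩ := one_sub_pos hε h1 h2
  rw [cone_char hε h1 h2, sp_fanQ d0.ne', sm_fanQ, sub_zero, add_zero,
    abs_of_pos (mul_pos hs (fanP_pos hε h1 h2))]
  have := mul_pos hs (fanP_pos hε h1 h2)
  nlinarith

lemma sp_lam1A_pos {ε : ℝ} (hε : 0 < ε) (hε1 : ε < 1) {l : ℝ × ℝ} (hl : l ∈ cone ε) :
    0 < sp ε (lam1A ε l) l := by
  obtain ⟨b1, b2⟩ := lam1A_bounds hε hε1 hl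
  exact sp_pos_of_sm_nonpos hε b1.le b2.le hl (by rw [sm_eq hε hε1.le hl]; simp)

lemma fan_scale_pos {ε : ℝ} (hε : 0 < ε) (hε1 : ε < 1) {l : ℝ × ℝ} (hl : l ∈ cone ε) :
    0 < sp ε (lam1A ε l) l / fanP ε (lam1A ε l) := by
  obtain ⟨b1, b2⟩ := lam1A_bounds hε hε1 hl
  exact div_pos (sp_lam1A_pos hε hε1 hl) (fanP_pos hε b1 b2)

lemma curve1_mem {ε : ℝ} (hε : 0 < ε) (hε1 : ε < 1) {l : ℝ × ℝ} (hl : l ∈ cone ε) {x : ℝ}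
    (h2 : x < 1 / ε) : curve1 ε l x ∈ cone ε := by
  rw [curve1]
  split_ifs with h
  · exact hl
  · exact fanQ_mem hε hε1 ((lam1A_bounds hε hε1 hl).1.trans_le (not_lt.1 h)) h2
      (fan_scale_pos hε hε1 hl)

lemma fanQ_lam1A {ε : ℝ} (hε : 0 < ε) (hε1 : ε < 1) {l : ℝ × ℝ} (hl : l ∈ cone ε) :
    fanQ ε (sp ε (lam1A ε l) l / fanP ε (lam1A ε l)) (lam1A ε l) = l := by
  obtain ⟨b1, b2⟩ := lam1A_bounds hε hε1 hl
  refine (eq_fanQ (one_sub_pos hε b1 b2).1.ne' ?_ ?_).symm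
  · rw [div_mul_cancel₀ _ (fanP_pos hε b1 b2).ne']
  · rw [sm_eq hε hε1.le hl]; simp

lemma sp_neg_end {ε : ℝ} (hε : 0 < ε) (q : ℝ × ℝ) :
    sp ε (-(1 / ε)) q = (1 + ε) / ε * (q.1 + ε * q.2) := by
  rw [sp]; field_simp; ring

lemma sm_neg_end {ε : ℝ} (hε : 0 < ε) (q : ℝ × ℝ) :
    sm ε (-(1 / ε)) q = -((1 - ε) / ε * (q.1 + ε * q.2)) := by
  rw [sm]; field_simp; ring

/-- Signs of the characteristic forms to the left of the light cone. -/
lemma signs_left {ε x : ℝ} (hε : 0 < ε) (hε1 : ε ≤ 1) (hx : x < -(1 / ε)) {q : ℝ × ℝ}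
    (h : q ∈ cone ε) : 0 < sp ε x q ∧ sm ε x q < 0 := by
  obtain ⟨h1, h2⟩ := (cone_iff hε).1 h
  have h0 := cone_fst_pos hε h
  have hx1 : ε * x < -1 := by
    have h3 : 1 < ε * -x := by
      have := (div_lt_iff₀ hε).1 (show 1 / ε < -x by linarith)
      linarith
    linarith
  constructor
  · have e : ε * sp ε x q = (1 - ε ^ 2 * x) * (q.1 + ε * q.2) + q.1 * ((1 - ε) * (-(ε * x) - 1)) := by
      rw [sp]; ring
    have p1 : 0 < (1 - ε ^ 2 * x) * (q.1 + ε * q.2) := mul_pos (by nlinarith) (by linarith)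
    have p2 : 0 ≤ q.1 * ((1 - ε) * (-(ε * x) - 1)) :=
      mul_nonneg h0.le (mul_nonneg (by linarith) (by linarith))
    exact (mul_pos_iff_of_pos_left hε).1 (by rw [e]; linarith)
  · have : ε * -sm ε x q > 0 := by
      rcases le_or_gt 0 (1 + ε ^ 2 * x) with hc | hc
      · have e : ε * -sm ε x q =
            (1 + ε ^ 2 * x) * (q.1 + ε * q.2) + q.1 * ((1 + ε) * (-(ε * x) - 1)) := by
          rw [sm]; ring
        rw [e]
        have p1 : 0 ≤ (1 + ε ^ 2 * x) * (q.1 + ε * q.2) := mul_nonneg hc (by linarith)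
        have p2 : 0 < q.1 * ((1 + ε) * (-(ε * x) - 1)) :=
          mul_pos h0 (mul_pos (by linarith) (by linarith))
        linarith
      · have e : ε * -sm ε x q =
            -(1 + ε ^ 2 * x) * (q.1 - ε * q.2) + q.1 * ((1 - ε) * (1 - ε * x)) := by
          rw [sm]; ring
        rw [e]
        have p1 : 0 < -(1 + ε ^ 2 * x) * (q.1 - ε * q.2) := mul_pos (by linarith) (by linarith)
        have p2 : 0 ≤ q.1 * ((1 - ε) * (1 - ε * x)) :=
          mul_nonneg h0.le (mul_nonneg (by linarith) (by linarith))
        linarith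
    have := (mul_pos_iff_of_pos_left hε).1 this
    linarith

namespace Prof

variable {ε : ℝ} {q : ℝ → ℝ × ℝ} {S : Set ℝ} {Ap Am m : ℝ → ℝ}

lemma ap_anti (h : Prof ε q S Ap Am m) (hε : 0 < ε) (hε1 : ε ≤ 1) {x y : ℝ} (hxy : x ≤ y)
    (hs : ∀ t ∈ S, x < t → t < y → 0 ≤ sp ε t (q t)) : Ap y ≤ Ap x := by
  have := h.reflect.am_mono hε hε1 (neg_le_neg hxy) (fun t ht h1 h2 => by
    have e := hs (-t) ht (by linarith) (by linarith)
    simp only [sp, sm] at e ⊢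
    linarith)
  simpa using this

lemma le_of_right (h : Prof ε q S Ap Am m) {f g : ℝ → ℝ} {x d : ℝ} (hf : ContinuousAt f x)
    (hg : ContinuousAt g x) (hxd : x < d) (hfg : ∀ t ∈ S, x < t → t < d → f t ≤ g t) :
    f x ≤ g x := by
  have := h.eq_of_right (f := fun t => max (f t) (g t)) (g := g) (hf.max hg) hg hxd
    (fun t ht h1 h2 => max_eq_right (hfg t ht h1 h2))
  rw [← this]; exact le_max_left _ _

lemma vac_of_ap (h : Prof ε q S Ap Am m) (hε : 0 < ε) {x : ℝ} (hx : x ∈ S)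
    (h1 : -(1 / ε) ≤ x) (h2 : x ≤ 1 / ε) (e1 : Ap x = 0) (e2 : sm ε x (q x) ≤ 0) :
    q x = (0, 0) := by
  rcases h.cases x with h0 | h0
  · exact h0
  · have := sp_pos_of_sm_nonpos hε h1 h2 h0 e2
    rw [h.ap x hx] at e1
    nlinarith

/-- Beyond the light cone sp > 0 > sm at every nonvacuum state, so there the profile is constant as
long as Ap > 0, and a continuity argument prevents a transition between the state and the vacuum. -/
lemma outer_const (h : Prof ε q S Ap Am m) (hε : 0 < ε) (hε1 : ε ≤ 1) :
    ∀ x ∈ S, ∀ y ∈ S, x < y → y < -(1 / ε) → q x = q y := by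
  intro x hx y hy hxy hye
  have hne : ∀ t, t < -(1 / ε) → 1 - ε ^ 2 * t ^ 2 ≠ 0 := by
    intro t ht
    have h1 : 1 < ε * -t := by
      have := (div_lt_iff₀ hε).1 (show 1 / ε < -t by linarith)
      linarith
    nlinarith
  have hsp : ∀ t, t < -(1 / ε) → 0 ≤ sp ε t (q t) := by
    intro t ht
    rcases h.cases t with h0 | h0
    · rw [h0, sp_vac]
    · exact (signs_left hε hε1 ht h0).1.le
  have hsm : ∀ t, t < -(1 / ε) → sm ε t (q t) ≤ 0 := by
    intro t ht
    rcases h.cases t with h0 | h0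
    · rw [h0, sm_vac]
    · exact (signs_left hε hε1 ht h0).2.le
  have hanti : ∀ s t, s ≤ t → t < -(1 / ε) → Ap t ≤ Ap s := fun s t hst ht =>
    h.ap_anti hε hε1 hst fun u _ _ hu => hsp u (hu.trans ht)
  have hcone : ∀ t ∈ S, t < -(1 / ε) → 0 < Ap t → q t ∈ cone ε := fun t ht _ hA => by
    refine h.cone_of_sp_ne fun h0 => ?_
    rw [h.ap t ht, h0] at hA; norm_num at hA
  have hvac : ∀ t ∈ S, t < -(1 / ε) → Ap t = 0 → q t = (0, 0) := fun t ht hte hA => by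
    rcases h.cases t with h0 | h0
    · exact h0
    · have := (signs_left hε hε1 hte h0).1
      rw [h.ap t ht] at hA
      nlinarith
  have hconst : ∀ z, z < -(1 / ε) → 0 < Ap z → ∀ s ∈ S, ∀ t ∈ S, s < z → t < z → q s = q t := by
    intro z hz hA s hs t ht hsz htz
    refine h.const_of_signs (c := min s t - 1) (d := z) (σ := 1) (τ := -1) (by norm_num)
      (by norm_num) (fun u hu => hne u (hu.2.trans hz))
      (fun u hu => hA.trans_le (hanti u z hu.2.le hz)) (fun u hu => ?_)
      (fun u _ _ hu => by rw [one_mul]; exact hsp u (hu.trans hz))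
      (fun u _ _ hu => by rw [neg_one_mul]; linarith [hsm u (hu.trans hz)]) s hs t ht
      (by linarith [min_le_left s t]) hsz (by linarith [min_le_right s t]) htz
    obtain ⟨w, hw, hw1, hw2⟩ := h.exists_mem hu.2
    have hwA : 0 < Ap w := hA.trans_le (hanti w z hw2.le hz)
    have hwm := (signs_left hε hε1 (hw2.trans hz) (hcone w hw (hw2.trans hz) hwA)).2
    have hwAm : 0 < Am w := by rw [h.am w hw]; nlinarith
    exact hwAm.trans_le (h.am_anti hε hε1 hw1.le fun v _ _ hv => hsm v (hv.trans (hw2.trans hz)))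
  rcases (h.ap_nonneg x).eq_or_lt with hA | hA
  · have hAy : Ap y = 0 := le_antisymm ((hanti x y hxy.le hye).trans hA.symm.le) (h.ap_nonneg y)
    rw [hvac x hx (hxy.trans hye) hA.symm, hvac y hy hye hAy]
  · have hq0 := hcone x hx (hxy.trans hye) hA
    have hval : ∀ z, x < z → z < -(1 / ε) → 0 < Ap z → Ap z = sp ε z (q x) ^ 2 := by
      intro z hxz hz hAz
      refine h.eq_of_left (g := fun z => sp ε z (q x) ^ 2) h.ap_cont.continuousAt ?_ hxz
        fun t ht h1 h2 => ?_
      · unfold sp; fun_prop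
      · rw [h.ap t ht, hconst z hz hAz x hx t ht hxz h2]
    have hpos : ∀ z, x < z → z < -(1 / ε) → 0 < Ap z := by
      intro z hxz hz
      by_contra hcon
      have hz0 : Ap z = 0 := le_antisymm (not_lt.1 hcon) (h.ap_nonneg z)
      have hs := (signs_left hε hε1 hz hq0).1
      have hmono : ∀ w, w ≤ z → sp ε z (q x) ^ 2 ≤ sp ε w (q x) ^ 2 := by
        intro w hw
        have : sp ε z (q x) ≤ sp ε w (q x) := by
          have := (cone_c_pos hε hε1 hq0).1
          unfold sp; nlinarith
        exact pow_le_pow_left₀ hs.le this 2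
      have hx2 := hmono x hxz.le
      rw [← h.ap x hx] at hx2
      have he : 0 < sp ε z (q x) ^ 2 := by positivity
      -- If Ap vanished at z, it would take at some w before z half the value sp²(z) of the constant
      -- state; but where Ap > 0 it equals sp² of that state, which is at least sp²(z).
      obtain ⟨w, ⟨hw1, hw2⟩, hw3⟩ := intermediate_value_Icc' hxz.le h.ap_cont.continuousOn
        (show sp ε z (q x) ^ 2 / 2 ∈ Icc (Ap z) (Ap x) by rw [hz0]; constructor <;> linarith)
      have hxw : x < w := by
        refine lt_of_le_of_ne hw1 ?_
        rintro rfl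
        linarith
      have := hval w hxw (hw2.trans_lt hz) (by rw [hw3]; linarith)
      have := hmono w hw2
      linarith
    obtain ⟨z, hz1, hz2⟩ := exists_between hye
    exact hconst z hz2 (hpos z (hxy.trans hz1) hz2) x hx y hy (hxy.trans hz1) hz1

/-- Along a sonic region the `2`-form is proportional to the rarefaction profile. -/
lemma fan_const (h : Prof ε q S Ap Am m) (hε : 0 < ε) {c d : ℝ} (hc : -(1 / ε) ≤ c)
    (hd : d ≤ 1 / ε) (hs : ∀ x ∈ S, c < x → x < d → sm ε x (q x) = 0) :
    ∀ x ∈ Ioo c d, ∀ y ∈ Ioo c d, Ap x / fanP ε x ^ 2 = Ap y / fanP ε y ^ 2 := by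
  have hI : ∀ x ∈ Ioo c d, -(1 / ε) < x ∧ x < 1 / ε := fun x hx =>
    ⟨hc.trans_lt hx.1, hx.2.trans_le hd⟩
  -- With sm = 0 the state is determined by sp, and the equation of Ap becomes a linear ODE solved
  -- by `fanP ε x ^ 2`.
  have hder : ∀ x ∈ Ioo c d,
      HasDerivAt Ap (-(Ap x * (1 + ε ^ 2 + 2 * ε ^ 2 * x) / (1 - ε ^ 2 * x ^ 2))) x := by
    intro x hx
    refine hasDerivAt_of_integral
      (g := fun x => -(Ap x * (1 + ε ^ 2 + 2 * ε ^ 2 * x) / (1 - ε ^ 2 * x ^ 2)))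
      h.ae h.ap_int ?_ (fun t ht h1 h2 => ?_) hx
    · have := h.ap_cont
      refine ContinuousOn.neg (ContinuousOn.div (by fun_prop) (by fun_prop) fun x hx => ?_)
      exact (one_sub_pos hε (hI x hx).1 (hI x hx).2).1.ne'
    · have h0 := (one_sub_pos hε (hI t ⟨h1, h2⟩).1 (hI t ⟨h1, h2⟩).2).1.ne'
      have e1 := fst_eq h0 (q t)
      have e2 := snd_eq h0 (q t)
      rw [hs t ht h1 h2] at e1 e2
      rw [h.ap t ht]
      rw [show -2 * sp ε t (q t) * ((q t).1 + ε ^ 2 * (q t).2) = -(2 * sp ε t (q t) *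
        ((q t).1 + ε ^ 2 * (q t).2)) by ring, e1, e2]
      field_simp; ring
  intro x hx y hy
  refine isOpen_Ioo.is_const_of_deriv_eq_zero (f := fun x => Ap x / fanP ε x ^ 2)
    isPreconnected_Ioo ?_ ?_ hx hy
  · intro z hz
    have e2 := hasDerivAt_fanP hε (hI z hz).1 (hI z hz).2
    exact ((hder z hz).div (e2.pow 2) (pow_pos (fanP_pos hε (hI z hz).1 (hI z hz).2) 2).ne')
      |>.differentiableAt.differentiableWithinAt
  · intro z hz
    have e2 := hasDerivAt_fanP hε (hI z hz).1 (hI z hz).2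
    have p := (fanP_pos hε (hI z hz).1 (hI z hz).2)
    have d0 := (one_sub_pos hε (hI z hz).1 (hI z hz).2).1.ne'
    refine (((hder z hz).div (e2.pow 2) (pow_pos p 2).ne').congr_deriv ?_).deriv
    have p' := p.ne'
    simp only [Pi.pow_apply]
    field_simp
    simp only [Pi.zero_apply]
    ring

end Prof

/-! ### Structure of self-similar solutions -/

/-- Near the left light cone this bounds Ap/fanP² by Ap, so a fan issuing from the vacuum has
amplitude zero. -/
lemma fanP_ge_one {ε x : ℝ} (hε : 0 < ε) (h1 : -(1 / ε) < x) (h2 : x ≤ 0) : 1 ≤ fanP ε x := by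
  obtain ⟨-, d1, d2⟩ := one_sub_pos hε h1 (h2.trans_lt (by positivity))
  have hx : ε * x ≤ 0 := mul_nonpos_of_nonneg_of_nonpos hε.le h2
  have e1 : 1 ≤ (1 - ε * x) ^ ((1 + ε) ^ 2 / (4 * ε)) :=
    Real.one_le_rpow (by linarith) (by positivity)
  have e2 : 1 ≤ (1 + ε * x) ^ (-((1 - ε) ^ 2 / (4 * ε))) :=
    Real.one_le_rpow_of_pos_of_le_one_of_nonpos d1 (by linarith)
      (neg_nonpos.2 (by positivity))
  rw [fanP]; nlinarith

lemma continuousAt_fanQ {ε s x : ℝ} (hε : 0 < ε) (h1 : -(1 / ε) < x) (h2 : x < 1 / ε) :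
    ContinuousAt (fanQ ε s) x := by
  have hc := (hasDerivAt_fanP hε h1 h2).continuousAt
  have h0 : 2 * (1 - ε ^ 2 * x ^ 2) ≠ 0 := mul_ne_zero two_ne_zero (one_sub_pos hε h1 h2).1.ne'
  unfold fanQ
  have hd : ContinuousAt (fun x => s * fanP ε x / (2 * (1 - ε ^ 2 * x ^ 2))) x :=
    (hc.const_mul s).div (by fun_prop) h0
  exact (hd.mul (by fun_prop)).prodMk (hd.mul (by fun_prop))

lemma continuousAt_curve1 {ε : ℝ} (hε : 0 < ε) (hε1 : ε < 1) {l : ℝ × ℝ} (hl : l ∈ cone ε) {x : ℝ}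
    (h2 : x < 1 / ε) : ContinuousAt (curve1 ε l) x := by
  obtain ⟨b1, b2⟩ := lam1A_bounds hε hε1 hl
  set s := sp ε (lam1A ε l) l / fanP ε (lam1A ε l) with hs
  have hcl : ∀ t ≤ lam1A ε l, curve1 ε l t = l := by
    intro t ht
    rcases ht.eq_or_lt with rfl | ht
    · rw [curve1, if_neg (lt_irrefl _)]; exact fanQ_lam1A hε hε1 hl
    · rw [curve1, if_pos ht]
  have hcr : ∀ t, lam1A ε l ≤ t → curve1 ε l t = fanQ ε s t := fun t ht => by
    rw [curve1, if_neg (not_lt.2 ht)]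
  rcases lt_trichotomy x (lam1A ε l) with h | h | h
  · refine continuousAt_const.congr (f := fun _ => l) ?_
    filter_upwards [eventually_lt_nhds h] with t ht
    exact (hcl t ht.le).symm
  · rw [continuousAt_iff_continuous_left_right]
    constructor
    · exact (continuousWithinAt_const (b := l)).congr (fun t ht => hcl t (h ▸ ht)) (hcl x h.le)
    · refine (continuousAt_fanQ (s := s) hε (h ▸ b1) h2).continuousWithinAt.congr
        (fun t ht => hcr t (h ▸ ht)) (hcr x h.ge)
  · refine (continuousAt_fanQ (s := s) hε (b1.trans h) h2).congr ?_
    filter_upwards [eventually_gt_nhds h] with t ht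
    exact (hcr t ht.le).symm

lemma sm_curve1 {ε : ℝ} (hε : 0 < ε) (hε1 : ε < 1) {l : ℝ × ℝ} (hl : l ∈ cone ε) (x : ℝ) :
    sm ε x (curve1 ε l x) ≤ 0 := by
  rw [curve1]
  split_ifs with h
  · rw [sm_eq hε hε1.le hl]
    exact mul_nonpos_of_nonneg_of_nonpos (cone_c_pos hε hε1.le hl).2.le (by linarith)
  · rw [sm_fanQ]

/-! ### Sign reversal, reflection and the state at the light cone -/

/-- The state with the same `2`-form and the opposite `1`-form at slope `x`. -/
def flip1 (ε x : ℝ) (q : ℝ × ℝ) : ℝ × ℝ :=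
  (((1 + ε ^ 2 * x) * sp ε x q - (1 - ε ^ 2 * x) * sm ε x q) / (2 * (1 - ε ^ 2 * x ^ 2)),
    ((1 + x) * sp ε x q + (1 - x) * sm ε x q) / (2 * (1 - ε ^ 2 * x ^ 2)))

/-- The state behind the `1`-wave ending at slope `x`. -/
def behind1 (ε : ℝ) (l : ℝ × ℝ) (x : ℝ) : ℝ × ℝ := flip1 ε x (curve1 ε l x)

/-- Reflection of states. -/
def refl (q : ℝ × ℝ) : ℝ × ℝ := (q.1, -q.2)

lemma refl_refl (q : ℝ × ℝ) : refl (refl q) = q := by simp [refl]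

lemma refl_mem {ε : ℝ} {q : ℝ × ℝ} (h : q ∈ cone ε) : refl q ∈ cone ε := by
  have : ε * |q.2| < q.1 := h
  show ε * |-q.2| < q.1
  rwa [abs_neg]

lemma refl_zero : refl (0, 0) = (0, 0) := by simp [refl]

lemma sp_refl (ε x : ℝ) (q : ℝ × ℝ) : sp ε x (refl q) = sm ε (-x) q := by
  simp only [sp, sm, refl]; ring

lemma sm_refl (ε x : ℝ) (q : ℝ × ℝ) : sm ε x (refl q) = sp ε (-x) q := by
  simp only [sp, sm, refl]; ring

/-- The centered `2`-rarefaction followed by the right state. -/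
def curve2 (ε : ℝ) (r : ℝ × ℝ) (x : ℝ) : ℝ × ℝ := refl (curve1 ε (refl r) (-x))

/-- The state ahead of the `2`-wave beginning at slope `x`. -/
def ahead2 (ε : ℝ) (r : ℝ × ℝ) (x : ℝ) : ℝ × ℝ := refl (behind1 ε (refl r) (-x))

lemma eq_of_sp_sm {ε x : ℝ} (h : 1 - ε ^ 2 * x ^ 2 ≠ 0) {p q : ℝ × ℝ} (h1 : sp ε x p = sp ε x q)
    (h2 : sm ε x p = sm ε x q) : p = q := by
  ext
  · rw [fst_eq h p, fst_eq h q, h1, h2]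
  · rw [snd_eq h p, snd_eq h q, h1, h2]

lemma sp_flip1 {ε x : ℝ} (h : 1 - ε ^ 2 * x ^ 2 ≠ 0) (q : ℝ × ℝ) :
    sp ε x (flip1 ε x q) = sp ε x q := by
  rw [sp, flip1]
  generalize sp ε x q = P
  generalize sm ε x q = N
  generalize hd : 1 - ε ^ 2 * x ^ 2 = d at *
  field_simp; rw [← hd]; ring

lemma sm_flip1 {ε x : ℝ} (h : 1 - ε ^ 2 * x ^ 2 ≠ 0) (q : ℝ × ℝ) :
    sm ε x (flip1 ε x q) = -sm ε x q := by
  rw [sm, flip1]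
  generalize sp ε x q = P
  generalize sm ε x q = N
  generalize hd : 1 - ε ^ 2 * x ^ 2 = d at *
  field_simp; rw [← hd]; ring

/-- At x = -1/ε both forms are multiples of a+εb, so the squares no longer determine the state. The
quantity H - xG = (a+εb)(a+ε³b)/ε supplies the missing combination, which is independent of a+εb as
ε < 1. -/
lemma neg_end_unique {ε : ℝ} (hε : 0 < ε) (hε1 : ε < 1) {p q : ℝ × ℝ} (hp : p ∈ cone ε)
    (hq : q ∈ cone ε) (h1 : sp ε (-(1 / ε)) p ^ 2 = sp ε (-(1 / ε)) q ^ 2)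
    (h2 : HA ε p - -(1 / ε) * GA ε p = HA ε q - -(1 / ε) * GA ε q) : p = q := by
  have a1 := (cone_iff hε).1 hp
  have a2 := (cone_iff hε).1 hq
  have e : ∀ q : ℝ × ℝ, HA ε q - -(1 / ε) * GA ε q =
      (q.1 + ε * q.2) * (q.1 + ε ^ 3 * q.2) / ε := by
    intro q; simp only [HA, GA]; field_simp; ring
  rw [e, e, div_left_inj' hε.ne'] at h2
  rw [sp_neg_end hε, sp_neg_end hε, mul_pow, mul_pow] at h1
  have hc : ((1 + ε) / ε) ^ 2 ≠ 0 := by positivity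
  have h3 := mul_left_cancel₀ hc h1
  have h4 : p.1 + ε * p.2 = q.1 + ε * q.2 :=
    (sq_eq_sq₀ (by linarith) (by linarith)).1 h3
  rw [h4] at h2
  have h5 := mul_left_cancel₀ (show q.1 + ε * q.2 ≠ 0 by linarith) h2
  have h6 : (1 - ε ^ 2) * (ε * (p.2 - q.2)) = 0 := by linear_combination h4 - h5
  have h7 : (1 - ε ^ 2) ≠ 0 := by nlinarith
  have h8 : p.2 = q.2 := by
    have := (mul_eq_zero.1 ((mul_eq_zero.1 h6).resolve_left h7)).resolve_left hε.ne'
    linarith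
  ext
  · rw [h8] at h4; linarith
  · exact h8

lemma continuousAt_sp {ε x : ℝ} {f : ℝ → ℝ × ℝ} (hf : ContinuousAt f x) :
    ContinuousAt (fun t => sp ε t (f t) ^ 2) x := by
  unfold sp; fun_prop

lemma continuousAt_sm {ε x : ℝ} {f : ℝ → ℝ × ℝ} (hf : ContinuousAt f x) :
    ContinuousAt (fun t => sm ε t (f t) ^ 2) x := by
  unfold sm; fun_prop

namespace Prof

variable {ε : ℝ} {q : ℝ → ℝ × ℝ} {S : Set ℝ} {Ap Am m : ℝ → ℝ}

lemma end_values (h : Prof ε q S Ap Am m) {l : ℝ × ℝ}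
    (hleft : ∀ x ∈ S, x < -(1 / ε) → q x = l) :
    Ap (-(1 / ε)) = sp ε (-(1 / ε)) l ^ 2 ∧ Am (-(1 / ε)) = sm ε (-(1 / ε)) l ^ 2 ∧
      m (-(1 / ε)) = HA ε l - -(1 / ε) * GA ε l := by
  have hlt : -(1 / ε) - 1 < -(1 / ε) := by linarith
  refine ⟨?_, ?_, ?_⟩
  · exact h.eq_of_left (g := fun t => sp ε t l ^ 2) h.ap_cont.continuousAt
      (continuousAt_sp continuousAt_const) hlt fun t ht _ h2 => by rw [h.ap t ht, hleft t ht h2]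
  · exact h.eq_of_left (g := fun t => sm ε t l ^ 2) h.am_cont.continuousAt
      (continuousAt_sm continuousAt_const) hlt fun t ht _ h2 => by rw [h.am t ht, hleft t ht h2]
  · exact h.eq_of_left (g := fun t => HA ε l - t * GA ε l) h.m_cont.continuousAt
      (by fun_prop) hlt fun t ht _ h2 => by rw [h.mm t ht, hleft t ht h2]

lemma sp_nonneg_of_sm (h : Prof ε q S Ap Am m) (hε : 0 < ε) {x : ℝ} (h1 : -(1 / ε) < x)
    (h2 : x < 1 / ε) (hs : sm ε x (q x) ≤ 0) : 0 ≤ sp ε x (q x) := by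
  rcases h.cases x with h0 | h0
  · rw [h0, sp_vac]
  · exact (sp_pos_of_sm_nonpos hε h1.le h2.le h0 hs).le

/-- The solution to the left of the sign change of the `1`-form, for a left state which is not
vacuum. -/
lemma left_nonvac (h : Prof ε q S Ap Am m) (hε : 0 < ε) (hε1 : ε < 1) {l : ℝ × ℝ}
    (hl : l ∈ cone ε) (hleft : ∀ x ∈ S, x < -(1 / ε) → q x = l) {α : ℝ}
    (hα1 : -(1 / ε) ≤ α) (hα2 : α ≤ 1 / ε)
    (hneg : ∀ x ∈ S, -(1 / ε) < x → x < α → sm ε x (q x) ≤ 0)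
    (hpos : ∀ x ∈ S, α < x → x < 1 / ε → 0 < sm ε x (q x)) :
    -(1 / ε) < α ∧ ∀ x ∈ S, x ≠ -(1 / ε) → x < α → q x = curve1 ε l x := by
  obtain ⟨vP, vM, vm⟩ := h.end_values hleft
  obtain ⟨b1, b2⟩ := lam1A_bounds hε hε1 hl
  have hc := (cone_c_pos hε hε1.le hl).2
  have h0 : 0 < 1 / ε := by positivity
  have hlneg : ∀ x, x < lam1A ε l → sm ε x l < 0 := fun x hx => by
    rw [sm_eq hε hε1.le hl]; exact mul_neg_of_pos_of_neg hc (by linarith)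
  have hlmono : ∀ x y, x ≤ y → y < lam1A ε l → sm ε y l ^ 2 ≤ sm ε x l ^ 2 := by
    intro x y hxy hy
    have e1 := hlneg y hy
    have e2 : sm ε x l ≤ sm ε y l := by
      rw [sm_eq hε hε1.le hl, sm_eq hε hε1.le hl]; exact mul_le_mul_of_nonneg_left (by linarith) hc.le
    nlinarith
  -- If sm were positive immediately after the light cone, then sm(t) ≤ 2C(t+1/ε), because its value
  -- at slope -1/ε is nonpositive for every state. So Am would vanish at -1/ε, contrary to its value
  -- for l.
  have hα : -(1 / ε) < α := by
    refine lt_of_le_of_ne hα1 fun he => ?_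
    obtain ⟨C, hC⟩ := h.bdd
    have key : Am (-(1 / ε)) ≤ (2 * C) ^ 2 * (-(1 / ε) + 1 / ε) ^ 2 := by
      refine h.le_of_right (f := Am) (g := fun t => (2 * C) ^ 2 * (t + 1 / ε) ^ 2) (d := 1 / ε)
        h.am_cont.continuousAt (by fun_prop) (by linarith) fun t ht t1 t2 => ?_
      have hp := hpos t ht (he ▸ t1) t2
      have hcone := h.cone_of_sm_ne hp.ne'
      have e1 : sm ε t (q t) = sm ε (-(1 / ε)) (q t) +
          (t + 1 / ε) * ((q t).1 - ε ^ 2 * (q t).2) := by simp only [sm]; ring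
      have e2 : sm ε (-(1 / ε)) (q t) ≤ 0 := by
        rw [sm_neg_end hε]
        have := ((cone_iff hε).1 hcone).1
        exact neg_nonpos.2 (mul_nonneg (div_nonneg (by linarith) hε.le) (by linarith))
      have e3 : (q t).1 - ε ^ 2 * (q t).2 ≤ 2 * C := by
        have g1 := (abs_le.1 (hC t).1).2
        have g2 := (abs_le.1 (hC t).2).1
        have g3 := (abs_nonneg _).trans (hC t).2
        have g4 : ε ^ 2 ≤ 1 := by nlinarith
        nlinarith [sq_nonneg ε]
      rw [h.am t ht, ← mul_pow]
      refine pow_le_pow_left₀ hp.le ?_ 2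
      nlinarith
    have e0 := hlneg _ b1
    rw [vM] at key
    rw [show -(1 / ε) + 1 / ε = 0 by ring] at key
    nlinarith
  refine ⟨hα, ?_⟩
  have hI : ∀ x, x < α → x < 1 / ε := fun x hx => hx.trans_le hα2
  have hsp : ∀ x ∈ S, -(1 / ε) < x → x < α → 0 ≤ sp ε x (q x) := fun x hx h1 h2 =>
    h.sp_nonneg_of_sm hε h1 (hI x h2) (hneg x hx h1 h2)
  have ham : ∀ x y, -(1 / ε) ≤ x → x ≤ y → y ≤ α → Am y ≤ Am x := fun x y h1 h2 h3 =>
    h.am_anti hε hε1.le h2 fun t ht t1 t2 => hneg t ht (h1.trans_lt t1) (t2.trans_le h3)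
  have hap : ∀ x y, -(1 / ε) ≤ x → x ≤ y → y ≤ α → Ap y ≤ Ap x := fun x y h1 h2 h3 =>
    h.ap_anti hε hε1.le h2 fun t ht t1 t2 => hsp t ht (h1.trans_lt t1) (t2.trans_le h3)
  -- Am decreases on this interval, so Am(z) > 0 makes both squares positive before z and the
  -- profile constant there. Continuity of Ap and m across the light cone identifies the constant as
  -- l.
  have claim1 : ∀ z, -(1 / ε) < z → z < α → 0 < Am z →
      (∀ x ∈ S, -(1 / ε) < x → x < z → q x = l) ∧ Am z = sm ε z l ^ 2 := by
    intro z hz1 hz2 hz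
    have hconst := h.const_of_signs (c := -(1 / ε)) (d := z) (σ := 1) (τ := -1) (by norm_num)
      (by norm_num) (fun x hx => (one_sub_pos hε hx.1 (hI x (hx.2.trans hz2))).1.ne')
      (fun x hx => by
        obtain ⟨s, hs, hs1, hs2⟩ := h.exists_mem hx.2
        have a1 : 0 < Am s := hz.trans_le (ham s z (hx.1.trans hs1).le hs2.le hz2.le)
        have a2 : sm ε s (q s) ≠ 0 := by
          intro he; rw [h.am s hs, he] at a1; norm_num at a1
        have a3 := sp_pos_of_sm_nonpos hε (hx.1.trans hs1).le (hI s (hs2.trans hz2)).le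
          (h.cone_of_sm_ne a2) (hneg s hs (hx.1.trans hs1) (hs2.trans hz2))
        have a4 : 0 < Ap s := by rw [h.ap s hs]; positivity
        exact a4.trans_le (hap x s hx.1.le hs1.le (hs2.trans hz2).le))
      (fun x hx => hz.trans_le (ham x z hx.1.le hx.2.le hz2.le))
      (fun x hx h1 h2 => by rw [one_mul]; exact hsp x hx h1 (h2.trans hz2))
      (fun x hx h1 h2 => by rw [neg_one_mul]; linarith [hneg x hx h1 (h2.trans hz2)])
    obtain ⟨s, hs, hs1, hs2⟩ := h.exists_mem hz1
    have a1 : 0 < Am s := hz.trans_le (ham s z hs1.le hs2.le hz2.le)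
    have a2 : sm ε s (q s) ≠ 0 := by
      intro he; rw [h.am s hs, he] at a1; norm_num at a1
    have hqs := h.cone_of_sm_ne a2
    have hall : ∀ x ∈ S, -(1 / ε) < x → x < z → q x = q s := fun x hx h1 h2 =>
      hconst x hx s hs h1 h2 hs1 hs2
    have w1 : Ap (-(1 / ε)) = sp ε (-(1 / ε)) (q s) ^ 2 :=
      h.eq_of_right (g := fun t => sp ε t (q s) ^ 2) h.ap_cont.continuousAt
        (continuousAt_sp continuousAt_const) hz1
        fun t ht h1 h2 => by rw [h.ap t ht, hall t ht h1 h2]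
    have w2 : m (-(1 / ε)) = HA ε (q s) - -(1 / ε) * GA ε (q s) :=
      h.eq_of_right (g := fun t => HA ε (q s) - t * GA ε (q s)) h.m_cont.continuousAt
        (by fun_prop) hz1 fun t ht h1 h2 => by rw [h.mm t ht, hall t ht h1 h2]
    have hql : q s = l := neg_end_unique hε hε1 hqs hl (by rw [← w1, vP]) (by rw [← w2, vm])
    rw [hql] at hall
    refine ⟨hall, ?_⟩
    exact h.eq_of_left (g := fun t => sm ε t l ^ 2) h.am_cont.continuousAt
      (continuousAt_sm continuousAt_const) hz1 fun t ht h1 h2 => by rw [h.am t ht, hall t ht h1 h2]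
  have claim2 : ∀ z, z < α → lam1A ε l ≤ z → Am z = 0 := by
    intro z hz1 hz2
    by_contra hne
    have hz : 0 < Am z := lt_of_le_of_ne (h.am_nonneg z) (Ne.symm hne)
    have h1 := hz.trans_le (ham _ _ b1.le hz2 hz1.le)
    have h2 := (claim1 _ b1 (hz2.trans_lt hz1) h1).2
    rw [sm_eq hε hε1.le hl, sub_self, mul_zero] at h2
    rw [h2] at h1; norm_num at h1
  -- If Am vanished before the wave speed of l, it would somewhere take half the value sm²(z) of l;
  -- by `claim1` it equals sm² of l there, which is larger.
  have claim3 : ∀ z, -(1 / ε) < z → z < α → z < lam1A ε l → 0 < Am z := by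
    intro z hz1 hz2 hz3
    by_contra hcon
    have hz0 : Am z = 0 := le_antisymm (not_lt.1 hcon) (h.am_nonneg z)
    have he : 0 < sm ε z l ^ 2 := by
      have := (hlneg z hz3).ne
      positivity
    have h1 := hlmono _ _ hz1.le hz3
    rw [← vM] at h1
    obtain ⟨w, ⟨hw1, hw2⟩, hw3⟩ := intermediate_value_Icc' hz1.le h.am_cont.continuousOn
        (show sm ε z l ^ 2 / 2 ∈ Icc (Am z) (Am (-(1 / ε))) by rw [hz0]; constructor <;> linarith)
    have hw1' : -(1 / ε) < w := by
      refine lt_of_le_of_ne hw1 ?_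
      rintro rfl
      linarith
    have h2 := (claim1 w hw1' (hw2.trans_lt hz2) (by rw [hw3]; linarith)).2
    have h3 := hlmono w z hw2 hz3
    linarith
  have hbefore : ∀ x ∈ S, -(1 / ε) < x → x < α → x < lam1A ε l → q x = l := by
    intro x hx h1 h2 h3
    obtain ⟨z, hz1, hz2⟩ := exists_between (lt_min h2 h3)
    have a1 := hz2.trans_le (min_le_left _ _)
    have a2 := hz2.trans_le (min_le_right _ _)
    exact (claim1 z (h1.trans hz1) a1 (claim3 z (h1.trans hz1) a1 a2)).1 x hx h1 hz1
  intro x hx hxne hxα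
  rcases lt_or_gt_of_ne hxne with hx1 | hx1
  · rw [hleft x hx hx1, curve1, if_pos (hx1.trans b1)]
  rcases lt_or_ge x (lam1A ε l) with hx2 | hx2
  · rw [hbefore x hx hx1 hxα hx2, curve1, if_pos hx2]
  have hlt_α := hx2.trans_lt hxα
  have hP_lam : Ap (lam1A ε l) = sp ε (lam1A ε l) l ^ 2 :=
    h.eq_of_left (g := fun t => sp ε t l ^ 2) h.ap_cont.continuousAt
      (continuousAt_sp continuousAt_const) b1
      fun t ht h1 h2 => by rw [h.ap t ht, hbefore t ht h1 (h2.trans hlt_α) h2]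
  -- Past the wave speed of l the form sm vanishes, and the amplitude of the fan is fixed by
  -- continuity of Ap at that speed.
  have hfan := h.fan_const hε b1.le hα2 (fun t ht h1 h2 => by
    have := claim2 t h2 h1.le
    rw [h.am t ht] at this
    exact pow_eq_zero_iff two_ne_zero |>.1 this)
  have hAx : Ap x / fanP ε x ^ 2 = sp ε (lam1A ε l) l ^ 2 / fanP ε (lam1A ε l) ^ 2 := by
    rw [← hP_lam]
    rcases hx2.eq_or_lt with he | hlt
    · rw [← he]
    · have hcont : ContinuousAt (fun t => Ap t / fanP ε t ^ 2) (lam1A ε l) :=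
        h.ap_cont.continuousAt.div ((hasDerivAt_fanP hε b1 b2).continuousAt.pow 2)
          (pow_pos (fanP_pos hε b1 b2) 2).ne'
      exact (h.eq_of_right (f := fun t => Ap t / fanP ε t ^ 2)
        (g := fun _ => Ap x / fanP ε x ^ 2) hcont continuousAt_const hlt_α
        fun t ht h1 h2 => hfan t ⟨h1, h2⟩ x ⟨hlt, hxα⟩).symm
  have px := fanP_pos hε hx1 (hI x hxα)
  have pl := fanP_pos hε b1 b2
  rw [curve1, if_neg (not_lt.2 hx2)]
  refine eq_fanQ (one_sub_pos hε hx1 (hI x hxα)).1.ne' ?_ ?_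
  · have e1 := hsp x hx hx1 hxα
    have e2 := sp_lam1A_pos hε hε1 hl
    rw [← sq_eq_sq₀ e1 (mul_nonneg (div_nonneg e2.le pl.le) px.le), mul_pow, div_pow, ← hAx,
      h.ap x hx, div_mul_cancel₀ _ (pow_pos px 2).ne']
  · have := claim2 x hxα hx2
    rw [h.am x hx] at this
    exact pow_eq_zero_iff two_ne_zero |>.1 this

/-- Am starts from zero at the light cone and cannot increase left of α, so only a fan could emerge;
its amplitude is forced to vanish by Ap(-1/ε) = 0. -/
lemma left_vac (h : Prof ε q S Ap Am m) (hε : 0 < ε) (hε1 : ε < 1)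
    (hleft : ∀ x ∈ S, x < -(1 / ε) → q x = (0, 0)) {α : ℝ}
    (hα2 : α ≤ 1 / ε)
    (hneg : ∀ x ∈ S, -(1 / ε) < x → x < α → sm ε x (q x) ≤ 0) :
    ∀ x ∈ S, x ≠ -(1 / ε) → x < α → q x = (0, 0) := by
  obtain ⟨vP, vM, -⟩ := h.end_values hleft
  have h0 : 0 < 1 / ε := by positivity
  rw [sp_vac] at vP
  rw [sm_vac] at vM
  intro x hx hxne hxα
  rcases lt_or_gt_of_ne hxne with hx1 | hx1
  · exact hleft x hx hx1
  have hzero : ∀ t, -(1 / ε) < t → t < α → Am t = 0 := fun t h1 h2 =>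
    le_antisymm ((h.am_anti hε hε1.le h1.le fun s hs s1 s2 => hneg s hs s1 (s2.trans h2)).trans
      (by rw [vM]; norm_num)) (h.am_nonneg t)
  have hfan := h.fan_const hε le_rfl hα2 (fun t ht h1 h2 => by
    have := hzero t h1 h2
    rw [h.am t ht] at this
    exact pow_eq_zero_iff two_ne_zero |>.1 this)
  have px := fanP_pos hε hx1 (hxα.trans_le hα2)
  have hr : 0 ≤ Ap x / fanP ε x ^ 2 := div_nonneg (h.ap_nonneg x) (by positivity)
  -- The amplitude is constant in the fan and at most Ap(t) for t near -1/ε, since `fanP` is at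
  -- least 1 there; let t tend to the light cone.
  have key : Ap x / fanP ε x ^ 2 ≤ Ap (-(1 / ε)) := by
    refine h.le_of_right (f := fun _ => Ap x / fanP ε x ^ 2) continuousAt_const
      h.ap_cont.continuousAt (lt_min (hx1.trans hxα) (neg_lt_zero.2 h0)) fun t ht h1 h2 => ?_
    have t1 := h2.trans_le (min_le_left _ _)
    have t2 := h2.trans_le (min_le_right _ _)
    have g := fanP_ge_one hε h1 t2.le
    rw [← hfan t ⟨h1, t1⟩ x ⟨hx1, hxα⟩]
    exact div_le_self (h.ap_nonneg t) (one_le_pow₀ g)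
  rw [vP] at key
  have hA : Ap x = 0 := by
    have h1 : Ap x / fanP ε x ^ 2 = 0 := le_antisymm (by simpa using key) hr
    rcases div_eq_zero_iff.1 h1 with h2 | h2
    · exact h2
    · exact absurd h2 (by positivity)
  exact h.vac_of_ap hε hx hx1.le (hxα.trans_le hα2).le hA (hneg x hx hx1 hxα)

end Prof

/-! ### Assembling the wave pattern of a solution with ε < 1 -/

/-- The Riemann profile: a `1`-wave up to slope `α`, the state `p`, a `2`-wave from slope `β`. -/
def wave (ε : ℝ) (l r : ℝ × ℝ) (α β : ℝ) (p : ℝ × ℝ) (x : ℝ) : ℝ × ℝ :=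
  if x < α then curve1 ε l x else if x < β then p else curve2 ε r x

lemma sp_curve2 {ε : ℝ} (hε : 0 < ε) (hε1 : ε < 1) {r : ℝ × ℝ} (hr : r ∈ cone ε) (x : ℝ) :
    sp ε x (curve2 ε r x) ≤ 0 := by
  rw [curve2, sp_refl]; exact sm_curve1 hε hε1 (refl_mem hr) (-x)

lemma curve2_mem {ε : ℝ} (hε : 0 < ε) (hε1 : ε < 1) {r : ℝ × ℝ} (hr : r ∈ cone ε) {x : ℝ}
    (h1 : -(1 / ε) < x) : curve2 ε r x ∈ cone ε :=
  refl_mem (curve1_mem hε hε1 (refl_mem hr) (by linarith))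

lemma continuousAt_curve2 {ε : ℝ} (hε : 0 < ε) (hε1 : ε < 1) {r : ℝ × ℝ} (hr : r ∈ cone ε) {x : ℝ}
    (h1 : -(1 / ε) < x) : ContinuousAt (curve2 ε r) x := by
  have h2 : ContinuousAt (fun t => curve1 ε (refl r) (-t)) x :=
    ContinuousAt.comp' (continuousAt_curve1 hε hε1 (refl_mem hr) (by linarith))
      continuousAt_neg
  exact h2.fst.prodMk h2.snd.neg

/-- A positive lower bound of one form by the other cannot hold in both directions. -/
lemma not_dom_both {ε a b c d : ℝ} (hε : 0 < ε) (hε1 : ε < 1) (hb : b ≤ 0) (hc : c ≤ 0)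
    (h1 : (1 + ε) * -b < (1 - ε) * a) (h2 : (1 + ε) * -c < (1 - ε) * d)
    (hac : a ^ 2 = c ^ 2) (hbd : b ^ 2 = d ^ 2) : False := by
  have ha : 0 ≤ a := by
    by_contra hcon
    nlinarith
  have hd : 0 ≤ d := by
    by_contra hcon
    nlinarith
  have e1 : a = -c := by
    have : a ^ 2 = (-c) ^ 2 := by rw [neg_sq]; exact hac
    exact (sq_eq_sq₀ ha (by linarith)).1 this
  have e2 : d = -b := by
    have : d ^ 2 = (-b) ^ 2 := by rw [neg_sq]; exact hbd.symm
    exact (sq_eq_sq₀ hd (by linarith)).1 this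
  rw [← e2] at h1
  rw [← e1] at h2
  nlinarith

namespace Prof

variable {ε : ℝ} {q : ℝ → ℝ × ℝ} {S : Set ℝ} {Ap Am m : ℝ → ℝ}

lemma exists_split_right (h : Prof ε q S Ap Am m) (hε : 0 < ε) (hε1 : ε < 1) :
    ∃ β, -(1 / ε) ≤ β ∧ β ≤ 1 / ε ∧
      (∀ x ∈ S, -(1 / ε) < x → x < β → 0 < sp ε x (q x)) ∧
      (∀ x ∈ S, β < x → x < 1 / ε → sp ε x (q x) ≤ 0) := by
  obtain ⟨γ, g1, g2, g3, g4⟩ := h.reflect.exists_split hε hε1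
  have e : ∀ x, sm ε (-x) ((q (- -x)).1, -(q (- -x)).2) = sp ε x (q x) := fun x => by
    simp only [sm, sp, neg_neg]; ring
  refine ⟨-γ, by linarith, by linarith, fun x hx h1 h2 => ?_, fun x hx h1 h2 => ?_⟩
  · rw [← e]; exact g4 (-x) (by simpa using hx) (by linarith) (by linarith)
  · rw [← e]; exact g3 (-x) (by simpa using hx) (by linarith) (by linarith)

lemma right_nonvac (h : Prof ε q S Ap Am m) (hε : 0 < ε) (hε1 : ε < 1) {r : ℝ × ℝ}
    (hr : r ∈ cone ε) (hright : ∀ x ∈ S, 1 / ε < x → q x = r) {β : ℝ}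
    (hβ1 : -(1 / ε) ≤ β) (hβ2 : β ≤ 1 / ε)
    (hpos : ∀ x ∈ S, -(1 / ε) < x → x < β → 0 < sp ε x (q x))
    (hneg : ∀ x ∈ S, β < x → x < 1 / ε → sp ε x (q x) ≤ 0) :
    β < 1 / ε ∧ ∀ x ∈ S, x ≠ 1 / ε → β < x → q x = curve2 ε r x := by
  have e : ∀ x, sm ε x ((q (-x)).1, -(q (-x)).2) = sp ε (-x) (q (-x)) := fun x => by
    simp only [sm, sp]; ring
  obtain ⟨g1, g2⟩ := h.reflect.left_nonvac hε hε1 (refl_mem hr) (α := -β)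
    (fun x hx h1 => by rw [hright (-x) hx (by linarith)]; rfl) (by linarith) (by linarith)
    (fun x hx h1 h2 => by rw [e]; exact hneg (-x) hx (by linarith) (by linarith))
    (fun x hx h1 h2 => by rw [e]; exact hpos (-x) hx (by linarith) (by linarith))
  refine ⟨by linarith, fun x hx h1 h2 => ?_⟩
  have := g2 (-x) (by simpa using hx) (by simpa using h1) (by linarith)
  rw [neg_neg] at this
  rw [curve2, ← this]; simp [refl]

lemma right_vac (h : Prof ε q S Ap Am m) (hε : 0 < ε) (hε1 : ε < 1)
    (hright : ∀ x ∈ S, 1 / ε < x → q x = (0, 0)) {β : ℝ} (hβ1 : -(1 / ε) ≤ β)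
    (hneg : ∀ x ∈ S, β < x → x < 1 / ε → sp ε x (q x) ≤ 0) :
    ∀ x ∈ S, x ≠ 1 / ε → β < x → q x = (0, 0) := by
  have e : ∀ x, sm ε x ((q (-x)).1, -(q (-x)).2) = sp ε (-x) (q (-x)) := fun x => by
    simp only [sm, sp]; ring
  have g2 := h.reflect.left_vac hε hε1 (α := -β)
    (fun x hx h1 => by rw [hright (-x) hx (by linarith)]; simp) (by linarith)
    (fun x hx h1 h2 => by rw [e]; exact hneg (-x) hx (by linarith) (by linarith))
  intro x hx h1 h2
  have := g2 (-x) (by simpa using hx) (by simpa using h1) (by linarith)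
  rw [neg_neg] at this
  have e1 := congrArg Prod.fst this
  have e2 := congrArg Prod.snd this
  ext
  · exact e1
  · simpa using e2

/-- The solution is constant where both forms are positive. -/
lemma middle_const (h : Prof ε q S Ap Am m) (hε : 0 < ε) (hε1 : ε ≤ 1) {α β : ℝ}
    (hα : -(1 / ε) ≤ α) (hβ : β ≤ 1 / ε) (hsm : ∀ x ∈ S, α < x → x < β → 0 < sm ε x (q x))
    (hsp : ∀ x ∈ S, α < x → x < β → 0 < sp ε x (q x)) :
    ∀ x ∈ S, ∀ y ∈ S, α < x → x < β → α < y → y < β → q x = q y := by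
  refine h.const_of_signs (σ := 1) (τ := 1) (by norm_num) (by norm_num)
    (fun x hx => (one_sub_pos hε (hα.trans_lt hx.1) (hx.2.trans_le hβ)).1.ne')
    (fun x hx => ?_) (fun x hx => ?_) (fun x hx h1 h2 => by rw [one_mul]; exact (hsp x hx h1 h2).le)
    (fun x hx h1 h2 => by rw [one_mul]; exact (hsm x hx h1 h2).le)
  · obtain ⟨s, hs, hs1, hs2⟩ := h.exists_mem hx.2
    have e : 0 < Ap s := by rw [h.ap s hs]; have := hsp s hs (hx.1.trans hs1) hs2; positivity
    exact e.trans_le (h.ap_anti hε hε1 hs1.le fun t ht t1 t2 =>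
      (hsp t ht (hx.1.trans t1) (t2.trans hs2)).le)
  · obtain ⟨s, hs, hs1, hs2⟩ := h.exists_mem hx.1
    have e : 0 < Am s := by rw [h.am s hs]; have := hsm s hs hs1 (hs2.trans hx.2); positivity
    exact e.trans_le (h.am_mono hε hε1 hs2.le fun t ht t1 t2 =>
      (hsm t ht (hs1.trans t1) (t2.trans hx.2)).le)

lemma values_left (h : Prof ε q S Ap Am m) {f : ℝ → ℝ × ℝ} {x c : ℝ} (hf : ContinuousAt f x)
    (hc : c < x) (hq : ∀ t ∈ S, c < t → t < x → q t = f t) :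
    Ap x = sp ε x (f x) ^ 2 ∧ Am x = sm ε x (f x) ^ 2 :=
  ⟨h.eq_of_left (g := fun t => sp ε t (f t) ^ 2) h.ap_cont.continuousAt (continuousAt_sp hf) hc
    fun t ht h1 h2 => by rw [h.ap t ht, hq t ht h1 h2],
  h.eq_of_left (g := fun t => sm ε t (f t) ^ 2) h.am_cont.continuousAt (continuousAt_sm hf) hc
    fun t ht h1 h2 => by rw [h.am t ht, hq t ht h1 h2]⟩

lemma values_right (h : Prof ε q S Ap Am m) {f : ℝ → ℝ × ℝ} {x d : ℝ} (hf : ContinuousAt f x)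
    (hd : x < d) (hq : ∀ t ∈ S, x < t → t < d → q t = f t) :
    Ap x = sp ε x (f x) ^ 2 ∧ Am x = sm ε x (f x) ^ 2 :=
  ⟨h.eq_of_right (g := fun t => sp ε t (f t) ^ 2) h.ap_cont.continuousAt (continuousAt_sp hf) hd
    fun t ht h1 h2 => by rw [h.ap t ht, hq t ht h1 h2],
  h.eq_of_right (g := fun t => sm ε t (f t) ^ 2) h.am_cont.continuousAt (continuousAt_sm hf) hd
    fun t ht h1 h2 => by rw [h.am t ht, hq t ht h1 h2]⟩

/-- At α the squares of both forms are continuous. The sign of sp is kept while sm passes from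
nonpositive to nonnegative, so the state behind is the flipped end state of the 1-wave; if that end
state is sonic, the flip does nothing. -/
lemma middle_eq (h : Prof ε q S Ap Am m) (hε : 0 < ε) (hε1 : ε < 1) {l : ℝ × ℝ} {α β : ℝ}
    (hl : l ∈ cone ε) (hα : -(1 / ε) < α) (hαβ : α < β) (hβ : β ≤ 1 / ε)
    (hL : ∀ x ∈ S, x ≠ -(1 / ε) → x < α → q x = curve1 ε l x)
    (hsm : ∀ x ∈ S, α < x → x < β → 0 < sm ε x (q x))
    (hsp : ∀ x ∈ S, α < x → x < β → 0 < sp ε x (q x)) :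
    ∀ x ∈ S, α < x → x < β → q x = behind1 ε l α := by
  intro x hx hx1 hx2
  have hconst := h.middle_const hε hε1.le hα.le hβ hsm hsp
  have hα2 : α < 1 / ε := hαβ.trans_le hβ
  have hall : ∀ t ∈ S, α < t → t < β → q t = q x := fun t ht h1 h2 =>
    hconst t ht x hx h1 h2 hx1 hx2
  obtain ⟨r1, r2⟩ := h.values_right (f := fun _ => q x) continuousAt_const hαβ hall
  obtain ⟨l1, l2⟩ := h.values_left (continuousAt_curve1 hε hε1 hl hα2) hα
    fun t ht h1 h2 => hL t ht h1.ne' h2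
  have d0 := (one_sub_pos hε hα hα2).1.ne'
  have hmem := curve1_mem hε hε1 hl hα2
  have n1 := sm_curve1 hε hε1 hl α
  have n2 := (sp_pos_of_sm_nonpos hε hα.le hα2.le hmem n1).le
  have n3 : 0 ≤ sp ε α (q x) :=
    h.le_of_right (f := fun _ => 0) (g := fun t => sp ε t (q x)) continuousAt_const
      (by unfold sp; fun_prop) hαβ fun t ht h1 h2 => by
        have := hsp t ht h1 h2
        rw [hall t ht h1 h2] at this
        exact this.le
  have n4 : 0 ≤ sm ε α (q x) :=
    h.le_of_right (f := fun _ => 0) (g := fun t => sm ε t (q x)) continuousAt_const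
      (by unfold sm; fun_prop) hαβ fun t ht h1 h2 => by
        have := hsm t ht h1 h2
        rw [hall t ht h1 h2] at this
        exact this.le
  refine eq_of_sp_sm d0 ?_ ?_
  · rw [behind1, sp_flip1 d0]
    exact (sq_eq_sq₀ n3 n2).1 (by rw [← r1, l1])
  · rw [behind1, sm_flip1 d0]
    exact (sq_eq_sq₀ n4 (by linarith)).1 (by rw [← r2, l2, neg_sq])

lemma middle_eq_right (h : Prof ε q S Ap Am m) (hε : 0 < ε) (hε1 : ε < 1) {r : ℝ × ℝ} {α β : ℝ}
    (hr : r ∈ cone ε) (hα : -(1 / ε) ≤ α) (hαβ : α < β) (hβ : β < 1 / ε)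
    (hR : ∀ x ∈ S, x ≠ 1 / ε → β < x → q x = curve2 ε r x)
    (hsm : ∀ x ∈ S, α < x → x < β → 0 < sm ε x (q x))
    (hsp : ∀ x ∈ S, α < x → x < β → 0 < sp ε x (q x)) :
    ∀ x ∈ S, α < x → x < β → q x = ahead2 ε r β := by
  have key := h.reflect.middle_eq hε hε1 (refl_mem hr) (α := -β) (β := -α) (by linarith)
    (by linarith) (by linarith)
    (fun x hx h1 h2 => by
      have := hR (-x) hx (fun h => h1 (by linarith)) (by linarith)
      show refl (q (-x)) = _
      rw [this, curve2, neg_neg, refl_refl])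
    (fun x hx h1 h2 => by
      show 0 < sm ε x (refl (q (-x)))
      rw [sm_refl]; exact hsp (-x) hx (by linarith) (by linarith))
    (fun x hx h1 h2 => by
      show 0 < sp ε x (refl (q (-x)))
      rw [sp_refl]; exact hsm (-x) hx (by linarith) (by linarith))
  intro x hx h1 h2
  have := key (-x) (by simpa using hx) (by linarith) (by linarith)
  have e : refl (q x) = behind1 ε (refl r) (-β) := by
    rw [← this, neg_neg]; rfl
  rw [ahead2, ← e, refl_refl]

theorem structure_nonvac (h : Prof ε q S Ap Am m) (hε : 0 < ε) (hε1 : ε < 1) {l r : ℝ × ℝ}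
    (hl : l ∈ cone ε) (hr : r ∈ cone ε) (hleft : ∀ x ∈ S, x < -(1 / ε) → q x = l)
    (hright : ∀ x ∈ S, 1 / ε < x → q x = r) :
    ∃ α β, -(1 / ε) < α ∧ α < β ∧ β < 1 / ε ∧ behind1 ε l α = ahead2 ε r β ∧
      ∀ᵐ x, q x = wave ε l r α β (behind1 ε l α) x := by
  obtain ⟨α, a1, a2, a3, a4⟩ := h.exists_split hε hε1
  obtain ⟨β, b1, b2, b3, b4⟩ := h.exists_split_right hε hε1
  obtain ⟨a1', hL⟩ := h.left_nonvac hε hε1 hl hleft a1 a2 a3 a4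
  obtain ⟨b2', hR⟩ := h.right_nonvac hε hε1 hr hright b1 b2 b3 b4
  -- Between β and α both forms would be nonpositive, which no nonvacuum state allows.
  have hle : α ≤ β := by
    by_contra hcon
    obtain ⟨x, hx, hx1, hx2⟩ := h.exists_mem (not_le.1 hcon)
    have e1 := hL x hx (b1.trans_lt hx1).ne' hx2
    have e2 := curve1_mem hε hε1 hl (hx2.trans_le a2)
    rw [← e1] at e2
    have e3 := cone_sum_pos hε (b1.trans hx1.le) (hx2.trans_le a2).le e2
    have e4 := a3 x hx (b1.trans_lt hx1) hx2
    have e5 := b4 x hx hx1 (hx2.trans_le a2)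
    linarith
  have hα2 : α < 1 / ε := hle.trans_lt b2'
  -- A single jump reversing both forms would need each of them to dominate the other in absolute
  -- value.
  have hne : α < β := by
    refine lt_of_le_of_ne hle ?_
    rintro rfl
    obtain ⟨l1, l2⟩ := h.values_left (continuousAt_curve1 hε hε1 hl hα2) a1'
      fun t ht h1 h2 => hL t ht h1.ne' h2
    obtain ⟨r1, r2⟩ := h.values_right (continuousAt_curve2 hε hε1 hr a1') hα2
      fun t ht h1 h2 => hR t ht h2.ne h1
    exact not_dom_both hε hε1 (sm_curve1 hε hε1 hl α) (sp_curve2 hε hε1 hr α)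
      (sp_dom hε a1' hα2 (curve1_mem hε hε1 hl hα2)) (sm_dom hε a1' hα2 (curve2_mem hε hε1 hr a1'))
      (by rw [← l1, r1]) (by rw [← l2, r2])
  have hsm : ∀ x ∈ S, α < x → x < β → 0 < sm ε x (q x) := fun x hx h1 h2 =>
    a4 x hx h1 (h2.trans b2')
  have hsp : ∀ x ∈ S, α < x → x < β → 0 < sp ε x (q x) := fun x hx h1 h2 =>
    b3 x hx (a1'.trans h1) h2
  have m1 := h.middle_eq hε hε1 hl a1' hne b2 hL hsm hsp
  have m2 := h.middle_eq_right hε hε1 hr a1 hne b2' hR hsm hsp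
  obtain ⟨x, hx, hx1, hx2⟩ := h.exists_mem hne
  refine ⟨α, β, a1', hne, b2', by rw [← m1 x hx hx1 hx2, m2 x hx hx1 hx2], ?_⟩
  filter_upwards [h.ae, Measure.ae_ne volume (-(1 / ε)), Measure.ae_ne volume (1 / ε),
    Measure.ae_ne volume α, Measure.ae_ne volume β] with x hx n1 n2 n3 n4
  rw [wave]
  split_ifs with c1 c2
  · exact hL x hx n1 c1
  · exact m1 x hx (lt_of_le_of_ne (not_lt.1 c1) n3.symm) c2
  · exact hR x hx n2 (lt_of_le_of_ne (not_lt.1 c2) n4.symm)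

/-- A constant nonvacuum state adjacent to the vacuum would have both squares zero at the interface,
contradicting the positivity of sp + sm up to and including the light cone. -/
lemma not_middle_vac (h : Prof ε q S Ap Am m) (hε : 0 < ε) (hε1 : ε ≤ 1) {α β : ℝ}
    (hα : -(1 / ε) ≤ α) (hαβ : α < β) (hβ : β ≤ 1 / ε)
    (hR : ∀ x ∈ S, x ≠ 1 / ε → β < x → q x = (0, 0))
    (hsm : ∀ x ∈ S, α < x → x < β → 0 < sm ε x (q x))
    (hsp : ∀ x ∈ S, α < x → x < β → 0 < sp ε x (q x)) : False := by
  have hconst := h.middle_const hε hε1 hα hβ hsm hsp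
  obtain ⟨x, hx, hx1, hx2⟩ := h.exists_mem hαβ
  obtain ⟨l1, l2⟩ := h.values_left (f := fun _ => q x) continuousAt_const hαβ
    fun t ht h1 h2 => hconst t ht x hx h1 h2 hx1 hx2
  obtain ⟨d, hd, hd'⟩ : ∃ d, β < d ∧ (d ≤ 1 / ε ∨ 1 / ε ≤ β) := by
    rcases hβ.eq_or_lt with he | hlt
    · exact ⟨β + 1, by linarith, Or.inr he.ge⟩
    · exact ⟨1 / ε, hlt, Or.inl le_rfl⟩
  obtain ⟨r1, r2⟩ := h.values_right (f := fun _ => (0, 0)) continuousAt_const hd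
    fun t ht h1 h2 => hR t ht (by rcases hd' with h' | h' <;> [exact (h2.trans_le h').ne; exact (h'.trans_lt h1).ne']) h1
  rw [l1, sp_vac] at r1
  rw [l2, sm_vac] at r2
  have := cone_sum_pos hε (hα.trans hαβ.le) hβ (h.cone_of_sp_ne (hsp x hx hx1 hx2).ne')
  have e1 := pow_eq_zero_iff two_ne_zero |>.1 (r1.trans (by norm_num))
  have e2 := pow_eq_zero_iff two_ne_zero |>.1 (r2.trans (by norm_num))
  linarith

theorem structure_vac_right (h : Prof ε q S Ap Am m) (hε : 0 < ε) (hε1 : ε < 1) {l : ℝ × ℝ}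
    (hl : l ∈ cone ε) (hleft : ∀ x ∈ S, x < -(1 / ε) → q x = l)
    (hright : ∀ x ∈ S, 1 / ε < x → q x = (0, 0)) :
    ∀ᵐ x, q x = if x < 1 / ε then curve1 ε l x else (0, 0) := by
  obtain ⟨α, a1, a2, a3, a4⟩ := h.exists_split hε hε1
  obtain ⟨β, b1, b2, b3, b4⟩ := h.exists_split_right hε hε1
  obtain ⟨a1', hL⟩ := h.left_nonvac hε hε1 hl hleft a1 a2 a3 a4
  have hR := h.right_vac hε hε1 hright b1 b4
  have hle : α ≤ β := by
    by_contra hcon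
    obtain ⟨x, hx, hx1, hx2⟩ := h.exists_mem (not_le.1 hcon)
    have e1 := hL x hx (b1.trans_lt hx1).ne' hx2
    have e2 := curve1_mem hε hε1 hl (hx2.trans_le a2)
    rw [← e1, hR x hx (hx2.trans_le a2).ne hx1] at e2
    exact lt_irrefl _ (cone_fst_pos hε e2)
  -- If the 1-wave ended earlier, it would meet the vacuum either directly, which continuity of Ap
  -- excludes, or through an intermediate state, which `not_middle_vac` excludes.
  have hα : α = 1 / ε := by
    by_contra hne
    have hα2 : α < 1 / ε := lt_of_le_of_ne a2 hne
    rcases hle.eq_or_lt with rfl | hlt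
    · obtain ⟨l1, -⟩ := h.values_left (continuousAt_curve1 hε hε1 hl hα2) a1'
        fun t ht h1 h2 => hL t ht h1.ne' h2
      obtain ⟨r1, -⟩ := h.values_right (f := fun _ => (0, 0)) continuousAt_const hα2
        fun t ht h1 h2 => hR t ht h2.ne h1
      have := sp_pos_of_sm_nonpos hε a1 a2 (curve1_mem hε hε1 hl hα2) (sm_curve1 hε hε1 hl α)
      rw [l1, sp_vac] at r1
      nlinarith
    · exact h.not_middle_vac hε hε1.le a1 hlt b2 hR
        (fun x hx h1 h2 => a4 x hx h1 (h2.trans_le b2))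
        (fun x hx h1 h2 => b3 x hx (a1'.trans h1) h2)
  filter_upwards [h.ae, Measure.ae_ne volume (-(1 / ε)), Measure.ae_ne volume (1 / ε)]
    with x hx n1 n2
  split_ifs with c1
  · exact hL x hx n1 (hα ▸ c1)
  · exact hright x hx (lt_of_le_of_ne (not_lt.1 c1) n2.symm)

theorem structure_vac_left (h : Prof ε q S Ap Am m) (hε : 0 < ε) (hε1 : ε < 1) {r : ℝ × ℝ}
    (hr : r ∈ cone ε) (hleft : ∀ x ∈ S, x < -(1 / ε) → q x = (0, 0))
    (hright : ∀ x ∈ S, 1 / ε < x → q x = r) :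
    ∀ᵐ x, q x = if -(1 / ε) < x then curve2 ε r x else (0, 0) := by
  have key := h.reflect.structure_vac_right hε hε1 (refl_mem hr)
    (fun x hx h1 => by rw [hright (-x) hx (by linarith)]; rfl)
    (fun x hx h1 => by rw [hleft (-x) hx (by linarith)]; simp)
  have key2 := (Measure.measurePreserving_neg (volume : Measure ℝ)).quasiMeasurePreserving.ae key
  filter_upwards [key2] with x hx
  rw [neg_neg] at hx
  have e : q x = refl (refl (q x)) := (refl_refl _).symm
  rw [e, show refl (q x) = _ from hx]
  by_cases c : -(1 / ε) < x
  · rw [if_pos (by linarith), if_pos c, curve2]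
  · rw [if_neg (fun h => c (by linarith)), if_neg c, refl_zero]

theorem structure_vac (h : Prof ε q S Ap Am m) (hε : 0 < ε) (hε1 : ε < 1)
    (hleft : ∀ x ∈ S, x < -(1 / ε) → q x = (0, 0))
    (hright : ∀ x ∈ S, 1 / ε < x → q x = (0, 0)) :
    ∀ᵐ x, q x = (0, 0) := by
  obtain ⟨α, a1, a2, a3, a4⟩ := h.exists_split hε hε1
  obtain ⟨β, b1, b2, b3, b4⟩ := h.exists_split_right hε hε1
  have hL := h.left_vac hε hε1 hleft a2 a3
  have hR := h.right_vac hε hε1 hright b1 b4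
  have hle : β ≤ α := by
    by_contra hcon
    exact h.not_middle_vac hε hε1.le a1 (not_le.1 hcon) b2 hR
      (fun x hx h1 h2 => a4 x hx h1 (h2.trans_le b2))
      (fun x hx h1 h2 => b3 x hx (a1.trans_lt h1) h2)
  filter_upwards [h.ae, Measure.ae_ne volume (-(1 / ε)), Measure.ae_ne volume (1 / ε),
    Measure.ae_ne volume α] with x hx n1 n2 n3
  rcases lt_or_gt_of_ne n3 with c | c
  · exact hL x hx n1 c
  · exact hR x hx n2 (hle.trans_lt c)

end Prof

/-! ### Far field and the case of light-speed sound -/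

lemma conserved_inj {ε : ℝ} (hε : 0 < ε) (hε1 : ε ≤ 1) {p q : ℝ × ℝ}
    (hp : p = (0, 0) ∨ p ∈ cone ε) (hq : q = (0, 0) ∨ q ∈ cone ε) (hG : GA ε p = GA ε q)
    (hH : HA ε p = HA ε q) : p = q := by
  rw [← phiInvA_apply hε hε1 hp, ← phiInvA_apply hε hε1 hq, hG, hH]

lemma IsRiemannSolution.far_field {ε : ℝ} (hε : 0 < ε) (hε1 : ε ≤ 1) {pl pr p₀ q₀ : ℝ × ℝ}
    {ψ : ℝ → ℝ × ℝ} (h : IsRiemannSolution ε pl pr ψ) {c : ℝ}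
    (hfar : ∀ᵐ ξ, ∀ t : ℝ, 0 < t → t < 1 → c - 1 < t * ξ → t * ξ < c + 1 → toA ε (ψ ξ) = q₀)
    (h0 : ∀ x, c - 1 < x → x < c + 1 → riemannData pl pr x = p₀) (hp : Adm ε p₀)
    (hq : q₀ = (0, 0) ∨ q₀ ∈ cone ε) : q₀ = toA ε p₀ := by
  obtain ⟨M, hM, ht'⟩ := h.tame
  have ht : ∀ x, ψ x ∈ tameRegion ε M := fun x => by simpa using ht' 1 x one_pos
  have hm := h.measurable
  have ha : ∀ x, Adm ε (ψ x) := fun x => adm_of_tame hM (ht x)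
  -- Applied to ±G and ±H, the comparison with the initial value becomes an equality of conserved
  -- variables, which determine the state.
  have key : ∀ U V : ℝ × ℝ → ℝ, ∀ u v : ℝ, IsWeakEntropyPair ε U V → IsConvexEntropy ε U →
      (∀ x, toA ε (ψ x) = q₀ → U (ψ x) = u ∧ V (ψ x) = v) → u ≤ U p₀ := by
    intro U V u v hp hc huv
    obtain ⟨bU, bV⟩ := hp.bddMeas hM hm ht
    refine (h.weakIneq hp hc).le_initial bU bV (c := c) (V := v) ?_ fun x x1 x2 => by rw [h0 x x1 x2]
    filter_upwards [hfar] with ξ hξ t t1 t2 t3 t4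
    exact huv ξ (hξ t t1 t2 t3 t4)
  have pGH := isWeakEntropyPair_GH hε hε1
  have pHF := isWeakEntropyPair_HF hε hε1
  have g1 := key (G ε) (H ε) (GA ε q₀) (HA ε q₀) pGH
    (by simpa using isConvexEntropy_linear hε 1 0)
    fun x hx => ⟨by rw [G_eq hε (ha x), hx], by rw [H_eq hε (ha x), hx]⟩
  have g2 := key _ _ (-GA ε q₀) (-HA ε q₀) pGH.neg
    (by simpa using isConvexEntropy_linear hε (-1) 0)
    fun x hx => ⟨by rw [G_eq hε (ha x), hx], by rw [H_eq hε (ha x), hx]⟩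
  have g3 := key (H ε) (F ε) (HA ε q₀) (FA ε q₀) pHF
    (by simpa using isConvexEntropy_linear hε 0 1)
    fun x hx => ⟨by rw [H_eq hε (ha x), hx], by rw [F_eq hε (ha x), hx]⟩
  have g4 := key _ _ (-HA ε q₀) (-FA ε q₀) pHF.neg
    (by simpa using isConvexEntropy_linear hε 0 (-1))
    fun x hx => ⟨by rw [H_eq hε (ha x), hx], by rw [F_eq hε (ha x), hx]⟩
  rw [G_eq hε hp] at g1 g2
  rw [H_eq hε hp] at g3 g4
  exact conserved_inj hε hε1 hq (toA_cases hε hp) (by linarith) (by linarith)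

/-- Profiles with the far field determined by the initial data. -/
theorem IsRiemannSolution.prof_far {ε : ℝ} (hε : 0 < ε) (hε1 : ε ≤ 1) {pl pr : ℝ × ℝ}
    {ψ : ℝ → ℝ × ℝ} (h : IsRiemannSolution ε pl pr ψ) (hl : Adm ε pl) (hr : Adm ε pr) :
    ∃ (S : Set ℝ) (Ap Am m : ℝ → ℝ), Prof ε (fun x => toA ε (ψ x)) S Ap Am m ∧
      (∀ x ∈ S, x < -(1 / ε) → toA ε (ψ x) = toA ε pl) ∧
      (∀ x ∈ S, 1 / ε < x → toA ε (ψ x) = toA ε pr) := by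
  obtain ⟨S, Ap, Am, m, hP⟩ := h.prof hε hε1
  have h0 : 0 < 1 / ε := by positivity
  refine ⟨S, Ap, Am, m, hP, fun x hx hxe => ?_, fun x hx hxe => ?_⟩
  · refine h.far_field hε hε1 (c := -(1 / ε) - 1) (p₀ := pl) ?_ (fun y y1 y2 => ?_) hl (hP.cases x)
    · filter_upwards [hP.ae] with ξ hξ t t1 t2 t3 t4
      have hξe : ξ < -(1 / ε) := by
        by_contra hcon
        have e1 : -(1 / ε) ≤ ξ := not_lt.1 hcon
        nlinarith
      rcases lt_trichotomy ξ x with hlt | rfl | hlt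
      · exact hP.outer_const hε hε1 ξ hξ x hx hlt hxe
      · rfl
      · exact (hP.outer_const hε hε1 x hx ξ hξ hlt hξe).symm
    · rw [riemannData, if_pos (by linarith)]
  · have hout : ∀ y ∈ S, ∀ z ∈ S, y < z → 1 / ε < y → toA ε (ψ y) = toA ε (ψ z) := by
      intro y hy z hz hyz hye
      have := hP.reflect.outer_const hε hε1 (-z) (by simpa using hz) (-y) (by simpa using hy)
        (by linarith) (by linarith)
      simp only [neg_neg, Prod.mk.injEq, neg_inj] at this
      exact (Prod.ext this.1 this.2).symm
    refine h.far_field hε hε1 (c := 1 / ε + 1) (p₀ := pr) ?_ (fun y y1 y2 => ?_) hr (hP.cases x)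
    · filter_upwards [hP.ae] with ξ hξ t t1 t2 t3 t4
      have hξe : 1 / ε < ξ := by
        by_contra hcon
        have e1 : ξ ≤ 1 / ε := not_lt.1 hcon
        nlinarith
      rcases lt_trichotomy ξ x with hlt | rfl | hlt
      · exact hout ξ hξ x hx hlt hξe
      · rfl
      · exact (hout x hx ξ hξ hlt hxe).symm
    · rw [riemannData, if_neg (by linarith)]

/-! ### Structure of solutions for ε = 1 -/

/-- The Riemann profile when the sound speed equals the speed of light. -/
def wave1 (l r : ℝ × ℝ) (x : ℝ) : ℝ × ℝ :=
  if x < -1 then l else if x < 1 then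
    (((l.1 + l.2) + (r.1 - r.2)) / 2, ((l.1 + l.2) - (r.1 - r.2)) / 2) else r

namespace Prof

variable {q : ℝ → ℝ × ℝ} {S : Set ℝ} {Ap Am m : ℝ → ℝ}

/-- For ε = 1 the form sp is (1-x)(a+b) and Ap' = -2Ap/(1-x) holds whatever the other component
does. So a+b keeps its left value up to x = 1, and no entropy condition is needed. -/
lemma sum_eq_left (h : Prof 1 q S Ap Am m) {l : ℝ × ℝ} (hleft : ∀ x ∈ S, x < -1 → q x = l) :
    ∀ x ∈ S, x < 1 → (q x).1 + (q x).2 = l.1 + l.2 := by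
  intro x hx hx1
  have hnn : ∀ y, 0 ≤ (q y).1 + (q y).2 := fun y => by
    simpa using (h.c_nonneg one_pos le_rfl y).1
  obtain ⟨z, hz, hz1, hz2⟩ := h.exists_mem (show min x (-1) - 1 < min x (-1) by linarith)
  have hzx : z < x := hz2.trans_le (min_le_left _ _)
  have hz3 : z < -1 := hz2.trans_le (min_le_right _ _)
  have hder : ∀ y ∈ Ioo (z - 1) 1, HasDerivAt Ap (-(2 * Ap y / (1 - y))) y := by
    intro y hy
    refine hasDerivAt_of_integral (g := fun y => -(2 * Ap y / (1 - y))) h.ae h.ap_int ?_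
      (fun t ht h1 h2 => ?_) hy
    · have := h.ap_cont
      refine ContinuousOn.neg (ContinuousOn.div (by fun_prop) (by fun_prop) fun w hw => ?_)
      exact (sub_pos.2 hw.2).ne'
    · have : 1 - t ≠ 0 := (sub_pos.2 h2).ne'
      rw [h.ap t ht]
      simp only [sp]; field_simp
  have hconst : Ap x / (1 - x) ^ 2 = Ap z / (1 - z) ^ 2 := by
    have hd : ∀ y ∈ Ioo (z - 1) 1, HasDerivAt (fun y => Ap y / (1 - y) ^ 2) 0 y := by
      intro y hy
      have hne : 1 - y ≠ 0 := (sub_pos.2 hy.2).ne'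
      refine ((hder y hy).div (((hasDerivAt_id' y).const_sub 1).pow 2)
        (pow_ne_zero 2 hne)).congr_deriv ?_
      simp only [Pi.pow_apply]
      field_simp; ring
    exact isOpen_Ioo.is_const_of_deriv_eq_zero isPreconnected_Ioo
      (fun y hy => (hd y hy).differentiableAt.differentiableWithinAt)
      (fun y hy => (hd y hy).deriv) ⟨by linarith, hx1⟩ ⟨by linarith, by linarith⟩
  have e : ∀ y ∈ S, y < 1 → Ap y / (1 - y) ^ 2 = ((q y).1 + (q y).2) ^ 2 := by
    intro y hy hy1
    have hne : 1 - y ≠ 0 := (sub_pos.2 hy1).ne'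
    rw [h.ap y hy]; simp only [sp]; field_simp
  rw [e x hx hx1, e z hz (by linarith)] at hconst
  rw [(sq_eq_sq₀ (hnn x) (hnn z)).1 hconst, hleft z hz hz3]

theorem structure_one (h : Prof 1 q S Ap Am m) {l r : ℝ × ℝ}
    (hleft : ∀ x ∈ S, x < -(1 / 1) → q x = l) (hright : ∀ x ∈ S, 1 / 1 < x → q x = r) :
    ∀ᵐ x, q x = wave1 l r x := by
  rw [div_one] at hleft hright
  have h1 := h.sum_eq_left hleft
  have h2 := h.reflect.sum_eq_left (l := refl r)
    (fun x hx hx1 => by rw [hright (-x) hx (by linarith)]; rfl)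
  filter_upwards [h.ae, Measure.ae_ne volume (-1 : ℝ), Measure.ae_ne volume (1 : ℝ)]
    with x hx n1 n2
  rw [wave1]
  split_ifs with c1 c2
  · exact hleft x hx c1
  · have e1 := h1 x hx c2
    have e2 := h2 (-x) (by simpa using hx) (by
      have := lt_of_le_of_ne (not_lt.1 c1) n1.symm
      linarith)
    simp only [neg_neg, refl] at e2
    ext
    · show (q x).1 = _
      linarith
    · show (q x).2 = _
      linarith
  · exact hright x hx (lt_of_le_of_ne (not_lt.1 c2) n2.symm)

end Prof

/-! ### Uniqueness of the intermediate state -/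

/-- Density in square-root coordinates. -/
def rhoA (ε : ℝ) (q : ℝ × ℝ) : ℝ := q.1 ^ 2 - ε ^ 2 * q.2 ^ 2

/-- Ratio of the light-cone coordinates. -/
def ratA (ε : ℝ) (q : ℝ × ℝ) : ℝ := (q.1 + ε * q.2) / (q.1 - ε * q.2)

/-- Velocity relative to the slope `x`. -/
def relV (ε x : ℝ) (q : ℝ × ℝ) : ℝ := (q.2 - x * q.1) / (q.1 - ε ^ 2 * x * q.2)

/-- Density ratio across a shock as a function of the relative velocity. -/
def shockRho (ε w : ℝ) : ℝ := (w ^ 2 - ε ^ 2) / (1 - ε ^ 2 * w ^ 2)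

/-- Ratio of the light-cone ratios across a `1`-shock. -/
def shockRat (ε w : ℝ) : ℝ := ((w + ε) * (1 - ε * w)) / ((w - ε) * (1 + ε * w))

lemma cone_light {ε : ℝ} (hε : 0 < ε) {q : ℝ × ℝ} (h : q ∈ cone ε) :
    0 < q.1 + ε * q.2 ∧ 0 < q.1 - ε * q.2 := by
  obtain ⟨h1, h2⟩ := (cone_iff hε).1 h
  constructor <;> linarith

lemma ratA_pos {ε : ℝ} (hε : 0 < ε) {q : ℝ × ℝ} (h : q ∈ cone ε) : 0 < ratA ε q :=
  div_pos (cone_light hε h).1 (cone_light hε h).2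

lemma rhoA_refl (ε : ℝ) (q : ℝ × ℝ) : rhoA ε (refl q) = rhoA ε q := by simp [rhoA, refl]

lemma ratA_refl (ε : ℝ) (q : ℝ × ℝ) : ratA ε (refl q) = (ratA ε q)⁻¹ := by
  simp only [ratA, refl, inv_div]; congr 1 <;> ring

/-- In the light-cone coordinates a ± εb the flip acts by scaling, with factors depending only on
the relative velocity w; the jumps of density and ratio across a shock are the product and quotient
of these factors. -/
lemma flip1_light {ε x : ℝ} (hε : 0 < ε) (h1 : -(1 / ε) < x) (h2 : x < 1 / ε) {q : ℝ × ℝ}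
    (h : q ∈ cone ε) (hs : sm ε x q ≤ 0) :
    1 ≤ relV ε x q ∧ ε * relV ε x q < 1 ∧
    (flip1 ε x q).1 + ε * (flip1 ε x q).2 =
      (q.1 + ε * q.2) * ((relV ε x q + ε) / (1 + ε * relV ε x q)) ∧
    (flip1 ε x q).1 - ε * (flip1 ε x q).2 =
      (q.1 - ε * q.2) * ((relV ε x q - ε) / (1 - ε * relV ε x q)) := by
  obtain ⟨d0, d1, d2⟩ := one_sub_pos hε h1 h2
  obtain ⟨c1, c2⟩ := cone_light hε h
  have hD : 0 < q.1 - ε ^ 2 * x * q.2 := by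
    have := cone_sum_pos hε h1.le h2.le h
    simp only [sp, sm] at this; linarith
  have w1 : 1 ≤ relV ε x q := by
    rw [relV, le_div_iff₀ hD]; simp only [sm] at hs; linarith
  have n3 := hD.ne'
  have e1 : 1 + ε * relV ε x q = (q.1 + ε * q.2) * (1 - ε * x) / (q.1 - ε ^ 2 * x * q.2) := by
    rw [relV, eq_div_iff n3, add_mul, mul_assoc ε, div_mul_cancel₀ _ n3]; ring
  have e2 : 1 - ε * relV ε x q = (q.1 - ε * q.2) * (1 + ε * x) / (q.1 - ε ^ 2 * x * q.2) := by
    rw [relV, eq_div_iff n3, sub_mul, mul_assoc ε, div_mul_cancel₀ _ n3]; ring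
  have w2 : 0 < 1 - ε * relV ε x q := by rw [e2]; positivity
  have f1 : relV ε x q + ε = (q.2 - x * q.1 + ε * (q.1 - ε ^ 2 * x * q.2)) /
      (q.1 - ε ^ 2 * x * q.2) := by rw [relV, eq_div_iff n3, add_mul, div_mul_cancel₀ _ n3]
  have f2 : relV ε x q - ε = (q.2 - x * q.1 - ε * (q.1 - ε ^ 2 * x * q.2)) /
      (q.1 - ε ^ 2 * x * q.2) := by rw [relV, eq_div_iff n3, sub_mul, div_mul_cancel₀ _ n3]
  have hd : 1 - ε ^ 2 * x ^ 2 = (1 - ε * x) * (1 + ε * x) := by ring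
  have n1 := c1.ne'
  have n2 := c2.ne'
  have n4 := d1.ne'
  have n5 := d2.ne'
  refine ⟨w1, by linarith, ?_, ?_⟩
  · rw [e1, f1, div_div_div_cancel_right₀ n3, ← mul_div_assoc, mul_div_mul_left _ _ n1]
    simp only [flip1, sp, sm, hd]
    rw [eq_div_iff n5]
    field_simp; ring
  · rw [e2, f2, div_div_div_cancel_right₀ n3, ← mul_div_assoc, mul_div_mul_left _ _ n2]
    simp only [flip1, sp, sm, hd]
    rw [eq_div_iff n4]
    field_simp; ring

lemma flip1_mem {ε x : ℝ} (hε : 0 < ε) (hε1 : ε < 1) (h1 : -(1 / ε) < x) (h2 : x < 1 / ε)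
    {q : ℝ × ℝ} (h : q ∈ cone ε) (hs : sm ε x q ≤ 0) : flip1 ε x q ∈ cone ε := by
  have d0 := (one_sub_pos hε h1 h2).1.ne'
  rw [cone_char hε h1 h2, sp_flip1 d0, sm_flip1 d0]
  have h3 := cone_sum_pos hε h1.le h2.le h
  rw [sub_neg_eq_add, abs_of_pos h3]
  nlinarith

lemma behind1_mem {ε : ℝ} (hε : 0 < ε) (hε1 : ε < 1) {l : ℝ × ℝ} (hl : l ∈ cone ε) {x : ℝ}
    (h1 : -(1 / ε) < x) (h2 : x < 1 / ε) : behind1 ε l x ∈ cone ε :=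
  flip1_mem hε hε1 h1 h2 (curve1_mem hε hε1 hl h2) (sm_curve1 hε hε1 hl x)

lemma rhoA_eq_mul (ε : ℝ) (q : ℝ × ℝ) : rhoA ε q = (q.1 + ε * q.2) * (q.1 - ε * q.2) := by
  rw [rhoA]; ring

lemma behind1_shock {ε : ℝ} (hε : 0 < ε) (hε1 : ε < 1) {l : ℝ × ℝ} (hl : l ∈ cone ε) {x : ℝ}
    (h1 : -(1 / ε) < x) (hx : x ≤ lam1A ε l) :
    1 ≤ relV ε x l ∧ ε * relV ε x l < 1 ∧
    rhoA ε (behind1 ε l x) = rhoA ε l * shockRho ε (relV ε x l) ∧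
    ratA ε (behind1 ε l x) = ratA ε l * shockRat ε (relV ε x l) := by
  have h2 := hx.trans_lt (lam1A_bounds hε hε1 hl).2
  have hb : behind1 ε l x = flip1 ε x l := by
    rw [behind1]
    congr 1
    rcases hx.eq_or_lt with rfl | hx
    · rw [curve1, if_neg (lt_irrefl _)]; exact fanQ_lam1A hε hε1 hl
    · rw [curve1, if_pos hx]
  have hs : sm ε x l ≤ 0 := by
    rw [sm_eq hε hε1.le hl]
    exact mul_nonpos_of_nonneg_of_nonpos (cone_c_pos hε hε1.le hl).2.le (by linarith)
  obtain ⟨w1, w2, w3, w4⟩ := flip1_light hε h1 h2 hl hs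
  refine ⟨w1, w2, ?_, ?_⟩
  · have hd : 1 - ε ^ 2 * relV ε x l ^ 2 = (1 - ε * relV ε x l) * (1 + ε * relV ε x l) := by ring
    rw [hb, rhoA_eq_mul, rhoA_eq_mul, w3, w4, shockRho, hd]
    have n1 : 1 - ε * relV ε x l ≠ 0 := by linarith
    have n2 : 1 + ε * relV ε x l ≠ 0 := by positivity
    field_simp; ring
  · rw [hb, ratA, ratA, w3, w4, shockRat]
    have n1 : 1 - ε * relV ε x l ≠ 0 := by linarith
    have n2 : 1 + ε * relV ε x l ≠ 0 := by positivity
    have n3 : relV ε x l - ε ≠ 0 := by linarith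
    have n4 := (cone_light hε hl).2.ne'
    field_simp

lemma light_fanQ {ε s x : ℝ} (hε : 0 < ε) (h1 : -(1 / ε) < x) (h2 : x < 1 / ε) :
    (fanQ ε s x).1 + ε * (fanQ ε s x).2 = (1 + ε) * (s * fanP ε x) / (2 * (1 - ε * x)) ∧
    (fanQ ε s x).1 - ε * (fanQ ε s x).2 = (1 - ε) * (s * fanP ε x) / (2 * (1 + ε * x)) := by
  obtain ⟨d0, d1, d2⟩ := one_sub_pos hε h1 h2
  have hd : 1 - ε ^ 2 * x ^ 2 = (1 - ε * x) * (1 + ε * x) := by ring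
  have n4 := d1.ne'
  have n5 := d2.ne'
  constructor <;> (simp only [fanQ, hd]; field_simp; ring)

lemma fanP_sq {ε x : ℝ} (hε : 0 < ε) (h1 : -(1 / ε) < x) (h2 : x < 1 / ε) :
    fanP ε x ^ 2 / (1 - ε ^ 2 * x ^ 2) =
      ((1 - ε * x) / (1 + ε * x)) ^ ((1 + ε ^ 2) / (2 * ε)) := by
  obtain ⟨d0, d1, d2⟩ := one_sub_pos hε h1 h2
  have hd : 1 - ε ^ 2 * x ^ 2 = (1 - ε * x) * (1 + ε * x) := by ring
  have sq : ∀ y p : ℝ, 0 < y → (y ^ p) ^ 2 = y ^ (p * ((2 : ℕ) : ℝ)) := fun y p hy => by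
    rw [Real.rpow_mul hy.le, Real.rpow_natCast]
  rw [Real.div_rpow d2.le d1.le, fanP, mul_pow, sq _ _ d2, sq _ _ d1, hd,
    div_eq_div_iff (by positivity) (Real.rpow_pos_of_pos d1 _).ne']
  have a1 : (1 + ε) ^ 2 / (4 * ε) * ((2 : ℕ) : ℝ) = (1 + ε ^ 2) / (2 * ε) + 1 := by
    push_cast; field_simp; ring
  have a2 : -((1 - ε) ^ 2 / (4 * ε)) * ((2 : ℕ) : ℝ) = 1 - (1 + ε ^ 2) / (2 * ε) := by
    push_cast; field_simp; ring
  rw [a1, a2, Real.rpow_add_one d2.ne', Real.rpow_sub d1, Real.rpow_one]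
  have := (Real.rpow_pos_of_pos d1 ((1 + ε ^ 2) / (2 * ε))).ne'
  field_simp

lemma rhoA_fanQ {ε s x : ℝ} (hε : 0 < ε) (h1 : -(1 / ε) < x) (h2 : x < 1 / ε) :
    rhoA ε (fanQ ε s x) = (1 - ε ^ 2) * s ^ 2 / 4 *
      ((1 - ε * x) / (1 + ε * x)) ^ ((1 + ε ^ 2) / (2 * ε)) := by
  obtain ⟨d0, d1, d2⟩ := one_sub_pos hε h1 h2
  rw [rhoA_eq_mul, (light_fanQ hε h1 h2).1, (light_fanQ hε h1 h2).2, ← fanP_sq hε h1 h2,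
    show 1 - ε ^ 2 * x ^ 2 = (1 - ε * x) * (1 + ε * x) by ring]
  have n4 := d1.ne'
  have n5 := d2.ne'
  field_simp; ring

lemma ratA_fanQ {ε s x : ℝ} (hε : 0 < ε) (hε1 : ε < 1) (h1 : -(1 / ε) < x) (h2 : x < 1 / ε)
    (hs : 0 < s) : ratA ε (fanQ ε s x) = (1 + ε) / (1 - ε) * ((1 + ε * x) / (1 - ε * x)) := by
  obtain ⟨d0, d1, d2⟩ := one_sub_pos hε h1 h2
  rw [ratA, (light_fanQ hε h1 h2).1, (light_fanQ hε h1 h2).2]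
  have n1 := hs.ne'
  have n2 := (fanP_pos hε h1 h2).ne'
  have n3 : 1 - ε ≠ 0 := by linarith
  have n4 := d1.ne'
  have n5 := d2.ne'
  field_simp

lemma behind1_fan {ε : ℝ} (hε : 0 < ε) (hε1 : ε < 1) {l : ℝ × ℝ} (hl : l ∈ cone ε) {x : ℝ}
    (hx : lam1A ε l ≤ x) (h2 : x < 1 / ε) :
    behind1 ε l x = fanQ ε (sp ε (lam1A ε l) l / fanP ε (lam1A ε l)) x := by
  have h1 := (lam1A_bounds hε hε1 hl).1.trans_le hx
  have d0 := (one_sub_pos hε h1 h2).1.ne'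
  rw [behind1, curve1, if_neg (not_lt.2 hx)]
  refine eq_of_sp_sm d0 (sp_flip1 d0 _) ?_
  rw [sm_flip1 d0, sm_fanQ, neg_zero]

lemma relV_anti {ε : ℝ} (hε : 0 < ε) {l : ℝ × ℝ} (hl : l ∈ cone ε) {x y : ℝ}
    (h1 : -(1 / ε) < x) (hxy : x < y) (h2 : y < 1 / ε) : relV ε y l < relV ε x l := by
  have hD : ∀ z, -(1 / ε) < z → z < 1 / ε → 0 < l.1 - ε ^ 2 * z * l.2 := by
    intro z z1 z2
    have := cone_sum_pos hε z1.le z2.le hl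
    simp only [sp, sm] at this; linarith
  rw [relV, relV, div_lt_div_iff₀ (hD y (h1.trans hxy) h2) (hD x h1 (hxy.trans h2))]
  have := cone_rho_pos hε hl
  nlinarith

lemma shockRho_mono {ε w w' : ℝ} (hε : 0 < ε) (hε1 : ε < 1) (h1 : 1 ≤ w) (h2 : w < w')
    (h3 : ε * w' < 1) : shockRho ε w < shockRho ε w' := by
  have e1 : (ε * w') ^ 2 < 1 := by
    have : 0 < ε * w' := mul_pos hε (by linarith)
    nlinarith
  have e2 : w ^ 2 < w' ^ 2 := by nlinarith
  have e3 : (ε * w) ^ 2 < 1 := by nlinarith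
  rw [shockRho, shockRho, div_lt_div_iff₀ (by linarith) (by linarith)]
  have : ε ^ 2 * ε ^ 2 < 1 := by nlinarith [sq_nonneg ε, mul_pos hε hε]
  nlinarith

lemma shockRat_anti {ε w w' : ℝ} (hε : 0 < ε) (hε1 : ε < 1) (h1 : 1 ≤ w) (h2 : w < w')
    (h3 : ε * w' < 1) : shockRat ε w' < shockRat ε w := by
  have g1 : ε * w < 1 := (mul_lt_mul_of_pos_left h2 hε).trans h3
  have a1 : (w' + ε) / (w' - ε) < (w + ε) / (w - ε) := by
    rw [div_lt_div_iff₀ (by linarith) (by linarith)]; nlinarith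
  have a2 : (1 - ε * w') / (1 + ε * w') < (1 - ε * w) / (1 + ε * w) := by
    rw [div_lt_div_iff₀ (by nlinarith) (by nlinarith)]; nlinarith
  have e : ∀ w, shockRat ε w = (w + ε) / (w - ε) * ((1 - ε * w) / (1 + ε * w)) := fun w => by
    rw [shockRat, mul_div_mul_comm]
  rw [e, e]
  exact mul_lt_mul'' a1 a2 (div_nonneg (by linarith) (by linarith))
    (div_nonneg (by linarith) (by nlinarith))

/-- On the shock branch both quantities are monotone in the relative velocity, which falls as the
slope grows; on the fan branch they are explicit in (1-εx)/(1+εx). The branches meet at the wave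
speed of l. -/
lemma behind1_mono {ε : ℝ} (hε : 0 < ε) (hε1 : ε < 1) {l : ℝ × ℝ} (hl : l ∈ cone ε) {x y : ℝ}
    (h1 : -(1 / ε) < x) (hxy : x < y) (h2 : y < 1 / ε) :
    rhoA ε (behind1 ε l y) < rhoA ε (behind1 ε l x) ∧
      ratA ε (behind1 ε l x) < ratA ε (behind1 ε l y) := by
  obtain ⟨b1, b2⟩ := lam1A_bounds hε hε1 hl
  have shock : ∀ x y, -(1 / ε) < x → x < y → y ≤ lam1A ε l →
      rhoA ε (behind1 ε l y) < rhoA ε (behind1 ε l x) ∧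
      ratA ε (behind1 ε l x) < ratA ε (behind1 ε l y) := by
    intro x y x1 xy y2
    obtain ⟨-, x3, x4, x5⟩ := behind1_shock hε hε1 hl x1 (xy.le.trans y2)
    obtain ⟨y3, -, y4, y5⟩ := behind1_shock hε hε1 hl (x1.trans xy) y2
    have hw := relV_anti hε hl x1 xy (y2.trans_lt b2)
    rw [x4, x5, y4, y5]
    exact ⟨mul_lt_mul_of_pos_left (shockRho_mono hε hε1 y3 hw x3) (cone_rho_pos hε hl),
      mul_lt_mul_of_pos_left (shockRat_anti hε hε1 y3 hw x3) (ratA_pos hε hl)⟩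
  have fan : ∀ x y, lam1A ε l ≤ x → x < y → y < 1 / ε →
      rhoA ε (behind1 ε l y) < rhoA ε (behind1 ε l x) ∧
      ratA ε (behind1 ε l x) < ratA ε (behind1 ε l y) := by
    intro x y x1 xy y2
    have x1' := b1.trans_le x1
    have hs := fan_scale_pos hε hε1 hl
    obtain ⟨-, p1, p2⟩ := one_sub_pos hε x1' (xy.trans y2)
    obtain ⟨-, p3, p4⟩ := one_sub_pos hε (x1'.trans xy) y2
    rw [behind1_fan hε hε1 hl x1 (xy.trans y2), behind1_fan hε hε1 hl (x1.trans xy.le) y2,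
      rhoA_fanQ hε x1' (xy.trans y2), rhoA_fanQ hε (x1'.trans xy) y2,
      ratA_fanQ hε hε1 x1' (xy.trans y2) hs, ratA_fanQ hε hε1 (x1'.trans xy) y2 hs]
    have hε2 : 0 < 1 - ε ^ 2 := by nlinarith
    constructor
    · refine mul_lt_mul_of_pos_left (Real.rpow_lt_rpow (by positivity) ?_ (by positivity))
        (by positivity)
      rw [div_lt_div_iff₀ p3 p1]; nlinarith
    · refine mul_lt_mul_of_pos_left ?_ (div_pos (by linarith) (by linarith))
      rw [div_lt_div_iff₀ p2 p4]; nlinarith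
  rcases le_or_gt y (lam1A ε l) with hy | hy
  · exact shock x y h1 hxy hy
  · rcases le_or_gt (lam1A ε l) x with hx | hx
    · exact fan x y hx hxy h2
    · have e1 := shock x _ h1 hx le_rfl
      have e2 := fan _ y le_rfl hy h2
      exact ⟨e2.1.trans e1.1, e1.2.trans e2.2⟩

/-- The wave speeds bounding the intermediate state are unique. -/
theorem slopes_unique {ε : ℝ} (hε : 0 < ε) (hε1 : ε < 1) {l r : ℝ × ℝ} (hl : l ∈ cone ε)
    (hr : r ∈ cone ε) {α β α' β' : ℝ} (hα1 : -(1 / ε) < α) (hα2 : α < 1 / ε)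
    (hβ1 : -(1 / ε) < β) (hβ2 : β < 1 / ε) (hα1' : -(1 / ε) < α') (hα2' : α' < 1 / ε)
    (hβ1' : -(1 / ε) < β') (hβ2' : β' < 1 / ε) (h : behind1 ε l α = ahead2 ε r β)
    (h' : behind1 ε l α' = ahead2 ε r β') : α = α' ∧ β = β' := by
  have hrr := refl_mem hr
  -- Moving along the 1-curve with α < α' lowers the density and raises the ratio. On the mirrored
  -- 2-curve the reflected ratio is inverted, so β < β' contradicts the density and β > β'
  -- contradicts the ratio.
  have aux : ∀ α β α' β' : ℝ, -(1 / ε) < α → α < 1 / ε → -(1 / ε) < β → β < 1 / ε →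
      -(1 / ε) < α' → α' < 1 / ε → -(1 / ε) < β' → β' < 1 / ε → behind1 ε l α = ahead2 ε r β →
      behind1 ε l α' = ahead2 ε r β' → ¬α < α' := by
    intro α β α' β' a1 a2 b1 b2 a1' a2' b1' b2' h h' hlt
    obtain ⟨m1, m2⟩ := behind1_mono hε hε1 hl a1 hlt a2'
    rw [h, h', ahead2, ahead2] at m1 m2
    rw [rhoA_refl, rhoA_refl] at m1
    rw [ratA_refl, ratA_refl] at m2
    have p1 := ratA_pos hε (behind1_mem hε hε1 hrr (x := -β) (by linarith) (by linarith))
    have p2 := ratA_pos hε (behind1_mem hε hε1 hrr (x := -β') (by linarith) (by linarith))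
    rw [inv_lt_inv₀ p1 p2] at m2
    rcases lt_trichotomy β β' with hb | hb | hb
    · have := (behind1_mono hε hε1 hrr (x := -β') (y := -β) (by linarith) (by linarith)
        (by linarith)).1
      linarith
    · rw [hb] at m1; exact lt_irrefl _ m1
    · have := (behind1_mono hε hε1 hrr (x := -β) (y := -β') (by linarith) (by linarith)
        (by linarith)).2
      linarith
  have hα : α = α' := le_antisymm
    (not_lt.1 (aux α' β' α β hα1' hα2' hβ1' hβ2' hα1 hα2 hβ1 hβ2 h' h))
    (not_lt.1 (aux α β α' β' hα1 hα2 hβ1 hβ2 hα1' hα2' hβ1' hβ2' h h'))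
  refine ⟨hα, ?_⟩
  subst hα
  have hb : behind1 ε (refl r) (-β) = behind1 ε (refl r) (-β') := by
    have := h.symm.trans h'
    rw [ahead2, ahead2] at this
    rw [← refl_refl (behind1 ε (refl r) (-β)), this, refl_refl]
  rcases lt_trichotomy β β' with hlt | he | hlt
  · have := (behind1_mono hε hε1 hrr (x := -β') (y := -β) (by linarith) (by linarith)
        (by linarith)).1
    rw [hb] at this; exact absurd this (lt_irrefl _)
  · exact he
  · have := (behind1_mono hε hε1 hrr (x := -β) (y := -β') (by linarith) (by linarith)
        (by linarith)).1
    rw [hb] at this; exact absurd this (lt_irrefl _)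

/-! ### Existence of the intermediate state -/

lemma eq_of_rhoA_ratA {ε : ℝ} (hε : 0 < ε) {p q : ℝ × ℝ} (hp : p ∈ cone ε) (hq : q ∈ cone ε)
    (h1 : rhoA ε p = rhoA ε q) (h2 : ratA ε p = ratA ε q) : p = q := by
  obtain ⟨p1, p2⟩ := cone_light hε hp
  obtain ⟨q1, q2⟩ := cone_light hε hq
  rw [rhoA_eq_mul, rhoA_eq_mul] at h1
  rw [ratA, ratA, div_eq_div_iff p2.ne' q2.ne'] at h2
  have e1 : p.1 + ε * p.2 = q.1 + ε * q.2 := by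
    refine (sq_eq_sq₀ p1.le q1.le).1 ?_
    have h3 : (p.1 - ε * p.2) ≠ 0 := p2.ne'
    have h4 : (q.1 - ε * q.2) ≠ 0 := q2.ne'
    apply mul_right_cancel₀ (mul_ne_zero h3 h4)
    linear_combination (q.1 - ε * q.2) * (p.1 + ε * p.2) * h1 + (q.1 + ε * q.2) * (q.1 - ε * q.2) * h2
  have e2 : p.1 - ε * p.2 = q.1 - ε * q.2 := by
    rw [e1] at h1
    exact mul_left_cancel₀ q1.ne' h1
  ext
  · linarith
  · have : ε * p.2 = ε * q.2 := by linarith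
    exact mul_left_cancel₀ hε.ne' this

lemma continuousAt_behind1 {ε : ℝ} (hε : 0 < ε) (hε1 : ε < 1) {l : ℝ × ℝ} (hl : l ∈ cone ε) {x : ℝ}
    (h1 : -(1 / ε) < x) (h2 : x < 1 / ε) : ContinuousAt (behind1 ε l) x := by
  have hc := continuousAt_curve1 hε hε1 hl h2
  have h0 : 2 * (1 - ε ^ 2 * x ^ 2) ≠ 0 := mul_ne_zero two_ne_zero (one_sub_pos hε h1 h2).1.ne'
  have a1 := hc.fst
  have a2 := hc.snd
  unfold behind1 flip1 sp sm
  refine ContinuousAt.prodMk (ContinuousAt.div ?_ (by fun_prop) h0)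
    (ContinuousAt.div ?_ (by fun_prop) h0) <;> fun_prop

lemma continuousAt_rhoA_behind1 {ε : ℝ} (hε : 0 < ε) (hε1 : ε < 1) {l : ℝ × ℝ} (hl : l ∈ cone ε)
    {x : ℝ} (h1 : -(1 / ε) < x) (h2 : x < 1 / ε) :
    ContinuousAt (fun x => rhoA ε (behind1 ε l x)) x := by
  have hc := continuousAt_behind1 hε hε1 hl h1 h2
  unfold rhoA
  have a1 := hc.fst
  have a2 := hc.snd
  fun_prop

lemma continuousAt_ratA_behind1 {ε : ℝ} (hε : 0 < ε) (hε1 : ε < 1) {l : ℝ × ℝ} (hl : l ∈ cone ε)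
    {x : ℝ} (h1 : -(1 / ε) < x) (h2 : x < 1 / ε) :
    ContinuousAt (fun x => ratA ε (behind1 ε l x)) x := by
  have hc := continuousAt_behind1 hε hε1 hl h1 h2
  unfold ratA
  have a1 := hc.fst
  have a2 := hc.snd
  exact ContinuousAt.div (by fun_prop) (by fun_prop)
    (cone_light hε (behind1_mem hε hε1 hl h1 h2)).2.ne'

/-- The limit of infinitely strong shocks, in which the slope tends to the light cone. -/
lemma exists_strong_shock {ε : ℝ} (hε : 0 < ε) (hε1 : ε < 1) {l : ℝ × ℝ} (hl : l ∈ cone ε) {δ K : ℝ}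
    (hδ : 0 < δ) : ∃ x, -(1 / ε) < x ∧ x < 1 / ε ∧ K < rhoA ε (behind1 ε l x) ∧
      ratA ε (behind1 ε l x) < δ := by
  obtain ⟨b1, b2⟩ := lam1A_bounds hε hε1 hl
  have hc := (cone_light hε hl).1
  have hD : l.1 - ε ^ 2 * -(1 / ε) * l.2 = l.1 + ε * l.2 := by field_simp; ring
  have hrel : ContinuousAt (fun x => relV ε x l) (-(1 / ε)) := by
    unfold relV
    exact ContinuousAt.div (by fun_prop) (by fun_prop) (by rw [hD]; exact hc.ne')
  -- At w = 1/ε the factor 1-εw vanishes, so `shockRat` tends to 0 and `shockRho` to +∞.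
  have hv : relV ε (-(1 / ε)) l = 1 / ε := by
    rw [relV, hD, div_eq_iff hc.ne']; field_simp; ring
  have hev : ∀ᶠ x in 𝓝[>] (-(1 / ε)), -(1 / ε) < x ∧ x ≤ lam1A ε l :=
    (eventually_mem_nhdsWithin).and (nhdsWithin_le_nhds (Iic_mem_nhds b1))
  have hrat : ∀ᶠ x in 𝓝[>] (-(1 / ε)), ratA ε (behind1 ε l x) < δ := by
    have h1 : ContinuousAt (fun x => ratA ε l * shockRat ε (relV ε x l)) (-(1 / ε)) := by
      unfold shockRat
      refine ContinuousAt.mul (by fun_prop) (ContinuousAt.div (by fun_prop) (by fun_prop) ?_)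
      rw [hv]
      have : 0 < 1 / ε - ε := by
        rw [sub_pos, lt_div_iff₀ hε]; nlinarith
      have : 0 < 1 + ε * (1 / ε) := by positivity
      positivity
    have h2 : ratA ε l * shockRat ε (relV ε (-(1 / ε)) l) < δ := by
      rw [hv, shockRat, mul_one_div_cancel hε.ne']; simpa using hδ
    filter_upwards [hev, nhdsWithin_le_nhds (h1.eventually (gt_mem_nhds h2))] with x hx hx2
    rw [(behind1_shock hε hε1 hl hx.1 hx.2).2.2.2]; exact hx2
  have hrho : ∀ᶠ x in 𝓝[>] (-(1 / ε)), K < rhoA ε (behind1 ε l x) := by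
    have h1 : Tendsto (fun x => 1 - ε ^ 2 * relV ε x l ^ 2) (𝓝[>] (-(1 / ε))) (𝓝[>] 0) := by
      refine tendsto_nhdsWithin_iff.2 ⟨?_, ?_⟩
      · have : ContinuousAt (fun x => 1 - ε ^ 2 * relV ε x l ^ 2) (-(1 / ε)) := by fun_prop
        have h3 := this.tendsto
        rw [hv, show 1 - ε ^ 2 * (1 / ε) ^ 2 = 0 by field_simp; ring] at h3
        exact h3.mono_left nhdsWithin_le_nhds
      · filter_upwards [hev] with x hx
        obtain ⟨w1, w2, -, -⟩ := behind1_shock hε hε1 hl hx.1 hx.2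
        have : 0 < ε * relV ε x l := by positivity
        show 0 < 1 - ε ^ 2 * relV ε x l ^ 2
        nlinarith
    have h2 : Tendsto (fun x => rhoA ε l * (relV ε x l ^ 2 - ε ^ 2)) (𝓝[>] (-(1 / ε)))
        (𝓝 (rhoA ε l * ((1 / ε) ^ 2 - ε ^ 2))) := by
      have : ContinuousAt (fun x => rhoA ε l * (relV ε x l ^ 2 - ε ^ 2)) (-(1 / ε)) := by fun_prop
      have h3 := this.tendsto
      rw [hv] at h3
      exact h3.mono_left nhdsWithin_le_nhds
    have h4 : 0 < rhoA ε l * ((1 / ε) ^ 2 - ε ^ 2) := by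
      refine mul_pos (cone_rho_pos hε hl) ?_
      have h5 : 1 < 1 / ε := by rw [lt_div_iff₀ hε]; linarith
      nlinarith
    have h3 := Tendsto.pos_mul_atTop h4 h2 (tendsto_inv_nhdsGT_zero.comp h1)
    filter_upwards [hev, h3.eventually_gt_atTop K] with x hx hx2
    rw [(behind1_shock hε hε1 hl hx.1 hx.2).2.2.1, shockRho]
    refine hx2.trans_le (le_of_eq ?_)
    simp only [Function.comp]; rw [div_eq_mul_inv]; ring
  obtain ⟨x, hx1, hx2, hx3⟩ := (hev.and (hrat.and hrho)).exists
  exact ⟨x, hx1.1, hx1.2.trans_lt b2, hx3, hx2⟩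

lemma exists_strong_fan {ε : ℝ} (hε : 0 < ε) (hε1 : ε < 1) {l : ℝ × ℝ} (hl : l ∈ cone ε) {δ K : ℝ}
    (hδ : 0 < δ) : ∃ x, -(1 / ε) < x ∧ x < 1 / ε ∧ rhoA ε (behind1 ε l x) < δ ∧
      K < ratA ε (behind1 ε l x) := by
  obtain ⟨b1, b2⟩ := lam1A_bounds hε hε1 hl
  have h0 : 0 < 1 / ε := by positivity
  have hε2 : 0 < 1 - ε := by linarith
  have hs := fan_scale_pos hε hε1 hl
  set s := sp ε (lam1A ε l) l / fanP ε (lam1A ε l) with hsdef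
  have hev : ∀ᶠ x in 𝓝[<] (1 / ε), x < 1 / ε ∧ lam1A ε l ≤ x :=
    (eventually_mem_nhdsWithin).and (nhdsWithin_le_nhds (Ici_mem_nhds b2))
  have hden : 1 + ε * (1 / ε) ≠ 0 := by positivity
  have hz : ContinuousAt (fun x => (1 - ε * x) / (1 + ε * x)) (1 / ε) :=
    ContinuousAt.div (by fun_prop) (by fun_prop) hden
  have hz0 : (1 - ε * (1 / ε)) / (1 + ε * (1 / ε)) = 0 := by
    rw [mul_one_div_cancel hε.ne']; norm_num
  have hrho : ∀ᶠ x in 𝓝[<] (1 / ε), rhoA ε (behind1 ε l x) < δ := by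
    have hk : 0 < (1 + ε ^ 2) / (2 * ε) := by positivity
    have h1 : ContinuousAt (fun x => (1 - ε ^ 2) * s ^ 2 / 4 *
        ((1 - ε * x) / (1 + ε * x)) ^ ((1 + ε ^ 2) / (2 * ε))) (1 / ε) :=
      continuousAt_const.mul (hz.rpow_const (Or.inr hk.le))
    have h2 : (1 - ε ^ 2) * s ^ 2 / 4 *
        ((1 - ε * (1 / ε)) / (1 + ε * (1 / ε))) ^ ((1 + ε ^ 2) / (2 * ε)) < δ := by
      rw [hz0, Real.zero_rpow hk.ne', mul_zero]; exact hδ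
    filter_upwards [hev, nhdsWithin_le_nhds (h1.eventually (gt_mem_nhds h2))] with x hx hx2
    rw [behind1_fan hε hε1 hl hx.2 hx.1, rhoA_fanQ hε (b1.trans_le hx.2) hx.1]
    exact hx2
  have hrat : ∀ᶠ x in 𝓝[<] (1 / ε), K < ratA ε (behind1 ε l x) := by
    have h1 : ContinuousAt (fun x => |K| * (1 - ε) * (1 - ε * x)) (1 / ε) := by fun_prop
    have h2 : |K| * (1 - ε) * (1 - ε * (1 / ε)) < (1 + ε) * (1 + ε * (1 / ε)) := by
      rw [mul_one_div_cancel hε.ne']; linarith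
    have h3 : ContinuousAt (fun x => (1 + ε) * (1 + ε * x)) (1 / ε) := by fun_prop
    filter_upwards [hev, nhdsWithin_le_nhds (h1.eventually_lt h3 h2)] with x hx hx2
    obtain ⟨-, d1, d2⟩ := one_sub_pos hε (b1.trans_le hx.2) hx.1
    rw [behind1_fan hε hε1 hl hx.2 hx.1, ratA_fanQ hε hε1 (b1.trans_le hx.2) hx.1 hs]
    refine (le_abs_self K).trans_lt ?_
    rw [div_mul_div_comm, lt_div_iff₀ (by positivity)]
    linarith
  obtain ⟨x, hx1, hx2, hx3⟩ := (hev.and (hrat.and hrho)).exists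
  exact ⟨x, b1.trans_le hx1.2, hx1.1, hx3, hx2⟩

/-- The `1`-wave curve parametrized by minus the logarithm of the density. -/
lemma exists_param {ε : ℝ} (hε : 0 < ε) (hε1 : ε < 1) {l : ℝ × ℝ} (hl : l ∈ cone ε) :
    ∃ g a : ℝ → ℝ, (∀ s, -(1 / ε) < a s ∧ a s < 1 / ε ∧ -Real.log (rhoA ε (behind1 ε l (a s))) = s ∧
      Real.log (ratA ε (behind1 ε l (a s))) = g s) ∧ Continuous g ∧ Monotone g ∧
      (∃ s, g s ≤ 0) ∧ ∃ s, 0 ≤ g s := by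
  have hmem : ∀ x : Ioo (-(1 / ε)) (1 / ε), behind1 ε l x ∈ cone ε := fun x =>
    behind1_mem hε hε1 hl x.2.1 x.2.2
  have hrp : ∀ x : Ioo (-(1 / ε)) (1 / ε), 0 < rhoA ε (behind1 ε l x) := fun x =>
    cone_rho_pos hε (hmem x)
  let f : Ioo (-(1 / ε)) (1 / ε) → ℝ := fun x => -Real.log (rhoA ε (behind1 ε l x))
  have hf : StrictMono f := fun x y hxy =>
    neg_lt_neg (Real.log_lt_log (hrp y) (behind1_mono hε hε1 hl x.2.1 hxy y.2.2).1)
  have hfc : Continuous f := by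
    refine continuous_iff_continuousAt.2 fun x => ContinuousAt.neg (ContinuousAt.log ?_ (hrp x).ne')
    exact ContinuousAt.comp (f := Subtype.val)
      (continuousAt_rhoA_behind1 hε hε1 hl x.2.1 x.2.2) continuousAt_subtype_val
  have hsurj : Function.Surjective f := by
    intro s
    obtain ⟨x, x1, x2, x3, -⟩ := exists_strong_shock hε hε1 hl (K := Real.exp (-s)) one_pos
    obtain ⟨y, y1, y2, y3, -⟩ := exists_strong_fan hε hε1 hl (K := 0) (Real.exp_pos (-s))
    have : PreconnectedSpace (Ioo (-(1 / ε)) (1 / ε)) :=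
      isPreconnected_iff_preconnectedSpace.1 isPreconnected_Ioo
    refine mem_range_of_exists_le_of_exists_ge hfc ⟨⟨x, x1, x2⟩, ?_⟩ ⟨⟨y, y1, y2⟩, ?_⟩
    · have := (Real.lt_log_iff_exp_lt (hrp ⟨x, x1, x2⟩)).2 x3
      show -Real.log _ ≤ s
      linarith
    · have := (Real.log_lt_iff_lt_exp (hrp ⟨y, y1, y2⟩)).2 y3
      show s ≤ -Real.log _
      linarith
  let e := hf.orderIsoOfSurjective f hsurj
  have hec : Continuous e.symm := e.symm.continuous
  have hrat : ∀ x : Ioo (-(1 / ε)) (1 / ε), 0 < ratA ε (behind1 ε l x) := fun x =>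
    ratA_pos hε (hmem x)
  refine ⟨fun s => Real.log (ratA ε (behind1 ε l (e.symm s))), fun s => e.symm s,
    fun s => ⟨(e.symm s).2.1, (e.symm s).2.2, e.apply_symm_apply s, rfl⟩, ?_, ?_, ?_, ?_⟩
  · refine continuous_iff_continuousAt.2 fun s => ContinuousAt.log ?_ (hrat _).ne'
    exact ContinuousAt.comp (f := fun s => (e.symm s : ℝ))
      (continuousAt_ratA_behind1 hε hε1 hl (e.symm s).2.1 (e.symm s).2.2)
      (continuous_subtype_val.comp hec).continuousAt
  · intro s t hst
    rcases hst.eq_or_lt with rfl | hst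
    · exact le_rfl
    · exact Real.log_le_log (hrat _) (behind1_mono hε hε1 hl (e.symm s).2.1
        (e.symm.strictMono hst) (e.symm t).2.2).2.le
  · obtain ⟨x, x1, x2, -, x3⟩ := exists_strong_shock hε hε1 hl (K := 0) one_pos
    refine ⟨e ⟨x, x1, x2⟩, ?_⟩
    simp only [OrderIso.symm_apply_apply]
    exact Real.log_nonpos (hrat ⟨x, x1, x2⟩).le x3.le
  · obtain ⟨x, x1, x2, -, x3⟩ := exists_strong_fan hε hε1 hl (K := 1) one_pos
    refine ⟨e ⟨x, x1, x2⟩, ?_⟩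
    simp only [OrderIso.symm_apply_apply]
    exact Real.log_nonneg x3.le

/-- The intermediate velocity exceeds the slope of the 1-wave. With its mirror image this gives α <
v < β in `exists_slopes`. -/
lemma behind1_fast {ε : ℝ} (hε : 0 < ε) (hε1 : ε < 1) {l : ℝ × ℝ} (hl : l ∈ cone ε) {x : ℝ}
    (h1 : -(1 / ε) < x) (h2 : x < 1 / ε) : x * (behind1 ε l x).1 < (behind1 ε l x).2 := by
  have d0 := (one_sub_pos hε h1 h2).1.ne'
  have := cone_sum_pos hε h1.le h2.le (curve1_mem hε hε1 hl h2)
  rw [← sp_flip1 d0, ← neg_neg (sm ε x (curve1 ε l x)), ← sm_flip1 d0] at this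
  change 0 < sp ε x (behind1 ε l x) + -sm ε x (behind1 ε l x) at this
  simp only [sp, sm] at this
  linarith

/-- The intermediate state of the Riemann problem. -/
theorem exists_slopes {ε : ℝ} (hε : 0 < ε) (hε1 : ε < 1) {l r : ℝ × ℝ} (hl : l ∈ cone ε)
    (hr : r ∈ cone ε) : ∃ α β, -(1 / ε) < α ∧ α < β ∧ β < 1 / ε ∧ behind1 ε l α = ahead2 ε r β := by
  have hrr := refl_mem hr
  obtain ⟨g, a, ha, gc, gm, ⟨s1, hs1⟩, s2, hs2⟩ := exists_param hε hε1 hl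
  obtain ⟨g', b, hb, gc', gm', ⟨t1, ht1⟩, t2, ht2⟩ := exists_param hε hε1 hrr
  -- A common parameter s means equal densities; since reflection inverts the ratio, the two curves
  -- meet exactly when the logarithms of the ratios add up to zero.
  obtain ⟨s, hs⟩ : ∃ s, g s + g' s = 0 := by
    refine mem_range_of_exists_le_of_exists_ge (gc.add gc') ⟨min s1 t1, ?_⟩ ⟨max s2 t2, ?_⟩
    · exact add_nonpos ((gm (min_le_left _ _)).trans hs1) ((gm' (min_le_right _ _)).trans ht1)
    · exact add_nonneg (hs2.trans (gm (le_max_left _ _))) (ht2.trans (gm' (le_max_right _ _)))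
  obtain ⟨a1, a2, a3, a4⟩ := ha s
  obtain ⟨b1, b2, b3, b4⟩ := hb s
  have m1 := behind1_mem hε hε1 hl a1 a2
  have m2 := behind1_mem hε hε1 hrr b1 b2
  have heq : behind1 ε l (a s) = ahead2 ε r (-b s) := by
    rw [ahead2, neg_neg]
    refine eq_of_rhoA_ratA hε m1 (refl_mem m2) ?_ ?_
    · rw [rhoA_refl]
      refine Real.log_injOn_pos (cone_rho_pos hε m1) (cone_rho_pos hε m2) ?_
      change Real.log (rhoA ε (behind1 ε l (a s))) = _
      linarith
    · rw [ratA_refl]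
      refine Real.log_injOn_pos (ratA_pos hε m1) (inv_pos.2 (ratA_pos hε m2)) ?_
      rw [Real.log_inv]; linarith
  refine ⟨a s, -b s, a1, ?_, by linarith, heq⟩
  have f1 := behind1_fast hε hε1 hl a1 a2
  have f2 := behind1_fast hε hε1 hrr b1 b2
  have e1 : (behind1 ε l (a s)).1 = (behind1 ε (refl r) (b s)).1 := by
    rw [heq, ahead2, neg_neg]; rfl
  have e2 : (behind1 ε l (a s)).2 = -(behind1 ε (refl r) (b s)).2 := by
    rw [heq, ahead2, neg_neg]; rfl
  have := cone_fst_pos hε m2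
  rw [e1, e2] at f1
  nlinarith

/-! ### Calculus of entropy pairs -/

lemma IsWeakEntropyPair.differentiableAt {ε : ℝ} {U V : ℝ × ℝ → ℝ} (h : IsWeakEntropyPair ε U V)
    {p : ℝ × ℝ} (hp : p ∈ nonVacuum ε) : DifferentiableAt ℝ U p ∧ DifferentiableAt ℝ V p :=
  ⟨(h.smooth_entropy.differentiableOn (by simp)).differentiableAt
      ((isOpen_nonVacuum ε).mem_nhds hp),
    (h.smooth_flux.differentiableOn (by simp)).differentiableAt ((isOpen_nonVacuum ε).mem_nhds hp)⟩

/-- Entropy and flux have the same coefficients with respect to the conserved quantities and their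
fluxes. -/
lemma IsWeakEntropyPair.fderiv_eq {ε : ℝ} (hε : 0 < ε) (hε1 : ε ≤ 1) {U V : ℝ × ℝ → ℝ}
    (h : IsWeakEntropyPair ε U V) {p : ℝ × ℝ} (hp : p ∈ nonVacuum ε) :
    ∃ c₁ c₂ : ℝ, ∀ y, fderiv ℝ U p y = c₁ * fderiv ℝ (G ε) p y + c₂ * fderiv ℝ (H ε) p y ∧
      fderiv ℝ V p y = c₁ * fderiv ℝ (H ε) p y + c₂ * fderiv ℝ (F ε) p y := by
  have hd := lum_pos hε hp.2
  obtain ⟨n1, n2⟩ := lam_den_pos hε hε1 hp.2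
  have hr := hp.1
  have g1 : fderiv ℝ (G ε) p (r₁ ε p) ≠ 0 := by
    have e : fderiv ℝ (G ε) p (r₁ ε p) =
        -((1 - ε ^ 2 * p.2) ^ 2 / (1 - ε ^ 2 * p.2 ^ 2) ^ 2) := by
      rw [fderiv_G hd.ne']; simp only [r₁]
      generalize 1 - ε ^ 2 * p.2 ^ 2 = d at *
      field_simp; ring
    rw [e]; exact (neg_lt_zero.2 (by positivity)).ne
  have g2 : fderiv ℝ (G ε) p (r₂ ε p) ≠ 0 := by
    have e : fderiv ℝ (G ε) p (r₂ ε p) = (1 + ε ^ 2 * p.2) ^ 2 / (1 - ε ^ 2 * p.2 ^ 2) ^ 2 := by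
      rw [fderiv_G hd.ne']; simp only [r₂]
      generalize 1 - ε ^ 2 * p.2 ^ 2 = d at *
      field_simp; ring
    rw [e]; positivity
  have hl : lam₂ ε p - lam₁ ε p ≠ 0 := by
    have e : lam₂ ε p - lam₁ ε p =
        2 * (1 - ε ^ 2 * p.2 ^ 2) / ((1 + ε ^ 2 * p.2) * (1 - ε ^ 2 * p.2)) := by
      rw [lam₂, lam₁, div_sub_div _ _ n2.ne' n1.ne']; congr 1; ring
    rw [e]; positivity
  have GH := isWeakEntropyPair_GH hε hε1
  have HF := isWeakEntropyPair_HF hε hε1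
  have dec : ∀ y : ℝ × ℝ, ∃ s t : ℝ, y = s • r₁ ε p + t • r₂ ε p := by
    intro y
    refine ⟨((1 + ε ^ 2) * p.1 * y.2 - (1 - ε ^ 2 * p.2 ^ 2) * y.1) / 2,
      ((1 + ε ^ 2) * p.1 * y.2 + (1 - ε ^ 2 * p.2 ^ 2) * y.1) / 2, ?_⟩
    have hr' := hr.ne'
    generalize hd' : 1 - ε ^ 2 * p.2 ^ 2 = d at *
    have hd0 := hd.ne'
    ext
    · simp only [r₁, r₂, Prod.fst_add, Prod.smul_fst, smul_eq_mul, hd']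
      field_simp; ring
    · simp only [r₁, r₂, Prod.snd_add, Prod.smul_snd, smul_eq_mul]
      field_simp; ring
  have a1 := GH.compat₁ p hp
  have a2 := GH.compat₂ p hp
  have b1 := HF.compat₁ p hp
  have b2 := HF.compat₂ p hp
  have k1 := h.compat₁ p hp
  have k2 := h.compat₂ p hp
  set γ₁ := fderiv ℝ (G ε) p (r₁ ε p)
  set γ₂ := fderiv ℝ (G ε) p (r₂ ε p)
  set u₁ := fderiv ℝ U p (r₁ ε p)
  set u₂ := fderiv ℝ U p (r₂ ε p)
  -- c₁ and c₂ solve c₁ + c₂ λⱼ = uⱼ/γⱼ, the equations for the gradient of U in (G, H) along both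
  -- eigenvectors; the flux relation then follows, as dH and dF act on rⱼ through λⱼ.
  obtain ⟨c₂, hc₂⟩ : ∃ c₂, c₂ * (lam₂ ε p - lam₁ ε p) = u₂ / γ₂ - u₁ / γ₁ :=
    ⟨_, div_mul_cancel₀ _ hl⟩
  obtain ⟨c₁, hc₁⟩ : ∃ c₁, c₁ = u₁ / γ₁ - c₂ * lam₁ ε p := ⟨_, rfl⟩
  have e1 : u₁ = (c₁ + c₂ * lam₁ ε p) * γ₁ := by
    rw [hc₁, sub_add_cancel, div_mul_cancel₀ _ g1]
  have e2 : u₂ = (c₁ + c₂ * lam₂ ε p) * γ₂ := by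
    have : c₁ + c₂ * lam₂ ε p = u₂ / γ₂ := by linarith
    rw [this, div_mul_cancel₀ _ g2]
  refine ⟨c₁, c₂, fun y => ?_⟩
  obtain ⟨s, t, rfl⟩ := dec y
  simp only [map_add, map_smul, smul_eq_mul]
  rw [k1, k2, b1, b2, a1, a2]
  change s * u₁ + t * u₂ = c₁ * (s * γ₁ + t * γ₂) + _ ∧ s * (_ * u₁) + t * (_ * u₂) = _
  rw [e1, e2]
  constructor <;> ring

lemma differentiableAt_ofA {ε : ℝ} {q : ℝ × ℝ} (h : q.1 ≠ 0) : DifferentiableAt ℝ (ofA ε) q := by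
  unfold ofA
  simp only [div_eq_mul_inv]
  have h1 : DifferentiableAt ℝ (fun q : ℝ × ℝ => q.1⁻¹) q := differentiableAt_fst.fun_inv h
  fun_prop

lemma differentiableAt_phiInv {ε : ℝ} (hε : 0 < ε) {q : ℝ × ℝ}
    (h : q ∈ conservedCone ε) : DifferentiableAt ℝ (phiInv ε) q := by
  have h1 : DifferentiableAt ℝ (phiInvA ε) q := by
    obtain ⟨p1, p2⟩ := conserved_pos hε h
    have d1 : DifferentiableAt ℝ (fun q : ℝ × ℝ => √(q.1 + 2 * ε ^ 2 / (1 + ε ^ 2) * q.2)) q :=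
      DifferentiableAt.sqrt (by fun_prop) p1.ne'
    have d2 : DifferentiableAt ℝ (fun q : ℝ × ℝ => √(q.1 - 2 * ε ^ 2 / (1 + ε ^ 2) * q.2)) q :=
      DifferentiableAt.sqrt (by fun_prop) p2.ne'
    unfold phiInvA
    simp only [div_eq_mul_inv] at d1 d2 ⊢
    fun_prop
  exact (differentiableAt_ofA (cone_fst_pos hε (phiInvA_mem hε h)).ne').comp q h1

lemma isOpen_conservedCone (ε : ℝ) : IsOpen (conservedCone ε) :=
  isOpen_lt (by fun_prop) (by fun_prop)

/-- The gradient inequality for convex entropies. -/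
lemma IsConvexEntropy.gradient_le {ε : ℝ} (hε : 0 < ε) (hε1 : ε ≤ 1) {U V : ℝ × ℝ → ℝ}
    (h : IsWeakEntropyPair ε U V) (hc : IsConvexEntropy ε U) {p p₀ : ℝ × ℝ} (hp : p ∈ nonVacuum ε)
    (hp₀ : p₀ ∈ nonVacuum ε) {c₁ c₂ : ℝ}
    (hg : ∀ y, fderiv ℝ U p y = c₁ * fderiv ℝ (G ε) p y + c₂ * fderiv ℝ (H ε) p y) :
    c₁ * (G ε p₀ - G ε p) + c₂ * (H ε p₀ - H ε p) ≤ U p₀ - U p := by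
  obtain ⟨η, hη, hUη⟩ := hc
  set P := (G ε p, H ε p) with hP
  set Q := (G ε p₀, H ε p₀) with hQ
  -- Convexity is used only on the segment between the two conserved states; pulling it back through
  -- `phiInv` gives the initial slope of η in terms of the derivative of U.
  let L : ℝ → ℝ × ℝ := fun t => P + t • (Q - P)
  have hL : HasDerivAt L (Q - P) 0 := by
    have := ((hasDerivAt_id' (0 : ℝ)).smul_const (Q - P)).const_add P
    rwa [one_smul] at this
  have hL0 : L 0 = P := by simp [L]
  have hL1 : L 1 = Q := by simp [L]
  have hPm : P ∈ conservedCone ε := GH_mem hε hε1 hp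
  have hQm : Q ∈ conservedCone ε := GH_mem hε hε1 hp₀
  have hev : ∀ᶠ t in 𝓝 (0 : ℝ), L t ∈ conservedCone ε :=
    hL.continuousAt.eventually_mem (by rw [hL0]; exact (isOpen_conservedCone ε).mem_nhds hPm)
  have hconv : ConvexOn ℝ (L ⁻¹' conservedCone ε) (η ∘ L) := by
    have := hη.comp_affineMap (AffineMap.lineMap P Q)
    have e : (AffineMap.lineMap P Q : ℝ → ℝ × ℝ) = L := by
      funext t; simp only [L, AffineMap.lineMap_apply, vsub_eq_sub, vadd_eq_add]; rw [add_comm]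
    rwa [e] at this
  have hy : DifferentiableAt ℝ (fun t => phiInv ε (L t)) 0 := by
    have h1 : DifferentiableAt ℝ (phiInv ε) (L 0) := by
      rw [hL0]; exact differentiableAt_phiInv hε hPm
    exact h1.comp 0 hL.differentiableAt
  have hy0 : phiInv ε (L 0) = p := by rw [hL0, hP, phiInv_apply hε hε1 hp]
  obtain ⟨y', hy'⟩ : ∃ y', HasDerivAt (fun t => phiInv ε (L t)) y' 0 := ⟨_, hy.hasDerivAt⟩
  have chain : ∀ K : ℝ × ℝ → ℝ, DifferentiableAt ℝ K p →
      HasDerivAt (fun t => K (phiInv ε (L t))) (fderiv ℝ K p y') 0 := by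
    intro K hK
    have hK' : HasFDerivAt K (fderiv ℝ K p) (phiInv ε (L 0)) := by
      rw [hy0]; exact hK.hasFDerivAt
    exact hK'.comp_hasDerivAt 0 hy'
  have GH := isWeakEntropyPair_GH hε hε1
  have dG : fderiv ℝ (G ε) p y' = (Q - P).1 := by
    refine ((chain _ (GH.differentiableAt hp).1).congr_of_eventuallyEq ?_).unique
      (show HasDerivAt (fun t => (L t).1) _ 0 from
        (ContinuousLinearMap.fst ℝ ℝ ℝ).hasFDerivAt.comp_hasDerivAt 0 hL)
    filter_upwards [hev] with t ht using (G_phiInv hε ht).symm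
  have dH : fderiv ℝ (H ε) p y' = (Q - P).2 := by
    refine ((chain _ (GH.differentiableAt hp).2).congr_of_eventuallyEq ?_).unique
      (show HasDerivAt (fun t => (L t).2) _ 0 from
        (ContinuousLinearMap.snd ℝ ℝ ℝ).hasFDerivAt.comp_hasDerivAt 0 hL)
    filter_upwards [hev] with t ht using (H_phiInv hε ht).symm
  have hUL : ∀ t, L t ∈ conservedCone ε → U (phiInv ε (L t)) = η (L t) := by
    intro t ht
    rw [hUη _ (phiInv_mem hε ht), G_phiInv hε ht, H_phiInv hε ht]
  have hder : HasDerivAt (η ∘ L) (fderiv ℝ U p y') 0 := by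
    refine (chain _ (h.differentiableAt hp).1).congr_of_eventuallyEq ?_
    filter_upwards [hev] with t ht using (hUL t ht).symm
  have hs := hconv.le_slope_of_hasDerivAt (x := 0) (y := 1) (by rw [mem_preimage, hL0]; exact hPm)
    (by rw [mem_preimage, hL1]; exact hQm) one_pos hder
  rw [hg, dG, dH, slope_def_field, Function.comp, Function.comp, hL0, hL1, sub_zero, div_one,
    ← hUη p₀ hp₀, ← hUη p hp] at hs
  exact hs

/-! ### Entropy dissipation of shocks -/

/-- H-xG and F-xH depend on the forms only through sp² and sm², hence are unchanged by reversing sm.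
-/
lemma flip1_jump {ε x : ℝ} (h : 1 - ε ^ 2 * x ^ 2 ≠ 0) (q : ℝ × ℝ) :
    HA ε (flip1 ε x q) - x * GA ε (flip1 ε x q) = HA ε q - x * GA ε q ∧
      FA ε (flip1 ε x q) - x * HA ε (flip1 ε x q) = FA ε q - x * HA ε q := by
  have h1 := fst_eq h q
  have h2 := snd_eq h q
  simp only [flip1, HA, GA, FA]
  generalize sp ε x q = P at *
  generalize sm ε x q = N at *
  rw [h1, h2]
  generalize hd : 1 - ε ^ 2 * x ^ 2 = d at *
  constructor <;> ring

lemma flip1_of_sm_eq_zero {ε x : ℝ} (h : 1 - ε ^ 2 * x ^ 2 ≠ 0) {q : ℝ × ℝ} (hq : sm ε x q = 0) :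
    flip1 ε x q = q :=
  eq_of_sp_sm h (sp_flip1 h q) (by rw [sm_flip1 h, hq, neg_zero])

/-- Shocks dissipate convex entropies. -/
lemma shock_dissipation {ε : ℝ} (hε : 0 < ε) (hε1 : ε < 1) {U V : ℝ × ℝ → ℝ}
    (h : IsWeakEntropyPair ε U V) (hc : IsConvexEntropy ε U) {l : ℝ × ℝ} (hl : l ∈ cone ε) {α : ℝ}
    (h1 : -(1 / ε) < α) (h2 : α ≤ lam1A ε l) :
    V (ofA ε (flip1 ε α l)) - α * U (ofA ε (flip1 ε α l)) ≤ V (ofA ε l) - α * U (ofA ε l) := by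
  obtain ⟨-, b2⟩ := lam1A_bounds hε hε1 hl
  have hsm : ∀ σ ∈ Icc α (lam1A ε l), sm ε σ l ≤ 0 := fun σ hσ => by
    rw [sm_eq hε hε1.le hl]
    exact mul_nonpos_of_nonneg_of_nonpos (cone_c_pos hε hε1.le hl).2.le (by linarith [hσ.2])
  have hI : ∀ σ ∈ Icc α (lam1A ε l), -(1 / ε) < σ ∧ σ < 1 / ε := fun σ hσ =>
    ⟨h1.trans_le hσ.1, hσ.2.trans_lt b2⟩
  have hmem : ∀ σ ∈ Icc α (lam1A ε l), flip1 ε σ l ∈ cone ε := fun σ hσ =>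
    flip1_mem hε hε1 (hI σ hσ).1 (hI σ hσ).2 hl (hsm σ hσ)
  have hpl := ofA_mem hε hl
  let p : ℝ → ℝ × ℝ := fun σ => ofA ε (flip1 ε σ l)
  have hpm : ∀ σ ∈ Icc α (lam1A ε l), p σ ∈ nonVacuum ε := fun σ hσ => ofA_mem hε (hmem σ hσ)
  have hpd : ∀ σ ∈ Icc α (lam1A ε l), DifferentiableAt ℝ p σ := by
    intro σ hσ
    have h0 : 2 * (1 - ε ^ 2 * σ ^ 2) ≠ 0 :=
      mul_ne_zero two_ne_zero (one_sub_pos hε (hI σ hσ).1 (hI σ hσ).2).1.ne'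
    have hfl : DifferentiableAt ℝ (fun σ => flip1 ε σ l) σ := by
      unfold flip1 sp sm
      exact DifferentiableAt.prodMk (DifferentiableAt.div (by fun_prop) (by fun_prop) h0)
        (DifferentiableAt.div (by fun_prop) (by fun_prop) h0)
    exact DifferentiableAt.comp (f := fun σ => flip1 ε σ l) σ
      (differentiableAt_ofA (cone_fst_pos hε (hmem σ hσ)).ne') hfl
  -- D(σ) is the entropy defect of the shock from l with slope σ. It vanishes at the wave speed of
  -- l, where the shock has zero strength, and will be shown to increase up to that point.
  let D : ℝ → ℝ := fun σ => V (p σ) - V (ofA ε l) - σ * (U (p σ) - U (ofA ε l))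
  have key : ∀ σ ∈ Ioo α (lam1A ε l), ∃ D', HasDerivAt D D' σ ∧ 0 ≤ D' := by
    intro σ hσ'
    have hσ := Ioo_subset_Icc_self hσ'
    obtain ⟨p', hp'⟩ : ∃ p', HasDerivAt p p' σ := ⟨_, (hpd σ hσ).hasDerivAt⟩
    have chain : ∀ K : ℝ × ℝ → ℝ, DifferentiableAt ℝ K (p σ) →
        HasDerivAt (fun t => K (p t)) (fderiv ℝ K (p σ) p') σ := fun K hK =>
      hK.hasFDerivAt.comp_hasDerivAt σ hp'
    have GH := (isWeakEntropyPair_GH hε hε1.le).differentiableAt (hpm σ hσ)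
    have HF := (isWeakEntropyPair_HF hε hε1.le).differentiableAt (hpm σ hσ)
    have hUV := h.differentiableAt (hpm σ hσ)
    obtain ⟨c₁, c₂, hcc⟩ := h.fderiv_eq hε hε1.le (hpm σ hσ)
    -- Differentiated jump relation: dK'·p' - σ dK·p' = K(p) - K(l).
    have rel : ∀ K K' : ℝ × ℝ → ℝ, DifferentiableAt ℝ K (p σ) → DifferentiableAt ℝ K' (p σ) →
        (∀ τ ∈ Icc α (lam1A ε l), K' (p τ) - τ * K (p τ) = K' (ofA ε l) - τ * K (ofA ε l)) →
        fderiv ℝ K' (p σ) p' - σ * fderiv ℝ K (p σ) p' = K (p σ) - K (ofA ε l) := by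
      intro K K' hK hK' hrel
      have d1 := (chain K' hK').sub ((hasDerivAt_id' σ).mul (chain K hK))
      have d2 := ((hasDerivAt_id' σ).mul_const (K (ofA ε l))).const_sub (K' (ofA ε l))
      have := d1.unique (d2.congr_of_eventuallyEq (by
        filter_upwards [Icc_mem_nhds hσ'.1 hσ'.2] with τ hτ using hrel τ hτ))
      linarith
    have jump : ∀ τ ∈ Icc α (lam1A ε l), H ε (p τ) - τ * G ε (p τ) =
        H ε (ofA ε l) - τ * G ε (ofA ε l) ∧ F ε (p τ) - τ * H ε (p τ) =
        F ε (ofA ε l) - τ * H ε (ofA ε l) := by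
      intro τ hτ
      have a1 := adm_of_nonVacuum (hpm τ hτ)
      have a2 := adm_of_nonVacuum hpl
      rw [G_eq hε a1, H_eq hε a1, F_eq hε a1, G_eq hε a2, H_eq hε a2, F_eq hε a2,
        toA_ofA hε (hmem τ hτ), toA_ofA hε hl]
      exact flip1_jump (one_sub_pos hε (hI τ hτ).1 (hI τ hτ).2).1.ne' l
    have e1 := rel _ _ GH.1 GH.2 fun τ hτ => (jump τ hτ).1
    have e2 := rel _ _ HF.1 HF.2 fun τ hτ => (jump τ hτ).2
    have hder := ((chain V hUV.2).sub_const (V (ofA ε l))).sub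
      ((hasDerivAt_id' σ).mul ((chain U hUV.1).sub_const (U (ofA ε l))))
    refine ⟨_, hder, ?_⟩
    -- With the differentiated jump relations, D' = U(l) - U(p) - c₁(G(l)-G(p)) - c₂(H(l)-H(p)),
    -- nonnegative by the gradient inequality at p.
    have grad := hc.gradient_le hε hε1.le h (hpm σ hσ) hpl fun y => (hcc y).1
    rw [(hcc p').1, (hcc p').2]
    have f1 := congrArg (c₁ * ·) e1
    have f2 := congrArg (c₂ * ·) e2
    linarith
  have hcont : ContinuousOn D (Icc α (lam1A ε l)) := by
    intro σ hσ
    have c0 := (hpd σ hσ).continuousAt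
    have c1 : ContinuousAt (fun t => U (p t)) σ :=
      ContinuousAt.comp (f := p) (h.differentiableAt (hpm σ hσ)).1.continuousAt c0
    have c2 : ContinuousAt (fun t => V (p t)) σ :=
      ContinuousAt.comp (f := p) (h.differentiableAt (hpm σ hσ)).2.continuousAt c0
    exact ((c2.sub continuousAt_const).sub
      (continuousAt_id.mul (c1.sub continuousAt_const))).continuousWithinAt
  have hmono : MonotoneOn D (Icc α (lam1A ε l)) := by
    refine monotoneOn_of_deriv_nonneg (convex_Icc _ _) hcont ?_ ?_
    · rw [interior_Icc]
      intro σ hσ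
      obtain ⟨D', hD, -⟩ := key σ hσ
      exact hD.differentiableAt.differentiableWithinAt
    · rw [interior_Icc]
      intro σ hσ
      obtain ⟨D', hD, hD'⟩ := key σ hσ
      rw [hD.deriv]; exact hD'
  have hfin := hmono (left_mem_Icc.2 h2) (right_mem_Icc.2 h2) h2
  have hpl' : p (lam1A ε l) = ofA ε l := by
    have hm := hI _ (right_mem_Icc.2 h2)
    simp only [p]
    rw [flip1_of_sm_eq_zero (one_sub_pos hε hm.1 hm.2).1.ne']
    rw [sm_eq hε hε1.le hl]; simp
  have hDend : D (lam1A ε l) = 0 := by simp only [D, hpl']; ring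
  rw [hDend] at hfin
  simp only [D, p] at hfin
  linarith

/-! ### Rarefactions -/

lemma ofA_fanQ {ε s x : ℝ} (hε : 0 < ε) (h1 : -(1 / ε) < x) (h2 : x < 1 / ε)
    (hs : 0 < s) : ofA ε (fanQ ε s x) = ((1 - ε ^ 2) * s ^ 2 / 4 *
      ((1 - ε * x) / (1 + ε * x)) ^ ((1 + ε ^ 2) / (2 * ε)), (1 + x) / (1 + ε ^ 2 * x)) := by
  ext
  · exact rhoA_fanQ hε h1 h2
  · have := fanP_pos hε h1 h2
    have := (one_sub_pos hε h1 h2).1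
    exact mul_div_mul_left _ _ (by positivity)

lemma fan_den_pos {ε x : ℝ} (hε : 0 < ε) (hε1 : ε < 1) (h1 : -(1 / ε) < x) :
    0 < 1 + ε ^ 2 * x := by
  have h3 : -1 < ε * x := by
    have := mul_lt_mul_of_pos_left h1 hε
    rwa [mul_neg, mul_one_div_cancel hε.ne'] at this
  nlinarith

/-- A centered 1-rarefaction is an integral curve of r₁ up to parametrization; `lam₁_fanQ` says that
its parameter is the first wave speed. -/
lemma hasDerivAt_ofA_fanQ {ε s x : ℝ} (hε : 0 < ε) (hε1 : ε < 1) (h1 : -(1 / ε) < x)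
    (h2 : x < 1 / ε) (hs : 0 < s) :
    HasDerivAt (fun x => ofA ε (fanQ ε s x)) (((1 - ε ^ 2) * (1 + ε ^ 2) *
      (ofA ε (fanQ ε s x)).1 / (1 + ε ^ 2 * x) ^ 2) • r₁ ε (ofA ε (fanQ ε s x))) x := by
  obtain ⟨d0, d1, d2⟩ := one_sub_pos hε h1 h2
  have d3 := fan_den_pos hε hε1 h1
  have hz : 0 < (1 - ε * x) / (1 + ε * x) := div_pos d2 d1
  set c := (1 - ε ^ 2) * s ^ 2 / 4 with hc
  set k := (1 + ε ^ 2) / (2 * ε) with hk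
  have hcp : 0 < c := by
    have : 0 < 1 - ε ^ 2 := by nlinarith
    positivity
  have hrho := ((((hasDerivAt_id' x).const_mul ε).const_sub 1).div
    (((hasDerivAt_id' x).const_mul ε).const_add 1) d1.ne').rpow_const (p := k) (Or.inl hz.ne')
    |>.const_mul c
  have hv := ((hasDerivAt_id' x).const_add 1).div
    (((hasDerivAt_id' x).const_mul (ε ^ 2)).const_add 1) d3.ne'
  have hpair := (hrho.prodMk hv).congr_of_eventuallyEq (f₁ := fun x => ofA ε (fanQ ε s x)) (by
    filter_upwards [Ioo_mem_nhds h1 h2] with y hy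
    exact ofA_fanQ hε hy.1 hy.2 hs)
  refine hpair.congr_deriv ?_
  rw [ofA_fanQ hε h1 h2 hs]
  have hP := Real.rpow_pos_of_pos hz k
  have hlum : 1 - ε ^ 2 * ((1 + x) / (1 + ε ^ 2 * x)) ^ 2 =
      (1 - ε ^ 2) * ((1 + ε * x) * (1 - ε * x)) / (1 + ε ^ 2 * x) ^ 2 := by
    field_simp; ring
  have hε2 : 1 - ε ^ 2 ≠ 0 := by nlinarith
  ext
  · simp only [r₁, Prod.smul_fst, smul_eq_mul, hlum, Pi.div_apply]
    rw [Real.rpow_sub_one hz.ne', ← hc, ← hk]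
    generalize ((1 - ε * x) / (1 + ε * x)) ^ k = R at *
    rw [hk]
    generalize 1 - ε ^ 2 = e at *
    field_simp; ring
  · simp only [r₁, Prod.smul_snd, smul_eq_mul]
    rw [← hc, ← hk]
    generalize ((1 - ε * x) / (1 + ε * x)) ^ k = R at *
    field_simp; ring

lemma lam₁_fanQ {ε s x : ℝ} (hε : 0 < ε) (hε1 : ε < 1) (h1 : -(1 / ε) < x) (h2 : x < 1 / ε)
    (hs : 0 < s) : lam₁ ε (ofA ε (fanQ ε s x)) = x := by
  have d3 := fan_den_pos hε hε1 h1
  rw [ofA_fanQ hε h1 h2 hs, lam₁]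
  have e1 : (1 + x) / (1 + ε ^ 2 * x) - 1 = (1 - ε ^ 2) * x / (1 + ε ^ 2 * x) := by
    rw [div_sub_one d3.ne']; congr 1; ring
  have e2 : 1 - ε ^ 2 * ((1 + x) / (1 + ε ^ 2 * x)) = (1 - ε ^ 2) / (1 + ε ^ 2 * x) := by
    rw [← mul_div_assoc, one_sub_div d3.ne']; congr 1; ring
  have hε2 : 1 - ε ^ 2 ≠ 0 := by nlinarith
  simp only [e1, e2]
  rw [div_div_div_cancel_right₀ d3.ne', mul_div_cancel_left₀ _ hε2]

/-- The flux of an entropy relative to slope `x` along a state. -/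
def relFlux (U V : ℝ × ℝ → ℝ) (x : ℝ) (p : ℝ × ℝ) : ℝ := V p - x * U p

/-- Along r₁ one has dV = λ₁ dU with λ₁ = x, so in the derivative of V - xU only the term -U from
the explicit x survives. -/
lemma fan_relFlux {ε s x : ℝ} (hε : 0 < ε) (hε1 : ε < 1) {U V : ℝ × ℝ → ℝ}
    (h : IsWeakEntropyPair ε U V) (h1 : -(1 / ε) < x) (h2 : x < 1 / ε) (hs : 0 < s) :
    HasDerivAt (fun x => relFlux U V x (ofA ε (fanQ ε s x))) (-U (ofA ε (fanQ ε s x))) x := by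
  have hp := ofA_mem hε (fanQ_mem hε hε1 h1 h2 hs)
  obtain ⟨dU, dV⟩ := h.differentiableAt hp
  have hd := hasDerivAt_ofA_fanQ hε hε1 h1 h2 hs
  have eU := dU.hasFDerivAt.comp_hasDerivAt x hd
  have eV := dV.hasFDerivAt.comp_hasDerivAt x hd
  have hcomp := h.compat₁ _ hp
  rw [lam₁_fanQ hε hε1 h1 h2 hs] at hcomp
  refine (eV.sub ((hasDerivAt_id' x).mul eU)).congr_deriv ?_
  simp only [map_smul, smul_eq_mul, Function.comp]
  rw [hcomp]; ring

lemma continuousAt_ofA {ε : ℝ} (hε : 0 < ε) {f : ℝ → ℝ × ℝ} {x : ℝ} (hf : ContinuousAt f x)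
    (hq : f x ∈ cone ε) : ContinuousAt (fun t => ofA ε (f t)) x :=
  ContinuousAt.comp (f := f) (differentiableAt_ofA (cone_fst_pos hε hq).ne').continuousAt hf

lemma continuousAt_relFlux {ε : ℝ} (hε : 0 < ε) {U V : ℝ × ℝ → ℝ}
    (h : IsWeakEntropyPair ε U V) {f : ℝ → ℝ × ℝ} {x : ℝ} (hf : ContinuousAt f x)
    (hq : f x ∈ cone ε) : ContinuousAt (fun t => relFlux U V t (ofA ε (f t))) x := by
  have hp := h.differentiableAt (ofA_mem hε hq)
  have c0 := continuousAt_ofA hε hf hq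
  have c1 : ContinuousAt (fun t => U (ofA ε (f t))) x :=
    ContinuousAt.comp (f := fun t => ofA ε (f t)) hp.1.continuousAt c0
  have c2 : ContinuousAt (fun t => V (ofA ε (f t))) x :=
    ContinuousAt.comp (f := fun t => ofA ε (f t)) hp.2.continuousAt c0
  exact c2.sub (continuousAt_id.mul c1)

lemma curve1_relFlux {ε : ℝ} (hε : 0 < ε) (hε1 : ε < 1) {U V : ℝ × ℝ → ℝ}
    (h : IsWeakEntropyPair ε U V) {l : ℝ × ℝ} (hl : l ∈ cone ε) {x : ℝ} (h2 : x < 1 / ε)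
    (hx : x ≠ lam1A ε l) :
    HasDerivAt (fun x => relFlux U V x (ofA ε (curve1 ε l x))) (-U (ofA ε (curve1 ε l x))) x := by
  obtain ⟨b1, b2⟩ := lam1A_bounds hε hε1 hl
  rcases lt_or_gt_of_ne hx with hx | hx
  · have : HasDerivAt (fun x => relFlux U V x (ofA ε l)) (-U (ofA ε l)) x := by
      simpa [relFlux] using ((hasDerivAt_id' x).mul_const (U (ofA ε l))).const_sub (V (ofA ε l))
    rw [curve1, if_pos hx]
    refine this.congr_of_eventuallyEq ?_
    filter_upwards [eventually_lt_nhds hx] with t ht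
    rw [curve1, if_pos ht]
  · rw [curve1, if_neg (not_lt.2 hx.le)]
    refine (fan_relFlux hε hε1 h (b1.trans hx) h2 (fan_scale_pos hε hε1 hl)).congr_of_eventuallyEq ?_
    filter_upwards [eventually_gt_nhds hx] with t ht
    rw [curve1, if_neg (not_lt.2 (le_of_lt ht))]

lemma behind1_relFlux {ε : ℝ} (hε : 0 < ε) (hε1 : ε < 1) {U V : ℝ × ℝ → ℝ}
    (h : IsWeakEntropyPair ε U V) (hc : IsConvexEntropy ε U) {l : ℝ × ℝ} (hl : l ∈ cone ε) {α : ℝ}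
    (h1 : -(1 / ε) < α) (h2 : α < 1 / ε) :
    relFlux U V α (ofA ε (behind1 ε l α)) ≤ relFlux U V α (ofA ε (curve1 ε l α)) := by
  rcases lt_or_ge α (lam1A ε l) with hlt | hge
  · rw [behind1, curve1, if_pos hlt]
    exact shock_dissipation hε hε1 h hc hl h1 hlt.le
  · rw [behind1_fan hε hε1 hl hge h2, curve1, if_neg (not_lt.2 hge)]

/-! ### Reflection of entropy pairs -/

lemma fderiv_comp_refl {K : ℝ × ℝ → ℝ} {p : ℝ × ℝ} (hK : DifferentiableAt ℝ K (refl p))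
    (y : ℝ × ℝ) : fderiv ℝ (fun p => K (refl p)) p y = fderiv ℝ K (refl p) (refl y) := by
  have h1 : HasFDerivAt refl ((ContinuousLinearMap.fst ℝ ℝ ℝ).prod
      (-ContinuousLinearMap.snd ℝ ℝ ℝ)) p :=
    hasFDerivAt_fst.prodMk hasFDerivAt_snd.neg
  have h2 := hK.hasFDerivAt.comp p h1
  have h3 : fderiv ℝ (fun p => K (refl p)) p = _ := h2.fderiv
  rw [h3]; rfl

lemma contDiff_refl : ContDiff ℝ ∞ refl := by unfold refl; fun_prop

lemma refl_nonVacuum {ε : ℝ} {p : ℝ × ℝ} (h : p ∈ nonVacuum ε) : refl p ∈ nonVacuum ε :=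
  ⟨h.1, by show ε * |-p.2| < 1; rw [abs_neg]; exact h.2⟩

lemma IsWeakEntropyPair.reflect {ε : ℝ} {U V : ℝ × ℝ → ℝ} (h : IsWeakEntropyPair ε U V) :
    IsWeakEntropyPair ε (fun p => U (refl p)) (fun p => -V (refl p)) where
  continuousOn_entropy := h.continuousOn_entropy.comp contDiff_refl.continuous.continuousOn
    fun p hp => ⟨hp.1, by show ε * |-p.2| < 1; rw [abs_neg]; exact hp.2⟩
  continuousOn_flux := (h.continuousOn_flux.comp contDiff_refl.continuous.continuousOn
    fun p hp => ⟨hp.1, by show ε * |-p.2| < 1; rw [abs_neg]; exact hp.2⟩).neg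
  smooth_entropy := h.smooth_entropy.comp contDiff_refl.contDiffOn fun p hp => refl_nonVacuum hp
  smooth_flux := (h.smooth_flux.comp contDiff_refl.contDiffOn fun p hp => refl_nonVacuum hp).neg
  compat₁ := fun p hp => by
    obtain ⟨dU, dV⟩ := h.differentiableAt (refl_nonVacuum hp)
    have e : refl (r₁ ε p) = -r₂ ε (refl p) := by
      ext <;> simp [refl, r₁, r₂, neg_div]
    have e2 : lam₁ ε p = -lam₂ ε (refl p) := by
      simp only [lam₁, lam₂, refl]; rw [← neg_div]; congr 1 <;> ring
    rw [fderiv_fun_neg, neg_apply, fderiv_comp_refl dV, fderiv_comp_refl dU, e,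
      map_neg, map_neg, h.compat₂ _ (refl_nonVacuum hp), e2]
    ring
  compat₂ := fun p hp => by
    obtain ⟨dU, dV⟩ := h.differentiableAt (refl_nonVacuum hp)
    have e : refl (r₂ ε p) = -r₁ ε (refl p) := by
      ext <;> simp [refl, r₁, r₂, neg_div]
    have e2 : lam₂ ε p = -lam₁ ε (refl p) := by
      simp only [lam₁, lam₂, refl]; rw [← neg_div]; congr 1 <;> ring
    rw [fderiv_fun_neg, neg_apply, fderiv_comp_refl dV, fderiv_comp_refl dU, e,
      map_neg, map_neg, h.compat₁ _ (refl_nonVacuum hp), e2]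
    ring
  vacuum := fun v => ⟨(h.vacuum (-v)).1, by rw [neg_eq_zero]; exact (h.vacuum (-v)).2⟩
  decay := fun M hM => (h.decay M hM).imp fun C hC p hp => by
    rw [abs_neg]
    exact hC (refl p) ⟨hp.1, hp.2.1, by show _ ≤ 1 - ε * |-p.2|; rw [abs_neg]; exact hp.2.2⟩

lemma IsConvexEntropy.reflect {ε : ℝ} {U : ℝ × ℝ → ℝ} (h : IsConvexEntropy ε U) :
    IsConvexEntropy ε (fun p => U (refl p)) := by
  obtain ⟨η, hη, hU⟩ := h
  have hm : ∀ q ∈ conservedCone ε, refl q ∈ conservedCone ε := fun q hq => by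
    show ε * |-q.2| < q.1
    rw [abs_neg]; exact hq
  refine ⟨fun q => η (refl q), ⟨hη.1, fun x hx y hy a b ha hb hab => ?_⟩, fun p hp => ?_⟩
  · have := hη.2 (hm x hx) (hm y hy) ha hb hab
    have e : refl (a • x + b • y) = a • refl x + b • refl y := by
      ext
      · simp [refl]
      · simp [refl]; ring
    simp only [e]; exact this
  · have e1 : G ε (refl p) = G ε p := by simp [G, refl]
    have e2 : H ε (refl p) = -H ε p := by simp [H, refl]
    show U (refl p) = _
    rw [hU _ (refl_nonVacuum hp), e1, e2]; rfl

lemma ofA_refl (ε : ℝ) (q : ℝ × ℝ) : ofA ε (refl q) = refl (ofA ε q) := by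
  simp [ofA, refl, neg_div]

lemma relFlux_reflect (U V : ℝ × ℝ → ℝ) (x : ℝ) (p : ℝ × ℝ) :
    relFlux (fun p => U (refl p)) (fun p => -V (refl p)) (-x) (refl p) = -relFlux U V x p := by
  simp only [relFlux, refl_refl]; ring

/-! ### Piecewise smooth profiles -/

/-- Where E = f - xu satisfies E' = -u the integrand is the derivative of E a; finitely many kinks
of the profile are absorbed by the countable exceptional set. -/
lemma integral_piece {u f E : ℝ → ℝ} {c d : ℝ} (hcd : c ≤ d) (hu : BddMeas u) (hf : BddMeas f)
    {s : Set ℝ} (hs : s.Countable) (hE : ContinuousOn E (Icc c d))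
    (hd : ∀ x ∈ Ioo c d, x ∉ s → HasDerivAt E (-u x) x) (hfE : ∀ x ∈ Ioo c d, f x - x * u x = E x)
    {a : ℝ → ℝ} (ha : ContDiff ℝ 1 a) :
    ∫ x in c..d, (-u x * a x + (f x - x * u x) * deriv a x) = E d * a d - E c * a c := by
  have ha' : Continuous (deriv a) := ha.continuous_deriv le_rfl
  refine integral_eq_of_hasDerivAt_off_countable_of_le (fun x => E x * a x) _ hcd hs
    (hE.mul ha.continuous.continuousOn) (fun x hx => ?_) ?_
  · rw [hfE x hx.1]
    exact (hd x hx.1 hx.2).mul ((ha.differentiable one_ne_zero) x).hasDerivAt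
  · have iu := hu.intervalIntegrable c d
    have i1 := iu.neg.mul_continuousOn ha.continuous.continuousOn
    have i2 := ((hf.intervalIntegrable c d).sub
      (iu.continuousOn_mul continuousOn_id)).mul_continuousOn ha'.continuousOn
    exact i1.add i2

/-- The boundary terms telescope: at infinity a vanishes, and at α and β the nonnegative values of a
multiply the one-sided jumps of E, whose signs are prescribed. -/
lemma dissipation_of_pieces {u f EL EM ER : ℝ → ℝ} {α β : ℝ} (hαβ : α ≤ β) (hu : BddMeas u)
    (hf : BddMeas f) {s : Set ℝ} (hs : s.Countable) (cL : ContinuousOn EL (Iic α))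
    (dL : ∀ x < α, x ∉ s → HasDerivAt EL (-u x) x) (eL : ∀ x < α, f x - x * u x = EL x)
    (cM : ContinuousOn EM (Icc α β)) (dM : ∀ x ∈ Ioo α β, x ∉ s → HasDerivAt EM (-u x) x)
    (eM : ∀ x ∈ Ioo α β, f x - x * u x = EM x) (cR : ContinuousOn ER (Ici β))
    (dR : ∀ x, β < x → x ∉ s → HasDerivAt ER (-u x) x) (eR : ∀ x, β < x → f x - x * u x = ER x)
    (jα : EM α ≤ EL α) (jβ : ER β ≤ EM β) {a : ℝ → ℝ} (ha : ContDiff ℝ 1 a)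
    (hc : HasCompactSupport a) (ha0 : ∀ x, 0 ≤ a x) :
    0 ≤ ∫ x, (-u x * a x + (f x - x * u x) * deriv a x) := by
  obtain ⟨R₀, hR₀⟩ := hc.isCompact.isBounded.subset_closedBall 0
  set R := max R₀ (max (-α) β) + 1 with hR
  have r1 : R₀ < R := by linarith [le_max_left R₀ (max (-α) β)]
  have r2 : -R ≤ α := by
    linarith [le_max_right R₀ (max (-α) β), le_max_left (-α) β]
  have r3 : β ≤ R := by
    linarith [le_max_right R₀ (max (-α) β), le_max_right (-α) β]
  have hout : ∀ x, R₀ < |x| → x ∉ tsupport a := fun x hx hxa => by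
    have := hR₀ hxa
    rw [Metric.mem_closedBall, dist_zero_right, Real.norm_eq_abs] at this
    linarith
  have hz : ∀ x, R₀ < |x| → a x = 0 := fun x hx =>
    image_eq_zero_of_notMem_tsupport (hout x hx)
  have hz' : ∀ x, R₀ < |x| → deriv a x = 0 := fun x hx =>
    image_eq_zero_of_notMem_tsupport fun h => hout x hx (tsupport_deriv_subset h)
  have hβR : -R ≤ R := r2.trans (hαβ.trans r3)
  have hR0 : 0 ≤ R := by linarith
  have hint : ∀ c d, IntervalIntegrable (fun x => -u x * a x + (f x - x * u x) * deriv a x)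
      volume c d := by
    intro c d
    have iu := hu.intervalIntegrable c d
    exact (iu.neg.mul_continuousOn ha.continuous.continuousOn).add
      (((hf.intervalIntegrable c d).sub (iu.continuousOn_mul continuousOn_id)).mul_continuousOn
        (ha.continuous_deriv le_rfl).continuousOn)
  have htot : ∫ x in (-R)..R, (-u x * a x + (f x - x * u x) * deriv a x) =
      ∫ x, (-u x * a x + (f x - x * u x) * deriv a x) := by
    refine intervalIntegral.integral_eq_integral_of_support_subset fun x hx => ?_
    by_contra hcon
    refine hx ?_
    have hxR : R₀ < |x| := by
      rw [mem_Ioc, not_and_or, not_lt, not_le] at hcon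
      rcases hcon with h | h
      · have := neg_le_abs x
        linarith
      · have := le_abs_self x
        linarith
    simp only [hz x hxR, hz' x hxR, mul_zero, add_zero]
  have aR : a R = 0 := hz R (by rw [abs_of_nonneg hR0]; exact r1)
  have aR' : a (-R) = 0 := hz _ (by rw [abs_neg, abs_of_nonneg hR0]; exact r1)
  have p1 := integral_piece r2 hu hf hs (cL.mono Icc_subset_Iic_self) (fun x hx => dL x hx.2)
    (fun x hx => eL x hx.2) ha
  have p2 := integral_piece hαβ hu hf hs cM dM eM ha
  have p3 := integral_piece r3 hu hf hs (cR.mono Icc_subset_Ici_self) (fun x hx => dR x hx.1)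
    (fun x hx => eR x hx.1) ha
  rw [← htot, ← intervalIntegral.integral_add_adjacent_intervals (hint (-R) α) (hint α R),
    ← intervalIntegral.integral_add_adjacent_intervals (hint α β) (hint β R), p1, p2, p3, aR, aR']
  nlinarith [mul_le_mul_of_nonneg_right jα (ha0 α), mul_le_mul_of_nonneg_right jβ (ha0 β)]

/-! ### From dissipative profiles to entropy solutions; the wave patterns -/

/-- Self-similar profiles dissipating all convex entropies. -/
def Dissipative (ε : ℝ) (φ : ℝ → ℝ × ℝ) : Prop :=
  ∀ U V : ℝ × ℝ → ℝ, IsWeakEntropyPair ε U V → IsConvexEntropy ε U →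
    ∀ a : ℝ → ℝ, ContDiff ℝ 1 a → HasCompactSupport a → (∀ x, 0 ≤ a x) →
      0 ≤ ∫ x, (-U (φ x) * a x + (V (φ x) - x * U (φ x)) * deriv a x)

lemma Dissipative.reflect {ε : ℝ} {φ : ℝ → ℝ × ℝ} (h : Dissipative ε φ) :
    Dissipative ε (fun x => refl (φ (-x))) := by
  intro U V hp hc a ha hs ha0
  have key := h _ _ hp.reflect hc.reflect (fun x => a (-x)) (ha.comp contDiff_neg)
    (hs.comp_homeomorph (Homeomorph.neg ℝ)) (fun x => ha0 (-x))
  rw [← integral_neg_eq_self] at key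
  refine key.trans_eq (integral_congr_ae (ae_of_all _ fun x => ?_))
  have : deriv (fun x => a (-x)) (-x) = -deriv a x := by rw [deriv_comp_neg, neg_neg]
  simp only [neg_neg, this]
  ring

/-- At the vacuum the velocity is immaterial, because entropies vanish there for every v; hence the
far field has to match the data only up to the velocity of a vacuum state. -/
theorem IsRiemannSolution.of_dissipative {ε M : ℝ} {pl pr : ℝ × ℝ} {φ : ℝ → ℝ × ℝ}
    (hm : Measurable φ) (hM : 0 < M) (ht : ∀ x, φ x ∈ tameRegion ε M) {R : ℝ}
    (hl : ∀ x < -R, φ x = pl ∨ (φ x).1 = 0 ∧ pl.1 = 0)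
    (hr : ∀ x, R < x → φ x = pr ∨ (φ x).1 = 0 ∧ pr.1 = 0) (hd : Dissipative ε φ) :
    IsRiemannSolution ε pl pr φ where
  measurable := hm.comp
    ((measurable_snd.comp measurable_subtype_coe).div (measurable_fst.comp measurable_subtype_coe))
  tame := ⟨M, hM, fun t x _ => ht _⟩
  entropy := fun U V hp hc => by
    have hU : ∀ p q : ℝ × ℝ, p = q ∨ p.1 = 0 ∧ q.1 = 0 → U p = U q := by
      rintro ⟨p1, p2⟩ ⟨q1, q2⟩ (h | ⟨h1, h2⟩)
      · rw [h]
      · simp only at h1 h2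
        rw [h1, h2, (hp.vacuum _).1, (hp.vacuum _).1]
    obtain ⟨bU, bV⟩ := hp.bddMeas hM hm ht
    exact weakIneq_of_dissipation bU bV (R := R)
      (fun ξ y h1 h2 => by rw [riemannData, if_pos h2]; exact hU _ _ (hl ξ h1))
      (fun ξ y h1 h2 => by rw [riemannData, if_neg h2.not_gt]; exact hU _ _ (hr ξ h1))
      (hd U V hp hc)

lemma measurable_ofA (ε : ℝ) : Measurable (ofA ε) := by unfold ofA; fun_prop

lemma measurable_fanP (ε : ℝ) : Measurable (fanP ε) := by unfold fanP; fun_prop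

lemma measurable_curve1 (ε : ℝ) (l : ℝ × ℝ) : Measurable (curve1 ε l) := by
  have := measurable_fanP ε
  have h : ∀ s, Measurable (fanQ ε s) := fun s => by unfold fanQ; fun_prop
  exact Measurable.ite measurableSet_Iio measurable_const (h _)

lemma measurable_refl : Measurable refl := contDiff_refl.continuous.measurable

lemma measurable_wave (ε : ℝ) (l r : ℝ × ℝ) (α β : ℝ) (p : ℝ × ℝ) :
    Measurable (wave ε l r α β p) :=
  Measurable.ite measurableSet_Iio (measurable_curve1 ε l)
    (Measurable.ite measurableSet_Iio measurable_const
      (measurable_refl.comp ((measurable_curve1 ε (refl r)).comp measurable_neg)))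

lemma const_relFlux (U V : ℝ × ℝ → ℝ) (p : ℝ × ℝ) (x : ℝ) :
    HasDerivAt (fun x => relFlux U V x p) (-U p) x := by
  simpa [relFlux] using ((hasDerivAt_id' x).mul_const (U p)).const_sub (V p)

lemma relFlux_curve2 {ε : ℝ} (U V : ℝ × ℝ → ℝ) (r : ℝ × ℝ) (x : ℝ) :
    relFlux U V x (ofA ε (curve2 ε r x)) = -relFlux (fun p => U (refl p)) (fun p => -V (refl p)) (-x)
      (ofA ε (curve1 ε (refl r) (-x))) := by
  rw [curve2, ofA_refl, eq_neg_iff_add_eq_zero, ← neg_eq_iff_add_eq_zero, ← relFlux_reflect,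
    refl_refl]

theorem wave_dissipative {ε M : ℝ} (hε : 0 < ε) (hε1 : ε < 1) {l r : ℝ × ℝ} (hl : l ∈ cone ε)
    (hr : r ∈ cone ε) {α β : ℝ} (hα : -(1 / ε) < α) (hαβ : α < β) (hβ : β < 1 / ε)
    (hp : behind1 ε l α = ahead2 ε r β) (hM : 0 < M)
    (ht : ∀ x, ofA ε (wave ε l r α β (behind1 ε l α) x) ∈ tameRegion ε M) :
    Dissipative ε (fun x => ofA ε (wave ε l r α β (behind1 ε l α) x)) := by
  intro U V h hc a ha hs ha0
  have hrr := refl_mem hr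
  obtain ⟨bU, bV⟩ := h.bddMeas hM ((measurable_ofA ε).comp (measurable_wave _ _ _ _ _ _)) ht
  have hR2 : ∀ x, β < x → -x < 1 / ε := fun x hx => by linarith
  -- The exceptional slopes are the heads of the possible rarefactions, where the profile is
  -- continuous but may have a kink.
  refine dissipation_of_pieces (EL := fun x => relFlux U V x (ofA ε (curve1 ε l x)))
    (EM := fun x => relFlux U V x (ofA ε (behind1 ε l α)))
    (ER := fun x => relFlux U V x (ofA ε (curve2 ε r x))) hαβ.le bU bV
    (s := {lam1A ε l, -lam1A ε (refl r)}) (by simp) ?_ ?_ ?_ ?_ ?_ ?_ ?_ ?_ ?_ ?_ ?_ ha hs ha0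
  · intro x hx
    have hx2 : x < 1 / ε := lt_of_le_of_lt hx (hαβ.trans hβ)
    exact (continuousAt_relFlux hε h (continuousAt_curve1 hε hε1 hl hx2)
      (curve1_mem hε hε1 hl hx2)).continuousWithinAt
  · intro x hx hxs
    simp only [Function.comp, wave, if_pos hx]
    exact curve1_relFlux hε hε1 h hl (hx.trans (hαβ.trans hβ)) (fun e => hxs (by simp [e]))
  · intro x hx
    simp only [Function.comp, wave, if_pos hx]; rfl
  · intro x _
    exact (const_relFlux U V _ x).continuousAt.continuousWithinAt
  · intro x hx _
    simp only [Function.comp, wave, if_neg hx.1.not_gt, if_pos hx.2]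
    exact const_relFlux U V _ x
  · intro x hx
    simp only [Function.comp, wave, if_neg hx.1.not_gt, if_pos hx.2]; rfl
  · intro x hx
    have hx2 : -(1 / ε) < x := (hα.trans hαβ).trans_le hx
    exact (continuousAt_relFlux hε h (continuousAt_curve2 hε hε1 hr hx2)
      (curve2_mem hε hε1 hr hx2)).continuousWithinAt
  · intro x hx hxs
    simp only [Function.comp, wave, if_neg (hαβ.trans hx).not_gt, if_neg hx.not_gt]
    simp only [relFlux_curve2]
    have hd := curve1_relFlux hε hε1 h.reflect hrr (x := -x)
      (by linarith) (fun e => hxs (by simp [← e]))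
    have := (HasDerivAt.scomp x hd (hasDerivAt_neg x)).neg
    refine this.congr_deriv ?_
    rw [curve2, ofA_refl]
    simp
  · intro x hx
    simp only [Function.comp, wave, if_neg (hαβ.trans hx).not_gt, if_neg hx.not_gt]; rfl
  · exact behind1_relFlux hε hε1 h hc hl hα (hαβ.trans hβ)
  · simp only [relFlux_curve2, hp]
    have := behind1_relFlux hε hε1 h.reflect hc.reflect hrr (α := -β) (by linarith) (by linarith)
    rw [ahead2, ofA_refl]
    have e := relFlux_reflect U V β (refl (ofA ε (behind1 ε (refl r) (-β))))
    rw [refl_refl] at e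
    linarith

/-- The profile joining a state to the vacuum by a rarefaction. -/
def vacWave (ε : ℝ) (l : ℝ × ℝ) (x : ℝ) : ℝ × ℝ := if x < 1 / ε then curve1 ε l x else (0, 0)

lemma measurable_vacWave (ε : ℝ) (l : ℝ × ℝ) : Measurable (vacWave ε l) :=
  Measurable.ite measurableSet_Iio (measurable_curve1 ε l) measurable_const

lemma alpha_pos {ε : ℝ} (hε1 : ε < 1) : 0 < alpha ε := by
  have : 0 < 1 - ε := by linarith
  unfold alpha; positivity

lemma vacWave_density_tendsto {ε : ℝ} (hε : 0 < ε) (hε1 : ε < 1) {l : ℝ × ℝ} (hl : l ∈ cone ε) :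
    Tendsto (fun x => (ofA ε (vacWave ε l x)).1) (𝓝[≤] (1 / ε)) (𝓝 0) := by
  obtain ⟨b1, b2⟩ := lam1A_bounds hε hε1 hl
  set s := sp ε (lam1A ε l) l / fanP ε (lam1A ε l) with hs
  have hk : 0 < (1 + ε ^ 2) / (2 * ε) := by positivity
  have hz : ContinuousAt (fun x => (1 - ε ^ 2) * s ^ 2 / 4 *
      ((1 - ε * x) / (1 + ε * x)) ^ ((1 + ε ^ 2) / (2 * ε))) (1 / ε) := by
    refine continuousAt_const.mul (ContinuousAt.rpow_const ?_ (Or.inr hk.le))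
    exact ContinuousAt.div (by fun_prop) (by fun_prop) (by positivity)
  have hz0 : (1 - ε ^ 2) * s ^ 2 / 4 *
      ((1 - ε * (1 / ε)) / (1 + ε * (1 / ε))) ^ ((1 + ε ^ 2) / (2 * ε)) = 0 := by
    rw [mul_one_div_cancel hε.ne', sub_self, zero_div, Real.zero_rpow hk.ne', mul_zero]
  have ht := hz.tendsto
  rw [hz0] at ht
  refine (ht.mono_left nhdsWithin_le_nhds).congr' ?_
  filter_upwards [self_mem_nhdsWithin, nhdsWithin_le_nhds (Ioi_mem_nhds b2)] with x hx hx2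
  rcases (show x ≤ 1 / ε from hx).eq_or_lt with rfl | hlt
  · rw [hz0, vacWave, if_neg (lt_irrefl _), ofA_zero]
  · rw [vacWave, if_pos hlt, curve1, if_neg (not_lt.2 (le_of_lt hx2)),
      ofA_fanQ hε (b1.trans hx2) hlt (fan_scale_pos hε hε1 hl)]

/-- The only question is continuity of V - xU at the edge of the vacuum, x = 1/ε. There the velocity
tends to the speed of light, so continuity of the pair on the phase space is not available and the
decay rate is used instead. -/
theorem vacWave_dissipative {ε M : ℝ} (hε : 0 < ε) (hε1 : ε < 1) {l : ℝ × ℝ} (hl : l ∈ cone ε)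
    (hM : 0 < M) (ht : ∀ x, ofA ε (vacWave ε l x) ∈ tameRegion ε M) :
    Dissipative ε (fun x => ofA ε (vacWave ε l x)) := by
  intro U V h hc a ha hs ha0
  obtain ⟨bU, bV⟩ := h.bddMeas hM ((measurable_ofA ε).comp (measurable_vacWave _ _)) ht
  have hvac : ∀ x, 1 / ε ≤ x → U (ofA ε (vacWave ε l x)) = 0 ∧ V (ofA ε (vacWave ε l x)) = 0 := by
    intro x hx
    rw [vacWave, if_neg hx.not_gt, ofA_zero]; exact h.vacuum 0
  refine dissipation_of_pieces (EL := fun x => relFlux U V x (ofA ε (vacWave ε l x)))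
    (EM := fun _ => 0) (ER := fun _ => 0) (α := 1 / ε) (β := 1 / ε) le_rfl bU bV
    (s := {lam1A ε l}) (by simp) ?_ ?_ ?_ continuousOn_const ?_ ?_ continuousOn_const ?_ ?_ ?_ le_rfl
    ha hs ha0
  · intro x hx
    rcases (show x ≤ 1 / ε from hx).eq_or_lt with rfl | hlt
    · obtain ⟨C, hC⟩ := h.decay M hM
      have h0 : relFlux U V (1 / ε) (ofA ε (vacWave ε l (1 / ε))) = 0 := by
        rw [relFlux, (hvac _ le_rfl).1, (hvac _ le_rfl).2]; ring
      have hα := alpha_pos hε1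
      have hlim : Tendsto (fun x => (1 + |x|) * (C * (ofA ε (vacWave ε l x)).1 ^ alpha ε))
          (𝓝[≤] (1 / ε)) (𝓝 0) := by
        have t1 := ((vacWave_density_tendsto hε hε1 hl).rpow_const
          (p := alpha ε) (Or.inr hα.le)).const_mul C
        rw [Real.zero_rpow hα.ne', mul_zero] at t1
        have t2 : Tendsto (fun x : ℝ => 1 + |x|) (𝓝[≤] (1 / ε)) (𝓝 (1 + |1 / ε|)) :=
          (continuous_const.add continuous_abs).continuousAt.tendsto.mono_left nhdsWithin_le_nhds
        simpa using t2.mul t1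
      rw [ContinuousWithinAt, h0]
      refine squeeze_zero_norm (fun y => ?_) hlim
      have hb := hC _ (ht y)
      have n1 := abs_nonneg (U (ofA ε (vacWave ε l y)))
      have n2 := abs_nonneg (V (ofA ε (vacWave ε l y)))
      rw [Real.norm_eq_abs, relFlux]
      refine (abs_sub _ _).trans ?_
      rw [abs_mul]
      nlinarith [abs_nonneg y, mul_le_mul_of_nonneg_left hb (abs_nonneg y),
        mul_nonneg (abs_nonneg y) n2]
    · refine ContinuousAt.continuousWithinAt ?_
      refine (continuousAt_relFlux hε h (continuousAt_curve1 hε hε1 hl hlt)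
        (curve1_mem hε hε1 hl hlt)).congr ?_
      filter_upwards [eventually_lt_nhds hlt] with y hy
      rw [vacWave, if_pos hy]
  · intro x hx hxs
    simp only [Function.comp]
    have := curve1_relFlux hε hε1 h hl hx hxs
    rw [vacWave, if_pos hx]
    refine this.congr_of_eventuallyEq ?_
    filter_upwards [eventually_lt_nhds hx] with y hy
    rw [vacWave, if_pos hy]
  · intro x _; rfl
  · intro x hx; exact absurd (hx.1.trans hx.2) (lt_irrefl _)
  · intro x hx; exact absurd (hx.1.trans hx.2) (lt_irrefl _)
  · intro x hx _
    simp only [Function.comp, (hvac x hx.le).1, neg_zero]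
    exact hasDerivAt_const x 0
  · intro x hx
    simp only [Function.comp, (hvac x hx.le).1, (hvac x hx.le).2]; ring
  · show 0 ≤ relFlux U V (1 / ε) _
    rw [relFlux, (hvac _ le_rfl).1, (hvac _ le_rfl).2]; simp

lemma vacuum_dissipative (ε : ℝ) : Dissipative ε (fun _ => (0, 0)) := by
  intro U V h hc a ha hs ha0
  simp [(h.vacuum 0).1, (h.vacuum 0).2]

/-! ### Contact discontinuities at light speed -/

/-- For ε = 1 the first wave speed is identically -1, and the curves a+b = const are integral curves
of r₁; along them V + U is constant. -/
lemma contact_relFlux {U V : ℝ × ℝ → ℝ} (h : IsWeakEntropyPair 1 U V) {p q : ℝ × ℝ}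
    (hp : p ∈ cone 1) (hq : q ∈ cone 1) (hpq : p.1 + p.2 = q.1 + q.2) :
    relFlux U V (-1) (ofA 1 p) = relFlux U V (-1) (ofA 1 q) := by
  obtain ⟨p1, p2⟩ := cone_light one_pos hp
  obtain ⟨q1, q2⟩ := cone_light one_pos hq
  rw [one_mul] at p1 p2 q1 q2
  set s := p.1 + p.2 with hs
  -- The state with a+b = s and a-b = δ in the variables (ρ, v).
  let c : ℝ → ℝ × ℝ := fun δ => (s * δ, (s - δ) / (s + δ))
  have hc : ∀ y : ℝ × ℝ, y.1 + y.2 = s → 0 < y.1 - y.2 → c (y.1 - y.2) = ofA 1 y := by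
    intro y hy hy'
    ext
    · simp only [c, ofA, ← hy]; ring
    · simp only [c, ofA, ← hy]
      rw [show y.1 + y.2 - (y.1 - y.2) = 2 * y.2 by ring,
        show y.1 + y.2 + (y.1 - y.2) = 2 * y.1 by ring, mul_div_mul_left _ _ two_ne_zero]
  have hcm : ∀ δ, 0 < δ → c δ ∈ nonVacuum 1 := by
    intro δ hδ
    have e := hc ((s + δ) / 2, (s - δ) / 2) (by simp only; ring) (by simp only; linarith)
    rw [show ((s + δ) / 2, (s - δ) / 2).1 - ((s + δ) / 2, (s - δ) / 2).2 = δ by simp only; ring] at e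
    rw [e]
    refine ofA_mem one_pos ((cone_iff one_pos).2 ⟨?_, ?_⟩) <;> simp only <;> linarith
  have hder : ∀ δ ∈ Ioi (0 : ℝ), HasDerivAt (fun δ => relFlux U V (-1) (c δ)) 0 δ := by
    intro δ hδ
    have hδ0 : (0 : ℝ) < δ := hδ
    have hsum : 0 < s + δ := by linarith
    have d1 : HasDerivAt c (-(4 * s ^ 2 * δ / (s + δ) ^ 2) • r₁ 1 (c δ)) δ := by
      refine (((hasDerivAt_id' δ).const_mul s).prodMk
        (((hasDerivAt_id' δ).const_sub s).div ((hasDerivAt_id' δ).const_add s)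
          hsum.ne')).congr_deriv ?_
      have hlum : 1 - 1 ^ 2 * ((s - δ) / (s + δ)) ^ 2 = 4 * s * δ / (s + δ) ^ 2 := by
        field_simp; ring
      ext
      · simp only [c, r₁, Prod.smul_fst, smul_eq_mul, hlum]
        field_simp
      · simp only [c, r₁, Prod.smul_snd, smul_eq_mul]
        field_simp; ring
    obtain ⟨dU, dV⟩ := h.differentiableAt (hcm δ hδ0)
    have eU := dU.hasFDerivAt.comp_hasDerivAt δ d1
    have eV := dV.hasFDerivAt.comp_hasDerivAt δ d1
    have hcomp := h.compat₁ _ (hcm δ hδ0)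
    have hlam : lam₁ 1 (c δ) = -1 := by
      have h1 : 1 - 1 ^ 2 * ((s - δ) / (s + δ)) ≠ 0 := by
        rw [one_pow, one_mul, one_sub_div hsum.ne']
        have : s + δ - (s - δ) = 2 * δ := by ring
        rw [this]; positivity
      simp only [lam₁, c]
      rw [div_eq_iff h1]; ring
    rw [hlam] at hcomp
    refine (eV.sub (eU.const_mul (-1))).congr_deriv ?_
    simp only [map_smul, smul_eq_mul]
    rw [hcomp]; ring
  have := isOpen_Ioi.is_const_of_deriv_eq_zero isPreconnected_Ioi
    (fun y hy => (hder y hy).differentiableAt.differentiableWithinAt)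
    (fun y hy => (hder y hy).deriv) (show p.1 - p.2 ∈ Ioi (0 : ℝ) from p2)
    (show q.1 - q.2 ∈ Ioi (0 : ℝ) from q2)
  rwa [hc p rfl p2, hc q hpq.symm q2] at this

/-- The intermediate state at light speed. -/
def mid1 (l r : ℝ × ℝ) : ℝ × ℝ :=
  (((l.1 + l.2) + (r.1 - r.2)) / 2, ((l.1 + l.2) - (r.1 - r.2)) / 2)

lemma mid1_mem {l r : ℝ × ℝ} (hl : l ∈ cone 1) (hr : r ∈ cone 1) : mid1 l r ∈ cone 1 := by
  have h1 := (cone_light one_pos hl).1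
  have h2 := (cone_light one_pos hr).2
  rw [cone_iff one_pos, mid1]
  constructor <;> simp only <;> linarith

lemma measurable_wave1 (l r : ℝ × ℝ) : Measurable (wave1 l r) :=
  Measurable.ite measurableSet_Iio measurable_const
    (Measurable.ite measurableSet_Iio measurable_const measurable_const)

theorem wave1_dissipative {M : ℝ} {l r : ℝ × ℝ} (hl : l ∈ cone 1) (hr : r ∈ cone 1) (hM : 0 < M)
    (ht : ∀ x, ofA 1 (wave1 l r x) ∈ tameRegion 1 M) :
    Dissipative 1 (fun x => ofA 1 (wave1 l r x)) := by
  intro U V h hc a ha hs ha0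
  obtain ⟨bU, bV⟩ := h.bddMeas hM ((measurable_ofA 1).comp (measurable_wave1 _ _)) ht
  have hm := mid1_mem hl hr
  have hcont : ∀ p s, ContinuousOn (fun x => relFlux U V x p) s := fun p s x _ =>
    (const_relFlux U V p x).continuousAt.continuousWithinAt
  have v1 : ∀ x < -1, wave1 l r x = l := fun x hx => by rw [wave1, if_pos hx]
  have v2 : ∀ x ∈ Ioo (-1 : ℝ) 1, wave1 l r x = mid1 l r := fun x hx => by
    rw [wave1, if_neg hx.1.not_gt, if_pos hx.2]; rfl
  have v3 : ∀ x, 1 < x → wave1 l r x = r := fun x hx => by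
    rw [wave1, if_neg (by linarith), if_neg hx.not_gt]
  refine dissipation_of_pieces (EL := fun x => relFlux U V x (ofA 1 l))
    (EM := fun x => relFlux U V x (ofA 1 (mid1 l r)))
    (ER := fun x => relFlux U V x (ofA 1 r)) (α := -1) (β := 1) (by norm_num) bU bV
    (s := ∅) (by simp) (hcont _ _) ?_ ?_ (hcont _ _) ?_ ?_ (hcont _ _) ?_ ?_ ?_ ?_ ha hs ha0
  · intro x hx _
    simp only [Function.comp, v1 x hx]; exact const_relFlux U V _ x
  · intro x hx
    simp only [Function.comp, v1 x hx]; rfl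
  · intro x hx _
    simp only [Function.comp, v2 x hx]; exact const_relFlux U V _ x
  · intro x hx
    simp only [Function.comp, v2 x hx]; rfl
  · intro x hx _
    simp only [Function.comp, v3 x hx]; exact const_relFlux U V _ x
  · intro x hx
    simp only [Function.comp, v3 x hx]; rfl
  · exact (contact_relFlux h hm hl (by simp only [mid1]; ring)).le
  · have := contact_relFlux h.reflect (refl_mem hm) (refl_mem hr)
      (by simp only [mid1, refl]; ring)
    rw [ofA_refl, ofA_refl, relFlux_reflect, relFlux_reflect] at this
    exact (neg_inj.1 this).ge

/-! ### Riemann invariants -/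

/-- The invariant `W` in square-root coordinates. -/
def WA (ε : ℝ) (q : ℝ × ℝ) : ℝ := rhoA ε q ^ (1 / (1 + ε ^ 2)) * ratA ε q ^ (1 / (2 * ε))

lemma WA_zero {ε : ℝ} : WA ε (0, 0) = 0 := by
  have : (1 / (1 + ε ^ 2)) ≠ 0 := by positivity
  simp only [WA, rhoA]
  norm_num
  left
  exact Real.zero_rpow (by positivity)

lemma WA_nonneg {ε : ℝ} (hε : 0 < ε) {q : ℝ × ℝ} (h : q = (0, 0) ∨ q ∈ cone ε) : 0 ≤ WA ε q := by
  rcases h with rfl | h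
  · rw [WA_zero]
  · exact mul_nonneg (Real.rpow_nonneg (cone_rho_pos hε h).le _)
      (Real.rpow_nonneg (ratA_pos hε h).le _)

lemma W_eq {ε : ℝ} (hε : 0 < ε) {p : ℝ × ℝ} (h : Adm ε p) : W ε p = WA ε (toA ε p) := by
  have h0 : (1 / (1 + ε ^ 2)) ≠ 0 := by positivity
  rcases h.cases with hp | hp
  · rw [toA_vac hp, WA_zero, W, hp, Real.zero_rpow h0, zero_mul]
  · have hc := toA_mem hε hp
    have e1 : p.1 = rhoA ε (toA ε p) := rho_eq hε h
    have e2 : (1 + ε * p.2) / (1 - ε * p.2) = ratA ε (toA ε p) := by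
      have hs : 0 < √(p.1 / (1 - ε ^ 2 * p.2 ^ 2)) := cone_fst_pos hε hc
      simp only [ratA, toA]
      rw [← mul_div_mul_left _ _ hs.ne']
      congr 1 <;> ring
    rw [WA, W, ← e1, ← e2]

lemma Z_eq {ε : ℝ} (hε : 0 < ε) {p : ℝ × ℝ} (h : Adm ε p) :
    Z ε p = WA ε (refl (toA ε p)) := by
  have h0 : (1 / (1 + ε ^ 2)) ≠ 0 := by positivity
  rcases h.cases with hp | hp
  · rw [toA_vac hp, refl_zero, WA_zero, Z, hp, Real.zero_rpow h0, zero_mul]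
  · have hc := toA_mem hε hp
    have e1 : p.1 = rhoA ε (toA ε p) := rho_eq hε h
    have e2 : (1 + ε * p.2) / (1 - ε * p.2) = ratA ε (toA ε p) := by
      have hs : 0 < √(p.1 / (1 - ε ^ 2 * p.2 ^ 2)) := cone_fst_pos hε hc
      simp only [ratA, toA]
      rw [← mul_div_mul_left _ _ hs.ne']
      congr 1 <;> ring
    rw [WA, Z, rhoA_refl, ratA_refl, ← e1, e2, Real.inv_rpow (ratA_pos hε hc).le,
      Real.rpow_neg (ratA_pos hε hc).le]

lemma WA_le {ε : ℝ} (hε : 0 < ε) {p q : ℝ × ℝ} (hp : p ∈ cone ε)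
    (h1 : rhoA ε p ≤ rhoA ε q) (h2 : ratA ε p ≤ ratA ε q) : WA ε p ≤ WA ε q := by
  have r1 : 0 ≤ rhoA ε p := (cone_rho_pos hε hp).le
  have r2 := (ratA_pos hε hp).le
  have e1 : 0 ≤ 1 / (1 + ε ^ 2) := by positivity
  have e2 : 0 ≤ 1 / (2 * ε) := by positivity
  exact mul_le_mul (Real.rpow_le_rpow r1 h1 e1) (Real.rpow_le_rpow r2 h2 e2)
    (Real.rpow_nonneg r2 _) (Real.rpow_nonneg (r1.trans h1) _)

/-- The density carries the power (1+ε²)/(2ε) of (1-εx)/(1+εx); raised to 1/(1+ε²), it cancels the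
contribution of the ratio. -/
lemma WA_fanQ {ε s x : ℝ} (hε : 0 < ε) (hε1 : ε < 1) (h1 : -(1 / ε) < x) (h2 : x < 1 / ε)
    (hs : 0 < s) : WA ε (fanQ ε s x) = ((1 - ε ^ 2) * s ^ 2 / 4) ^ (1 / (1 + ε ^ 2)) *
      ((1 + ε) / (1 - ε)) ^ (1 / (2 * ε)) := by
  obtain ⟨d0, d1, d2⟩ := one_sub_pos hε h1 h2
  have hz : 0 < (1 - ε * x) / (1 + ε * x) := div_pos d2 d1
  have hε2 : 0 < 1 - ε ^ 2 := by nlinarith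
  have hε3 : 0 < 1 - ε := by linarith
  rw [WA, rhoA_fanQ hε h1 h2, ratA_fanQ hε hε1 h1 h2 hs, ← inv_div (1 - ε * x) (1 + ε * x),
    Real.mul_rpow (by positivity) (by positivity), Real.mul_rpow (by positivity) (by positivity),
    ← Real.rpow_mul hz.le, Real.inv_rpow hz.le,
    show (1 + ε ^ 2) / (2 * ε) * (1 / (1 + ε ^ 2)) = 1 / (2 * ε) by field_simp]
  have := (Real.rpow_pos_of_pos hz (1 / (2 * ε))).ne'
  field_simp

lemma WA_curve1 {ε : ℝ} (hε : 0 < ε) (hε1 : ε < 1) {l : ℝ × ℝ} (hl : l ∈ cone ε) {x : ℝ}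
    (h2 : x < 1 / ε) : WA ε (curve1 ε l x) = WA ε l := by
  rw [curve1]
  split_ifs with hx
  · rfl
  · obtain ⟨b1, b2⟩ := lam1A_bounds hε hε1 hl
    have hs := fan_scale_pos hε hε1 hl
    conv_rhs => rw [← fanQ_lam1A hε hε1 hl]
    rw [WA_fanQ hε hε1 (b1.trans_le (not_lt.1 hx)) h2 hs, WA_fanQ hε hε1 b1 b2 hs]

/-- In a 1-rarefaction the density falls and the ratio rises, so both factors of the mirrored
invariant fall. -/
lemma WA_refl_curve1 {ε : ℝ} (hε : 0 < ε) (hε1 : ε < 1) {l : ℝ × ℝ} (hl : l ∈ cone ε) {x : ℝ}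
    (h2 : x < 1 / ε) : WA ε (refl (curve1 ε l x)) ≤ WA ε (refl l) := by
  obtain ⟨b1, b2⟩ := lam1A_bounds hε hε1 hl
  rcases lt_or_ge (lam1A ε l) x with hx | hx
  · have e1 : behind1 ε l x = curve1 ε l x := by
      rw [behind1_fan hε hε1 hl hx.le h2, curve1, if_neg hx.not_gt]
    have e2 : behind1 ε l (lam1A ε l) = l := by
      rw [behind1_fan hε hε1 hl le_rfl b2, fanQ_lam1A hε hε1 hl]
    obtain ⟨m1, m2⟩ := behind1_mono hε hε1 hl b1 hx h2
    rw [e1, e2] at m1 m2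
    have hc := curve1_mem hε hε1 hl h2
    refine WA_le hε (refl_mem hc) ?_ ?_
    · rw [rhoA_refl, rhoA_refl]; exact m1.le
    · rw [ratA_refl, ratA_refl]
      exact (inv_le_inv₀ (ratA_pos hε hc) (ratA_pos hε hl)).2 m2.le
  · rcases hx.eq_or_lt with rfl | hx
    · rw [curve1, if_neg (lt_irrefl _), fanQ_lam1A hε hε1 hl]
    · rw [curve1, if_pos hx]

/-- Logarithm of the jump of the first invariant across a `1`-shock. -/
lemma shock_invariant_log {ε w : ℝ} (hε : 0 < ε) (hε1 : ε < 1) (h1 : 1 ≤ w) (h2 : ε * w < 1) :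
    1 / (1 + ε ^ 2) * Real.log (shockRho ε w) + 1 / (2 * ε) * Real.log (shockRat ε w) ≤ 0 := by
  have pos : ∀ t ∈ Icc 1 w, 0 < t - ε ∧ 0 < t + ε ∧ 0 < 1 - ε * t ∧ 0 < 1 + ε * t := by
    intro t ht
    have := mul_le_mul_of_nonneg_left ht.2 hε.le
    have := mul_le_mul_of_nonneg_left ht.1 hε.le
    refine ⟨by linarith [ht.1], by linarith [ht.1], by linarith, by linarith⟩
  -- f is zero for the trivial shock t = 1; the chosen exponents make its derivative a negative
  -- multiple of (1-t)².
  set f : ℝ → ℝ := fun t => 1 / (1 + ε ^ 2) *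
      (Real.log (t - ε) + Real.log (t + ε) - Real.log (1 - ε * t) - Real.log (1 + ε * t)) +
    1 / (2 * ε) *
      (Real.log (t + ε) + Real.log (1 - ε * t) - Real.log (t - ε) - Real.log (1 + ε * t)) with hf
  have hd : ∀ t ∈ Icc 1 w, HasDerivAt f (-((1 - ε ^ 2) * (1 - t) ^ 2 /
      ((t - ε) * (t + ε) * ((1 - ε * t) * (1 + ε * t))))) t := by
    intro t ht
    obtain ⟨a1, a2, a3, a4⟩ := pos t ht
    have l1 := ((hasDerivAt_id' t).sub_const ε).log a1.ne'
    have l2 := ((hasDerivAt_id' t).add_const ε).log a2.ne'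
    have l3 := (((hasDerivAt_id' t).const_mul ε).const_sub 1).log a3.ne'
    have l4 := (((hasDerivAt_id' t).const_mul ε).const_add 1).log a4.ne'
    refine (((((l1.add l2).sub l3).sub l4).const_mul (1 / (1 + ε ^ 2))).add
      ((((l2.add l3).sub l1).sub l4).const_mul (1 / (2 * ε)))).congr_deriv ?_
    have n1 := a1.ne'
    have n2 := a2.ne'
    have n3 := a3.ne'
    have n4 := a4.ne'
    field_simp; ring
  have hanti : AntitoneOn f (Icc 1 w) := by
    refine antitoneOn_of_deriv_nonpos (convex_Icc _ _)
      (fun t ht => (hd t ht).continuousAt.continuousWithinAt)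
      (fun t ht => (hd t (interior_subset ht)).differentiableAt.differentiableWithinAt)
      (fun t ht => ?_)
    obtain ⟨a1, a2, a3, a4⟩ := pos t (interior_subset ht)
    rw [(hd t (interior_subset ht)).deriv, neg_nonpos]
    have : 0 < 1 - ε ^ 2 := by nlinarith
    positivity
  have key := hanti (left_mem_Icc.2 h1) (right_mem_Icc.2 h1) h1
  have f1 : f 1 = 0 := by
    simp only [hf, mul_one]
    rw [add_comm 1 ε]; ring
  obtain ⟨a1, a2, a3, a4⟩ := pos w (right_mem_Icc.2 h1)
  have e1 : Real.log (shockRho ε w) =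
      Real.log (w - ε) + Real.log (w + ε) - Real.log (1 - ε * w) - Real.log (1 + ε * w) := by
    rw [shockRho, show w ^ 2 - ε ^ 2 = (w - ε) * (w + ε) by ring,
      show 1 - ε ^ 2 * w ^ 2 = (1 - ε * w) * (1 + ε * w) by ring,
      Real.log_div (by positivity) (by positivity), Real.log_mul a1.ne' a2.ne',
      Real.log_mul a3.ne' a4.ne']
    ring
  have e2 : Real.log (shockRat ε w) =
      Real.log (w + ε) + Real.log (1 - ε * w) - Real.log (w - ε) - Real.log (1 + ε * w) := by
    rw [shockRat, Real.log_div (by positivity) (by positivity), Real.log_mul a2.ne' a3.ne',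
      Real.log_mul a1.ne' a4.ne']
    ring
  rw [e1, e2]
  exact key.trans_eq f1

lemma WA_behind1 {ε : ℝ} (hε : 0 < ε) (hε1 : ε < 1) {l : ℝ × ℝ} (hl : l ∈ cone ε) {x : ℝ}
    (h1 : -(1 / ε) < x) (h2 : x < 1 / ε) : WA ε (behind1 ε l x) ≤ WA ε l := by
  rcases le_or_gt x (lam1A ε l) with hx | hx
  · obtain ⟨w1, w2, w3, w4⟩ := behind1_shock hε hε1 hl h1 hx
    set w := relV ε x l
    have hw : 0 < ε * w := by positivity
    have s1 : 0 < shockRho ε w := div_pos (by nlinarith) (by nlinarith)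
    have s2 : 0 < shockRat ε w :=
      div_pos (mul_pos (by linarith) (by linarith)) (mul_pos (by linarith) (by linarith))
    have r1 : 0 ≤ rhoA ε l := (cone_rho_pos hε hl).le
    have r2 := (ratA_pos hε hl).le
    have key : shockRho ε w ^ (1 / (1 + ε ^ 2)) * shockRat ε w ^ (1 / (2 * ε)) ≤ 1 := by
      rw [Real.rpow_def_of_pos s1, Real.rpow_def_of_pos s2, ← Real.exp_add, Real.exp_le_one_iff]
      have := shock_invariant_log hε hε1 w1 w2
      linarith
    rw [WA, w3, w4, Real.mul_rpow r1 s1.le, Real.mul_rpow r2 s2.le, mul_mul_mul_comm]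
    exact mul_le_of_le_one_right (WA_nonneg hε (Or.inr hl)) key
  · have e1 : behind1 ε l x = curve1 ε l x := by
      rw [behind1_fan hε hε1 hl hx.le h2, curve1, if_neg hx.not_gt]
    rw [e1, WA_curve1 hε hε1 hl h2]

/-- For ε = 1 the invariants are the light-cone coordinates themselves, so the bounds for the
intermediate state are equalities with the data. -/
lemma WA_one {q : ℝ × ℝ} (h : q ∈ cone 1) : WA 1 q = q.1 + q.2 := by
  obtain ⟨h1, h2⟩ := cone_light one_pos h
  rw [one_mul] at h1 h2
  have e : rhoA 1 q * ratA 1 q = (q.1 + q.2) ^ 2 := by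
    rw [rhoA_eq_mul, ratA]; simp only [one_mul]
    have := h2.ne'
    field_simp
  have r1 : 0 ≤ rhoA 1 q := (cone_rho_pos one_pos h).le
  rw [WA, show (1 : ℝ) / (1 + 1 ^ 2) = 1 / 2 by norm_num, show (1 : ℝ) / (2 * 1) = 1 / 2 by norm_num,
    ← Real.mul_rpow r1 (ratA_pos one_pos h).le, e, ← Real.sqrt_eq_rpow, Real.sqrt_sq h1.le]

/-- The pointwise invariant bounds for profiles in square-root coordinates. -/
def InvariantBound (ε : ℝ) (l r : ℝ × ℝ) (q : ℝ × ℝ) : Prop :=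
  (q = (0, 0) ∨ q ∈ cone ε) ∧ WA ε q ≤ max (WA ε l) (WA ε r) ∧
    WA ε (refl q) ≤ max (WA ε (refl l)) (WA ε (refl r))

lemma InvariantBound.left {ε : ℝ} {l r q : ℝ × ℝ} (h : q = (0, 0) ∨ q ∈ cone ε)
    (h1 : WA ε q ≤ WA ε l) (h2 : WA ε (refl q) ≤ WA ε (refl l)) : InvariantBound ε l r q :=
  ⟨h, h1.trans (le_max_left _ _), h2.trans (le_max_left _ _)⟩

lemma InvariantBound.symm {ε : ℝ} {l r q : ℝ × ℝ} (h : InvariantBound ε l r q) :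
    InvariantBound ε r l q := by
  refine ⟨h.1, ?_, ?_⟩
  · rw [max_comm]; exact h.2.1
  · rw [max_comm]; exact h.2.2

lemma InvariantBound.refl {ε : ℝ} {l r q : ℝ × ℝ} (h : InvariantBound ε l r q) :
    InvariantBound ε (refl l) (refl r) (refl q) :=
  ⟨h.1.imp (fun e => by rw [e, refl_zero]) refl_mem, h.2.2, by simpa only [refl_refl] using h.2.1⟩

lemma bound_zero {ε : ℝ} (hε : 0 < ε) {l r : ℝ × ℝ} (hl : l = (0, 0) ∨ l ∈ cone ε) :
    InvariantBound ε l r (0, 0) := by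
  refine .left (Or.inl rfl) ?_ ?_
  · rw [WA_zero]; exact WA_nonneg hε hl
  · rw [refl_zero, WA_zero]
    exact WA_nonneg hε (hl.imp (fun e => by rw [e, refl_zero]) refl_mem)

lemma bound_curve1 {ε : ℝ} (hε : 0 < ε) (hε1 : ε < 1) {l : ℝ × ℝ} (hl : l ∈ cone ε) (r : ℝ × ℝ)
    {x : ℝ} (h2 : x < 1 / ε) : InvariantBound ε l r (curve1 ε l x) :=
  .left (Or.inr (curve1_mem hε hε1 hl h2)) (WA_curve1 hε hε1 hl h2).le (WA_refl_curve1 hε hε1 hl h2)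

lemma bound_vacWave {ε : ℝ} (hε : 0 < ε) (hε1 : ε < 1) {l : ℝ × ℝ} (hl : l ∈ cone ε) (r : ℝ × ℝ)
    (x : ℝ) : InvariantBound ε l r (vacWave ε l x) := by
  rw [vacWave]
  split_ifs with hx
  · exact bound_curve1 hε hε1 hl r hx
  · exact bound_zero hε (Or.inr hl)

lemma bound_wave {ε : ℝ} (hε : 0 < ε) (hε1 : ε < 1) {l r : ℝ × ℝ} (hl : l ∈ cone ε)
    (hr : r ∈ cone ε) {α β : ℝ} (hα : -(1 / ε) < α) (hαβ : α < β) (hβ : β < 1 / ε)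
    (hp : behind1 ε l α = ahead2 ε r β) (x : ℝ) :
    InvariantBound ε l r (wave ε l r α β (behind1 ε l α) x) := by
  rw [wave]
  split_ifs with h1 h2
  · exact bound_curve1 hε hε1 hl r (h1.trans (hαβ.trans hβ))
  · refine ⟨Or.inr (behind1_mem hε hε1 hl hα (hαβ.trans hβ)),
      (WA_behind1 hε hε1 hl hα (hαβ.trans hβ)).trans (le_max_left _ _), ?_⟩
    rw [hp, ahead2, refl_refl]
    exact (WA_behind1 hε hε1 (refl_mem hr) (by linarith) (by linarith)).trans (le_max_right _ _)
  · have := (bound_curve1 hε hε1 (refl_mem hr) (refl l) (x := -x) (by linarith)).symm.refl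
    rwa [refl_refl, refl_refl] at this

lemma bound_wave1 {l r : ℝ × ℝ} (hl : l ∈ cone 1) (hr : r ∈ cone 1) (x : ℝ) :
    InvariantBound 1 l r (wave1 l r x) := by
  have hself : ∀ l r : ℝ × ℝ, l ∈ cone 1 → InvariantBound 1 l r l := fun l r hl =>
    .left (Or.inr hl) le_rfl le_rfl
  rw [wave1]
  split_ifs
  · exact hself l r hl
  · have hm := mid1_mem hl hr
    refine ⟨Or.inr hm, le_max_of_le_left ?_, le_max_of_le_right ?_⟩
    · rw [WA_one hl]
      refine (WA_one hm).trans_le ?_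
      simp only [mid1]; linarith
    · rw [WA_one (refl_mem hr)]
      refine (WA_one (refl_mem hm)).trans_le ?_
      simp only [mid1, refl]; linarith
  · exact (hself r l hr).symm

/-! ### The tame region -/

lemma tame_zero {ε K : ℝ} (hε : 0 < ε) (hK : 0 < K) : (0, 0) ∈ tameRegion ε K := by
  refine ⟨le_rfl, hK.le, ?_⟩
  have : epsPrime ε ≠ 0 := by unfold epsPrime; positivity
  simp [Real.zero_rpow this]

/-- Raising W ≤ K to the power 2ε clears the exponent of the velocity factor and turns that of the
density into ε'. -/
lemma density_le_of_W {ε K : ℝ} (hε : 0 < ε) {p : ℝ × ℝ} (hp : p ∈ nonVacuum ε)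
    (hW : W ε p ≤ K) :
    p.1 ^ epsPrime ε * ((1 + ε * p.2) / (1 - ε * p.2)) ≤ K ^ (2 * ε) := by
  obtain ⟨l1, l2⟩ := lum_lt hε hp.2
  have hq : 0 < (1 + ε * p.2) / (1 - ε * p.2) := div_pos (by linarith) (by linarith)
  have h0 : 0 ≤ W ε p := mul_nonneg (Real.rpow_nonneg hp.1.le _) (Real.rpow_nonneg hq.le _)
  refine le_trans (le_of_eq ?_) (Real.rpow_le_rpow h0 hW (by positivity : 0 ≤ 2 * ε))
  rw [W, Real.mul_rpow (Real.rpow_nonneg hp.1.le _) (Real.rpow_nonneg hq.le _),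
    ← Real.rpow_mul hp.1.le, ← Real.rpow_mul hq.le, one_div_mul_cancel (by positivity), Real.rpow_one,
    epsPrime]
  congr 2
  ring

lemma refl_W (ε : ℝ) {p : ℝ × ℝ} (hε : 0 < ε) (hp : p ∈ nonVacuum ε) : W ε (refl p) = Z ε p := by
  obtain ⟨l1, l2⟩ := lum_lt hε hp.2
  have hq : 0 < (1 + ε * p.2) / (1 - ε * p.2) := div_pos (by linarith) (by linarith)
  rw [W, Z, Real.rpow_neg hq.le, ← Real.inv_rpow hq.le, inv_div]
  simp only [refl]
  congr 3 <;> ring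

/-- For v ≥ 0 the bound on W with 1+εv ≥ 1 gives ρ^ε' ≤ K^(2ε)(1-ε|v|); for v ≤ 0 the bound on Z
does the same after reflection. -/
lemma tame_of_bounds {ε K : ℝ} (hε : 0 < ε) (hε1 : ε ≤ 1) (hK : 1 ≤ K) {p : ℝ × ℝ}
    (hp : p ∈ nonVacuum ε) (hW : W ε p ≤ K) (hZ : Z ε p ≤ K) : p ∈ tameRegion ε (K ^ 2) := by
  have hK0 : 0 < K := one_pos.trans_le hK
  have key : p.1 ^ epsPrime ε ≤ K ^ (2 * ε) * (1 - ε * |p.2|) := by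
    have aux : ∀ p : ℝ × ℝ, p ∈ nonVacuum ε → W ε p ≤ K → 0 ≤ p.2 →
        p.1 ^ epsPrime ε ≤ K ^ (2 * ε) * (1 - ε * |p.2|) := by
      intro p hp hW h2
      obtain ⟨l1, l2⟩ := lum_lt hε hp.2
      have h3 := density_le_of_W hε hp hW
      have h4 : 0 ≤ ε * p.2 := by positivity
      have h5 : 0 ≤ p.1 ^ epsPrime ε := Real.rpow_nonneg hp.1.le _
      rw [← mul_div_assoc, div_le_iff₀ (by linarith)] at h3
      rw [abs_of_nonneg h2]
      nlinarith
    rcases le_total 0 p.2 with h2 | h2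
    · exact aux p hp hW h2
    · have := aux (refl p) (refl_nonVacuum hp) (by rw [refl_W ε hε hp]; exact hZ)
        (by simpa [refl] using h2)
      simpa [refl] using this
  have hlum : ε * |p.2| < 1 := hp.2
  have he : 0 < epsPrime ε := by unfold epsPrime; positivity
  -- As ε ≤ 1, 2ε' = 4ε/(1+ε²) ≥ 2ε; with K ≥ 1 the square of K therefore works for every ε.
  have hM : K ^ (2 * ε) ≤ (K ^ 2) ^ epsPrime ε := by
    rw [← Real.rpow_natCast K 2, ← Real.rpow_mul hK0.le]
    refine Real.rpow_le_rpow_of_exponent_le hK ?_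
    rw [epsPrime, ← mul_div_assoc, le_div_iff₀ (by positivity)]
    push_cast
    nlinarith
  have hK1 : 0 < K ^ (2 * ε) := Real.rpow_pos_of_pos hK0 _
  have hv : 1 - ε * |p.2| ≤ 1 := by
    have : 0 ≤ ε * |p.2| := by positivity
    linarith
  have hfin : p.1 ^ epsPrime ε ≤ (K ^ 2) ^ epsPrime ε * (1 - ε * |p.2|) :=
    key.trans (mul_le_mul_of_nonneg_right hM (by linarith))
  have hpos : 0 < (K ^ 2) ^ epsPrime ε := hK1.trans_le hM
  refine ⟨hp.1.le, ?_, ?_⟩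
  · refine (Real.rpow_le_rpow_iff hp.1.le (by positivity) he).1 ?_
    exact hfin.trans (mul_le_of_le_one_right hpos.le hv)
  · rw [Real.div_rpow hp.1.le (by positivity), div_le_iff₀ hpos, mul_comm]
    exact hfin

/-- Uniform bounds on the invariants of a fixed state. -/
lemma exists_invariant_bound {ρ v ε₁ : ℝ} (hρ : 0 ≤ ρ) (hv : ε₁ * |v| < 1) :
    ∃ K : ℝ, 1 ≤ K ∧ ∀ ε, 0 < ε → ε ≤ ε₁ → W ε (ρ, v) ≤ K ∧ Z ε (ρ, v) ≤ K := by
  -- The density factor is at most max 1 ρ since its exponent is at most 1; the exponential is the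
  -- bound for the velocity factor, uniform as ε tends to 0.
  refine ⟨max 1 ρ * Real.exp (|v| / (1 - ε₁ * |v|)), ?_, fun ε hε hle => ?_⟩
  · have : 0 ≤ |v| / (1 - ε₁ * |v|) := div_nonneg (abs_nonneg _) (by linarith)
    exact one_le_mul_of_one_le_of_one_le (le_max_left _ _) (Real.one_le_exp this)
  have hy : ε * |v| ≤ ε₁ * |v| := mul_le_mul_of_nonneg_right hle (abs_nonneg _)
  have hy0 : 0 ≤ ε * |v| := by positivity
  have hρ' : ρ ^ (1 / (1 + ε ^ 2)) ≤ max 1 ρ := by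
    have e1 : 0 ≤ 1 / (1 + ε ^ 2) := by positivity
    have e2 : 1 / (1 + ε ^ 2) ≤ 1 := by
      rw [div_le_one (by positivity)]; nlinarith [sq_nonneg ε]
    calc ρ ^ (1 / (1 + ε ^ 2)) ≤ (max 1 ρ) ^ (1 / (1 + ε ^ 2)) :=
          Real.rpow_le_rpow hρ (le_max_right _ _) e1
      _ ≤ (max 1 ρ) ^ (1 : ℝ) := Real.rpow_le_rpow_of_exponent_le (le_max_left _ _) e2
      _ = max 1 ρ := Real.rpow_one _
  have hfac : ∀ u : ℝ, |u| = |v| →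
      ((1 + ε * u) / (1 - ε * u)) ^ (1 / (2 * ε)) ≤ Real.exp (|v| / (1 - ε₁ * |v|)) := by
    intro u hu
    have hu1 : ε * u ≤ ε * |v| := by
      rw [← hu]; exact mul_le_mul_of_nonneg_left (le_abs_self u) hε.le
    have hu2 : -(ε * |v|) ≤ ε * u := by
      rw [← hu]
      have := mul_le_mul_of_nonneg_left (neg_le_of_abs_le (le_refl |u|)) hε.le
      linarith
    have d1 : 0 < 1 - ε * u := by linarith
    have d2 : 0 ≤ (1 + ε * u) / (1 - ε * u) := div_nonneg (by linarith) d1.le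
    -- The fraction is 1 + 2εu/(1-εu), estimated by 1 + y ≤ exp y; the exponent 1/(2ε) then cancels
    -- the factor 2ε.
    have d3 : (1 + ε * u) / (1 - ε * u) ≤ Real.exp (2 * (ε * |v|) / (1 - ε₁ * |v|)) := by
      refine le_trans ?_ (Real.add_one_le_exp _)
      rw [div_add_one (by linarith), div_le_div_iff₀ d1 (by linarith)]
      nlinarith
    calc ((1 + ε * u) / (1 - ε * u)) ^ (1 / (2 * ε))
        ≤ Real.exp (2 * (ε * |v|) / (1 - ε₁ * |v|)) ^ (1 / (2 * ε)) :=
          Real.rpow_le_rpow d2 d3 (by positivity)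
      _ = Real.exp (|v| / (1 - ε₁ * |v|)) := by
          rw [← Real.exp_mul]; congr 1
          have : 1 - ε₁ * |v| ≠ 0 := by linarith
          generalize 1 - ε₁ * |v| = d at *
          field_simp
  have hZfac : ((1 + ε * v) / (1 - ε * v)) ^ (-(1 / (2 * ε))) ≤
      Real.exp (|v| / (1 - ε₁ * |v|)) := by
    have h1 := hfac (-v) (abs_neg v)
    obtain ⟨l1, l2⟩ := lum_lt hε (show ε * |v| < 1 by linarith)
    have hq : 0 < (1 + ε * v) / (1 - ε * v) := div_pos (by linarith) (by linarith)
    rw [Real.rpow_neg hq.le, ← Real.inv_rpow hq.le, inv_div]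
    refine le_trans (le_of_eq ?_) h1
    congr 2 <;> ring
  have h1 : 0 ≤ max 1 ρ := zero_le_one.trans (le_max_left _ _)
  obtain ⟨l1, l2⟩ := lum_lt hε (show ε * |v| < 1 by linarith)
  have hq : 0 < (1 + ε * v) / (1 - ε * v) := div_pos (by linarith) (by linarith)
  exact ⟨mul_le_mul hρ' (hfac v rfl) (Real.rpow_nonneg hq.le _) h1,
    mul_le_mul hρ' hZfac (Real.rpow_nonneg hq.le _) h1⟩

/-! ### The Riemann problem -/

lemma far_state {ε : ℝ} (hε : 0 < ε) {p : ℝ × ℝ} (h : Adm ε p) :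
    ofA ε (toA ε p) = p ∨ (ofA ε (toA ε p)).1 = 0 ∧ p.1 = 0 := by
  rcases h.cases with h0 | h0
  · right; rw [toA_vac h0, ofA_zero]; exact ⟨rfl, h0⟩
  · exact Or.inl (ofA_toA hε h0)

/-- Existence, uniqueness and bounds from a profile in square-root coordinates. -/
lemma riemann_of_profile {ε K : ℝ} (hε : 0 < ε) (hε1 : ε ≤ 1) (hK : 1 ≤ K) {pl pr : ℝ × ℝ}
    (hl : Adm ε pl) (hr : Adm ε pr) (hWl : W ε pl ≤ K) (hWr : W ε pr ≤ K) (hZl : Z ε pl ≤ K)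
    (hZr : Z ε pr ≤ K) {A : ℝ → ℝ × ℝ} (hm : Measurable A)
    (hb : ∀ x, InvariantBound ε (toA ε pl) (toA ε pr) (A x))
    (hL : ∀ x < -(1 / ε), A x = toA ε pl) (hR : ∀ x, 1 / ε < x → A x = toA ε pr)
    (hd : ∀ M, 0 < M → (∀ x, ofA ε (A x) ∈ tameRegion ε M) → Dissipative ε (fun x => ofA ε (A x)))
    (hu : ∀ ψ : ℝ → ℝ × ℝ, IsRiemannSolution ε pl pr ψ → ∀ᵐ x, toA ε (ψ x) = A x) :
    ∃ φ : ℝ → ℝ × ℝ, IsRiemannSolution ε pl pr φ ∧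
      (∀ ψ : ℝ → ℝ × ℝ, IsRiemannSolution ε pl pr ψ →
        ∀ᵐ ξ : ℝ, (ψ ξ).1 = (φ ξ).1 ∧ (0 < (φ ξ).1 → (ψ ξ).2 = (φ ξ).2)) ∧
      ∀ ξ : ℝ, (0 ≤ W ε (φ ξ) ∧ W ε (φ ξ) ≤ max (W ε pl) (W ε pr)) ∧
        (0 ≤ Z ε (φ ξ) ∧ Z ε (φ ξ) ≤ max (Z ε pl) (Z ε pr)) ∧ φ ξ ∈ tameRegion ε (K ^ 2) := by
  have hA : ∀ x, Adm ε (ofA ε (A x)) := fun x => adm_ofA hε (hb x).1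
  have hW : ∀ x, 0 ≤ W ε (ofA ε (A x)) ∧ W ε (ofA ε (A x)) ≤ max (W ε pl) (W ε pr) := by
    intro x
    rw [W_eq hε (hA x), W_eq hε hl, W_eq hε hr, toA_ofA' hε (hb x).1]
    exact ⟨WA_nonneg hε (hb x).1, (hb x).2.1⟩
  have hZ : ∀ x, 0 ≤ Z ε (ofA ε (A x)) ∧ Z ε (ofA ε (A x)) ≤ max (Z ε pl) (Z ε pr) := by
    intro x
    rw [Z_eq hε (hA x), Z_eq hε hl, Z_eq hε hr, toA_ofA' hε (hb x).1]
    exact ⟨WA_nonneg hε (hb x).refl.1, (hb x).2.2⟩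
  have hK2 : 0 < K ^ 2 := by positivity
  have ht : ∀ x, ofA ε (A x) ∈ tameRegion ε (K ^ 2) := by
    intro x
    rcases (hb x).1 with h0 | h0
    · rw [h0, ofA_zero]; exact tame_zero hε hK2
    · exact tame_of_bounds hε hε1 hK (ofA_mem hε h0) ((hW x).2.trans (max_le hWl hWr))
        ((hZ x).2.trans (max_le hZl hZr))
  refine ⟨fun x => ofA ε (A x), ?_, fun ψ hψ => ?_, fun ξ => ⟨hW ξ, hZ ξ, ht ξ⟩⟩
  · refine IsRiemannSolution.of_dissipative ((measurable_ofA ε).comp hm) hK2 ht (R := 1 / ε)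
      (fun x hx => ?_) (fun x hx => ?_) (hd _ hK2 ht)
    · rw [hL x hx]; exact far_state hε hl
    · rw [hR x hx]; exact far_state hε hr
  · obtain ⟨M, hM, ht'⟩ := hψ.tame
    have hψt : ∀ x, ψ x ∈ tameRegion ε M := fun x => by simpa using ht' 1 x one_pos
    filter_upwards [hu ψ hψ] with x hx
    have ha := adm_of_tame hM (hψt x)
    show (ψ x).1 = (ofA ε (A x)).1 ∧ (0 < (ofA ε (A x)).1 → (ψ x).2 = (ofA ε (A x)).2)
    rw [← hx]
    rcases ha.cases with h0 | h0
    · rw [toA_vac h0, ofA_zero]; exact ⟨h0, fun h => absurd h (lt_irrefl _)⟩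
    · rw [ofA_toA hε h0]; exact ⟨rfl, fun _ => rfl⟩

lemma curve1_far {ε : ℝ} (hε : 0 < ε) (hε1 : ε < 1) {l : ℝ × ℝ} (hl : l ∈ cone ε) {x : ℝ}
    (hx : x < -(1 / ε)) : curve1 ε l x = l := by
  rw [curve1, if_pos (hx.trans (lam1A_bounds hε hε1 hl).1)]

/-- The solution of the Riemann problem for a fixed value of `ε`. -/
theorem riemann_problem {ε K : ℝ} (hε : 0 < ε) (hε1 : ε ≤ 1) (hK : 1 ≤ K) {pl pr : ℝ × ℝ}
    (hl : Adm ε pl) (hr : Adm ε pr) (h1 : ε = 1 → (pl.1 = 0 ↔ pr.1 = 0)) (hWl : W ε pl ≤ K)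
    (hWr : W ε pr ≤ K) (hZl : Z ε pl ≤ K) (hZr : Z ε pr ≤ K) :
    ∃ φ : ℝ → ℝ × ℝ, IsRiemannSolution ε pl pr φ ∧
      (∀ ψ : ℝ → ℝ × ℝ, IsRiemannSolution ε pl pr ψ →
        ∀ᵐ ξ : ℝ, (ψ ξ).1 = (φ ξ).1 ∧ (0 < (φ ξ).1 → (ψ ξ).2 = (φ ξ).2)) ∧
      ∀ ξ : ℝ, (0 ≤ W ε (φ ξ) ∧ W ε (φ ξ) ≤ max (W ε pl) (W ε pr)) ∧
        (0 ≤ Z ε (φ ξ) ∧ Z ε (φ ξ) ≤ max (Z ε pl) (Z ε pr)) ∧ φ ξ ∈ tameRegion ε (K ^ 2) := by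
  have h0 : 0 < 1 / ε := by positivity
  have hvac : pl.1 = 0 → pr.1 = 0 → toA ε pl = (0, 0) ∧ toA ε pr = (0, 0) := fun a b =>
    ⟨toA_vac a, toA_vac b⟩
  -- At ε = 1 only the cases of two vacuum or two nonvacuum states occur by `h1`; for ε < 1 all four
  -- combinations are treated, a vacuum on the left being the mirror image of one on the right.
  rcases hε1.eq_or_lt with rfl | hlt
  · rcases hl.cases with l0 | l0
    · obtain ⟨el, er⟩ := hvac l0 ((h1 rfl).1 l0)
      refine riemann_of_profile hε hε1 hK hl hr hWl hWr hZl hZr (A := fun _ => (0, 0))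
        measurable_const (fun x => bound_zero hε (Or.inl el)) (fun x _ => el.symm)
        (fun x _ => er.symm) (fun M _ _ => ?_) fun ψ hψ => ?_
      · simp only [ofA_zero]; exact vacuum_dissipative 1
      · obtain ⟨S, Ap, Am, m, hP, fl, fr⟩ := hψ.prof_far hε hε1 hl hr
        filter_upwards [hP.structure_one fl fr] with x hx
        rw [hx, wave1, el, er]
        split_ifs <;> simp
    · have r0 : pr ∈ nonVacuum 1 := by
        rcases hr.cases with r0 | r0
        · exact absurd ((h1 rfl).2 r0) l0.1.ne'
        · exact r0
      have cl := toA_mem hε l0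
      have cr := toA_mem hε r0
      refine riemann_of_profile hε hε1 hK hl hr hWl hWr hZl hZr
        (A := wave1 (toA 1 pl) (toA 1 pr)) (measurable_wave1 _ _) (fun x => bound_wave1 cl cr x)
        (fun x hx => ?_) (fun x hx => ?_) (fun M hM ht => wave1_dissipative cl cr hM ht)
        fun ψ hψ => ?_
      · rw [div_one] at hx
        rw [wave1, if_pos hx]
      · rw [div_one] at hx
        rw [wave1, if_neg (by linarith), if_neg hx.not_gt]
      · obtain ⟨S, Ap, Am, m, hP, fl, fr⟩ := hψ.prof_far hε hε1 hl hr
        exact hP.structure_one fl fr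
  · rcases hl.cases with l0 | l0 <;> rcases hr.cases with r0 | r0
    · obtain ⟨el, er⟩ := hvac l0 r0
      refine riemann_of_profile hε hε1 hK hl hr hWl hWr hZl hZr (A := fun _ => (0, 0))
        measurable_const (fun x => bound_zero hε (Or.inl el)) (fun x _ => el.symm)
        (fun x _ => er.symm) (fun M _ _ => ?_) fun ψ hψ => ?_
      · simp only [ofA_zero]; exact vacuum_dissipative ε
      · obtain ⟨S, Ap, Am, m, hP, fl, fr⟩ := hψ.prof_far hε hε1 hl hr
        rw [el] at fl
        rw [er] at fr
        exact hP.structure_vac hε hlt fl fr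
    · have cr := toA_mem hε r0
      have cr' := refl_mem cr
      have el := toA_vac (ε := ε) l0
      refine riemann_of_profile hε hε1 hK hl hr hWl hWr hZl hZr
        (A := fun x => refl (vacWave ε (refl (toA ε pr)) (-x)))
        (measurable_refl.comp ((measurable_vacWave _ _).comp measurable_neg))
        (fun x => ?_) (fun x hx => ?_) (fun x hx => ?_) (fun M hM ht => ?_) fun ψ hψ => ?_
      · have := (bound_vacWave hε hlt cr' (refl (toA ε pl)) (-x)).symm.refl
        rwa [refl_refl, refl_refl] at this
      · rw [vacWave, if_neg (by linarith), el, refl_zero]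
      · rw [vacWave, if_pos (by linarith), curve1_far hε hlt cr' (by linarith), refl_refl]
      · have key := (vacWave_dissipative hε hlt cr' hM fun x => ?_).reflect
        · simpa only [ofA_refl] using key
        · have := ht (-x)
          rw [neg_neg, ofA_refl] at this
          refine ⟨this.1, this.2.1, ?_⟩
          have e := this.2.2
          simpa only [refl, abs_neg] using e
      · obtain ⟨S, Ap, Am, m, hP, fl, fr⟩ := hψ.prof_far hε hε1 hl hr
        rw [el] at fl
        filter_upwards [hP.structure_vac_left hε hlt cr fl fr] with x hx
        rw [hx, vacWave]
        by_cases hx1 : -(1 / ε) < x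
        · rw [if_pos hx1, if_pos (by linarith)]; rfl
        · rw [if_neg hx1, if_neg (by linarith), refl_zero]
    · have cl := toA_mem hε l0
      have er := toA_vac (ε := ε) r0
      refine riemann_of_profile hε hε1 hK hl hr hWl hWr hZl hZr (A := vacWave ε (toA ε pl))
        (measurable_vacWave _ _) (fun x => bound_vacWave hε hlt cl _ x)
        (fun x hx => ?_) (fun x hx => ?_) (fun M hM ht => vacWave_dissipative hε hlt cl hM ht)
        fun ψ hψ => ?_
      · rw [vacWave, if_pos (by linarith), curve1_far hε hlt cl hx]
      · rw [vacWave, if_neg hx.not_gt, er]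
      · obtain ⟨S, Ap, Am, m, hP, fl, fr⟩ := hψ.prof_far hε hε1 hl hr
        rw [er] at fr
        exact hP.structure_vac_right hε hlt cl fl fr
    · have cl := toA_mem hε l0
      have cr := toA_mem hε r0
      obtain ⟨α, β, a1, ab, b1, hp⟩ := exists_slopes hε hlt cl cr
      refine riemann_of_profile hε hε1 hK hl hr hWl hWr hZl hZr
        (A := wave ε (toA ε pl) (toA ε pr) α β (behind1 ε (toA ε pl) α))
        (measurable_wave _ _ _ _ _ _) (fun x => bound_wave hε hlt cl cr a1 ab b1 hp x)
        (fun x hx => ?_) (fun x hx => ?_)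
        (fun M hM ht => wave_dissipative hε hlt cl cr a1 ab b1 hp hM ht) fun ψ hψ => ?_
      · rw [wave, if_pos (by linarith), curve1_far hε hlt cl hx]
      · rw [wave, if_neg (by linarith), if_neg (by linarith), curve2,
          curve1_far hε hlt (refl_mem cr) (by linarith), refl_refl]
      · obtain ⟨S, Ap, Am, m, hP, fl, fr⟩ := hψ.prof_far hε hε1 hl hr
        obtain ⟨α', β', a1', ab', b1', hp', hae⟩ := hP.structure_nonvac hε hlt cl cr fl fr
        obtain ⟨rfl, rfl⟩ := slopes_unique hε hlt cl cr a1 (ab.trans b1) (a1.trans ab) b1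
          a1' (ab'.trans b1') (a1'.trans ab') b1' hp hp'
        exact hae

end RelEuler

end

/-! ### The lemma with a constant independent of ε -/

theorem lemma5p1 (ρl vl ρr vr : ℝ) (hρl : 0 ≤ ρl) (hρr : 0 ≤ ρr)
    (ε₁ : ℝ) (hε₁ : 0 < ε₁) (hε₁' : ε₁ ≤ 1) (hvl : ε₁ * |vl| < 1) (hvr : ε₁ * |vr| < 1) :
    ∃ M : ℝ, 0 < M ∧
      ∀ ε : ℝ, 0 < ε → ε ≤ ε₁ → (ε = 1 → (ρl = 0 ↔ ρr = 0)) →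
        ∃ φ : ℝ → ℝ × ℝ,
          RelEuler.IsRiemannSolution ε (ρl, vl) (ρr, vr) φ ∧
          (∀ ψ : ℝ → ℝ × ℝ, RelEuler.IsRiemannSolution ε (ρl, vl) (ρr, vr) ψ →
            ∀ᵐ ξ : ℝ, (ψ ξ).1 = (φ ξ).1 ∧ (0 < (φ ξ).1 → (ψ ξ).2 = (φ ξ).2)) ∧
          ∀ ξ : ℝ,
            (0 ≤ RelEuler.W ε (φ ξ) ∧
              RelEuler.W ε (φ ξ) ≤ max (RelEuler.W ε (ρl, vl)) (RelEuler.W ε (ρr, vr))) ∧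
            (0 ≤ RelEuler.Z ε (φ ξ) ∧
              RelEuler.Z ε (φ ξ) ≤ max (RelEuler.Z ε (ρl, vl)) (RelEuler.Z ε (ρr, vr))) ∧
            φ ξ ∈ RelEuler.tameRegion ε M := by
  obtain ⟨K₁, k1, h1⟩ := RelEuler.exists_invariant_bound hρl hvl
  obtain ⟨K₂, k2, h2⟩ := RelEuler.exists_invariant_bound hρr hvr
  have hK : 1 ≤ max K₁ K₂ := k1.trans (le_max_left _ _)
  -- The larger of the two ε-uniform bounds on the invariants of the data serves as K, and M = K².
  refine ⟨max K₁ K₂ ^ 2, by positivity, fun ε hε hle hvac => ?_⟩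
  have hadm : ∀ ρ v : ℝ, 0 ≤ ρ → ε₁ * |v| < 1 → RelEuler.Adm ε (ρ, v) := fun ρ v hρ hv =>
    ⟨hρ, fun _ => (mul_le_mul_of_nonneg_right hle (abs_nonneg v)).trans_lt hv⟩
  exact RelEuler.riemann_problem hε (hle.trans hε₁') hK (hadm _ _ hρl hvl) (hadm _ _ hρr hvr) hvac
    ((h1 ε hε hle).1.trans (le_max_left _ _)) ((h2 ε hε hle).1.trans (le_max_right _ _))
    ((h1 ε hε hle).2.trans (le_max_left _ _)) ((h2 ε hε hle).2.trans (le_max_right _ _))
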